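/- **Conventions.** All categories are small, with sets of objects and morphisms in a fixed universe. A profunctor $\mathbb V\times\mathbb V ⧑ \mathbb V$ is a functor $\mathbb V^{op}\times\mathbb V\times\mathbb V\to\mathbf{Set}$, written $(A,B,C)\mapsto\mathbb V(A;B\otimes C)$, and a profunctor $1 ⧑ \mathbb V$ is a presheaf, written $A\mapsto\mathbb V(A;I)$. Nested expressions denote composition of profunctors, that is, coends: for presheaves $P,Q$ on $\mathbb V$, $P\otimes Q=\int^{X,Y}\mathbb V(\bullet;X\otimes Y)\times P(X)\times Q(Y)$, where an object $X$ stands for the presheaf $\mathbb V(\bullet;X)$. A *promonoidal structure* $(\otimes,I)$ on $\mathbb V$ consists of such profunctors with natural isomorphisms $\mathbb V(\bullet;(X\otimes Y)\otimes Z)\cong\mathbb V(\bullet;X\otimes(Y\otimes Z))$, $\mathbb V(\bullet;I\otimes X)\cong\mathbb V(\bullet;X)\cong\mathbb V(\bullet;X\otimes I)$ satisfying the pentagon and triangle equations. A *produoidal category* is a category $\mathbb V$ with two promonoidal structures $(\otimes,I)$ and $(\triangleleft,N)$ and natural *laxators* $$\psi_2:\mathbb V(\bullet;(X\triangleleft Y)\otimes(Z\triangleleft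 W))\to\mathbb V(\bullet;(X\otimes Z)\triangleleft(Y\otimes W)),\quad \psi_0:\mathbb V(\bullet;I)\to\mathbb V(\bullet;I\triangleleft I),$$ $$\varphi_2:\mathbb V(\bullet;N\otimes N)\to\mathbb V(\bullet;N),\quad \varphi_0:\mathbb V(\bullet;I)\to\mathbb V(\bullet;N),$$ satisfying the coherence equations of a duoidal category: $\psi_2$ is compatible with the associators of $\otimes$ and of $\triangleleft$, $(\psi_2,\psi_0)$ with the unitors of $\otimes$, $(\psi_2,\varphi_2)$ with the unitors of $\triangleleft$, $(N,\varphi_2,\varphi_0)$ satisfies the associativity and unit laws of a monoid for $\otimes$, and $(I,\psi_0,\varphi_0)$ the coassociativity and counit laws of a comonoid for $\triangleleft$. It is *normal* if $\varphi_0$ is invertible. A *produoidal functor* $F:\mathbb V\to\mathbb W$ is a functor with natural maps $\mathbb V(A;B\otimes C)\to\mathbb W(FA;FB\otimes FC)$, $\mathbb V(A;I)\to\mathbb W(FA;I)$, $\mathbb V(A;B\triangleleft C)\to\mathbb W(FA;FB\triangleleft FC)$, $\mathbb V(A;N)\to\mathbb W(FA;N)$ that preserve associators, unitors and laxators. Let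 $\mathbf{pDuo}$ be the category of produoidal categories and produoidal functors, and $\mathcal U:\mathbf{npDuo}\hookrightarrow\mathbf{pDuo}$ the full subcategory of the normal ones. The *normalization* $\mathcal N\mathbb V$ of a produoidal category $\mathbb V$ is the Kleisli category of the promonad $\mathbb V(\bullet;N\otimes\bullet\otimes N)$, whose unit is given by the unitors and $\varphi_0$ and whose multiplication is given by the associators and $\varphi_2$. It has the objects of $\mathbb V$ and $$\mathcal N\mathbb V(A;B)=\mathbb V(A;N\otimes B\otimes N),\qquad \mathcal N\mathbb V(A;B\otimes C)=\mathbb V(A;N\otimes B\otimes N\otimes C\otimes N),$$ $$\mathcal N\mathbb V(A;B\triangleleft C)=\mathbb V(A;(N\otimes B\otimes N)\triangleleft(N\otimes C\otimes N)),\qquad \mathcal N\mathbb V(A;I)=\mathcal N\mathbb V(A;N)=\mathbb V(A;N),$$ with the structure maps for which these identifications are induced by the canonical produoidal functor $\eta_{\mathbb V}:\mathbb V\to\mathcal N\mathbb V$ (the identity on objects, the unit of the promonad on morphisms, the identity on $\mathbb V(A;N)$). **Theorem.** The inclusion $\mathcal U$ is fully faithful, and normalization is a functor left adjoint to it, $$\mathcal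 N:\mathbf{pDuo}\rightleftarrows\mathbf{npDuo}:\mathcal U,$$ with unit $\eta$; thus $\mathcal N\mathbb V$ is the free normal produoidal category on $\mathbb V$. The induced monad on $\mathbf{pDuo}$ is idempotent (its multiplication is invertible), and normal produoidal categories are exactly its algebras: the comparison functor from $\mathbf{npDuo}$ to the category of algebras is an equivalence, a normal produoidal category has exactly one algebra structure, and a produoidal category that is not normal has none. -/

import Mathlib

open CategoryTheory Opposite

universe u

namespace Produoidal

/-! ## Presheaves, profunctors and their composition

All categories are small (objects and morphisms in `Type u`), and `Type u` plays the role of `Set`.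
A profunctor `V × V ⧑ V` is Mathlib's `Profunctor.{u} (V × V) V`, that is, a functor
`V × V ⥤ Vᵒᵖ ⥤ Type u`; the set `V(A; B ⊗ C)` is `(T.obj (B, C)).obj (op A)`. -/

/-- Presheaves on `V`, that is, profunctors `1 ⧑ V`. -/
abbrev Psh (V : Type u) [SmallCategory V] : Type (u + 1) := Vᵒᵖ ⥤ Type u

/-- An object `X`, seen as the presheaf `V(•; X)`. -/
abbrev yo {V : Type u} [SmallCategory V] (X : V) : Psh V := yoneda.obj X

/-- An element `p ∈ P(X)`, seen as a map `V(•; X) ⟶ P` (Yoneda). -/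
abbrev el {V : Type u} [SmallCategory V] {P : Psh V} {X : V} (p : P.obj (op X)) : yo X ⟶ P :=
  yonedaEquiv.symm p

section Conv

variable {V : Type u} [SmallCategory V] (T : Profunctor.{u} (V × V) V)

/-- An element of `∑_{X, Y} T(A; X, Y) × P(X) × Q(Y)`. -/
structure ConvRep (P Q : Psh V) (A : Vᵒᵖ) : Type u where
  /-- The first bound object. -/
  fst : V
  /-- The second bound object. -/
  snd : V
  /-- The outer split. -/
  split : (T.obj (fst, snd)).obj A
  /-- What is plugged into the first output. -/
  left : P.obj (op fst)
  /-- What is plugged into the second output. -/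
  right : Q.obj (op snd)

/-- The relation that generates dinatural equivalence. -/
inductive ConvRel (P Q : Psh V) (A : Vᵒᵖ) : ConvRep T P Q A → ConvRep T P Q A → Prop where
  | mk {X X' Y Y' : V} (f : X ⟶ X') (g : Y ⟶ Y') (s : (T.obj (X, Y)).obj A)
      (p : P.obj (op X')) (q : Q.obj (op Y')) :
      ConvRel P Q A ⟨X', Y', (T.map (Prod.mkHom f g)).app A s, p, q⟩
        ⟨X, Y, s, P.map f.op p, Q.map g.op q⟩

/-- The composition of profunctors `T(•; •₁, •₂) ⋄ P(•₁) ⋄ Q(•₂)`, the coend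
`∫^{X, Y} T(•; X, Y) × P(X) × Q(Y)`. All nested expressions `V(•; P ⊗ Q)` are of this form, an
object `X` being plugged in as the presheaf `V(•; X)`. -/
def conv (P Q : Psh V) : Psh V where
  obj A := Quot (ConvRel T P Q A)
  map {A A'} h := ↾fun x => Quot.map
    (fun r : ConvRep T P Q A => (⟨r.fst, r.snd, (T.obj (r.fst, r.snd)).map h r.split, r.left,
      r.right⟩ : ConvRep T P Q A'))
    (by
      rintro _ _ ⟨f, g, s, p, q⟩
      dsimp only
      rw [← NatTrans.naturality_apply]
      exact ConvRel.mk f g _ p q) x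
  map_id A := by
    ext x
    induction x using Quot.ind with
    | mk r => simp [Quot.map]
  map_comp h k := by
    ext x
    induction x using Quot.ind with
    | mk r => simp [Quot.map]

variable {T}

/-- Plugging `p ∈ P(X)` and `q ∈ Q(Y)` into splits `s ∈ T(•; X, Y)`. -/
def conv.ι {P Q : Psh V} {X Y : V} (p : P.obj (op X)) (q : Q.obj (op Y)) :
    T.obj (X, Y) ⟶ conv T P Q where
  app A := ↾fun s => Quot.mk _ ⟨X, Y, s, p, q⟩
  naturality A A' h := by ext s; rfl

lemma conv.ι_naturality {P Q : Psh V} {X X' Y Y' : V} (f : X ⟶ X') (g : Y ⟶ Y')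
    (p : P.obj (op X')) (q : Q.obj (op Y')) :
    T.map (Prod.mkHom f g) ≫ conv.ι (P := P) (Q := Q) p q
      = conv.ι (P.map f.op p) (Q.map g.op q) := by
  ext A s
  exact Quot.sound (ConvRel.mk f g s p q)

/-- The universal property of the coend. -/
def conv.desc {P Q R : Psh V}
    (h : ∀ {X Y : V}, P.obj (op X) → Q.obj (op Y) → (T.obj (X, Y) ⟶ R))
    (hh : ∀ {X X' Y Y' : V} (f : X ⟶ X') (g : Y ⟶ Y') (p : P.obj (op X')) (q : Q.obj (op Y')),
      T.map (Prod.mkHom f g) ≫ h p q = h (P.map f.op p) (Q.map g.op q)) :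
    conv T P Q ⟶ R where
  app A := ↾fun x => Quot.lift (fun r => (h r.left r.right).app A r.split)
    (by
      rintro _ _ ⟨f, g, s, p, q⟩
      exact congrArg (fun k => k.app A s) (hh f g p q)) x
  naturality A A' k := by
    ext x
    induction x using Quot.ind with
    | mk r => exact NatTrans.naturality_apply (h r.left r.right) k r.split

lemma conv.hom_ext {P Q R : Psh V} {a b : conv T P Q ⟶ R}
    (h : ∀ {X Y : V} (p : P.obj (op X)) (q : Q.obj (op Y)), conv.ι p q ≫ a = conv.ι p q ≫ b) :
    a = b := by
  ext A x
  induction x using Quot.ind with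
  | mk r => exact congrArg (fun k => k.app A r.split) (h r.left r.right)

/-- Functoriality of `∫^{X, Y} T(•; X, Y) × P(X) × Q(Y)` in `P` and `Q`. -/
def conv.map {P P' Q Q' : Psh V} (a : P ⟶ P') (b : Q ⟶ Q') : conv T P Q ⟶ conv T P' Q' :=
  conv.desc (fun {X Y} p q => conv.ι (a.app (op X) p) (b.app (op Y) q)) (by
    intro X X' Y Y' f g p q
    rw [conv.ι_naturality, NatTrans.naturality_apply, NatTrans.naturality_apply])

lemma conv.ι_map {P P' Q Q' : Psh V} (a : P ⟶ P') (b : Q ⟶ Q') {X Y : V}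
    (p : P.obj (op X)) (q : Q.obj (op Y)) :
    conv.ι p q ≫ conv.map (T := T) a b = conv.ι (a.app (op X) p) (b.app (op Y) q) := rfl

lemma conv.map_comp {P P' P'' Q Q' Q'' : Psh V} (a : P ⟶ P') (a' : P' ⟶ P'') (b : Q ⟶ Q')
    (b' : Q' ⟶ Q'') :
    conv.map (T := T) (a ≫ a') (b ≫ b') = conv.map a b ≫ conv.map a' b' :=
  conv.hom_ext fun _ _ => rfl

/-- The Yoneda reduction `∫^{X, Y} T(•; X, Y) × V(X; B) × V(Y; C) → T(•; B, C)`. -/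
def conv.reduce (B C : V) : conv T (yo B) (yo C) ⟶ T.obj (B, C) :=
  conv.desc (fun f g => T.map (Prod.mkHom f g)) (by
    intro X X' Y Y' f g p q
    exact (T.map_comp _ _).symm)

end Conv

lemma el_map {V : Type u} [SmallCategory V] {P : Psh V} {X X' : V} (f : X ⟶ X')
    (p : P.obj (op X')) : el (P.map f.op p) = yoneda.map f ≫ el p :=
  (yonedaEquiv_symm_naturality_left f P p).symm

lemma conv.ι_right {V : Type u} [SmallCategory V] {T : Profunctor.{u} (V × V) V} {P Q : Psh V}
    {X Y Y' : V} (g : Y ⟶ Y') (p : P.obj (op X)) (q : Q.obj (op Y')) :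
    conv.ι (T := T) p (Q.map g.op q) = T.map (Prod.mkHom (𝟙 X) g) ≫ conv.ι p q := by
  rw [conv.ι_naturality]; simp

lemma conv.ι_left {V : Type u} [SmallCategory V] {T : Profunctor.{u} (V × V) V} {P Q : Psh V}
    {X X' Y : V} (f : X ⟶ X') (p : P.obj (op X')) (q : Q.obj (op Y)) :
    conv.ι (T := T) (P.map f.op p) q = T.map (Prod.mkHom f (𝟙 Y)) ≫ conv.ι p q := by
  rw [conv.ι_naturality]; simp

/-- Composing a split with a morphism `g` on the second output, two ways. -/
lemma conv.ι_yo_right {V : Type u} [SmallCategory V] {T : Profunctor.{u} (V × V) V} {P : Psh V}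
    {X X' Y Y' : V} (f : X ⟶ X') (g : Y ⟶ Y') (p : P.obj (op X')) :
    T.map (Prod.mkHom f g) ≫ conv.ι (Q := yo Y') p (𝟙 Y')
      = conv.ι (Q := yo Y) (P.map f.op p) (𝟙 Y) ≫ conv.map (𝟙 P) (yoneda.map g) := by
  rw [conv.ι_naturality, conv.ι_map]; simp

/-- Composing a split with a morphism `f` on the first output, two ways. -/
lemma conv.ι_yo_left {V : Type u} [SmallCategory V] {T : Profunctor.{u} (V × V) V} {Q : Psh V}
    {X X' Y Y' : V} (f : X ⟶ X') (g : Y ⟶ Y') (q : Q.obj (op Y')) :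
    T.map (Prod.mkHom f g) ≫ conv.ι (P := yo X') (𝟙 X') q
      = conv.ι (P := yo X) (𝟙 X) (Q.map g.op q) ≫ conv.map (yoneda.map f) (𝟙 Q) := by
  rw [conv.ι_naturality, conv.ι_map]; simp

/-! ## Promonoidal categories -/

/-- The data of a promonoidal structure on `V`: the splits `V(A; X ⊗ Y)`, the units `V(A; I)`, the
associator `V(•; (X ⊗ Y) ⊗ Z) ≅ V(•; X ⊗ (Y ⊗ Z))` and the unitors `V(•; I ⊗ X) ≅ V(•; X)` and
`V(•; X ⊗ I) ≅ V(•; X)`, all natural. -/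
structure PromonoidalData (V : Type u) [SmallCategory V] where
  /-- The splits. -/
  tensor : Profunctor.{u} (V × V) V
  /-- The units. -/
  unit : Psh V
  /-- The associator. -/
  assoc : ∀ X Y Z : V,
    conv tensor (tensor.obj (X, Y)) (yo Z) ≅ conv tensor (yo X) (tensor.obj (Y, Z))
  /-- The left unitor. -/
  left : ∀ X : V, conv tensor unit (yo X) ≅ yo X
  /-- The right unitor. -/
  right : ∀ X : V, conv tensor (yo X) unit ≅ yo X
  assoc_naturality : ∀ {X X' Y Y' Z Z' : V} (f : X ⟶ X') (g : Y ⟶ Y') (h : Z ⟶ Z'),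
    conv.map (tensor.map (Prod.mkHom f g)) (yoneda.map h) ≫ (assoc X' Y' Z').hom
      = (assoc X Y Z).hom ≫ conv.map (yoneda.map f) (tensor.map (Prod.mkHom g h))
  left_naturality : ∀ {X X' : V} (f : X ⟶ X'),
    conv.map (𝟙 unit) (yoneda.map f) ≫ (left X').hom = (left X).hom ≫ yoneda.map f
  right_naturality : ∀ {X X' : V} (f : X ⟶ X'),
    conv.map (yoneda.map f) (𝟙 unit) ≫ (right X').hom = (right X).hom ≫ yoneda.map f

namespace PromonoidalData

variable {V : Type u} [SmallCategory V] (M : PromonoidalData V)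

/-- `P ⊗ Q`, the presheaf `∫^{X, Y} V(•; X ⊗ Y) × P(X) × Q(Y)`. -/
abbrev conv (P Q : Psh V) : Psh V := Produoidal.conv M.tensor P Q

lemma assocInv_naturality {X X' Y Y' Z Z' : V} (f : X ⟶ X') (g : Y ⟶ Y') (h : Z ⟶ Z') :
    conv.map (yoneda.map f) (M.tensor.map (Prod.mkHom g h)) ≫ (M.assoc X' Y' Z').inv
      = (M.assoc X Y Z).inv ≫ conv.map (M.tensor.map (Prod.mkHom f g)) (yoneda.map h) := by
  rw [Iso.eq_inv_comp, ← Category.assoc, Iso.comp_inv_eq, M.assoc_naturality]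

/-- The associator under composition with `P ⋄ Q ⋄ R`: on nested splits it acts as the associator
`(X ⊗ Y) ⊗ Z → X ⊗ (Y ⊗ Z)`, and it keeps what is plugged into `X`, `Y`, `Z`. -/
def assocHom (P Q R : Psh V) : M.conv (M.conv P Q) R ⟶ M.conv P (M.conv Q R) :=
  conv.desc (fun {_ Z} x r => Quot.lift (fun w : ConvRep M.tensor P Q _ =>
      conv.ι w.split (𝟙 Z) ≫ (M.assoc w.fst w.snd Z).hom ≫
        conv.map (el w.left) (conv.ι w.right r))
    (by
      rintro _ _ ⟨f, g, t, p, q⟩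
      have e : conv.ι (T := M.tensor) (M.tensor.map (Prod.mkHom f g) |>.app _ t) (𝟙 Z)
          = conv.ι (T := M.tensor) t (𝟙 Z) ≫
            conv.map (M.tensor.map (Prod.mkHom f g)) (yoneda.map (𝟙 Z)) := by
        rw [conv.ι_map]; simp
      dsimp only
      rw [e, el_map, conv.ι_left, conv.map_comp, Category.assoc,
        reassoc_of% (M.assoc_naturality f g (𝟙 Z))]) x)
    (by
      intro X X' Y Y' f g x r
      induction x using Quot.ind with
      | mk w =>
        obtain ⟨A, B, t, p, q⟩ := w
        change _ ≫ conv.ι t (𝟙 Y') ≫ (M.assoc A B Y').hom ≫ conv.map (el p) (conv.ι q r)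
          = conv.ι ((M.tensor.obj (A, B)).map f.op t) (𝟙 Y) ≫ (M.assoc A B Y).hom ≫
            conv.map (el p) (conv.ι q (R.map g.op r))
        have h := M.assoc_naturality (𝟙 A) (𝟙 B) g
        rw [← prod_id, M.tensor.map_id, yoneda.map_id] at h
        rw [← Category.assoc, conv.ι_yo_right, Category.assoc, reassoc_of% h, conv.ι_right,
          ← conv.map_comp, Category.id_comp])

/-- The inverse associator under composition with `P ⋄ Q ⋄ R`. -/
def assocInv (P Q R : Psh V) : M.conv P (M.conv Q R) ⟶ M.conv (M.conv P Q) R :=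
  conv.desc (fun {X _} p x => Quot.lift (fun w : ConvRep M.tensor Q R _ =>
      conv.ι (𝟙 X) w.split ≫ (M.assoc X w.fst w.snd).inv ≫
        conv.map (conv.ι p w.left) (el w.right))
    (by
      rintro _ _ ⟨f, g, t, q, r⟩
      have e : conv.ι (T := M.tensor) (𝟙 X) (M.tensor.map (Prod.mkHom f g) |>.app _ t)
          = conv.ι (T := M.tensor) (𝟙 X) t ≫
            conv.map (yoneda.map (𝟙 X)) (M.tensor.map (Prod.mkHom f g)) := by
        rw [conv.ι_map]; simp
      dsimp only
      rw [e, el_map, conv.ι_right, conv.map_comp, Category.assoc,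
        reassoc_of% (M.assocInv_naturality (𝟙 X) f g)]) x)
    (by
      intro X X' Y Y' f g p x
      induction x using Quot.ind with
      | mk w =>
        obtain ⟨A, B, t, q, r⟩ := w
        change _ ≫ conv.ι (𝟙 X') t ≫ (M.assoc X' A B).inv ≫ conv.map (conv.ι p q) (el r)
          = conv.ι (𝟙 X) ((M.tensor.obj (A, B)).map g.op t) ≫ (M.assoc X A B).inv ≫
            conv.map (conv.ι (P.map f.op p) q) (el r)
        have h := M.assocInv_naturality f (𝟙 A) (𝟙 B)
        rw [← prod_id, M.tensor.map_id, yoneda.map_id] at h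
        rw [← Category.assoc, conv.ι_yo_left, Category.assoc, reassoc_of% h, conv.ι_left,
          ← conv.map_comp, Category.id_comp])

/-- The left unitor under composition with `P`. -/
def leftHom (P : Psh V) : M.conv M.unit P ⟶ P :=
  conv.desc (fun {_ X} n p => conv.ι n (𝟙 X) ≫ (M.left X).hom ≫ el p) (by
    intro X X' Y Y' f g n p
    rw [← Category.assoc, conv.ι_yo_right, Category.assoc, reassoc_of% (M.left_naturality g),
      el_map])

/-- The right unitor under composition with `P`. -/
def rightHom (P : Psh V) : M.conv P M.unit ⟶ P :=
  conv.desc (fun {X _} p n => conv.ι (𝟙 X) n ≫ (M.right X).hom ≫ el p) (by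
    intro X X' Y Y' f g p n
    rw [← Category.assoc, conv.ι_yo_left, Category.assoc, reassoc_of% (M.right_naturality f),
      el_map])

/-- The inverse left unitor under composition with `P`. -/
def leftInv (P : Psh V) : P ⟶ M.conv M.unit P where
  app A := ↾fun p => ((M.left A.unop).inv ≫ conv.map (𝟙 M.unit) (el p)).app A (𝟙 A.unop)
  naturality A A' k := by
    obtain ⟨k, rfl⟩ : ∃ k', k = Quiver.Hom.op k' := ⟨k.unop, rfl⟩
    ext p
    have h : (M.left A'.unop).inv ≫ conv.map (𝟙 M.unit) (yoneda.map k)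
        = yoneda.map k ≫ (M.left A.unop).inv := by
      rw [Iso.inv_comp_eq, ← Category.assoc, Iso.eq_comp_inv, M.left_naturality]
    have e : (M.left A'.unop).inv ≫ conv.map (𝟙 M.unit) (el (P.map k.op p))
        = yoneda.map k ≫ (M.left A.unop).inv ≫ conv.map (𝟙 M.unit) (el p) := by
      rw [el_map, ← reassoc_of% h, ← conv.map_comp, Category.id_comp]
    have e' := congrArg (fun z => z.app A' (𝟙 A'.unop)) e
    refine e'.trans ?_
    have := NatTrans.naturality_apply ((M.left A.unop).inv ≫ conv.map (𝟙 M.unit) (el p)) k.op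
      (𝟙 A.unop)
    refine Eq.trans ?_ this
    simp

/-- The inverse right unitor under composition with `P`. -/
def rightInv (P : Psh V) : P ⟶ M.conv P M.unit where
  app A := ↾fun p => ((M.right A.unop).inv ≫ conv.map (el p) (𝟙 M.unit)).app A (𝟙 A.unop)
  naturality A A' k := by
    obtain ⟨k, rfl⟩ : ∃ k', k = Quiver.Hom.op k' := ⟨k.unop, rfl⟩
    ext p
    have h : (M.right A'.unop).inv ≫ conv.map (yoneda.map k) (𝟙 M.unit)
        = yoneda.map k ≫ (M.right A.unop).inv := by
      rw [Iso.inv_comp_eq, ← Category.assoc, Iso.eq_comp_inv, M.right_naturality]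
    have e : (M.right A'.unop).inv ≫ conv.map (el (P.map k.op p)) (𝟙 M.unit)
        = yoneda.map k ≫ (M.right A.unop).inv ≫ conv.map (el p) (𝟙 M.unit) := by
      rw [el_map, ← reassoc_of% h, ← conv.map_comp, Category.id_comp]
    have e' := congrArg (fun z => z.app A' (𝟙 A'.unop)) e
    refine e'.trans ?_
    have := NatTrans.naturality_apply ((M.right A.unop).inv ≫ conv.map (el p) (𝟙 M.unit)) k.op
      (𝟙 A.unop)
    refine Eq.trans ?_ this
    simp

end PromonoidalData

/-- A promonoidal structure on `V`: associator and unitors satisfy the pentagon and triangle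
equations. -/
structure Promonoidal (V : Type u) [SmallCategory V] extends PromonoidalData V where
  pentagon : ∀ X Y Z W : V,
    conv.map (toPromonoidalData.assocHom (yo X) (yo Y) (yo Z)) (𝟙 (yo W)) ≫
        toPromonoidalData.assocHom (yo X) (toPromonoidalData.conv (yo Y) (yo Z)) (yo W) ≫
        conv.map (𝟙 (yo X)) (toPromonoidalData.assocHom (yo Y) (yo Z) (yo W))
      = toPromonoidalData.assocHom (toPromonoidalData.conv (yo X) (yo Y)) (yo Z) (yo W) ≫
        toPromonoidalData.assocHom (yo X) (yo Y) (toPromonoidalData.conv (yo Z) (yo W))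
  triangle : ∀ X Y : V,
    toPromonoidalData.assocHom (yo X) unit (yo Y) ≫
        conv.map (𝟙 (yo X)) (toPromonoidalData.leftHom (yo Y))
      = conv.map (toPromonoidalData.rightHom (yo X)) (𝟙 (yo Y))

/-! ## Produoidal categories -/

/-- The data of a produoidal structure on `V`: a parallel promonoidal structure `(⊗, I)`, a
sequential promonoidal structure `(◁, N)` and the laxators
* `ψ₂ : V(•; (X ◁ Y) ⊗ (Z ◁ W)) → V(•; (X ⊗ Z) ◁ (Y ⊗ W))`, natural in `X`, `Y`, `Z`, `W`,
* `ψ₀ : V(•; I) → V(•; I ◁ I)`,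
* `φ₂ : V(•; N ⊗ N) → V(•; N)`,
* `φ₀ : V(•; I) → V(•; N)`. -/
structure ProduoidalData (V : Type u) [SmallCategory V] where
  /-- The parallel structure `(⊗, I)`. -/
  par : Promonoidal V
  /-- The sequential structure `(◁, N)`. -/
  seq : Promonoidal V
  /-- The laxator `ψ₂`. -/
  psi₂ : ∀ X Y Z W : V,
    par.conv (seq.tensor.obj (X, Y)) (seq.tensor.obj (Z, W)) ⟶
      seq.conv (par.tensor.obj (X, Z)) (par.tensor.obj (Y, W))
  /-- The laxator `ψ₀`. -/
  psi₀ : par.unit ⟶ seq.conv par.unit par.unit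
  /-- The laxator `φ₂`. -/
  phi₂ : par.conv seq.unit seq.unit ⟶ seq.unit
  /-- The laxator `φ₀`. -/
  phi₀ : par.unit ⟶ seq.unit
  psi₂_naturality : ∀ {X X' Y Y' Z Z' W W' : V} (f : X ⟶ X') (g : Y ⟶ Y') (h : Z ⟶ Z')
      (k : W ⟶ W'),
    conv.map (seq.tensor.map (Prod.mkHom f g)) (seq.tensor.map (Prod.mkHom h k)) ≫
        psi₂ X' Y' Z' W'
      = psi₂ X Y Z W ≫
        conv.map (par.tensor.map (Prod.mkHom f h)) (par.tensor.map (Prod.mkHom g k))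

namespace ProduoidalData

variable {V : Type u} [SmallCategory V] (D : ProduoidalData V)

/-- The parallel composite `P ⊗ Q`. -/
abbrev otimes (P Q : Psh V) : Psh V := D.par.conv P Q

/-- The sequential composite `P ◁ Q`. -/
abbrev tri (P Q : Psh V) : Psh V := D.seq.conv P Q

/-- The parallel unit `I`. -/
abbrev I : Psh V := D.par.unit

/-- The sequential unit `N`. -/
abbrev N : Psh V := D.seq.unit

/-- The laxator `ψ₂` under composition with `P ⋄ Q ⋄ R ⋄ S`: on nested splits it acts as
`ψ₂ : (X ◁ Y) ⊗ (Z ◁ W) → (X ⊗ Z) ◁ (Y ⊗ W)`, and it keeps what is plugged into `X`, `Y`, `Z`,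
`W`. -/
def psi (P Q R S : Psh V) :
    D.otimes (D.tri P Q) (D.tri R S) ⟶ D.tri (D.otimes P R) (D.otimes Q S) :=
  conv.desc (fun {_ _} x x' => Quot.lift₂
    (fun (w : ConvRep D.seq.tensor P Q _) (w' : ConvRep D.seq.tensor R S _) =>
      conv.ι w.split w'.split ≫ D.psi₂ w.fst w.snd w'.fst w'.snd ≫
        conv.map (conv.ι w.left w'.left) (conv.ι w.right w'.right))
    (by
      rintro ⟨X, Y, t, p, q⟩ _ _ ⟨f, g, t', r, s⟩
      have e : conv.ι (T := D.par.tensor) t ((D.seq.tensor.map (Prod.mkHom f g)).app _ t')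
          = conv.ι (T := D.par.tensor) t t' ≫
            conv.map (D.seq.tensor.map (Prod.mkHom (𝟙 X) (𝟙 Y)))
              (D.seq.tensor.map (Prod.mkHom f g)) := by
        rw [conv.ι_map, ← prod_id, D.seq.tensor.map_id]; rfl
      dsimp only
      rw [e, conv.ι_right, conv.ι_right, conv.map_comp, Category.assoc,
        reassoc_of% (D.psi₂_naturality (𝟙 X) (𝟙 Y) f g)])
    (by
      rintro _ _ ⟨Z, W, t', r, s⟩ ⟨f, g, t, p, q⟩
      have e : conv.ι (T := D.par.tensor) ((D.seq.tensor.map (Prod.mkHom f g)).app _ t) t'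
          = conv.ι (T := D.par.tensor) t t' ≫
            conv.map (D.seq.tensor.map (Prod.mkHom f g))
              (D.seq.tensor.map (Prod.mkHom (𝟙 Z) (𝟙 W))) := by
        rw [conv.ι_map, ← prod_id, D.seq.tensor.map_id]; rfl
      dsimp only
      rw [e, conv.ι_left, conv.ι_left, conv.map_comp, Category.assoc,
        reassoc_of% (D.psi₂_naturality f g (𝟙 Z) (𝟙 W))]) x x')
    (by
      intro U U' U₁ U₁' f g x x'
      induction x using Quot.ind with
      | mk w =>
        induction x' using Quot.ind with
        | mk w' =>
          exact (congrArg (fun k => k ≫ D.psi₂ w.fst w.snd w'.fst w'.snd ≫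
            conv.map (conv.ι w.left w'.left) (conv.ι w.right w'.right))
            (conv.ι_naturality f g w.split w'.split)))

end ProduoidalData

/-- A produoidal structure on `V`: the laxators, associators and unitors satisfy the coherence
equations. -/
structure ProduoidalStruct (V : Type u) [SmallCategory V] extends ProduoidalData V where
  /-- `ψ₂` and the associator of `⊗`. -/
  psi_par_assoc : ∀ A B C D E F : V,
    conv.map (toProduoidalData.psi (yo A) (yo B) (yo C) (yo D)) (𝟙 (seq.conv (yo E) (yo F))) ≫
        toProduoidalData.psi (par.conv (yo A) (yo C)) (par.conv (yo B) (yo D)) (yo E) (yo F) ≫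
        conv.map (par.assocHom (yo A) (yo C) (yo E)) (par.assocHom (yo B) (yo D) (yo F))
      = par.assocHom (seq.conv (yo A) (yo B)) (seq.conv (yo C) (yo D)) (seq.conv (yo E) (yo F)) ≫
        conv.map (𝟙 (seq.conv (yo A) (yo B)))
          (toProduoidalData.psi (yo C) (yo D) (yo E) (yo F)) ≫
        toProduoidalData.psi (yo A) (yo B) (par.conv (yo C) (yo E)) (par.conv (yo D) (yo F))
  /-- `ψ₂` and the associator of `◁`. -/
  psi_seq_assoc : ∀ A B C D E F : V,
    toProduoidalData.psi (seq.conv (yo A) (yo B)) (yo C) (seq.conv (yo D) (yo E)) (yo F) ≫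
        conv.map (toProduoidalData.psi (yo A) (yo B) (yo D) (yo E))
          (𝟙 (par.conv (yo C) (yo F))) ≫
        seq.assocHom (par.conv (yo A) (yo D)) (par.conv (yo B) (yo E)) (par.conv (yo C) (yo F))
      = conv.map (seq.assocHom (yo A) (yo B) (yo C)) (seq.assocHom (yo D) (yo E) (yo F)) ≫
        toProduoidalData.psi (yo A) (seq.conv (yo B) (yo C)) (yo D) (seq.conv (yo E) (yo F)) ≫
        conv.map (𝟙 (par.conv (yo A) (yo D)))
          (toProduoidalData.psi (yo B) (yo C) (yo E) (yo F))
  /-- `ψ₀` is a left unit for `ψ₂`. -/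
  psi₀_left : ∀ A B : V,
    conv.map psi₀ (𝟙 (seq.conv (yo A) (yo B))) ≫
        toProduoidalData.psi par.unit par.unit (yo A) (yo B) ≫
        conv.map (par.leftHom (yo A)) (par.leftHom (yo B))
      = par.leftHom (seq.conv (yo A) (yo B))
  /-- `ψ₀` is a right unit for `ψ₂`. -/
  psi₀_right : ∀ A B : V,
    conv.map (𝟙 (seq.conv (yo A) (yo B))) psi₀ ≫
        toProduoidalData.psi (yo A) (yo B) par.unit par.unit ≫
        conv.map (par.rightHom (yo A)) (par.rightHom (yo B))
      = par.rightHom (seq.conv (yo A) (yo B))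
  /-- `φ₂` and the left unitor of `◁`. -/
  phi₂_left : ∀ A B : V,
    toProduoidalData.psi seq.unit (yo A) seq.unit (yo B) ≫
        conv.map phi₂ (𝟙 (par.conv (yo A) (yo B))) ≫ seq.leftHom (par.conv (yo A) (yo B))
      = conv.map (seq.leftHom (yo A)) (seq.leftHom (yo B))
  /-- `φ₂` and the right unitor of `◁`. -/
  phi₂_right : ∀ A B : V,
    toProduoidalData.psi (yo A) seq.unit (yo B) seq.unit ≫
        conv.map (𝟙 (par.conv (yo A) (yo B))) phi₂ ≫ seq.rightHom (par.conv (yo A) (yo B))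
      = conv.map (seq.rightHom (yo A)) (seq.rightHom (yo B))
  /-- `φ₂ : N ⊗ N → N` is associative. -/
  phi₂_assoc : conv.map phi₂ (𝟙 seq.unit) ≫ phi₂
    = par.assocHom seq.unit seq.unit seq.unit ≫ conv.map (𝟙 seq.unit) phi₂ ≫ phi₂
  /-- `ψ₀ : I → I ◁ I` is coassociative. -/
  psi₀_assoc : psi₀ ≫ conv.map psi₀ (𝟙 par.unit) ≫ seq.assocHom par.unit par.unit par.unit
    = psi₀ ≫ conv.map (𝟙 par.unit) psi₀
  /-- `φ₀ : I → N` is a right unit for `φ₂`. -/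
  phi₀_right : conv.map (𝟙 seq.unit) phi₀ ≫ phi₂ = par.rightHom seq.unit
  /-- `φ₀ : I → N` is a left unit for `φ₂`. -/
  phi₀_left : conv.map phi₀ (𝟙 seq.unit) ≫ phi₂ = par.leftHom seq.unit
  /-- `φ₀ : I → N` is a right counit for `ψ₀`. -/
  phi₀_coright : psi₀ ≫ conv.map (𝟙 par.unit) phi₀ ≫ seq.rightHom par.unit = 𝟙 par.unit
  /-- `φ₀ : I → N` is a left counit for `ψ₀`. -/
  phi₀_coleft : psi₀ ≫ conv.map phi₀ (𝟙 par.unit) ≫ seq.leftHom par.unit = 𝟙 par.unit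

/-! ## Produoidal functors -/

/-- A family of maps `V(A; X ⊗ Y) → W(F A; F X ⊗ F Y)`, natural in `A`, `X` and `Y`. -/
@[ext]
structure SplitMap {V W : Type u} [SmallCategory V] [SmallCategory W] (F : V ⥤ W)
    (T : Profunctor.{u} (V × V) V) (T' : Profunctor.{u} (W × W) W) where
  /-- The maps. -/
  app : ∀ X Y : V, T.obj (X, Y) ⟶ F.op ⋙ T'.obj (F.obj X, F.obj Y)
  naturality : ∀ {X X' Y Y' : V} (f : X ⟶ X') (g : Y ⟶ Y'),
    T.map (Prod.mkHom f g) ≫ app X' Y'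
      = app X Y ≫ Functor.whiskerLeft F.op (T'.map (Prod.mkHom (F.map f) (F.map g)))

/-- The map induced on composites, sending a split `s` with `p`, `q` plugged in to the split `F s`
with `a p`, `b q` plugged in. -/
def SplitMap.conv {V W : Type u} [SmallCategory V] [SmallCategory W] {F : V ⥤ W}
    {T : Profunctor.{u} (V × V) V} {T' : Profunctor.{u} (W × W) W} (τ : SplitMap F T T')
    {P Q : Psh V} {P' Q' : Psh W} (a : P ⟶ F.op ⋙ P') (b : Q ⟶ F.op ⋙ Q') :
    conv T P Q ⟶ F.op ⋙ Produoidal.conv T' P' Q' :=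
  conv.desc (fun {X Y} p q => τ.app X Y ≫
    Functor.whiskerLeft F.op (conv.ι (a.app (op X) p) (b.app (op Y) q))) (by
    intro X X' Y Y' f g p q
    rw [← Category.assoc, τ.naturality, Category.assoc, NatTrans.naturality_apply,
      NatTrans.naturality_apply]
    congr 1
    exact congrArg (Functor.whiskerLeft F.op)
      (conv.ι_naturality (F.map f) (F.map g) (a.app (op X') p) (b.app (op Y') q)))

/-- The structure of a promonoidal functor on `F`: natural transformations
`V(A; X ⊗ Y) → W(F A; F X ⊗ F Y)` and `V(A; I) → W(F A; I)` that preserve the associator and the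
unitors. -/
@[ext]
structure PromonoidalFunctor {V W : Type u} [SmallCategory V] [SmallCategory W] (F : V ⥤ W)
    (M : Promonoidal V) (M' : Promonoidal W) where
  /-- The action on splits. -/
  tensor : SplitMap F M.tensor M'.tensor
  /-- The action on units. -/
  unit : M.unit ⟶ F.op ⋙ M'.unit
  map_assoc : ∀ X Y Z : V,
    (M.assoc X Y Z).hom ≫ tensor.conv (yonedaMap F X) (tensor.app Y Z)
      = tensor.conv (tensor.app X Y) (yonedaMap F Z) ≫
        Functor.whiskerLeft F.op (M'.assoc (F.obj X) (F.obj Y) (F.obj Z)).hom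
  map_left : ∀ X : V,
    (M.left X).hom ≫ yonedaMap F X
      = tensor.conv unit (yonedaMap F X) ≫ Functor.whiskerLeft F.op (M'.left (F.obj X)).hom
  map_right : ∀ X : V,
    (M.right X).hom ≫ yonedaMap F X
      = tensor.conv (yonedaMap F X) unit ≫ Functor.whiskerLeft F.op (M'.right (F.obj X)).hom

/-- A produoidal functor: a functor with promonoidal structures for `⊗` and `◁` that preserves the
laxators. -/
structure ProduoidalFunctor {V W : Type u} [SmallCategory V] [SmallCategory W]
    (D : ProduoidalStruct V) (E : ProduoidalStruct W) where
  /-- The underlying functor. -/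
  toFunctor : V ⥤ W
  /-- The action on parallel splits and units. -/
  par : PromonoidalFunctor toFunctor D.par E.par
  /-- The action on sequential splits and units. -/
  seq : PromonoidalFunctor toFunctor D.seq E.seq
  map_psi₂ : ∀ X Y Z W : V,
    D.psi₂ X Y Z W ≫ seq.tensor.conv (par.tensor.app X Z) (par.tensor.app Y W)
      = par.tensor.conv (seq.tensor.app X Y) (seq.tensor.app Z W) ≫
        Functor.whiskerLeft toFunctor.op (E.psi₂ (toFunctor.obj X) (toFunctor.obj Y)
          (toFunctor.obj Z) (toFunctor.obj W))
  map_psi₀ : D.psi₀ ≫ seq.tensor.conv par.unit par.unit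
    = par.unit ≫ Functor.whiskerLeft toFunctor.op E.psi₀
  map_phi₂ : D.phi₂ ≫ seq.unit
    = par.tensor.conv seq.unit seq.unit ≫ Functor.whiskerLeft toFunctor.op E.phi₂
  map_phi₀ : D.phi₀ ≫ seq.unit = par.unit ≫ Functor.whiskerLeft toFunctor.op E.phi₀

/-- The identity on splits. -/
def SplitMap.id {V : Type u} [SmallCategory V] (T : Profunctor.{u} (V × V) V) :
    SplitMap (𝟭 V) T T where
  app X Y := 𝟙 (T.obj (X, Y))
  naturality _ _ := rfl

/-- Composition of actions on splits. -/
def SplitMap.comp {U V W : Type u} [SmallCategory U] [SmallCategory V] [SmallCategory W]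
    {F : U ⥤ V} {G : V ⥤ W} {T : Profunctor.{u} (U × U) U} {T' : Profunctor.{u} (V × V) V}
    {T'' : Profunctor.{u} (W × W) W} (τ : SplitMap F T T') (σ : SplitMap G T' T'') :
    SplitMap (F ⋙ G) T T'' where
  app X Y := τ.app X Y ≫ Functor.whiskerLeft F.op (σ.app (F.obj X) (F.obj Y))
  naturality {X X' Y Y'} f g := by
    rw [← Category.assoc, τ.naturality, Category.assoc, Category.assoc]
    congr 1
    exact congrArg (Functor.whiskerLeft F.op) (σ.naturality (F.map f) (F.map g))

lemma SplitMap.comp_conv {U V W : Type u} [SmallCategory U] [SmallCategory V] [SmallCategory W]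
    {F : U ⥤ V} {G : V ⥤ W} {T : Profunctor.{u} (U × U) U} {T' : Profunctor.{u} (V × V) V}
    {T'' : Profunctor.{u} (W × W) W} (τ : SplitMap F T T') (σ : SplitMap G T' T'')
    {P Q : Psh U} {P' Q' : Psh V} {P'' Q'' : Psh W} (a : P ⟶ F.op ⋙ P') (b : Q ⟶ F.op ⋙ Q')
    (a' : P' ⟶ G.op ⋙ P'') (b' : Q' ⟶ G.op ⋙ Q'') :
    (τ.comp σ).conv (P' := P'') (Q' := Q'') (a ≫ Functor.whiskerLeft F.op a')
        (b ≫ Functor.whiskerLeft F.op b')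
      = τ.conv a b ≫ Functor.whiskerLeft F.op (σ.conv a' b') :=
  conv.hom_ext fun _ _ => rfl

lemma SplitMap.id_conv_id {V : Type u} [SmallCategory V] (T : Profunctor.{u} (V × V) V)
    {P Q : Psh V} (a : P ⟶ (𝟭 V).op ⋙ P) (b : Q ⟶ (𝟭 V).op ⋙ Q) (ha : a = 𝟙 P) (hb : b = 𝟙 Q) :
    (SplitMap.id T).conv a b = 𝟙 (Produoidal.conv T P Q) := by
  subst ha hb
  exact conv.hom_ext fun _ _ => rfl

/-- Pasting of commutative squares over two functors. -/
lemma square_comp {U V W : Type u} [SmallCategory U] [SmallCategory V] [SmallCategory W]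
    {F : U ⥤ V} {G : V ⥤ W} {S S₁ : Psh U} {S' S₁' : Psh V} {S'' S₁'' : Psh W}
    {a : S ⟶ S₁} {a' : S' ⟶ S₁'} {a'' : S'' ⟶ S₁''} {b : S ⟶ F.op ⋙ S'} {b₁ : S₁ ⟶ F.op ⋙ S₁'}
    {c : S' ⟶ G.op ⋙ S''} {c₁ : S₁' ⟶ G.op ⋙ S₁''}
    (h : a ≫ b₁ = b ≫ Functor.whiskerLeft F.op a')
    (h' : a' ≫ c₁ = c ≫ Functor.whiskerLeft G.op a'') :
    a ≫ b₁ ≫ Functor.whiskerLeft F.op c₁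
      = (b ≫ Functor.whiskerLeft F.op c) ≫ Functor.whiskerLeft (F ⋙ G).op a'' := by
  rw [← Category.assoc, h, Category.assoc, Category.assoc]
  congr 1
  exact congrArg (Functor.whiskerLeft F.op) h'

/-- The identity promonoidal functor. -/
def PromonoidalFunctor.id {V : Type u} [SmallCategory V] (M : Promonoidal V) :
    PromonoidalFunctor (𝟭 V) M M where
  tensor := SplitMap.id M.tensor
  unit := 𝟙 M.unit
  map_assoc X Y Z := by
    rw [SplitMap.id_conv_id M.tensor _ _ rfl rfl, SplitMap.id_conv_id M.tensor _ _ rfl rfl]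
    rfl
  map_left X := by
    rw [SplitMap.id_conv_id M.tensor _ _ rfl rfl]
    rfl
  map_right X := by
    rw [SplitMap.id_conv_id M.tensor _ _ rfl rfl]
    rfl

/-- Composition of promonoidal functors. -/
def PromonoidalFunctor.comp {U V W : Type u} [SmallCategory U] [SmallCategory V]
    [SmallCategory W] {F : U ⥤ V} {G : V ⥤ W} {M : Promonoidal U} {M' : Promonoidal V}
    {M'' : Promonoidal W} (f : PromonoidalFunctor F M M') (g : PromonoidalFunctor G M' M'') :
    PromonoidalFunctor (F ⋙ G) M M'' where
  tensor := f.tensor.comp g.tensor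
  unit := f.unit ≫ Functor.whiskerLeft F.op g.unit
  map_assoc X Y Z := by
    rw [show yonedaMap (F ⋙ G) X = yonedaMap F X ≫ Functor.whiskerLeft F.op (yonedaMap G _) from rfl,
      show yonedaMap (F ⋙ G) Z = yonedaMap F Z ≫ Functor.whiskerLeft F.op (yonedaMap G _) from rfl]
    refine (congrArg (_ ≫ ·) (SplitMap.comp_conv f.tensor g.tensor _ (f.tensor.app Y Z) _
      (g.tensor.app _ _))).trans ((square_comp (f.map_assoc X Y Z) (g.map_assoc _ _ _)).trans ?_)
    exact congrArg (· ≫ _) (SplitMap.comp_conv f.tensor g.tensor (f.tensor.app X Y) _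
      (g.tensor.app _ _) _).symm
  map_left X := by
    refine (square_comp (f.map_left X) (g.map_left _)).trans ?_
    exact congrArg (· ≫ _) (SplitMap.comp_conv f.tensor g.tensor _ _ _ _).symm
  map_right X := by
    refine (square_comp (f.map_right X) (g.map_right _)).trans ?_
    exact congrArg (· ≫ _) (SplitMap.comp_conv f.tensor g.tensor _ _ _ _).symm

/-- The identity produoidal functor. -/
def ProduoidalFunctor.id {V : Type u} [SmallCategory V] (D : ProduoidalStruct V) :
    ProduoidalFunctor D D where
  toFunctor := 𝟭 V
  par := .id D.par
  seq := .id D.seq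
  map_psi₂ X Y Z W := by
    refine (congrArg (_ ≫ ·) (SplitMap.id_conv_id D.seq.tensor _ _ rfl rfl)).trans ?_
    exact (congrArg (· ≫ D.psi₂ X Y Z W)
      (SplitMap.id_conv_id D.par.tensor (𝟙 (D.seq.tensor.obj (X, Y)))
        (𝟙 (D.seq.tensor.obj (Z, W))) rfl rfl)).symm
  map_psi₀ := by
    exact congrArg (D.psi₀ ≫ ·)
      (SplitMap.id_conv_id D.seq.tensor (𝟙 D.par.unit) (𝟙 D.par.unit) rfl rfl)
  map_phi₂ := by
    exact (congrArg (· ≫ D.phi₂)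
      (SplitMap.id_conv_id D.par.tensor (𝟙 D.seq.unit) (𝟙 D.seq.unit) rfl rfl)).symm
  map_phi₀ := rfl

/-- Composition of produoidal functors. -/
def ProduoidalFunctor.comp {U V W : Type u} [SmallCategory U] [SmallCategory V]
    [SmallCategory W] {C : ProduoidalStruct U} {D : ProduoidalStruct V} {E : ProduoidalStruct W}
    (f : ProduoidalFunctor C D) (g : ProduoidalFunctor D E) : ProduoidalFunctor C E where
  toFunctor := f.toFunctor ⋙ g.toFunctor
  par := f.par.comp g.par
  seq := f.seq.comp g.seq
  map_psi₂ X Y Z W := by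
    refine (congrArg (_ ≫ ·) (SplitMap.comp_conv f.seq.tensor g.seq.tensor (f.par.tensor.app X Z)
      (f.par.tensor.app Y W) (g.par.tensor.app _ _) (g.par.tensor.app _ _))).trans
      ((square_comp (f.map_psi₂ X Y Z W) (g.map_psi₂ _ _ _ _)).trans ?_)
    exact congrArg (· ≫ _) (SplitMap.comp_conv f.par.tensor g.par.tensor (f.seq.tensor.app X Y)
      (f.seq.tensor.app Z W) (g.seq.tensor.app _ _) (g.seq.tensor.app _ _)).symm
  map_psi₀ := by
    refine (congrArg (_ ≫ ·) (SplitMap.comp_conv f.seq.tensor g.seq.tensor f.par.unit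
      f.par.unit g.par.unit g.par.unit)).trans ?_
    exact square_comp f.map_psi₀ g.map_psi₀
  map_phi₂ := by
    refine (square_comp f.map_phi₂ g.map_phi₂).trans ?_
    exact congrArg (· ≫ _) (SplitMap.comp_conv f.par.tensor g.par.tensor f.seq.unit
      f.seq.unit g.seq.unit g.seq.unit).symm
  map_phi₀ := by
    exact square_comp f.map_phi₀ g.map_phi₀

/-- The objects of the category `pDuo`: small categories with a produoidal structure. -/
structure PDuo : Type (u + 1) where
  /-- The objects of the category. -/
  carrier : Type u
  /-- The category structure. -/
  [cat : SmallCategory carrier]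
  /-- The produoidal structure. -/
  str : ProduoidalStruct carrier

instance : CoeSort PDuo.{u} (Type u) := ⟨PDuo.carrier⟩

instance (V : PDuo.{u}) : SmallCategory V := V.cat

/-- The category `pDuo` of produoidal categories and produoidal functors. -/
instance : LargeCategory PDuo.{u} where
  Hom V W := ProduoidalFunctor V.str W.str
  id V := .id V.str
  comp f g := f.comp g
  id_comp _ := rfl
  comp_id _ := rfl
  assoc _ _ _ := rfl

/-- A produoidal category is normal when the laxator `φ₀ : V(•; I) → V(•; N)` is invertible. -/
def isNormal : ObjectProperty PDuo.{u} := fun V => IsIso V.str.phi₀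

/-- The category `nPDuo` of normal produoidal categories: the full subcategory of `pDuo`. -/
abbrev NPDuo : Type (u + 1) := isNormal.{u}.FullSubcategory

instance (W : NPDuo.{u}) : IsIso W.obj.str.phi₀ := W.property

/-! ## Normalization -/

namespace ProduoidalData

variable {V : Type u} [SmallCategory V] (D : ProduoidalData V)

/-- `N ⊗ P ⊗ N`. -/
abbrev sandwich (P : Psh V) : Psh V := D.otimes D.N (D.otimes P D.N)

/-- `P ≅ I ⊗ P ⊗ I → N ⊗ P ⊗ N`, by the unitors and `φ₀`. -/
def sandwichUnit (P : Psh V) : P ⟶ D.sandwich P :=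
  D.par.rightInv P ≫ D.par.leftInv (D.otimes P D.I) ≫
    conv.map D.phi₀ (conv.map (𝟙 P) D.phi₀)

/-- `N ⊗ (N ⊗ P ⊗ N) ⊗ N ≅ (N ⊗ N) ⊗ P ⊗ (N ⊗ N) → N ⊗ P ⊗ N`, by the associators and `φ₂`. -/
def sandwichMul (P : Psh V) : D.sandwich (D.sandwich P) ⟶ D.sandwich P :=
  conv.map (𝟙 D.N) (D.par.assocHom D.N (D.otimes P D.N) D.N) ≫
    conv.map (𝟙 D.N) (conv.map (𝟙 D.N) (D.par.assocHom P D.N D.N)) ≫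
    D.par.assocInv D.N D.N (D.otimes P (D.otimes D.N D.N)) ≫
    conv.map D.phi₂ (conv.map (𝟙 P) D.phi₂)

/-- The promonad `𝓝V(A; B) = V(A; N ⊗ B ⊗ N)`. -/
abbrev NHom (A B : V) : Type u := (D.sandwich (yo B)).obj (op A)

/-- The unit of the promonad, `V(A; B) → 𝓝V(A; B)`. -/
def NHom.unit {A B : V} (f : A ⟶ B) : D.NHom A B := (D.sandwichUnit (yo B)).app (op A) f

/-- The multiplication of the promonad, `𝓝V(A; B) × 𝓝V(B; C) → 𝓝V(A; C)`: plug the second element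
into the first, then multiply the units. -/
def NHom.comp {A B C : V} (f : D.NHom A B) (g : D.NHom B C) : D.NHom A C :=
  (conv.map (𝟙 D.N) (conv.map (el g) (𝟙 D.N)) ≫ D.sandwichMul (yo C)).app (op A) f

/-- In a normal produoidal category, `N ⊗ P ⊗ N ≅ I ⊗ P ⊗ I ≅ P`, by `φ₀⁻¹` and the unitors. -/
noncomputable def collapse [IsIso D.phi₀] (P : Psh V) : D.sandwich P ⟶ P :=
  conv.map (inv D.phi₀) (conv.map (𝟙 P) (inv D.phi₀) ≫ D.par.rightHom P) ≫ D.par.leftHom P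

end ProduoidalData

section Comparison

variable {V : PDuo.{u}} {W : NPDuo.{u}} (η : V ⟶ W.obj)

/-- The functor underlying a produoidal functor. -/
abbrev under {V W : PDuo.{u}} (F : V ⟶ W) : V.carrier ⥤ W.carrier := F.toFunctor

/-- For a produoidal functor `η` from `V` to a normal `W`, the comparison map
`V(A; N ⊗ B ⊗ N) → W(ηA; N ⊗ ηB ⊗ N) ≅ W(ηA; ηB)`. -/
noncomputable def compareHom (B : V) :
    V.str.sandwich (yo B) ⟶ (under η).op ⋙ yo ((under η).obj B) :=
  η.par.tensor.conv η.seq.unit (η.par.tensor.conv (yonedaMap (under η) B) η.seq.unit) ≫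
    Functor.whiskerLeft (under η).op (W.obj.str.collapse (yo ((under η).obj B)))

/-- For a produoidal functor `η` from `V` to a normal `W`, the comparison map
`V(A; N ⊗ B ⊗ N ⊗ C ⊗ N) → W(ηA; N ⊗ ηB ⊗ N ⊗ ηC ⊗ N) ≅ W(ηA; ηB ⊗ ηC)`. -/
noncomputable def comparePar (B C : V) :
    V.str.otimes V.str.N (V.str.otimes (yo B) (V.str.sandwich (yo C))) ⟶
      (under η).op ⋙ W.obj.str.par.tensor.obj ((under η).obj B, (under η).obj C) :=
  η.par.tensor.conv η.seq.unit
      (η.par.tensor.conv (yonedaMap (under η) B) (compareHom η C)) ≫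
    Functor.whiskerLeft (under η).op
      (conv.map (inv W.obj.str.phi₀) (conv.reduce ((under η).obj B) ((under η).obj C)) ≫
        W.obj.str.par.leftHom _)

/-- For a produoidal functor `η` from `V` to a normal `W`, the comparison map
`V(A; (N ⊗ B ⊗ N) ◁ (N ⊗ C ⊗ N)) → W(ηA; (N ⊗ ηB ⊗ N) ◁ (N ⊗ ηC ⊗ N)) ≅ W(ηA; ηB ◁ ηC)`. -/
noncomputable def compareSeq (B C : V) :
    V.str.tri (V.str.sandwich (yo B)) (V.str.sandwich (yo C)) ⟶
      (under η).op ⋙ W.obj.str.seq.tensor.obj ((under η).obj B, (under η).obj C) :=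
  η.seq.tensor.conv (compareHom η B) (compareHom η C) ≫
    Functor.whiskerLeft (under η).op (conv.reduce ((under η).obj B) ((under η).obj C))

/-- `η` exhibits the normal produoidal category `W` as the normalization `𝓝V` of `V`: up to the
bijection `η` on objects, `W` is the Kleisli category of the promonad `V(•; N ⊗ • ⊗ N)`, `η` is
the functor that the unit of the promonad induces, and
* `W(A; B) = V(A; N ⊗ B ⊗ N)`,
* `W(A; B ⊗ C) = V(A; N ⊗ B ⊗ N ⊗ C ⊗ N)`,
* `W(A; B ◁ C) = V(A; (N ⊗ B ⊗ N) ◁ (N ⊗ C ⊗ N))`,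
* `W(A; N) = V(A; N)` (and hence `W(A; I) = V(A; N)`, because `W` is normal).
The identifications are the canonical maps, so that the remaining structure of `W` is determined
by that of `V`. -/
structure IsNormalization : Prop where
  obj_bijective : Function.Bijective (under η).obj
  hom_isIso : ∀ B : V, IsIso (compareHom η B)
  map_eq : ∀ {A B : V} (f : A ⟶ B),
    (under η).map f = (compareHom η B).app (op A) (ProduoidalData.NHom.unit _ f)
  comp_eq : ∀ {A B C : V} (f : V.str.NHom A B) (g : V.str.NHom B C),
    ((compareHom η B).app (op A) f : (under η).obj A ⟶ (under η).obj B) ≫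
        (compareHom η C).app (op B) g
      = (compareHom η C).app (op A) (ProduoidalData.NHom.comp _ f g)
  par_isIso : ∀ B C : V, IsIso (comparePar η B C)
  seq_isIso : ∀ B C : V, IsIso (compareSeq η B C)
  unit_isIso : IsIso η.seq.unit

end Comparison

end Produoidal

/-! The construction takes place one level up, in presheaves, where promonoidal structures become
monoidal ones. Day convolution makes the presheaves on `V` a duoidal category for `⊗` and `◁` (the
instance on `ProduoidalStruct.Day`). Two maps of presheaves agree as soon as they agree on a jointly
surjective family (`Covers.hom_ext`), so each law for arbitrary presheaves follows, by naturality,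
from the axiom on representables.

In a duoidal category the unit N of `◁` is a monoid for `⊗` by φ₂ and φ₀, and a comonoid for `◁` by
the inverse unitor `delta`, which is a map of `⊗`-monoids (`phi₀_delta`, `phi₂_delta`). Hence
N-bimodules carry two tensor products: the one over N, a coequalizer that is well behaved because
Day convolution is closed, and `◁`, on which N acts by `delta` followed by ψ₂. Both have the unit N
and φ₀ becomes an identity, so N-bimodules form a normal duoidal category. The free bimodule on P is
N ⊗ P ⊗ N; bimodule maps from the free one on A to the free one on B are therefore the elements of
V(A; N ⊗ B ⊗ N).

The normalization consists of the free bimodules on representables; its splits are the bimodule maps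
from one of them into a tensor product of two others. These profunctors are promonoidal because both
tensor products of bimodules are coends over this family (`TensorDense`, `TriDense`). By the
free-forgetful adjunction, the nerve of a bimodule restricted to `V` is its underlying presheaf. The
composite of underlying presheaves over `V` maps onto the composite of nerves
(`LaxToDay.covers_spread`), and this map is balanced over N (`spread_condition`), so it descends to
an inverse of the canonical map (`LaxToDay.tensorDense`). The stated formula for parallel splits is
(N ⊗ B ⊗ N) ⊗_N M ≅ N ⊗ B ⊗ M with M free (`isIso_freeBimodTensor`).

For the universal property let F : V → W be produoidal with W normal. Restriction of presheaves
along F is lax duoidal (`restrictLax`). In a normal duoidal category every object is an N-bimodule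
through φ₀⁻¹, and a lax duoidal functor turns this into a bimodule over the N of its target; so
restriction lifts to a lax duoidal functor into bimodules (`LaxDuoidal.lift`). Bimodule maps from
the free bimodule on A into the restriction of P are the elements of P(FA), and this evaluation
yields a produoidal functor from the normalization to W that extends F (`extension`,
`normalizationUnit_comp_extension`). Uniqueness: every morphism and split of the normalization is
the value of a comparison map on an element coming from V, and functors between normal produoidal
categories commute with the comparison maps (`compareHom_comp`, `comparePar_comp`,
`compareSeq_comp`), whence `IsNormalization.hom_ext`.

The rest is formal. Normal produoidal categories form a reflective full subcategory, so the monad is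
idempotent and the adjunction monadic. An algebra structure is in particular a retraction of the
unit, and a retract of a normal produoidal category is normal (`isNormal_of_retract`). -/

section

namespace Produoidal

/-! ### Jointly surjective families of presheaf maps. -/

section Covers

variable {V : Type u} [SmallCategory V]

/-- A family of maps of presheaves that is jointly surjective. -/
def Covers {ι : Type*} {Q : ι → Psh V} {P : Psh V} (f : ∀ i, Q i ⟶ P) : Prop :=
  ∀ (A : Vᵒᵖ) (x : P.obj A), ∃ (i : ι) (y : (Q i).obj A), (f i).app A y = x

lemma Covers.hom_ext {ι : Type*} {Q : ι → Psh V} {P : Psh V} {f : ∀ i, Q i ⟶ P} (hf : Covers f)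
    {R : Psh V} {a b : P ⟶ R} (h : ∀ i, f i ≫ a = f i ≫ b) : a = b := by
  ext A x
  obtain ⟨i, y, rfl⟩ := hf A x
  exact congrArg (fun k => k.app A y) (h i)

lemma el_app {P : Psh V} {X : V} (p : P.obj (op X)) {A : V} (f : A ⟶ X) :
    (el p).app (op A) f = P.map f.op p := rfl

lemma el_app_id {P : Psh V} {X : V} (p : P.obj (op X)) : (el p).app (op X) (𝟙 X) = p := by
  rw [el_app]; simp

lemma el_comp {P Q : Psh V} {X : V} (p : P.obj (op X)) (a : P ⟶ Q) :
    el p ≫ a = el (a.app (op X) p) :=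
  yonedaEquiv_symm_naturality_right X a p

lemma el_yo {X Y : V} (f : X ⟶ Y) : el (P := yo Y) f = yoneda.map f := by
  ext A g; rfl

lemma yo_hom_ext {X : V} {P : Psh V} {a b : yo X ⟶ P}
    (h : a.app (op X) (𝟙 X) = b.app (op X) (𝟙 X)) : a = b :=
  yonedaEquiv.injective h

/-- Each element is the image of an identity, by Yoneda. Together with `Covers.conv` this reduces
equations out of nested composites to composites of representables. -/
lemma covers_el (P : Psh V) : Covers (fun x : (Σ X : V, (yo X ⟶ P)) => x.2) :=
  fun A x => ⟨⟨A.unop, el x⟩, 𝟙 A.unop, el_app_id x⟩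

lemma covers_id (P : Psh V) : Covers (fun _ : Unit => 𝟙 P) := fun _ x => ⟨(), x, rfl⟩

/-- A class in the coend has a representative, and only its two plugged-in elements have to be
lifted; the split is kept. -/
lemma Covers.conv {T : Profunctor.{u} (V × V) V} {ι κ : Type*} {P : ι → Psh V} {P' : Psh V}
    {f : ∀ i, P i ⟶ P'} (hf : Covers f) {Q : κ → Psh V} {Q' : Psh V}
    {g : ∀ i, Q i ⟶ Q'} (hg : Covers g) :
    Covers (fun x : ι × κ => conv.map (T := T) (f x.1) (g x.2)) := by
  intro A x
  induction x using Quot.ind with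
  | mk r =>
    obtain ⟨X, Y, s, p, q⟩ := r
    obtain ⟨i, p, rfl⟩ := hf _ p
    obtain ⟨j, q, rfl⟩ := hg _ q
    exact ⟨(i, j), (conv.ι p q).app A s, rfl⟩

end Covers

/-! ### Calculus of coends and Yoneda reduction. -/

section Conv

variable {V : Type u} [SmallCategory V] {T : Profunctor.{u} (V × V) V}

lemma conv.exists_ι {P Q : Psh V} {A : V} (x : (Produoidal.conv T P Q).obj (op A)) :
    ∃ (X Y : V) (t : (T.obj (X, Y)).obj (op A)) (p : P.obj (op X)) (q : Q.obj (op Y)),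
      x = (conv.ι p q).app (op A) t := by
  obtain ⟨⟨X, Y, t, p, q⟩, rfl⟩ := Quot.exists_rep x
  exact ⟨X, Y, t, p, q, rfl⟩

lemma conv.map_id (P Q : Psh V) : conv.map (T := T) (𝟙 P) (𝟙 Q) = 𝟙 (conv T P Q) :=
  conv.hom_ext fun _ _ => rfl

lemma conv.map_comp_assoc : type_of% (reassoc_of% @conv.map_comp) :=
  @(reassoc_of% @conv.map_comp)

lemma conv.ι_map_assoc : type_of% (reassoc_of% @conv.ι_map) :=
  @(reassoc_of% @conv.ι_map)

lemma conv.ι_naturality_assoc : type_of% (reassoc_of% @conv.ι_naturality) :=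
  @(reassoc_of% @conv.ι_naturality)

lemma conv.ι_reduce {B C X Y : V} (f : X ⟶ B) (g : Y ⟶ C) :
    conv.ι (P := yo B) (Q := yo C) f g ≫ conv.reduce (T := T) B C = T.map (Prod.mkHom f g) := rfl

/-- The Yoneda isomorphism `∫^{X, Y} T(•; X, Y) × V(X; B) × V(Y; C) ≅ T(•; B, C)`. -/
def conv.reduceIso (B C : V) : Produoidal.conv T (yo B) (yo C) ≅ T.obj (B, C) where
  hom := conv.reduce B C
  inv := conv.ι (𝟙 B) (𝟙 C)
  hom_inv_id := conv.hom_ext fun {X Y} f g => by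
    rw [← Category.assoc, conv.ι_reduce, conv.ι_naturality]
    simp
  inv_hom_id := by
    rw [conv.ι_reduce, ← prod_id, T.map_id]

lemma conv.reduce_naturality {B B' C C' : V} (f : B ⟶ B') (g : C ⟶ C') :
    conv.map (T := T) (yoneda.map f) (yoneda.map g) ≫ conv.reduce B' C'
      = conv.reduce B C ≫ T.map (Prod.mkHom f g) := by
  refine conv.hom_ext fun {X Y} p q => ?_
  rw [← Category.assoc, conv.ι_map, conv.ι_reduce, ← Category.assoc, conv.ι_reduce, ← T.map_comp]
  rfl

/-- Tensoring two isomorphisms of presheaves. -/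
@[simps]
def conv.mapIso {P P' Q Q' : Psh V} (a : P ≅ P') (b : Q ≅ Q') :
    Produoidal.conv T P Q ≅ Produoidal.conv T P' Q' where
  hom := conv.map a.hom b.hom
  inv := conv.map a.inv b.inv
  hom_inv_id := by rw [← conv.map_comp, a.hom_inv_id, b.hom_inv_id, conv.map_id]
  inv_hom_id := by rw [← conv.map_comp, a.inv_hom_id, b.inv_hom_id, conv.map_id]

end Conv

/-! ### Associators and unitors extended from representables to presheaves. -/

namespace PromonoidalData

variable {V : Type u} [SmallCategory V] (M : PromonoidalData V)

lemma ι_assocHom {P Q R : Psh V} {X Y A Z : V} (t : (M.tensor.obj (X, Y)).obj (op A))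
    (p : P.obj (op X)) (q : Q.obj (op Y)) (r : R.obj (op Z)) :
    conv.ι ((conv.ι (T := M.tensor) p q).app (op A) t) r ≫ M.assocHom P Q R
      = conv.ι t (𝟙 Z) ≫ (M.assoc X Y Z).hom ≫ conv.map (el p) (conv.ι q r) := rfl

lemma ι_assocHom_assoc : type_of% (reassoc_of% @ι_assocHom) :=
  @(reassoc_of% @ι_assocHom)

lemma ι_assocInv {P Q R : Psh V} {X Y A Z : V} (t : (M.tensor.obj (Y, Z)).obj (op A))
    (p : P.obj (op X)) (q : Q.obj (op Y)) (r : R.obj (op Z)) :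
    conv.ι p ((conv.ι (T := M.tensor) q r).app (op A) t) ≫ M.assocInv P Q R
      = conv.ι (𝟙 X) t ≫ (M.assoc X Y Z).inv ≫ conv.map (conv.ι p q) (el r) := rfl

lemma ι_assocInv_assoc : type_of% (reassoc_of% @ι_assocInv) :=
  @(reassoc_of% @ι_assocInv)

lemma ι_leftHom {P : Psh V} {A X : V} (n : M.unit.obj (op A)) (p : P.obj (op X)) :
    conv.ι n p ≫ M.leftHom P = conv.ι n (𝟙 X) ≫ (M.left X).hom ≫ el p := rfl

lemma ι_leftHom_assoc : type_of% (reassoc_of% @ι_leftHom) :=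
  @(reassoc_of% @ι_leftHom)

lemma ι_rightHom {P : Psh V} {A X : V} (n : M.unit.obj (op A)) (p : P.obj (op X)) :
    conv.ι p n ≫ M.rightHom P = conv.ι (𝟙 X) n ≫ (M.right X).hom ≫ el p := rfl

lemma ι_rightHom_assoc : type_of% (reassoc_of% @ι_rightHom) :=
  @(reassoc_of% @ι_rightHom)

/-- The associator rearranges splits and carries the plugged-in elements along unchanged, so
applying maps to these elements before or after makes no difference. -/
lemma assocHom_naturality {P P' Q Q' R R' : Psh V} (a : P ⟶ P') (b : Q ⟶ Q') (c : R ⟶ R') :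
    conv.map (conv.map a b) c ≫ M.assocHom P' Q' R'
      = M.assocHom P Q R ≫ conv.map a (conv.map b c) := by
  refine conv.hom_ext fun {B Z} x r => ?_
  obtain ⟨X, Y, t, p, q, rfl⟩ := conv.exists_ι x
  rw [conv.ι_map_assoc]
  change conv.ι ((conv.ι (a.app _ p) (b.app _ q)).app (op B) t) (c.app _ r) ≫ _ = _
  rw [ι_assocHom, ι_assocHom_assoc, ← conv.map_comp, conv.ι_map, el_comp]

lemma assocHom_naturality_assoc : type_of% (reassoc_of% @assocHom_naturality) :=
  @(reassoc_of% @assocHom_naturality)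

lemma assocInv_naturality' {P P' Q Q' R R' : Psh V} (a : P ⟶ P') (b : Q ⟶ Q') (c : R ⟶ R') :
    conv.map a (conv.map b c) ≫ M.assocInv P' Q' R'
      = M.assocInv P Q R ≫ conv.map (conv.map a b) c := by
  refine conv.hom_ext fun {X B} p x => ?_
  obtain ⟨Y, Z, t, q, r, rfl⟩ := conv.exists_ι x
  rw [conv.ι_map_assoc]
  change conv.ι (a.app _ p) ((conv.ι (b.app _ q) (c.app _ r)).app (op B) t) ≫ _ = _
  rw [ι_assocInv, ι_assocInv_assoc, ← conv.map_comp, conv.ι_map, el_comp]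

lemma assocInv_naturality'_assoc : type_of% (reassoc_of% @assocInv_naturality') :=
  @(reassoc_of% @assocInv_naturality')

lemma leftHom_naturality {P P' : Psh V} (a : P ⟶ P') :
    conv.map (𝟙 M.unit) a ≫ M.leftHom P' = M.leftHom P ≫ a := by
  refine conv.hom_ext fun {A X} n p => ?_
  rw [conv.ι_map_assoc, ι_leftHom, ι_leftHom_assoc, el_comp]
  rfl

lemma leftHom_naturality_assoc : type_of% (reassoc_of% @leftHom_naturality) :=
  @(reassoc_of% @leftHom_naturality)

lemma rightHom_naturality {P P' : Psh V} (a : P ⟶ P') :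
    conv.map a (𝟙 M.unit) ≫ M.rightHom P' = M.rightHom P ≫ a := by
  refine conv.hom_ext fun {X A} p n => ?_
  rw [conv.ι_map_assoc, ι_rightHom, ι_rightHom_assoc, el_comp]
  rfl

lemma rightHom_naturality_assoc : type_of% (reassoc_of% @rightHom_naturality) :=
  @(reassoc_of% @rightHom_naturality)

/-- On representables, `assocHom` is the associator. -/
lemma assocHom_reduce (X Y Z : V) :
    M.assocHom (yo X) (yo Y) (yo Z) ≫ conv.map (𝟙 (yo X)) (conv.reduce Y Z)
      = conv.map (conv.reduce X Y) (𝟙 (yo Z)) ≫ (M.assoc X Y Z).hom := by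
  refine conv.hom_ext fun {B C} x r => ?_
  obtain ⟨A, A', t, p, q, rfl⟩ := conv.exists_ι x
  rw [conv.ι_map_assoc]
  change _ = conv.ι ((M.tensor.map (Prod.mkHom p q)).app (op B) t) r ≫ (M.assoc X Y Z).hom
  have e : conv.ι (T := M.tensor) (Q := yo Z) ((M.tensor.map (Prod.mkHom p q)).app (op B) t) r
      = conv.ι (Q := yo C) t (𝟙 C) ≫
        conv.map (M.tensor.map (Prod.mkHom p q)) (yoneda.map r) := by
    rw [conv.ι_map]; simp
  rw [ι_assocHom_assoc, e, Category.assoc, M.assoc_naturality,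
    ← conv.map_comp, Category.comp_id, conv.ι_reduce, el_yo]

lemma assocHom_reduce_assoc : type_of% (reassoc_of% @assocHom_reduce) :=
  @(reassoc_of% @assocHom_reduce)

lemma assocInv_reduce (X Y Z : V) :
    M.assocInv (yo X) (yo Y) (yo Z) ≫ conv.map (conv.reduce X Y) (𝟙 (yo Z))
      = conv.map (𝟙 (yo X)) (conv.reduce Y Z) ≫ (M.assoc X Y Z).inv := by
  refine conv.hom_ext fun {C B} p x => ?_
  obtain ⟨A, A', t, q, r, rfl⟩ := conv.exists_ι x
  rw [conv.ι_map_assoc]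
  change _ = conv.ι p ((M.tensor.map (Prod.mkHom q r)).app (op B) t) ≫ (M.assoc X Y Z).inv
  have e : conv.ι (T := M.tensor) (P := yo X) p ((M.tensor.map (Prod.mkHom q r)).app (op B) t)
      = conv.ι (P := yo C) (𝟙 C) t ≫
        conv.map (yoneda.map p) (M.tensor.map (Prod.mkHom q r)) := by
    rw [conv.ι_map]; simp
  rw [ι_assocInv_assoc, e, Category.assoc, M.assocInv_naturality,
    ← conv.map_comp, Category.comp_id, conv.ι_reduce, el_yo]

lemma assocInv_reduce_assoc : type_of% (reassoc_of% @assocInv_reduce) :=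
  @(reassoc_of% @assocInv_reduce)

lemma leftHom_yo (X : V) : M.leftHom (yo X) = (M.left X).hom := by
  refine conv.hom_ext fun {A Y} n (p : Y ⟶ X) => ?_
  rw [ι_leftHom, el_yo, ← M.left_naturality, ← Category.assoc, conv.ι_map]
  simp

lemma rightHom_yo (X : V) : M.rightHom (yo X) = (M.right X).hom := by
  refine conv.hom_ext fun {Y A} (p : Y ⟶ X) n => ?_
  rw [ι_rightHom, el_yo, ← M.right_naturality, ← Category.assoc, conv.ι_map]
  simp

/-- By Yoneda both sides are determined by the identity of X, where this is the elementwise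
definition of `leftInv`. In this form naturality and invertibility of the unitor apply. -/
lemma el_leftInv {P : Psh V} {X : V} (p : yo X ⟶ P) :
    p ≫ M.leftInv P = (M.left X).inv ≫ conv.map (𝟙 M.unit) p := by
  apply yo_hom_ext
  obtain ⟨p, rfl⟩ := yonedaEquiv.symm.surjective p
  change (M.leftInv P).app _ ((el p).app (op X) (𝟙 X)) = _
  rw [el_app_id]
  rfl

lemma el_rightInv {P : Psh V} {X : V} (p : yo X ⟶ P) :
    p ≫ M.rightInv P = (M.right X).inv ≫ conv.map p (𝟙 M.unit) := by
  apply yo_hom_ext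
  obtain ⟨p, rfl⟩ := yonedaEquiv.symm.surjective p
  change (M.rightInv P).app _ ((el p).app (op X) (𝟙 X)) = _
  rw [el_app_id]
  rfl

/-- The associator of three presheaves. -/
@[simps]
def assocIso (P Q R : Psh V) : M.conv (M.conv P Q) R ≅ M.conv P (M.conv Q R) where
  hom := M.assocHom P Q R
  inv := M.assocInv P Q R
  hom_inv_id := by
    refine (((covers_el P).conv (covers_el Q)).conv (covers_el R)).hom_ext ?_
    rintro ⟨⟨⟨X, p⟩, ⟨Y, q⟩⟩, ⟨Z, r⟩⟩
    dsimp only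
    rw [assocHom_naturality_assoc, assocInv_naturality', Category.comp_id]
    -- On representables the invertible Yoneda reduction turns the two maps into the given
    -- associator and its inverse.
    have : M.assocHom (yo X) (yo Y) (yo Z) ≫ M.assocInv (yo X) (yo Y) (yo Z) = 𝟙 _ := by
      rw [← cancel_mono (conv.mapIso (conv.reduceIso X Y) (Iso.refl (yo Z))).hom]
      change (_ ≫ _) ≫ conv.map (conv.reduce X Y) (𝟙 (yo Z))
        = 𝟙 _ ≫ conv.map (conv.reduce X Y) (𝟙 (yo Z))
      rw [Category.assoc, assocInv_reduce, assocHom_reduce_assoc]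
      simp
    rw [reassoc_of% this]
  inv_hom_id := by
    refine ((covers_el P).conv ((covers_el Q).conv (covers_el R))).hom_ext ?_
    rintro ⟨⟨X, p⟩, ⟨⟨Y, q⟩, ⟨Z, r⟩⟩⟩
    dsimp only
    rw [assocInv_naturality'_assoc, assocHom_naturality, Category.comp_id]
    have : M.assocInv (yo X) (yo Y) (yo Z) ≫ M.assocHom (yo X) (yo Y) (yo Z) = 𝟙 _ := by
      rw [← cancel_mono (conv.mapIso (Iso.refl (yo X)) (conv.reduceIso Y Z)).hom]
      change (_ ≫ _) ≫ conv.map (𝟙 (yo X)) (conv.reduce Y Z)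
        = 𝟙 _ ≫ conv.map (𝟙 (yo X)) (conv.reduce Y Z)
      rw [Category.assoc, assocHom_reduce, assocInv_reduce_assoc]
      simp
    rw [reassoc_of% this]

/-- The left unitor of a presheaf. -/
@[simps]
def leftIso (P : Psh V) : M.conv M.unit P ≅ P where
  hom := M.leftHom P
  inv := M.leftInv P
  hom_inv_id := by
    refine ((covers_id M.unit).conv (covers_el P)).hom_ext ?_
    rintro ⟨⟨⟩, ⟨X, p⟩⟩
    dsimp only
    rw [leftHom_naturality_assoc, el_leftInv, leftHom_yo]
    simp
  inv_hom_id := by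
    refine (covers_el P).hom_ext ?_
    rintro ⟨X, p⟩
    dsimp only
    rw [← Category.assoc, el_leftInv, Category.assoc, leftHom_naturality, leftHom_yo]
    simp

/-- The right unitor of a presheaf. -/
@[simps]
def rightIso (P : Psh V) : M.conv P M.unit ≅ P where
  hom := M.rightHom P
  inv := M.rightInv P
  hom_inv_id := by
    refine ((covers_el P).conv (covers_id M.unit)).hom_ext ?_
    rintro ⟨⟨X, p⟩, ⟨⟩⟩
    dsimp only
    rw [rightHom_naturality_assoc, el_rightInv, rightHom_yo]
    simp
  inv_hom_id := by
    refine (covers_el P).hom_ext ?_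
    rintro ⟨X, p⟩
    dsimp only
    rw [← Category.assoc, el_rightInv, Category.assoc, rightHom_naturality, rightHom_yo]
    simp

end PromonoidalData

/-! ### Day convolution as a monoidal structure. -/

namespace Promonoidal

variable {V : Type u} [SmallCategory V] (M : Promonoidal V)

/-- On the cover by four representables, naturality slides the plugged-in elements past every
associator to the end, and what remains in front is the pentagon axiom. -/
lemma pentagon' (P Q R S : Psh V) :
    conv.map (M.assocHom P Q R) (𝟙 S) ≫ M.assocHom P (M.conv Q R) S ≫
        conv.map (𝟙 P) (M.assocHom Q R S)
      = M.assocHom (M.conv P Q) R S ≫ M.assocHom P Q (M.conv R S) := by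
  refine ((((covers_el P).conv (covers_el Q)).conv (covers_el R)).conv (covers_el S)).hom_ext ?_
  rintro ⟨⟨⟨⟨X, p⟩, ⟨Y, q⟩⟩, ⟨Z, r⟩⟩, ⟨W, s⟩⟩
  dsimp only
  have e₁ := M.assocHom_naturality p (conv.map (T := M.tensor) q r) s
  have e₂ : conv.map (T := M.tensor) p (conv.map (T := M.tensor) (conv.map (T := M.tensor) q r) s)
        ≫ conv.map (𝟙 P) (M.assocHom Q R S)
      = conv.map (𝟙 (yo X)) (M.assocHom (yo Y) (yo Z) (yo W)) ≫
        conv.map p (conv.map q (conv.map r s)) := by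
    rw [← conv.map_comp, ← conv.map_comp, M.assocHom_naturality, Category.comp_id,
      Category.id_comp]
  have e₃ : conv.map (T := M.tensor) (conv.map (T := M.tensor) (conv.map (T := M.tensor) p q) r) s
        ≫ conv.map (M.assocHom P Q R) (𝟙 S)
      = conv.map (M.assocHom (yo X) (yo Y) (yo Z)) (𝟙 (yo W)) ≫
        conv.map (conv.map p (conv.map q r)) s := by
    rw [← conv.map_comp, ← conv.map_comp, M.assocHom_naturality, Category.comp_id,
      Category.id_comp]
  rw [reassoc_of% e₃, reassoc_of% e₁, e₂, M.assocHom_naturality_assoc, M.assocHom_naturality]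
  simpa only [Category.assoc] using
    congrArg (· ≫ conv.map p (conv.map q (conv.map r s))) (M.pentagon X Y Z W)

lemma triangle' (P Q : Psh V) :
    M.assocHom P M.unit Q ≫ conv.map (𝟙 P) (M.leftHom Q) = conv.map (M.rightHom P) (𝟙 Q) := by
  refine (((covers_el P).conv (covers_id _)).conv (covers_el Q)).hom_ext ?_
  rintro ⟨⟨⟨X, p⟩, ⟨⟩⟩, ⟨Y, q⟩⟩
  dsimp only
  have e : conv.map (T := M.tensor) p (conv.map (T := M.tensor) (𝟙 M.unit) q)
        ≫ conv.map (𝟙 P) (M.leftHom Q)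
      = conv.map (𝟙 (yo X)) (M.leftHom (yo Y)) ≫ conv.map p q := by
    rw [← conv.map_comp, ← conv.map_comp, M.leftHom_naturality, Category.comp_id,
      Category.id_comp]
  rw [M.assocHom_naturality_assoc, e, reassoc_of% (M.triangle X Y), ← conv.map_comp,
    ← conv.map_comp, M.rightHom_naturality, Category.comp_id, Category.id_comp]

/-- Day convolution. -/
abbrev day : MonoidalCategory (Psh V) :=
  letI : MonoidalCategoryStruct (Psh V) :=
    { tensorObj := M.conv
      tensorHom := conv.map
      whiskerLeft := fun P _ _ f => conv.map (𝟙 P) f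
      whiskerRight := fun f P => conv.map f (𝟙 P)
      tensorUnit := M.unit
      associator := M.assocIso
      leftUnitor := M.leftIso
      rightUnitor := M.rightIso }
  MonoidalCategory.ofTensorHom
    (id_tensorHom_id := conv.map_id)
    (id_tensorHom := fun _ _ _ _ => rfl)
    (tensorHom_id := fun _ _ => rfl)
    (tensorHom_comp_tensorHom := fun a b c d => (conv.map_comp a c b d).symm)
    (associator_naturality := M.assocHom_naturality)
    (leftUnitor_naturality := M.leftHom_naturality)
    (rightUnitor_naturality := M.rightHom_naturality)
    (pentagon := M.pentagon')
    (triangle := M.triangle')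

end Promonoidal

end Produoidal

end

/-! ### Abstract duoidal categories, and the laxator ψ₂ on presheaves. -/

section

namespace Produoidal

open MonoidalCategory

/-- A duoidal structure on a monoidal category `(C, ⊗, 𝟙_)`: a second monoidal structure
`(tri, triUnit)` and laxators satisfying the coherence equations. -/
class Duoidal (C : Type*) [Category* C] [MonoidalCategory C] where
  /-- The second tensor product. -/
  tri : C → C → C
  /-- Functoriality of the second tensor product. -/
  triMap {X X' Y Y' : C} (f : X ⟶ X') (g : Y ⟶ Y') : tri X Y ⟶ tri X' Y'
  /-- The second unit. -/
  triUnit : C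
  /-- The second associator. -/
  triAssoc (X Y Z : C) : tri (tri X Y) Z ≅ tri X (tri Y Z)
  /-- The second left unitor. -/
  triLeft (X : C) : tri triUnit X ≅ X
  /-- The second right unitor. -/
  triRight (X : C) : tri X triUnit ≅ X
  triMap_id (X Y : C) : triMap (𝟙 X) (𝟙 Y) = 𝟙 (tri X Y)
  triMap_comp {X X' X'' Y Y' Y'' : C} (f : X ⟶ X') (f' : X' ⟶ X'') (g : Y ⟶ Y') (g' : Y' ⟶ Y'') :
    triMap (f ≫ f') (g ≫ g') = triMap f g ≫ triMap f' g'
  triAssoc_naturality {X X' Y Y' Z Z' : C} (f : X ⟶ X') (g : Y ⟶ Y') (h : Z ⟶ Z') :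
    triMap (triMap f g) h ≫ (triAssoc X' Y' Z').hom
      = (triAssoc X Y Z).hom ≫ triMap f (triMap g h)
  triLeft_naturality {X X' : C} (f : X ⟶ X') :
    triMap (𝟙 triUnit) f ≫ (triLeft X').hom = (triLeft X).hom ≫ f
  triRight_naturality {X X' : C} (f : X ⟶ X') :
    triMap f (𝟙 triUnit) ≫ (triRight X').hom = (triRight X).hom ≫ f
  tri_pentagon (X Y Z W : C) :
    triMap (triAssoc X Y Z).hom (𝟙 W) ≫ (triAssoc X (tri Y Z) W).hom ≫
        triMap (𝟙 X) (triAssoc Y Z W).hom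
      = (triAssoc (tri X Y) Z W).hom ≫ (triAssoc X Y (tri Z W)).hom
  tri_triangle (X Y : C) :
    (triAssoc X triUnit Y).hom ≫ triMap (𝟙 X) (triLeft Y).hom = triMap (triRight X).hom (𝟙 Y)
  /-- The laxator `ψ₂`. -/
  psi (X Y Z W : C) : tri X Y ⊗ tri Z W ⟶ tri (X ⊗ Z) (Y ⊗ W)
  /-- The laxator `ψ₀`. -/
  psi₀ : 𝟙_ C ⟶ tri (𝟙_ C) (𝟙_ C)
  /-- The laxator `φ₂`. -/
  phi₂ : triUnit ⊗ triUnit ⟶ triUnit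
  /-- The laxator `φ₀`. -/
  phi₀ : 𝟙_ C ⟶ triUnit
  psi_naturality {X X' Y Y' Z Z' W W' : C} (f : X ⟶ X') (g : Y ⟶ Y') (h : Z ⟶ Z') (k : W ⟶ W') :
    (triMap f g ⊗ₘ triMap h k) ≫ psi X' Y' Z' W' = psi X Y Z W ≫ triMap (f ⊗ₘ h) (g ⊗ₘ k)
  psi_par_assoc (X X' Y Y' Z Z' : C) :
    psi X X' Y Y' ▷ tri Z Z' ≫ psi (X ⊗ Y) (X' ⊗ Y') Z Z' ≫ triMap (α_ X Y Z).hom (α_ X' Y' Z').hom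
      = (α_ (tri X X') (tri Y Y') (tri Z Z')).hom ≫ tri X X' ◁ psi Y Y' Z Z' ≫
        psi X X' (Y ⊗ Z) (Y' ⊗ Z')
  psi_seq_assoc (X Y Z X' Y' Z' : C) :
    psi (tri X Y) Z (tri X' Y') Z' ≫ triMap (psi X Y X' Y') (𝟙 (Z ⊗ Z')) ≫
        (triAssoc (X ⊗ X') (Y ⊗ Y') (Z ⊗ Z')).hom
      = ((triAssoc X Y Z).hom ⊗ₘ (triAssoc X' Y' Z').hom) ≫ psi X (tri Y Z) X' (tri Y' Z') ≫
        triMap (𝟙 (X ⊗ X')) (psi Y Z Y' Z')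
  psi₀_left (A B : C) :
    psi₀ ▷ tri A B ≫ psi (𝟙_ C) (𝟙_ C) A B ≫ triMap (λ_ A).hom (λ_ B).hom = (λ_ (tri A B)).hom
  psi₀_right (A B : C) :
    tri A B ◁ psi₀ ≫ psi A B (𝟙_ C) (𝟙_ C) ≫ triMap (ρ_ A).hom (ρ_ B).hom = (ρ_ (tri A B)).hom
  phi₂_left (A B : C) :
    psi triUnit A triUnit B ≫ triMap phi₂ (𝟙 (A ⊗ B)) ≫ (triLeft (A ⊗ B)).hom
      = ((triLeft A).hom ⊗ₘ (triLeft B).hom)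
  phi₂_right (A B : C) :
    psi A triUnit B triUnit ≫ triMap (𝟙 (A ⊗ B)) phi₂ ≫ (triRight (A ⊗ B)).hom
      = ((triRight A).hom ⊗ₘ (triRight B).hom)
  phi₂_assoc : phi₂ ▷ triUnit ≫ phi₂
    = (α_ triUnit triUnit triUnit).hom ≫ triUnit ◁ phi₂ ≫ phi₂
  psi₀_assoc : psi₀ ≫ triMap psi₀ (𝟙 (𝟙_ C)) ≫ (triAssoc (𝟙_ C) (𝟙_ C) (𝟙_ C)).hom
    = psi₀ ≫ triMap (𝟙 (𝟙_ C)) psi₀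
  phi₀_right : triUnit ◁ phi₀ ≫ phi₂ = (ρ_ triUnit).hom
  phi₀_left : phi₀ ▷ triUnit ≫ phi₂ = (λ_ triUnit).hom
  phi₀_coright : psi₀ ≫ triMap (𝟙 (𝟙_ C)) phi₀ ≫ (triRight (𝟙_ C)).hom = 𝟙 (𝟙_ C)
  phi₀_coleft : psi₀ ≫ triMap phi₀ (𝟙 (𝟙_ C)) ≫ (triLeft (𝟙_ C)).hom = 𝟙 (𝟙_ C)

namespace Duoidal

lemma triLeft_naturality_assoc : type_of% (reassoc_of% @triLeft_naturality) :=
  @(reassoc_of% @triLeft_naturality)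

lemma psi_naturality_assoc : type_of% (reassoc_of% @psi_naturality) :=
  @(reassoc_of% @psi_naturality)

lemma psi_par_assoc_assoc : type_of% (reassoc_of% @psi_par_assoc) :=
  @(reassoc_of% @psi_par_assoc)

lemma psi_seq_assoc_assoc : type_of% (reassoc_of% @psi_seq_assoc) :=
  @(reassoc_of% @psi_seq_assoc)

lemma phi₂_left_assoc : type_of% (reassoc_of% @phi₂_left) :=
  @(reassoc_of% @phi₂_left)

lemma phi₂_right_assoc : type_of% (reassoc_of% @phi₂_right) :=
  @(reassoc_of% @phi₂_right)

/-- The second monoidal structure of a duoidal category. -/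
abbrev seqMonoidal (C : Type*) [Category* C] [MonoidalCategory C] [Duoidal C] :
    MonoidalCategory C :=
  letI : MonoidalCategoryStruct C :=
    { tensorObj := tri
      tensorHom := triMap
      whiskerLeft := fun P _ _ f => triMap (𝟙 P) f
      whiskerRight := fun f P => triMap f (𝟙 P)
      tensorUnit := triUnit
      associator := triAssoc
      leftUnitor := triLeft
      rightUnitor := triRight }
  MonoidalCategory.ofTensorHom
    (id_tensorHom_id := triMap_id)
    (id_tensorHom := fun _ _ _ _ => rfl)
    (tensorHom_id := fun _ _ => rfl)
    (tensorHom_comp_tensorHom := fun a b c d => (triMap_comp a c b d).symm)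
    (associator_naturality := triAssoc_naturality)
    (leftUnitor_naturality := triLeft_naturality)
    (rightUnitor_naturality := triRight_naturality)
    (pentagon := tri_pentagon)
    (triangle := tri_triangle)

variable {C : Type*} [Category* C] [MonoidalCategory C] [Duoidal C]

/-- In any monoidal category the two unitors agree at the unit. Because of this the comultiplication
of N can be defined from either side. -/
lemma triLeft_eq_triRight : triLeft (triUnit : C) = triRight triUnit :=
  Iso.ext (@unitors_equal C _ (seqMonoidal C))

instance {X X' Y Y' : C} (f : X ⟶ X') (g : Y ⟶ Y') [IsIso f] [IsIso g] : IsIso (triMap f g) :=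
  ⟨triMap (inv f) (inv g), by simp [← triMap_comp, triMap_id], by simp [← triMap_comp, triMap_id]⟩

end Duoidal

namespace ProduoidalData

variable {V : Type u} [SmallCategory V] (D : ProduoidalData V)

lemma ι_psi {P Q R S : Psh V} {X Y Z W A B : V} (s : (D.seq.tensor.obj (X, Y)).obj (op A))
    (t : (D.seq.tensor.obj (Z, W)).obj (op B)) (p : P.obj (op X)) (q : Q.obj (op Y))
    (r : R.obj (op Z)) (w : S.obj (op W)) :
    conv.ι ((conv.ι (T := D.seq.tensor) p q).app (op A) s)
        ((conv.ι (T := D.seq.tensor) r w).app (op B) t) ≫ D.psi P Q R S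
      = conv.ι s t ≫ D.psi₂ X Y Z W ≫ conv.map (conv.ι p r) (conv.ι q w) := rfl

lemma psi_naturality {P P' Q Q' R R' S S' : Psh V} (a : P ⟶ P') (b : Q ⟶ Q') (c : R ⟶ R')
    (d : S ⟶ S') :
    conv.map (conv.map a b) (conv.map c d) ≫ D.psi P' Q' R' S'
      = D.psi P Q R S ≫ conv.map (conv.map a c) (conv.map b d) := by
  refine conv.hom_ext fun {A B} x y => ?_
  obtain ⟨X, Y, s, p, q, rfl⟩ := conv.exists_ι x
  obtain ⟨Z, W, t, r, w, rfl⟩ := conv.exists_ι y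
  rw [conv.ι_map_assoc, reassoc_of% (D.ι_psi s t p q r w), ← conv.map_comp, conv.ι_map, conv.ι_map]
  rfl

lemma psi_naturality_assoc : type_of% (reassoc_of% @psi_naturality) :=
  @(reassoc_of% @psi_naturality)

/-- On representables, `psi` is the laxator `ψ₂`. -/
lemma psi_reduce (X Y Z W : V) :
    D.psi (yo X) (yo Y) (yo Z) (yo W) ≫ conv.map (conv.reduce X Z) (conv.reduce Y W)
      = conv.map (conv.reduce X Y) (conv.reduce Z W) ≫ D.psi₂ X Y Z W := by
  refine conv.hom_ext fun {A B} x y => ?_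
  obtain ⟨X', Y', s, p, q, rfl⟩ := conv.exists_ι x
  obtain ⟨Z', W', t, r, w, rfl⟩ := conv.exists_ι y
  rw [reassoc_of% (D.ι_psi s t p q r w), ← conv.map_comp, conv.ι_reduce, conv.ι_reduce,
    ← D.psi₂_naturality, conv.ι_map_assoc, conv.ι_map_assoc]
  rfl

lemma psi_reduce_assoc : type_of% (reassoc_of% @psi_reduce) :=
  @(reassoc_of% @psi_reduce)

end ProduoidalData

/-! ### Presheaves on a produoidal category form a duoidal category. -/

namespace ProduoidalStruct

variable {V : Type u} [SmallCategory V] (D : ProduoidalStruct V)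

/-- The axiom on six representables, with the six plugged-in elements moved to the end by naturality
of `psi` and of the associators. -/
lemma psi_par_assoc' (A B C E F G : Psh V) :
    conv.map (D.psi A B C E) (𝟙 (D.tri F G)) ≫ D.psi (D.otimes A C) (D.otimes B E) F G ≫
        conv.map (D.par.assocHom A C F) (D.par.assocHom B E G)
      = D.par.assocHom (D.tri A B) (D.tri C E) (D.tri F G) ≫
        conv.map (𝟙 (D.tri A B)) (D.psi C E F G) ≫
        D.psi A B (D.otimes C F) (D.otimes E G) := by
  refine ((((covers_el A).conv (covers_el B)).conv ((covers_el C).conv (covers_el E))).conv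
    ((covers_el F).conv (covers_el G))).hom_ext ?_
  rintro ⟨⟨⟨⟨X₁, a⟩, ⟨X₂, b⟩⟩, ⟨⟨X₃, c⟩, ⟨X₄, e⟩⟩⟩, ⟨⟨X₅, f⟩, ⟨X₆, g⟩⟩⟩
  dsimp only
  rw [← conv.map_comp_assoc, D.psi_naturality, Category.comp_id, D.par.assocHom_naturality_assoc,
    ← conv.map_comp_assoc, D.psi_naturality, Category.comp_id]
  have e₁ := conv.map_comp (T := D.par.tensor) (D.psi (yo X₁) (yo X₂) (yo X₃) (yo X₄))
    (conv.map (conv.map a c) (conv.map b e)) (𝟙 _) (conv.map (T := D.seq.tensor) f g)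
  have e₂ := conv.map_comp (T := D.par.tensor) (𝟙 _) (conv.map (T := D.seq.tensor) a b)
    (D.psi (yo X₃) (yo X₄) (yo X₅) (yo X₆)) (conv.map (conv.map c f) (conv.map e g))
  rw [Category.id_comp] at e₁ e₂
  rw [e₁, e₂, Category.assoc, Category.assoc, D.psi_naturality_assoc, D.psi_naturality,
    ← conv.map_comp, D.par.assocHom_naturality, D.par.assocHom_naturality, conv.map_comp,
    reassoc_of% (D.psi_par_assoc X₁ X₂ X₃ X₄ X₅ X₆)]

lemma psi_seq_assoc' (A B C E F G : Psh V) :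
    D.psi (D.tri A B) C (D.tri E F) G ≫ conv.map (D.psi A B E F) (𝟙 (D.otimes C G)) ≫
        D.seq.assocHom (D.otimes A E) (D.otimes B F) (D.otimes C G)
      = conv.map (D.seq.assocHom A B C) (D.seq.assocHom E F G) ≫
        D.psi A (D.tri B C) E (D.tri F G) ≫
        conv.map (𝟙 (D.otimes A E)) (D.psi B C F G) := by
  refine ((((covers_el A).conv (covers_el B)).conv (covers_el C)).conv
    (((covers_el E).conv (covers_el F)).conv (covers_el G))).hom_ext ?_
  rintro ⟨⟨⟨⟨X₁, a⟩, ⟨X₂, b⟩⟩, ⟨X₃, c⟩⟩, ⟨⟨⟨X₄, e⟩, ⟨X₅, f⟩⟩, ⟨X₆, g⟩⟩⟩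
  dsimp only
  rw [← conv.map_comp_assoc, D.psi_naturality_assoc, ← conv.map_comp_assoc, D.psi_naturality,
    Category.comp_id, D.seq.assocHom_naturality, D.seq.assocHom_naturality]
  have e₁ := conv.map_comp (T := D.seq.tensor) (D.psi (yo X₁) (yo X₂) (yo X₄) (yo X₅))
    (conv.map (conv.map a e) (conv.map b f)) (𝟙 _) (conv.map (T := D.par.tensor) c g)
  have e₂ := conv.map_comp (T := D.seq.tensor) (𝟙 _) (conv.map (T := D.par.tensor) a e)
    (D.psi (yo X₂) (yo X₃) (yo X₅) (yo X₆)) (conv.map (conv.map b f) (conv.map c g))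
  rw [Category.id_comp] at e₁ e₂
  rw [e₁, Category.assoc, D.seq.assocHom_naturality, conv.map_comp, Category.assoc,
    D.psi_naturality_assoc, ← conv.map_comp, D.psi_naturality, Category.comp_id, e₂,
    reassoc_of% (D.psi_seq_assoc X₁ X₂ X₃ X₄ X₅ X₆)]

/-- The axiom mentions the presheaf I itself, so the factor I is covered by its identity and only A
and B by representables. -/
lemma psi₀_left' (A B : Psh V) :
    conv.map D.psi₀ (𝟙 (D.tri A B)) ≫ D.psi D.I D.I A B ≫
        conv.map (D.par.leftHom A) (D.par.leftHom B)
      = D.par.leftHom (D.tri A B) := by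
  refine ((covers_id D.I).conv ((covers_el A).conv (covers_el B))).hom_ext ?_
  rintro ⟨⟨⟩, ⟨⟨X, a⟩, ⟨Y, b⟩⟩⟩
  dsimp only
  have e₁ : conv.map (T := D.par.tensor) (𝟙 D.I) (conv.map (T := D.seq.tensor) a b) ≫
      conv.map D.psi₀ (𝟙 (D.tri A B))
      = conv.map D.psi₀ (𝟙 _) ≫ conv.map (conv.map (𝟙 D.I) (𝟙 D.I)) (conv.map a b) := by
    rw [← conv.map_comp, ← conv.map_comp, conv.map_id, Category.id_comp, Category.id_comp,
      Category.comp_id, Category.comp_id]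
  rw [reassoc_of% e₁, D.psi_naturality_assoc, ← conv.map_comp, D.par.leftHom_naturality,
    D.par.leftHom_naturality, conv.map_comp, reassoc_of% (D.psi₀_left X Y),
    D.par.leftHom_naturality]

lemma psi₀_right' (A B : Psh V) :
    conv.map (𝟙 (D.tri A B)) D.psi₀ ≫ D.psi A B D.I D.I ≫
        conv.map (D.par.rightHom A) (D.par.rightHom B)
      = D.par.rightHom (D.tri A B) := by
  refine (((covers_el A).conv (covers_el B)).conv (covers_id D.I)).hom_ext ?_
  rintro ⟨⟨⟨X, a⟩, ⟨Y, b⟩⟩, ⟨⟩⟩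
  dsimp only
  have e₁ : conv.map (T := D.par.tensor) (conv.map (T := D.seq.tensor) a b) (𝟙 D.I) ≫
      conv.map (𝟙 (D.tri A B)) D.psi₀
      = conv.map (𝟙 _) D.psi₀ ≫ conv.map (conv.map a b) (conv.map (𝟙 D.I) (𝟙 D.I)) := by
    rw [← conv.map_comp, ← conv.map_comp, conv.map_id, Category.id_comp, Category.id_comp,
      Category.comp_id, Category.comp_id]
  rw [reassoc_of% e₁, D.psi_naturality_assoc, ← conv.map_comp, D.par.rightHom_naturality,
    D.par.rightHom_naturality, conv.map_comp, reassoc_of% (D.psi₀_right X Y),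
    D.par.rightHom_naturality]

lemma phi₂_left' (A B : Psh V) :
    D.psi D.N A D.N B ≫ conv.map D.phi₂ (𝟙 (D.otimes A B)) ≫ D.seq.leftHom (D.otimes A B)
      = conv.map (D.seq.leftHom A) (D.seq.leftHom B) := by
  refine (((covers_id D.N).conv (covers_el A)).conv ((covers_id D.N).conv (covers_el B))).hom_ext ?_
  rintro ⟨⟨⟨⟩, ⟨X, a⟩⟩, ⟨⟨⟩, ⟨Y, b⟩⟩⟩
  dsimp only
  have e₁ : conv.map (T := D.seq.tensor) (conv.map (T := D.par.tensor) (𝟙 D.N) (𝟙 D.N))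
        (conv.map (T := D.par.tensor) a b) ≫ conv.map D.phi₂ (𝟙 (D.otimes A B))
      = conv.map D.phi₂ (𝟙 _) ≫ conv.map (𝟙 D.N) (conv.map a b) := by
    rw [← conv.map_comp, ← conv.map_comp, conv.map_id, Category.id_comp, Category.id_comp,
      Category.comp_id, Category.comp_id]
  rw [D.psi_naturality_assoc, reassoc_of% e₁, D.seq.leftHom_naturality,
    reassoc_of% (D.phi₂_left X Y), ← conv.map_comp, ← conv.map_comp, D.seq.leftHom_naturality,
    D.seq.leftHom_naturality]

lemma phi₂_right' (A B : Psh V) :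
    D.psi A D.N B D.N ≫ conv.map (𝟙 (D.otimes A B)) D.phi₂ ≫ D.seq.rightHom (D.otimes A B)
      = conv.map (D.seq.rightHom A) (D.seq.rightHom B) := by
  refine (((covers_el A).conv (covers_id D.N)).conv ((covers_el B).conv (covers_id D.N))).hom_ext ?_
  rintro ⟨⟨⟨X, a⟩, ⟨⟩⟩, ⟨⟨Y, b⟩, ⟨⟩⟩⟩
  dsimp only
  have e₁ : conv.map (T := D.seq.tensor) (conv.map (T := D.par.tensor) a b)
        (conv.map (T := D.par.tensor) (𝟙 D.N) (𝟙 D.N)) ≫ conv.map (𝟙 (D.otimes A B)) D.phi₂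
      = conv.map (𝟙 _) D.phi₂ ≫ conv.map (conv.map a b) (𝟙 D.N) := by
    rw [← conv.map_comp, ← conv.map_comp, conv.map_id, Category.id_comp, Category.id_comp,
      Category.comp_id, Category.comp_id]
  rw [D.psi_naturality_assoc, reassoc_of% e₁, D.seq.rightHom_naturality,
    reassoc_of% (D.phi₂_right X Y), ← conv.map_comp, ← conv.map_comp, D.seq.rightHom_naturality,
    D.seq.rightHom_naturality]

/-- The category of presheaves on a produoidal category, with the duoidal structure given by Day
convolution. -/
def Day (_ : ProduoidalStruct V) : Type (u + 1) := Psh V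

instance : LargeCategory D.Day := inferInstanceAs (Category (Psh V))

instance : MonoidalCategory D.Day := D.par.day

instance : Duoidal D.Day where
  tri := D.tri
  triMap := conv.map
  triUnit := D.N
  triAssoc := D.seq.assocIso
  triLeft := D.seq.leftIso
  triRight := D.seq.rightIso
  triMap_id := conv.map_id
  triMap_comp := conv.map_comp
  triAssoc_naturality := D.seq.assocHom_naturality
  triLeft_naturality := D.seq.leftHom_naturality
  triRight_naturality := D.seq.rightHom_naturality
  tri_pentagon := D.seq.pentagon'
  tri_triangle := D.seq.triangle'
  psi := D.psi
  psi₀ := D.psi₀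
  phi₂ := D.phi₂
  phi₀ := D.phi₀
  psi_naturality := D.psi_naturality
  psi_par_assoc := D.psi_par_assoc'
  psi_seq_assoc := D.psi_seq_assoc'
  psi₀_left := D.psi₀_left'
  psi₀_right := D.psi₀_right'
  phi₂_left := D.phi₂_left'
  phi₂_right := D.phi₂_right'
  phi₂_assoc := D.phi₂_assoc
  psi₀_assoc := D.psi₀_assoc
  phi₀_right := D.phi₀_right
  phi₀_left := D.phi₀_left
  phi₀_coright := D.phi₀_coright
  phi₀_coleft := D.phi₀_coleft

instance : Limits.HasCoequalizers D.Day :=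
  inferInstanceAs (Limits.HasCoequalizers (Psh V))

end ProduoidalStruct

/-! ### Day convolution is closed on both sides. -/

section Closed

variable {V : Type u} [SmallCategory V] (T : Profunctor.{u} (V × V) V)

/-- The right adjoint of `conv T P`, on objects. -/
def convRightHom (P R : Psh V) : Psh V where
  obj Y := conv T P (yo Y.unop) ⟶ R
  map k := ↾fun a => conv.map (𝟙 P) (yoneda.map k.unop) ≫ a
  map_id Y := by
    refine ConcreteCategory.hom_ext _ _ fun a => ?_
    change conv.map (𝟙 P) (yoneda.map (𝟙 Y.unop)) ≫ a = (a : conv T P (yo Y.unop) ⟶ R)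
    simp [conv.map_id]
  map_comp h k := by
    refine ConcreteCategory.hom_ext _ _ fun a => ?_
    change conv.map (𝟙 P) (yoneda.map (k.unop ≫ h.unop)) ≫ a
      = conv.map (𝟙 P) (yoneda.map k.unop) ≫ conv.map (𝟙 P) (yoneda.map h.unop) ≫ a
    rw [← conv.map_comp_assoc, yoneda.map_comp, Category.id_comp]

/-- The right adjoint of `conv T • Q`, on objects. -/
def convLeftHom (Q R : Psh V) : Psh V where
  obj X := conv T (yo X.unop) Q ⟶ R
  map k := ↾fun a => conv.map (yoneda.map k.unop) (𝟙 Q) ≫ a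
  map_id Y := by
    refine ConcreteCategory.hom_ext _ _ fun a => ?_
    change conv.map (yoneda.map (𝟙 Y.unop)) (𝟙 Q) ≫ a = (a : conv T (yo Y.unop) Q ⟶ R)
    simp [conv.map_id]
  map_comp h k := by
    refine ConcreteCategory.hom_ext _ _ fun a => ?_
    change conv.map (yoneda.map (k.unop ≫ h.unop)) (𝟙 Q) ≫ a
      = conv.map (yoneda.map k.unop) (𝟙 Q) ≫ conv.map (yoneda.map h.unop) (𝟙 Q) ≫ a
    rw [← conv.map_comp_assoc, yoneda.map_comp, Category.id_comp]

variable {T} in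
/-- The value of a map into `convRightHom`. -/
def convRightHom.eval {P Q R : Psh V} (b : Q ⟶ convRightHom T P R) {Y : V} (q : Q.obj (op Y)) :
    conv T P (yo Y) ⟶ R :=
  b.app (op Y) q

variable {T} in
lemma convRightHom.eval_map {P Q R : Psh V} (b : Q ⟶ convRightHom T P R) {Y Y' : V} (g : Y ⟶ Y')
    (q : Q.obj (op Y')) :
    eval b (Q.map g.op q) = conv.map (𝟙 P) (yoneda.map g) ≫ eval b q :=
  NatTrans.naturality_apply b g.op q

variable {T} in
/-- The value of a map into `convLeftHom`. -/
def convLeftHom.eval {P Q R : Psh V} (b : P ⟶ convLeftHom T Q R) {X : V} (p : P.obj (op X)) :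
    conv T (yo X) Q ⟶ R :=
  b.app (op X) p

variable {T} in
lemma convLeftHom.eval_map {P Q R : Psh V} (b : P ⟶ convLeftHom T Q R) {X X' : V} (f : X ⟶ X')
    (p : P.obj (op X')) :
    eval b (P.map f.op p) = conv.map (yoneda.map f) (𝟙 Q) ≫ eval b p :=
  NatTrans.naturality_apply b f.op p

/-- Maps out of `conv T P Q`, as maps out of `Q`. -/
def convRightEquiv (P Q R : Psh V) : (conv T P Q ⟶ R) ≃ (Q ⟶ convRightHom T P R) where
  toFun a :=
    { app Y := ↾fun q => conv.map (𝟙 P) (el q) ≫ a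
      naturality Y Y' k := by
        refine ConcreteCategory.hom_ext _ _ fun q => ?_
        change conv.map (𝟙 P) (el (Q.map k q)) ≫ a
          = conv.map (𝟙 P) (yoneda.map k.unop) ≫ conv.map (𝟙 P) (el q) ≫ a
        rw [← conv.map_comp_assoc, ← el_map, Category.id_comp]
        rfl }
  invFun b := conv.desc (fun {X Y} p q => conv.ι p (𝟙 Y) ≫ convRightHom.eval b q) (by
    intro X X' Y Y' f g p q
    rw [convRightHom.eval_map, conv.ι_map_assoc, conv.ι_naturality_assoc]
    simp)
  left_inv a := conv.hom_ext fun {X Y} p q => by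
    change conv.ι p (𝟙 Y) ≫ conv.map (𝟙 P) (el q) ≫ a = _
    rw [conv.ι_map_assoc, el_app_id]
    rfl
  right_inv b := by
    refine NatTrans.ext (funext fun Y => ConcreteCategory.hom_ext _ _ fun q => ?_)
    refine conv.hom_ext fun {X Z} p (z : Z ⟶ Y.unop) => ?_
    change conv.ι p (𝟙 Z) ≫ convRightHom.eval b (Q.map z.op q)
      = conv.ι p z ≫ convRightHom.eval b q
    rw [convRightHom.eval_map, conv.ι_map_assoc]
    simp

/-- Maps out of `conv T P Q`, as maps out of `P`. -/
def convLeftEquiv (P Q R : Psh V) : (conv T P Q ⟶ R) ≃ (P ⟶ convLeftHom T Q R) where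
  toFun a :=
    { app Y := ↾fun p => conv.map (el p) (𝟙 Q) ≫ a
      naturality Y Y' k := by
        refine ConcreteCategory.hom_ext _ _ fun p => ?_
        change conv.map (el (P.map k p)) (𝟙 Q) ≫ a
          = conv.map (yoneda.map k.unop) (𝟙 Q) ≫ conv.map (el p) (𝟙 Q) ≫ a
        rw [← conv.map_comp_assoc, ← el_map, Category.id_comp]
        rfl }
  invFun b := conv.desc (fun {X Y} p q => conv.ι (𝟙 X) q ≫ convLeftHom.eval b p) (by
    intro X X' Y Y' f g p q
    rw [convLeftHom.eval_map, conv.ι_map_assoc, conv.ι_naturality_assoc]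
    simp)
  left_inv a := conv.hom_ext fun {X Y} p q => by
    change conv.ι (𝟙 X) q ≫ conv.map (el p) (𝟙 Q) ≫ a = _
    rw [conv.ι_map_assoc, el_app_id]
    rfl
  right_inv b := by
    refine NatTrans.ext (funext fun X => ConcreteCategory.hom_ext _ _ fun p => ?_)
    refine conv.hom_ext fun {Z Y} (z : Z ⟶ X.unop) q => ?_
    change conv.ι (𝟙 Z) q ≫ convLeftHom.eval b (P.map z.op p)
      = conv.ι z q ≫ convLeftHom.eval b p
    rw [convLeftHom.eval_map, conv.ι_map_assoc]
    simp

end Closed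

namespace ProduoidalStruct

variable {V : Type u} [SmallCategory V] (D : ProduoidalStruct V)

/-- A left adjoint preserves colimits. This is what the tensor product over a monoid requires:
tensoring must preserve the coequalizers that define it. -/
instance (P : D.Day) : (tensorLeft P).IsLeftAdjoint :=
  (Adjunction.adjunctionOfEquivRight (F := tensorLeft P)
    (G_obj := convRightHom D.par.tensor P) (fun Q R => convRightEquiv D.par.tensor P Q R) (by
      intro Q' Q R f g
      refine NatTrans.ext (funext fun Y => ConcreteCategory.hom_ext _ _ fun q => ?_)
      change conv.map (𝟙 _) (el q) ≫ conv.map (𝟙 P) f ≫ g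
        = conv.map (𝟙 _) (el (f.app Y q)) ≫ g
      erw [← conv.map_comp_assoc, el_comp, Category.comp_id])).isLeftAdjoint

instance (Q : D.Day) : (tensorRight Q).IsLeftAdjoint :=
  (Adjunction.adjunctionOfEquivRight (F := tensorRight Q)
    (G_obj := convLeftHom D.par.tensor Q) (fun P R => convLeftEquiv D.par.tensor P Q R) (by
      intro P' P R f g
      refine NatTrans.ext (funext fun Y => ConcreteCategory.hom_ext _ _ fun p => ?_)
      change conv.map (el p) (𝟙 _) ≫ conv.map f (𝟙 Q) ≫ g
        = conv.map (el (f.app Y p)) (𝟙 _) ≫ g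
      erw [← conv.map_comp_assoc, el_comp, Category.comp_id])).isLeftAdjoint

end ProduoidalStruct

end Produoidal

end

/-! ### The monoidal category of bimodules over a monoid. -/

section

namespace Produoidal

open MonoidalCategory Limits

section BimodMonoidal

variable {C : Type*} [Category* C] [MonoidalCategory C] [HasCoequalizers C]
  [∀ X : C, PreservesColimitsOfSize.{0, 0} (tensorLeft X)]
  [∀ X : C, PreservesColimitsOfSize.{0, 0} (tensorRight X)] (A : Mon C)

/-- Bimodules over a monoid `A` form a monoidal category under the tensor product over `A`. -/
noncomputable instance bimodMonoidal : MonoidalCategory (Bimod A A) where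
  tensorObj := Bimod.tensorBimod
  tensorHom f g := Bimod.whiskerRight f _ ≫ Bimod.whiskerLeft _ g
  whiskerLeft M _ _ f := Bimod.whiskerLeft M f
  whiskerRight f M := Bimod.whiskerRight f M
  tensorUnit := Bimod.regular A
  associator := Bimod.associatorBimod
  leftUnitor := Bimod.leftUnitorBimod
  rightUnitor := Bimod.rightUnitorBimod
  tensorHom_def _ _ := rfl
  id_tensorHom_id M M' := by
    rw [Bimod.whiskerLeft_id_bimod, Bimod.id_whiskerRight_bimod, Category.comp_id]
  tensorHom_comp_tensorHom f f' g g' := by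
    simp only [Bimod.comp_whiskerRight_bimod, Bimod.whiskerLeft_comp_bimod, Category.assoc]
    rw [← Category.assoc (Bimod.whiskerLeft _ f'), Bimod.whisker_exchange_bimod, Category.assoc]
  whiskerLeft_id _ _ := Bimod.whiskerLeft_id_bimod
  id_whiskerRight _ _ := Bimod.id_whiskerRight_bimod
  associator_naturality f g h := by
    simp only [Bimod.comp_whiskerRight_bimod, Bimod.whiskerLeft_comp_bimod, Category.assoc,
      Bimod.whiskerRight_comp_bimod, Bimod.whisker_assoc_bimod, Bimod.comp_whiskerLeft_bimod,
      Iso.hom_inv_id_assoc, Iso.inv_hom_id_assoc, Iso.inv_hom_id, Category.comp_id]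
  leftUnitor_naturality f := by rw [Bimod.id_whiskerLeft_bimod]; simp
  rightUnitor_naturality f := by rw [Bimod.whiskerRight_id_bimod]; simp
  pentagon := Bimod.pentagon_bimod
  triangle := Bimod.triangle_bimod

namespace BimodTensor

variable {A}

/-- The quotient map from the tensor product to the tensor product over `A`. -/
noncomputable def π (M M' : Bimod A A) : M.X ⊗ M'.X ⟶ (M ⊗ M').X :=
  coequalizer.π (M.actRight ▷ M'.X) ((α_ _ _ _).hom ≫ (M.X ◁ M'.actLeft))

instance (M M' : Bimod A A) : Epi (π M M') :=
  inferInstanceAs (Epi (coequalizer.π (M.actRight ▷ M'.X)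
    ((α_ _ _ _).hom ≫ (M.X ◁ M'.actLeft))))

/-- Tensoring preserves colimits and hence epimorphisms. Maps out of a whiskered or iterated tensor
product over A can thus be compared on the plain tensor product. -/
instance (X : C) (M M' : Bimod A A) : Epi (X ◁ π M M') :=
  inferInstanceAs (Epi ((tensorLeft X).map (π M M')))

instance (X : C) (M M' : Bimod A A) : Epi (π M M' ▷ X) :=
  inferInstanceAs (Epi ((tensorRight X).map (π M M')))

lemma condition (M M' : Bimod A A) :
    M.actRight ▷ M'.X ≫ π M M' = (α_ M.X A.X M'.X).hom ≫ M.X ◁ M'.actLeft ≫ π M M' := by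
  rw [← Category.assoc (α_ _ _ _).hom]
  exact coequalizer.condition _ _

/-- Maps out of the tensor product over `A`. -/
noncomputable def desc {M M' : Bimod A A} {X : C} (f : M.X ⊗ M'.X ⟶ X)
    (h : M.actRight ▷ M'.X ≫ f = (α_ M.X A.X M'.X).hom ≫ M.X ◁ M'.actLeft ≫ f) :
    (M ⊗ M').X ⟶ X :=
  coequalizer.desc f (by rw [h, Category.assoc])

lemma π_desc {M M' : Bimod A A} {X : C} (f : M.X ⊗ M'.X ⟶ X)
    (h : M.actRight ▷ M'.X ≫ f = (α_ M.X A.X M'.X).hom ≫ M.X ◁ M'.actLeft ≫ f) :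
    π M M' ≫ desc f h = f :=
  coequalizer.π_desc _ _

lemma π_desc_assoc : type_of% (reassoc_of% @π_desc) :=
  @(reassoc_of% @π_desc)

lemma hom_ext {M M' L : Bimod A A} {f g : M ⊗ M' ⟶ L} (h : π M M' ≫ f.hom = π M M' ≫ g.hom) :
    f = g :=
  Bimod.hom_ext _ _ ((cancel_epi _).1 h)

lemma π_whiskerLeft (M : Bimod A A) {L L' : Bimod A A} (f : L ⟶ L') :
    π M L ≫ (M ◁ f).hom = M.X ◁ f.hom ≫ π M L' :=
  ι_colimMap _ _

lemma π_whiskerLeft_assoc : type_of% (reassoc_of% @π_whiskerLeft) :=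
  @(reassoc_of% @π_whiskerLeft)

lemma π_whiskerRight (M : Bimod A A) {L L' : Bimod A A} (f : L ⟶ L') :
    π L M ≫ (f ▷ M).hom = f.hom ▷ M.X ≫ π L' M :=
  ι_colimMap _ _

lemma π_whiskerRight_assoc : type_of% (reassoc_of% @π_whiskerRight) :=
  @(reassoc_of% @π_whiskerRight)

lemma π_tensorHom {M M' L L' : Bimod A A} (f : M ⟶ M') (g : L ⟶ L') :
    π M L ≫ (f ⊗ₘ g).hom = (f.hom ⊗ₘ g.hom) ≫ π M' L' := by
  rw [MonoidalCategory.tensorHom_def, Bimod.comp_hom', π_whiskerRight_assoc, π_whiskerLeft,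
    ← Category.assoc, ← MonoidalCategory.tensorHom_def]

lemma π_tensorHom_assoc : type_of% (reassoc_of% @π_tensorHom) :=
  @(reassoc_of% @π_tensorHom)

lemma whiskerLeft_π_actLeft (M M' : Bimod A A) :
    A.X ◁ π M M' ≫ (M ⊗ M').actLeft = (α_ _ _ _).inv ≫ M.actLeft ▷ M'.X ≫ π M M' :=
  Bimod.TensorBimod.whiskerLeft_π_actLeft M M'

lemma whiskerLeft_π_actLeft_assoc : type_of% (reassoc_of% @whiskerLeft_π_actLeft) :=
  @(reassoc_of% @whiskerLeft_π_actLeft)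

lemma actLeft_whiskerRight_π (M M' : Bimod A A) :
    M.actLeft ▷ M'.X ≫ π M M' = (α_ _ _ _).hom ≫ A.X ◁ π M M' ≫ (M ⊗ M').actLeft := by
  rw [whiskerLeft_π_actLeft, Iso.hom_inv_id_assoc]

lemma π_whiskerRight_actRight (M M' : Bimod A A) :
    π M M' ▷ A.X ≫ (M ⊗ M').actRight = (α_ _ _ _).hom ≫ M.X ◁ M'.actRight ≫ π M M' :=
  Bimod.TensorBimod.π_tensor_id_actRight M M'

lemma π_whiskerRight_actRight_assoc : type_of% (reassoc_of% @π_whiskerRight_actRight) :=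
  @(reassoc_of% @π_whiskerRight_actRight)

/-- The associator over A is induced by the ambient one. After cancelling the two quotient maps,
associativity over A becomes an equation in `C`. -/
lemma π_assoc (M M' M'' : Bimod A A) :
    π M M' ▷ M''.X ≫ π (M ⊗ M') M'' ≫ (α_ M M' M'').hom.hom
      = (α_ _ _ _).hom ≫ M.X ◁ π M' M'' ≫ π M (M' ⊗ M'') := by
  have : π (M ⊗ M') M'' ≫ (α_ M M' M'').hom.hom = Bimod.AssociatorBimod.homAux M M' M'' :=
    coequalizer.π_desc _ _
  rw [this]
  exact π_tensor_id_preserves_coequalizer_inv_desc _ _ _ _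

lemma π_assoc_assoc : type_of% (reassoc_of% @π_assoc) :=
  @(reassoc_of% @π_assoc)

lemma π_leftUnitor (M : Bimod A A) : π (𝟙_ _) M ≫ (λ_ M).hom.hom = M.actLeft :=
  coequalizer.π_desc _ _

lemma π_rightUnitor (M : Bimod A A) : π M (𝟙_ _) ≫ (ρ_ M).hom.hom = M.actRight :=
  coequalizer.π_desc _ _

end BimodTensor

end BimodMonoidal

/-! ### The unit of `◁` as a bimonoid, and `◁` of bimodules over it. -/

namespace Duoidal

variable {C : Type*} [Category* C] [MonoidalCategory C] [Duoidal C]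

/-- The monoid laws are among the duoidal axioms. -/
instance : MonObj (triUnit : C) where
  one := phi₀
  mul := phi₂
  one_mul := phi₀_left
  mul_one := phi₀_right
  mul_assoc := phi₂_assoc

variable (C) in
/-- The unit of the second tensor product, as a monoid for the first. -/
abbrev unitMon : Mon C := ⟨triUnit⟩

/-- The laxator followed by two maps. -/
def psiMap {X Y Z X' Y' Z' : C} (f : X ⊗ Y ⟶ Z) (f' : X' ⊗ Y' ⟶ Z') :
    tri X X' ⊗ tri Y Y' ⟶ tri Z Z' :=
  psi X X' Y Y' ≫ triMap f f'

lemma triMap_psiMap {X Y Z X' Y' Z' W W₁ W' W₁' : C} (f : X ⊗ Y ⟶ Z) (f' : X' ⊗ Y' ⟶ Z')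
    (a : W ⟶ X) (a' : W' ⟶ X') (b : W₁ ⟶ Y) (b' : W₁' ⟶ Y') :
    (triMap a a' ⊗ₘ triMap b b') ≫ psiMap f f'
      = psiMap ((a ⊗ₘ b) ≫ f) ((a' ⊗ₘ b') ≫ f') := by
  rw [psiMap, psi_naturality_assoc, ← triMap_comp, psiMap]

lemma psiMap_triMap {X Y Z X' Y' Z' W W' : C} (f : X ⊗ Y ⟶ Z) (f' : X' ⊗ Y' ⟶ Z')
    (a : Z ⟶ W) (a' : Z' ⟶ W') :
    psiMap f f' ≫ triMap a a' = psiMap (f ≫ a) (f' ≫ a') := by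
  rw [psiMap, Category.assoc, ← triMap_comp, psiMap]

lemma triMap_whiskerRight_psiMap {P Q R S P' Q' R' S' : C} (f : P ⊗ Q ⟶ R) (f' : P' ⊗ Q' ⟶ R')
    (a : S ⟶ P) (a' : S' ⟶ P') :
    triMap a a' ▷ tri Q Q' ≫ psiMap f f' = psiMap (a ▷ Q ≫ f) (a' ▷ Q' ≫ f') := by
  simpa [triMap_id] using triMap_psiMap f f' a a' (𝟙 Q) (𝟙 Q')

lemma whiskerLeft_triMap_psiMap {P Q R S P' Q' R' S' : C} (f : P ⊗ Q ⟶ R) (f' : P' ⊗ Q' ⟶ R')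
    (a : S ⟶ Q) (a' : S' ⟶ Q') :
    tri P P' ◁ triMap a a' ≫ psiMap f f' = psiMap (P ◁ a ≫ f) (P' ◁ a' ≫ f') := by
  simpa [triMap_id] using triMap_psiMap f f' (𝟙 P) (𝟙 P') a a'

/-- Compatibility of ψ₂ with the associator of `◁`, applied to three actions at once: the inner
`triMap`s are factored so that the bare ψ₂ become adjacent. -/
lemma psiMap_triAssoc {P Q R P' Q' R' P'' Q'' R'' : C} (f : P ⊗ Q ⟶ R) (f' : P' ⊗ Q' ⟶ R')
    (f'' : P'' ⊗ Q'' ⟶ R'') :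
    psiMap (psiMap f f') f'' ≫ (triAssoc _ _ _).hom
      = ((triAssoc _ _ _).hom ⊗ₘ (triAssoc _ _ _).hom) ≫ psiMap f (psiMap f' f'') := by
  have e₁ : triMap (psiMap f f') f'' = triMap (psi P P' Q Q') (𝟙 _) ≫ triMap (triMap f f') f'' := by
    rw [← triMap_comp, Category.id_comp, psiMap]
  have e₂ : triMap f (psiMap f' f'')
      = triMap (𝟙 _) (psi P' P'' Q' Q'') ≫ triMap f (triMap f' f'') := by
    rw [← triMap_comp, Category.id_comp, psiMap]
  rw [psiMap, e₁, Category.assoc, Category.assoc, triAssoc_naturality, psi_seq_assoc_assoc, psiMap,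
    e₂]

/-- Under ψ₂, multiplying two copies of N next to f is the same as removing both copies first. -/
lemma psiMap_triLeft {P Q R : C} (f : P ⊗ Q ⟶ R) :
    psiMap phi₂ f ≫ (triLeft R).hom = ((triLeft P).hom ⊗ₘ (triLeft Q).hom) ≫ f := by
  have e : triMap phi₂ f = triMap phi₂ (𝟙 _) ≫ triMap (𝟙 _) f := by
    rw [← triMap_comp, Category.id_comp, Category.comp_id]
  rw [psiMap, e, Category.assoc, Category.assoc, triLeft_naturality, phi₂_left_assoc]

lemma psiMap_triRight {P Q R : C} (f : P ⊗ Q ⟶ R) :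
    psiMap f phi₂ ≫ (triRight R).hom = ((triRight P).hom ⊗ₘ (triRight Q).hom) ≫ f := by
  have e : triMap f phi₂ = triMap (𝟙 _) phi₂ ≫ triMap f (𝟙 _) := by
    rw [← triMap_comp, Category.id_comp, Category.comp_id]
  rw [psiMap, e, Category.assoc, Category.assoc, triRight_naturality, phi₂_right_assoc]

/-- The laxator preserves associativity laws. -/
lemma psiMap_assoc {P Q R S T U P' Q' R' S' T' U' : C} {l : P ⊗ Q ⟶ R} {m : R ⊗ S ⟶ T}
    {n : Q ⊗ S ⟶ U} {o : P ⊗ U ⟶ T} {l' : P' ⊗ Q' ⟶ R'} {m' : R' ⊗ S' ⟶ T'}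
    {n' : Q' ⊗ S' ⟶ U'} {o' : P' ⊗ U' ⟶ T'}
    (h : l ▷ S ≫ m = (α_ _ _ _).hom ≫ P ◁ n ≫ o)
    (h' : l' ▷ S' ≫ m' = (α_ _ _ _).hom ≫ P' ◁ n' ≫ o') :
    psiMap l l' ▷ tri S S' ≫ psiMap m m'
      = (α_ _ _ _).hom ≫ tri P P' ◁ psiMap n n' ≫ psiMap o o' := by
  have e₃ : psiMap ((α_ P Q S).hom ≫ P ◁ n ≫ o) ((α_ P' Q' S').hom ≫ P' ◁ n' ≫ o')
      = psi (P ⊗ Q) (P' ⊗ Q') S S' ≫ triMap (α_ P Q S).hom (α_ P' Q' S').hom ≫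
        triMap (P ◁ n ≫ o) (P' ◁ n' ≫ o') := by
    rw [← triMap_comp, psiMap]
  rw [psiMap, comp_whiskerRight, Category.assoc, triMap_whiskerRight_psiMap, h, h', e₃,
    psi_par_assoc_assoc]
  rw [psiMap, whiskerLeft_comp, Category.assoc, whiskerLeft_triMap_psiMap, psiMap]

variable (C) in
/-- The comultiplication of the unit. -/
def delta : (triUnit : C) ⟶ tri triUnit triUnit := (triLeft triUnit).inv

/-- φ₀ is a map of `◁`-comonoids from I to N. The counit law identifies ψ₀ followed by φ₀ on the
left with the inverse unitor at I, and naturality of the unitor moves the other φ₀. -/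
lemma phi₀_delta : phi₀ ≫ delta C = psi₀ ≫ triMap phi₀ phi₀ := by
  have h : psi₀ ≫ triMap (phi₀ (C := C)) (𝟙 _) = (triLeft (𝟙_ C)).inv := by
    rw [← cancel_mono (triLeft (𝟙_ C)).hom, Category.assoc, phi₀_coleft, Iso.inv_hom_id]
  have h' : triMap (phi₀ (C := C)) phi₀ = triMap phi₀ (𝟙 _) ≫ triMap (𝟙 _) phi₀ := by
    rw [← triMap_comp, Category.id_comp, Category.comp_id]
  rw [h', reassoc_of% h, Iso.eq_inv_comp, delta, ← triLeft_naturality_assoc, Iso.hom_inv_id,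
    Category.comp_id]

/-- `delta` is multiplicative. By `phi₂_left`, two copies of `delta` followed by ψ₂ and φ₂ on the
left form the inverse unitor at N ⊗ N, and the remaining φ₂ passes by naturality. -/
lemma phi₂_delta : phi₂ ≫ delta C = (delta C ⊗ₘ delta C) ≫ psiMap phi₂ phi₂ := by
  have h : (delta C ⊗ₘ delta C) ≫ psi _ _ _ _ ≫ triMap phi₂ (𝟙 _)
      = (triLeft (triUnit ⊗ triUnit : C)).inv := by
    rw [← cancel_mono (triLeft _).hom, Category.assoc, Category.assoc, phi₂_left, delta,
      MonoidalCategory.tensorHom_comp_tensorHom]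
    simp
  have h' : triMap (phi₂ (C := C)) phi₂ = triMap phi₂ (𝟙 _) ≫ triMap (𝟙 _) phi₂ := by
    rw [← triMap_comp, Category.id_comp, Category.comp_id]
  rw [psiMap, h', reassoc_of% h, Iso.eq_inv_comp, delta, ← triLeft_naturality_assoc,
    Iso.hom_inv_id, Category.comp_id]

/-- The triangle equation at N, where the left and right unitors coincide and both are inverse to
`delta`. -/
lemma delta_assoc : delta C ≫ triMap (delta C) (𝟙 _) ≫ (triAssoc _ _ _).hom
    = delta C ≫ triMap (𝟙 _) (delta C) := by
  have h := tri_triangle (C := C) triUnit triUnit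
  rw [← triLeft_eq_triRight] at h
  have h' : triMap (𝟙 (triUnit : C)) (triLeft _).hom ≫ triMap (𝟙 _) (delta C) = 𝟙 _ := by
    rw [← triMap_comp, delta, Iso.hom_inv_id, Category.id_comp, triMap_id]
  have h'' : triMap (delta C) (𝟙 triUnit) ≫ triMap (triLeft (triUnit : C)).hom (𝟙 _) = 𝟙 _ := by
    rw [← triMap_comp, delta, Iso.inv_hom_id, Category.id_comp, triMap_id]
  rw [← Category.comp_id (triAssoc _ _ _).hom, ← h', reassoc_of% h, reassoc_of% h'']

/-- The laxator preserves associativity laws, restricted along `delta` on the left. -/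
lemma psiMap_assoc_left {Q R S T U Q' R' S' T' U' : C} {l : triUnit ⊗ Q ⟶ R} {m : R ⊗ S ⟶ T}
    {n : Q ⊗ S ⟶ U} {o : triUnit ⊗ U ⟶ T} {l' : triUnit ⊗ Q' ⟶ R'} {m' : R' ⊗ S' ⟶ T'}
    {n' : Q' ⊗ S' ⟶ U'} {o' : triUnit ⊗ U' ⟶ T'}
    (h : l ▷ S ≫ m = (α_ _ _ _).hom ≫ triUnit ◁ n ≫ o)
    (h' : l' ▷ S' ≫ m' = (α_ _ _ _).hom ≫ triUnit ◁ n' ≫ o') :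
    (delta C ▷ _ ≫ psiMap l l') ▷ tri S S' ≫ psiMap m m'
      = (α_ _ _ _).hom ≫ triUnit ◁ psiMap n n' ≫ delta C ▷ _ ≫ psiMap o o' := by
  rw [comp_whiskerRight, Category.assoc, psiMap_assoc h h', associator_naturality_left_assoc,
    whisker_exchange_assoc]

/-- The laxator preserves associativity laws, restricted along `delta` on the right. -/
lemma psiMap_assoc_right {P Q R T U P' Q' R' T' U' : C} {l : P ⊗ Q ⟶ R} {m : R ⊗ triUnit ⟶ T}
    {n : Q ⊗ triUnit ⟶ U} {o : P ⊗ U ⟶ T} {l' : P' ⊗ Q' ⟶ R'} {m' : R' ⊗ triUnit ⟶ T'}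
    {n' : Q' ⊗ triUnit ⟶ U'} {o' : P' ⊗ U' ⟶ T'}
    (h : l ▷ triUnit ≫ m = (α_ _ _ _).hom ≫ P ◁ n ≫ o)
    (h' : l' ▷ triUnit ≫ m' = (α_ _ _ _).hom ≫ P' ◁ n' ≫ o') :
    psiMap l l' ▷ triUnit ≫ (_ ◁ delta C ≫ psiMap m m')
      = (α_ _ _ _).hom ≫ tri P P' ◁ (_ ◁ delta C ≫ psiMap n n') ≫ psiMap o o' := by
  rw [← whisker_exchange_assoc, psiMap_assoc h h', whiskerLeft_comp, Category.assoc,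
    ← associator_naturality_right_assoc]

/-- The laxator preserves associativity laws, restricted along `delta` in the middle. -/
lemma psiMap_assoc_middle {P R S T U P' R' S' T' U' : C} {l : P ⊗ triUnit ⟶ R} {m : R ⊗ S ⟶ T}
    {n : triUnit ⊗ S ⟶ U} {o : P ⊗ U ⟶ T} {l' : P' ⊗ triUnit ⟶ R'} {m' : R' ⊗ S' ⟶ T'}
    {n' : triUnit ⊗ S' ⟶ U'} {o' : P' ⊗ U' ⟶ T'}
    (h : l ▷ S ≫ m = (α_ _ _ _).hom ≫ P ◁ n ≫ o)
    (h' : l' ▷ S' ≫ m' = (α_ _ _ _).hom ≫ P' ◁ n' ≫ o') :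
    (_ ◁ delta C ≫ psiMap l l') ▷ tri S S' ≫ psiMap m m'
      = (α_ _ _ _).hom ≫ tri P P' ◁ (delta C ▷ _ ≫ psiMap n n') ≫ psiMap o o' := by
  rw [comp_whiskerRight, Category.assoc, psiMap_assoc h h', whiskerLeft_comp, Category.assoc,
    associator_naturality_middle_assoc]

variable (C) in
/-- The bimodules over the unit of the second tensor product. -/
abbrev NBimod := Bimod (unitMon C) (unitMon C)

namespace NBimod

variable (M : NBimod C)

lemma one_actLeft : phi₀ ▷ M.X ≫ M.actLeft = (λ_ M.X).hom :=
  Bimod.one_actLeft M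

lemma actRight_one : M.X ◁ phi₀ ≫ M.actRight = (ρ_ M.X).hom :=
  Bimod.actRight_one M

lemma left_assoc : phi₂ ▷ M.X ≫ M.actLeft
    = (α_ triUnit triUnit M.X).hom ≫ triUnit ◁ M.actLeft ≫ M.actLeft :=
  Bimod.left_assoc M

lemma right_assoc : M.actRight ▷ triUnit ≫ M.actRight
    = (α_ M.X triUnit triUnit).hom ≫ M.X ◁ phi₂ ≫ M.actRight := by
  rw [← Iso.inv_comp_eq]
  exact (Bimod.right_assoc M).symm

lemma middle_assoc : M.actLeft ▷ triUnit ≫ M.actRight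
    = (α_ triUnit M.X triUnit).hom ≫ triUnit ◁ M.actRight ≫ M.actLeft :=
  Bimod.middle_assoc M

variable {M} in
lemma left_act_hom {M' : NBimod C} (f : M ⟶ M') :
    M.actLeft ≫ f.hom = triUnit ◁ f.hom ≫ M'.actLeft := f.left_act_hom

variable {M} in
lemma right_act_hom {M' : NBimod C} (f : M ⟶ M') :
    M.actRight ≫ f.hom = f.hom ▷ triUnit ≫ M'.actRight := f.right_act_hom

end NBimod

/-- The second tensor product of bimodules. -/
@[simps]
def triBimod (M M' : NBimod C) : NBimod C where
  X := tri M.X M'.X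
  actLeft := delta C ▷ _ ≫ psiMap M.actLeft M'.actLeft
  actRight := _ ◁ delta C ≫ psiMap M.actRight M'.actRight
  one_actLeft := by
    -- The comonoid map φ₀ replaces `delta` by ψ₀, so that the unit laws of the two factors can be
    -- used under ψ₂; ψ₀ is then a unit for ψ₂.
    have h : (triMap phi₀ phi₀) ▷ tri M.X M'.X ≫ psiMap M.actLeft M'.actLeft
        = psiMap (λ_ _).hom (λ_ _).hom := by
      rw [← NBimod.one_actLeft, ← NBimod.one_actLeft, ← tensorHom_id, ← tensorHom_id,
        ← tensorHom_id, ← triMap_psiMap, triMap_id]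
    change phi₀ ▷ _ ≫ _ = _
    rw [← comp_whiskerRight_assoc, phi₀_delta, comp_whiskerRight_assoc, h, psiMap, psi₀_left]
  left_assoc := by
    change phi₂ ▷ _ ≫ _ = _
    -- Multiplicativity splits `delta` after φ₂ into two copies of `delta`; ψ₂ preserves the two
    -- associativity laws, and the copies move into place by interchange.
    rw [← comp_whiskerRight_assoc, phi₂_delta, comp_whiskerRight_assoc,
      psiMap_assoc (NBimod.left_assoc M) (NBimod.left_assoc M'), tensorHom_def',
      comp_whiskerRight_assoc, associator_naturality_left_assoc,
      associator_naturality_middle_assoc, ← whisker_exchange_assoc,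
      MonoidalCategory.whiskerLeft_comp, Category.assoc]
  actRight_one := by
    have h : tri M.X M'.X ◁ (triMap phi₀ phi₀) ≫ psiMap M.actRight M'.actRight
        = psiMap (ρ_ _).hom (ρ_ _).hom := by
      rw [← NBimod.actRight_one, ← NBimod.actRight_one, ← id_tensorHom, ← id_tensorHom,
        ← id_tensorHom, ← triMap_psiMap, triMap_id]
    change _ ◁ phi₀ ≫ _ = _
    rw [← MonoidalCategory.whiskerLeft_comp_assoc, phi₀_delta,
      MonoidalCategory.whiskerLeft_comp_assoc, h, psiMap, psi₀_right]
  right_assoc := by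
    change _ ◁ phi₂ ≫ _ = _
    rw [Iso.eq_inv_comp, ← MonoidalCategory.whiskerLeft_comp_assoc, phi₂_delta, comp_whiskerRight,
      Category.assoc, ← whisker_exchange_assoc,
      psiMap_assoc (NBimod.right_assoc M) (NBimod.right_assoc M'),
      MonoidalCategory.whiskerLeft_comp_assoc, MonoidalCategory.tensorHom_def,
      MonoidalCategory.whiskerLeft_comp_assoc, associator_naturality_right_assoc,
      associator_naturality_middle_assoc]
  middle_assoc := by
    rw [← whisker_exchange_assoc,
      psiMap_assoc_left (NBimod.middle_assoc M) (NBimod.middle_assoc M'),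
      associator_naturality_right_assoc, MonoidalCategory.whiskerLeft_comp_assoc]

/-- Functoriality of the second tensor product of bimodules. -/
@[simps]
def triBimodMap {M M' L L' : NBimod C} (f : M ⟶ M') (g : L ⟶ L') :
    triBimod M L ⟶ triBimod M' L' where
  hom := triMap f.hom g.hom
  left_act_hom := by
    change (delta C ▷ _ ≫ psiMap _ _) ≫ _ = triUnit ◁ triMap _ _ ≫ delta C ▷ _ ≫ psiMap _ _
    rw [Category.assoc, psiMap_triMap, NBimod.left_act_hom, NBimod.left_act_hom,
      whisker_exchange_assoc, whiskerLeft_triMap_psiMap]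
  right_act_hom := by
    change (_ ◁ delta C ≫ psiMap _ _) ≫ _ = triMap _ _ ▷ triUnit ≫ _ ◁ delta C ≫ psiMap _ _
    rw [Category.assoc, psiMap_triMap, NBimod.right_act_hom, NBimod.right_act_hom,
      ← whisker_exchange_assoc, triMap_whiskerRight_psiMap]

/-- The second associator of bimodules. -/
def triBimodAssoc (M M' M'' : NBimod C) :
    triBimod (triBimod M M') M'' ≅ triBimod M (triBimod M' M'') :=
  Bimod.isoOfIso (triAssoc _ _ _) (by
    change (delta C ▷ _ ≫ psiMap (delta C ▷ _ ≫ psiMap _ _) _) ≫ _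
      = triUnit ◁ (triAssoc _ _ _).hom ≫ delta C ▷ _ ≫ psiMap _ (delta C ▷ _ ≫ psiMap _ _)
    -- With the inner `delta` pulled to the front, N acts on the two bracketings through the two
    -- iterated comultiplications, which `delta_assoc` identifies.
    have e₁ := triMap_whiskerRight_psiMap (psiMap M.actLeft M'.actLeft) M''.actLeft (delta C) (𝟙 _)
    have e₂ := triMap_whiskerRight_psiMap M.actLeft (psiMap M'.actLeft M''.actLeft) (𝟙 _) (delta C)
    rw [id_whiskerRight, Category.id_comp] at e₁ e₂
    rw [← e₁, ← e₂, Category.assoc, Category.assoc, psiMap_triAssoc, ← comp_whiskerRight_assoc,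
      MonoidalCategory.tensorHom_def, Category.assoc, ← comp_whiskerRight_assoc, Category.assoc,
      delta_assoc,
      comp_whiskerRight_assoc, ← whisker_exchange_assoc, ← whisker_exchange_assoc]) (by
    change (_ ◁ delta C ≫ psiMap (_ ◁ delta C ≫ psiMap _ _) _) ≫ _
      = (triAssoc _ _ _).hom ▷ triUnit ≫ _ ◁ delta C ≫ psiMap _ (_ ◁ delta C ≫ psiMap _ _)
    have e₁ := whiskerLeft_triMap_psiMap (psiMap M.actRight M'.actRight) M''.actRight
      (delta C) (𝟙 _)
    have e₂ := whiskerLeft_triMap_psiMap M.actRight (psiMap M'.actRight M''.actRight)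
      (𝟙 _) (delta C)
    rw [MonoidalCategory.whiskerLeft_id, Category.id_comp] at e₁ e₂
    rw [← e₁, ← e₂, Category.assoc, Category.assoc, psiMap_triAssoc,
      ← MonoidalCategory.whiskerLeft_comp_assoc, tensorHom_def', Category.assoc,
      ← MonoidalCategory.whiskerLeft_comp_assoc, Category.assoc, delta_assoc,
      ← MonoidalCategory.whiskerLeft_comp_assoc, ← whisker_exchange_assoc])

/-- The second left unitor of bimodules. -/
def triBimodLeft (M : NBimod C) : triBimod (Bimod.regular _) M ≅ M :=
  Bimod.isoOfIso (triLeft _) (by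
    change (delta C ▷ _ ≫ psiMap phi₂ _) ≫ _ = triUnit ◁ (triLeft M.X).hom ≫ M.actLeft
    -- The unitor produced by `psiMap_triLeft` on the acting N cancels `delta`, its inverse.
    rw [Category.assoc, psiMap_triLeft, MonoidalCategory.tensorHom_def, Category.assoc,
      ← comp_whiskerRight_assoc, delta, Iso.inv_hom_id, id_whiskerRight, Category.id_comp]) (by
    change (_ ◁ delta C ≫ psiMap phi₂ _) ≫ _ = (triLeft M.X).hom ▷ triUnit ≫ M.actRight
    rw [Category.assoc, psiMap_triLeft, tensorHom_def', Category.assoc,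
      ← MonoidalCategory.whiskerLeft_comp_assoc, delta, Iso.inv_hom_id,
      MonoidalCategory.whiskerLeft_id, Category.id_comp])

/-- The second right unitor of bimodules. -/
def triBimodRight (M : NBimod C) : triBimod M (Bimod.regular _) ≅ M :=
  Bimod.isoOfIso (triRight _) (by
    change (delta C ▷ _ ≫ psiMap _ phi₂) ≫ _ = triUnit ◁ (triRight M.X).hom ≫ M.actLeft
    -- Here the right unitor of N appears; it cancels `delta` because it equals the left one.
    rw [Category.assoc, psiMap_triRight, MonoidalCategory.tensorHom_def, Category.assoc,
      ← comp_whiskerRight_assoc, delta, triLeft_eq_triRight, Iso.inv_hom_id, id_whiskerRight,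
      Category.id_comp]) (by
    change (_ ◁ delta C ≫ psiMap _ phi₂) ≫ _ = (triRight M.X).hom ▷ triUnit ≫ M.actRight
    rw [Category.assoc, psiMap_triRight, tensorHom_def', Category.assoc,
      ← MonoidalCategory.whiskerLeft_comp_assoc, delta, triLeft_eq_triRight, Iso.inv_hom_id,
      MonoidalCategory.whiskerLeft_id, Category.id_comp])

/-! ### The duoidal category of bimodules over the unit of `◁`. -/

section Laxator

variable [HasCoequalizers C] [∀ X : C, PreservesColimitsOfSize.{0, 0} (tensorLeft X)]
  [∀ X : C, PreservesColimitsOfSize.{0, 0} (tensorRight X)]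

open BimodTensor

/-- The laxator, as a balanced map of bimodules. -/
noncomputable def psiπ (M M' L L' : NBimod C) :
    (triBimod M M').X ⊗ (triBimod L L').X ⟶ (triBimod (M ⊗ L) (M' ⊗ L')).X :=
  psiMap (π M L) (π M' L')

/-- `delta` distributes the middle N over the two factors of `◁`, and in each factor the quotient
map is balanced. -/
lemma psiπ_condition (M M' L L' : NBimod C) :
    (triBimod M M').actRight ▷ (triBimod L L').X ≫ psiπ M M' L L'
      = (α_ _ _ _).hom ≫ (triBimod M M').X ◁ (triBimod L L').actLeft ≫ psiπ M M' L L' :=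
  psiMap_assoc_middle (condition M L) (condition M' L')

lemma psiπ_actLeft (M M' L L' : NBimod C) :
    (triBimod M M').actLeft ▷ (triBimod L L').X ≫ psiπ M M' L L'
      = (α_ _ _ _).hom ≫ triUnit ◁ psiπ M M' L L' ≫ (triBimod (M ⊗ L) (M' ⊗ L')).actLeft :=
  psiMap_assoc_left (actLeft_whiskerRight_π M L) (actLeft_whiskerRight_π M' L')

lemma psiπ_actRight (M M' L L' : NBimod C) :
    psiπ M M' L L' ▷ triUnit ≫ (triBimod (M ⊗ L) (M' ⊗ L')).actRight
      = (α_ _ _ _).hom ≫ (triBimod M M').X ◁ (triBimod L L').actRight ≫ psiπ M M' L L' :=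
  psiMap_assoc_right (π_whiskerRight_actRight _ _) (π_whiskerRight_actRight _ _)

/-- The laxator of bimodules. -/
noncomputable def psiBimod (M M' L L' : NBimod C) :
    triBimod M M' ⊗ triBimod L L' ⟶ triBimod (M ⊗ L) (M' ⊗ L') where
  hom := desc (psiπ M M' L L') (psiπ_condition M M' L L')
  left_act_hom := by
    rw [← cancel_epi ((unitMon C).X ◁ π (triBimod M M') (triBimod L L')),
      whiskerLeft_π_actLeft_assoc, π_desc, ← MonoidalCategory.whiskerLeft_comp_assoc, π_desc,
      Iso.inv_comp_eq, psiπ_actLeft]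
  right_act_hom := by
    rw [← cancel_epi (π (triBimod M M') (triBimod L L') ▷ triUnit),
      π_whiskerRight_actRight_assoc, π_desc, ← comp_whiskerRight_assoc, π_desc, psiπ_actRight]

lemma π_psiBimod (M M' L L' : NBimod C) :
    π (triBimod M M') (triBimod L L') ≫ (psiBimod M M' L L').hom = psiπ M M' L L' :=
  π_desc _ (psiπ_condition M M' L L')

lemma π_psiBimod_assoc : type_of% (reassoc_of% @π_psiBimod) :=
  @(reassoc_of% @π_psiBimod)

lemma psiπ_triBimodMap {M M' L L' P P' : NBimod C} (f : M ⊗ L ⟶ P) (f' : M' ⊗ L' ⟶ P') :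
    psiπ M M' L L' ≫ (triBimodMap f f').hom = psiMap (π M L ≫ f.hom) (π M' L' ≫ f'.hom) :=
  psiMap_triMap _ _ _ _

/-- Bimodules over the unit of the second tensor product form a duoidal category, under the tensor
product of bimodules and the second tensor product. -/
noncomputable instance : Duoidal (NBimod C) where
  tri := triBimod
  triMap := triBimodMap
  triUnit := Bimod.regular _
  triAssoc := triBimodAssoc
  triLeft := triBimodLeft
  triRight := triBimodRight
  triMap_id _ _ := Bimod.hom_ext _ _ (triMap_id _ _)
  triMap_comp _ _ _ _ := Bimod.hom_ext _ _ (triMap_comp _ _ _ _)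
  triAssoc_naturality _ _ _ := Bimod.hom_ext _ _ (triAssoc_naturality _ _ _)
  triLeft_naturality _ := Bimod.hom_ext _ _ (triLeft_naturality _)
  triRight_naturality _ := Bimod.hom_ext _ _ (triRight_naturality _)
  tri_pentagon _ _ _ _ := Bimod.hom_ext _ _ (tri_pentagon _ _ _ _)
  tri_triangle _ _ := Bimod.hom_ext _ _ (tri_triangle _ _)
  psi := psiBimod
  -- Both tensor products have the regular bimodule N as unit. So ψ₀ is `delta`, φ₂ is a unitor and
  -- φ₀ an identity, which makes the structure normal.
  psi₀ := (triBimodLeft (Bimod.regular _)).inv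
  phi₂ := (λ_ (𝟙_ (NBimod C))).hom
  phi₀ := 𝟙 (𝟙_ (NBimod C))
  psi_naturality f g h k := by
    -- Equations out of a tensor product over N are tested after the quotient map, where the laxator
    -- of bimodules is ψ₂ followed by two quotient maps.
    refine hom_ext ?_
    rw [Bimod.comp_hom', Bimod.comp_hom', π_tensorHom_assoc, π_psiBimod_assoc, π_psiBimod,
      psiπ_triBimodMap, π_tensorHom, π_tensorHom]
    exact triMap_psiMap _ _ _ _ _ _
  psi_par_assoc M M' L L' P P' := by
    refine hom_ext ?_
    -- The source is an iterated tensor product over N, so a second, whiskered quotient map is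
    -- cancelled.
    rw [← cancel_epi (π _ _ ▷ _)]
    simp only [Bimod.comp_hom']
    rw [π_whiskerRight_assoc, π_psiBimod_assoc, π_assoc_assoc, π_whiskerLeft_assoc, π_psiBimod,
      ← comp_whiskerRight_assoc, ← MonoidalCategory.whiskerLeft_comp_assoc, π_psiBimod, π_psiBimod,
      psiπ_triBimodMap]
    exact psiMap_assoc (π_assoc _ _ _) (π_assoc _ _ _)
  psi_seq_assoc M L P M' L' P' := by
    refine hom_ext ?_
    simp only [Bimod.comp_hom']
    rw [π_psiBimod_assoc, π_tensorHom_assoc, π_psiBimod_assoc, psiπ_triBimodMap, ← Category.assoc,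
      psiπ_triBimodMap, π_psiBimod, π_psiBimod, Bimod.id_hom', Bimod.id_hom', Category.comp_id,
      Category.comp_id]
    exact psiMap_triAssoc _ _ _
  psi₀_left M M' := by
    refine hom_ext ?_
    simp only [Bimod.comp_hom']
    rw [π_whiskerRight_assoc, π_psiBimod_assoc, π_leftUnitor, psiπ_triBimodMap, π_leftUnitor,
      π_leftUnitor]
    rfl
  psi₀_right M M' := by
    refine hom_ext ?_
    simp only [Bimod.comp_hom']
    rw [π_whiskerLeft_assoc, π_psiBimod_assoc, π_rightUnitor, psiπ_triBimodMap, π_rightUnitor,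
      π_rightUnitor]
    rfl
  phi₂_left M M' := by
    refine hom_ext ?_
    simp only [Bimod.comp_hom']
    rw [π_psiBimod_assoc, π_tensorHom, ← Category.assoc]
    refine (congrArg (· ≫ _) (psiπ_triBimodMap (M := 𝟙_ (NBimod C)) (L := 𝟙_ (NBimod C)) _ _)).trans
      ?_
    rw [π_leftUnitor, Bimod.id_hom', Category.comp_id]
    exact psiMap_triLeft _
  phi₂_right M M' := by
    refine hom_ext ?_
    simp only [Bimod.comp_hom']
    rw [π_psiBimod_assoc, π_tensorHom, ← Category.assoc]
    refine (congrArg (· ≫ _) (psiπ_triBimodMap (M' := 𝟙_ (NBimod C)) (L' := 𝟙_ (NBimod C))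
      _ _)).trans ?_
    rw [π_leftUnitor, Bimod.id_hom', Category.comp_id]
    exact psiMap_triRight _
  phi₂_assoc := by
    change (λ_ (𝟙_ (NBimod C))).hom ▷ 𝟙_ _ ≫ (λ_ _).hom
      = (α_ (𝟙_ _) (𝟙_ _) (𝟙_ _)).hom ≫ 𝟙_ _ ◁ (λ_ _).hom ≫ (λ_ _).hom
    rw [triangle_assoc, unitors_equal]
  psi₀_assoc := Bimod.hom_ext _ _ delta_assoc
  phi₀_right := by
    change 𝟙_ (NBimod C) ◁ 𝟙 (𝟙_ _) ≫ (λ_ _).hom = (ρ_ _).hom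
    rw [MonoidalCategory.whiskerLeft_id, Category.id_comp, unitors_equal]
  phi₀_left := by
    change 𝟙 (𝟙_ (NBimod C)) ▷ 𝟙_ _ ≫ (λ_ _).hom = (λ_ _).hom
    rw [id_whiskerRight, Category.id_comp]
  phi₀_coright := by
    refine Bimod.hom_ext _ _ ?_
    change delta C ≫ triMap (𝟙 _) (𝟙 _) ≫ (triRight _).hom = 𝟙 _
    rw [triMap_id, Category.id_comp, delta, triLeft_eq_triRight, Iso.inv_hom_id]
  phi₀_coleft := by
    refine Bimod.hom_ext _ _ ?_
    change delta C ≫ triMap (𝟙 _) (𝟙 _) ≫ (triLeft _).hom = 𝟙 _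
    rw [triMap_id, Category.id_comp, delta, Iso.inv_hom_id]

end Laxator

end Duoidal

end Produoidal

end

/-! ### The promonoidal structure on a dense family of objects of a monoidal category. -/

section

namespace Produoidal

open MonoidalCategory

/-- The category with objects `K` and homs those of `E` between the images under `J`. -/
def NerveCat {K : Type u} {E : Type*} [Category.{u} E] (_ : K → E) : Type u := K

section

variable {K : Type u} {E : Type*} [Category.{u} E] (J : K → E)

instance : SmallCategory (NerveCat J) where
  Hom A B := J A ⟶ J B
  id A := 𝟙 (J A)
  comp f g := f ≫ g

/-- An object of `E`, seen as a presheaf on `NerveCat J`. -/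
def nerve : E ⥤ Psh (NerveCat J) where
  obj M :=
    { obj A := J (unop A) ⟶ M
      map k := ↾fun g => (show J _ ⟶ J _ from k.unop) ≫ g
      map_id A := ConcreteCategory.hom_ext _ _ fun g => Category.id_comp (X := J (unop A)) g
      map_comp _ _ := ConcreteCategory.hom_ext _ _ fun g => Category.assoc (W := J _) _ _ g }
  map f :=
    { app _ := ↾fun g => g ≫ f
      naturality _ _ _ := ConcreteCategory.hom_ext _ _ fun g => Category.assoc (W := J _) _ g f }
  map_id _ := NatTrans.ext (funext fun A => ConcreteCategory.hom_ext _ _ fun g =>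
    Category.comp_id (X := J (unop A)) g)
  map_comp f g := NatTrans.ext (funext fun A => ConcreteCategory.hom_ext _ _ fun h =>
    (Category.assoc (W := J (unop A)) h f g).symm)

variable {J}

variable (J) in
/-- The canonical isomorphism from the representable presheaf at `A` to the nerve of `J A`. -/
def nerveId (A : NerveCat J) : yo A ⟶ (nerve J).obj (J A) := 𝟙 (yo A)

instance (A : NerveCat J) : IsIso (nerveId J A) := inferInstanceAs (IsIso (𝟙 (yo A)))

/-- The Yoneda lemma. It makes every element of a nerve come from a morphism of `E`, so that
naturality in `E` can be used on it. -/
lemma exists_nerveId {M : E} {A : NerveCat J} (f : yo A ⟶ (nerve J).obj M) :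
    ∃ g : J A ⟶ M, nerveId J A ≫ (nerve J).map g = f := by
  obtain ⟨f, rfl⟩ := yonedaEquiv.symm.surjective f
  exact ⟨f, rfl⟩

end

section Monoidal

variable {K : Type u} {E : Type*} [Category.{u} E] [MonoidalCategory E] (J : K → E)

/-- The profunctor `(A, B, C) ↦ (J A ⟶ J B ⊗ J C)`. -/
def nerveTensor : Profunctor.{u} (NerveCat J × NerveCat J) (NerveCat J) where
  obj p := (nerve J).obj (J p.1 ⊗ J p.2)
  map f := (nerve J).map (tensorHom (C := E) f.1 f.2)
  map_id p := by
    refine Eq.trans ?_ ((nerve J).map_id _)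
    exact congrArg (nerve J).map (id_tensorHom_id (C := E) (J p.1) (J p.2))
  map_comp f g := by
    refine Eq.trans ?_ ((nerve J).map_comp _ _)
    exact congrArg (nerve J).map (tensorHom_comp_tensorHom (C := E) f.1 f.2 g.1 g.2).symm

/-- The canonical map from the tensor product of nerves to the nerve of the tensor product. -/
def nerveCan (M M' : E) :
    conv (nerveTensor J) ((nerve J).obj M) ((nerve J).obj M') ⟶ (nerve J).obj (M ⊗ M') :=
  conv.desc (fun {X Y} (f : J X ⟶ M) (g : J Y ⟶ M') => (nerve J).map (f ⊗ₘ g)) (by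
    intro X X' Y Y' f g (p : J X' ⟶ M) (q : J Y' ⟶ M')
    refine ((nerve J).map_comp _ _).symm.trans ?_
    exact congrArg (nerve J).map (tensorHom_comp_tensorHom (C := E) f g p q))

variable {J}

/-- The product of two maps into nerves. -/
def nerveMul {P Q : Psh (NerveCat J)} {M M' : E} (a : P ⟶ (nerve J).obj M)
    (b : Q ⟶ (nerve J).obj M') : conv (nerveTensor J) P Q ⟶ (nerve J).obj (M ⊗ M') :=
  conv.map a b ≫ nerveCan J M M'

lemma map_nerveMul {P P' Q Q' : Psh (NerveCat J)} {M M' : E} (f : P ⟶ P') (g : Q ⟶ Q')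
    (a : P' ⟶ (nerve J).obj M) (b : Q' ⟶ (nerve J).obj M') :
    conv.map (T := nerveTensor J) f g ≫ nerveMul a b = nerveMul (f ≫ a) (g ≫ b) := by
  rw [nerveMul, nerveMul, conv.map_comp, Category.assoc]

lemma map_nerveMul_assoc : type_of% (reassoc_of% @map_nerveMul) :=
  @(reassoc_of% @map_nerveMul)

lemma nerveMul_map {P Q : Psh (NerveCat J)} {M M' L L' : E} (a : P ⟶ (nerve J).obj M)
    (b : Q ⟶ (nerve J).obj M') (f : M ⟶ L) (g : M' ⟶ L') :
    nerveMul a b ≫ (nerve J).map (f ⊗ₘ g)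
      = nerveMul (a ≫ (nerve J).map f) (b ≫ (nerve J).map g) := by
  refine conv.hom_ext fun {X Y} p q => ?_
  change (nerve J).map ((show J X ⟶ M from a.app _ p) ⊗ₘ (show J Y ⟶ M' from b.app _ q)) ≫
      (nerve J).map (f ⊗ₘ g)
    = (nerve J).map (((show J X ⟶ M from a.app _ p) ≫ f) ⊗ₘ ((show J Y ⟶ M' from b.app _ q) ≫ g))
  rw [← Functor.map_comp, tensorHom_comp_tensorHom]

lemma nerveMul_map_left {P Q : Psh (NerveCat J)} {M M' L : E} (a : P ⟶ (nerve J).obj M)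
    (b : Q ⟶ (nerve J).obj M') (f : M ⟶ L) :
    nerveMul (a ≫ (nerve J).map f) b = nerveMul a b ≫ (nerve J).map (f ▷ M') := by
  rw [← tensorHom_id, nerveMul_map, (nerve J).map_id, Category.comp_id]

lemma nerveMul_map_right {P Q : Psh (NerveCat J)} {M M' L : E} (a : P ⟶ (nerve J).obj M)
    (b : Q ⟶ (nerve J).obj M') (f : M' ⟶ L) :
    nerveMul a (b ≫ (nerve J).map f) = nerveMul a b ≫ (nerve J).map (M ◁ f) := by
  rw [← id_tensorHom, nerveMul_map, (nerve J).map_id, Category.comp_id]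

lemma nerveMul_left {Q : Psh (NerveCat J)} {M M' L : E} (f : L ⟶ M)
    (b : Q ⟶ (nerve J).obj M') :
    nerveMul ((nerve J).map f) b = nerveMul (𝟙 _) b ≫ (nerve J).map (f ▷ M') := by
  rw [← nerveMul_map_left, Category.id_comp]

lemma nerveMul_right {P : Psh (NerveCat J)} {M M' L : E} (a : P ⟶ (nerve J).obj M)
    (f : L ⟶ M') :
    nerveMul a ((nerve J).map f) = nerveMul a (𝟙 _) ≫ (nerve J).map (M ◁ f) := by
  rw [← nerveMul_map_right, Category.id_comp]

lemma nerveMul_id (M M' : E) :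
    nerveMul (𝟙 ((nerve J).obj M)) (𝟙 ((nerve J).obj M')) = nerveCan J M M' := by
  rw [nerveMul, conv.map_id, Category.id_comp]

lemma nerveCan_naturality {M M' L L' : E} (f : M ⟶ L) (f' : M' ⟶ L') :
    conv.map ((nerve J).map f) ((nerve J).map f') ≫ nerveCan J L L'
      = nerveCan J M M' ≫ (nerve J).map (f ⊗ₘ f') := by
  rw [← nerveMul_id M, nerveMul_map, Category.id_comp, Category.id_comp, nerveMul]

lemma nerveCan_naturality_assoc : type_of% (reassoc_of% @nerveCan_naturality) :=
  @(reassoc_of% @nerveCan_naturality)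

variable (J) in
/-- `J` is a dense family of objects that is compatible with the tensor product: the tensor product
of `E` is the Day convolution of its restriction to `J`. -/
class TensorDense : Prop where
  isIso_can : ∀ M M' : E, IsIso (nerveCan J M M')

attribute [instance] TensorDense.isIso_can

variable [TensorDense J]

/-- Density makes these products invertible. An equation between maps into a nested composite may
hence be tested in the nerve of the tensor product in `E`. -/
instance instIsIsoNerveMul {P Q : Psh (NerveCat J)} {M M' : E} (a : P ⟶ (nerve J).obj M)
    (b : Q ⟶ (nerve J).obj M') [IsIso a] [IsIso b] : IsIso (nerveMul a b) := by
  have : IsIso (conv.map (T := nerveTensor J) a b) :=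
    inferInstanceAs (IsIso (conv.mapIso (asIso a) (asIso b)).hom)
  unfold nerveMul
  infer_instance

variable (J) in
/-- The canonical isomorphism from the tensor product of nerves to the nerve of the tensor
product. -/
@[simps! hom]
noncomputable def nerveCanIso (M M' : E) :
    conv (nerveTensor J) ((nerve J).obj M) ((nerve J).obj M') ≅ (nerve J).obj (M ⊗ M') :=
  asIso (nerveCan J M M')

lemma nerveCanIso_inv_comp (M M' : E) : (nerveCanIso J M M').inv ≫ nerveCan J M M' = 𝟙 _ :=
  (nerveCanIso J M M').inv_hom_id

lemma nerveCanIso_inv_comp_assoc : type_of% (reassoc_of% @nerveCanIso_inv_comp) :=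
  @(reassoc_of% @nerveCanIso_inv_comp)

variable (J) in
/-- The data of the promonoidal structure that a monoidal category induces on a dense family of
objects. -/
noncomputable abbrev nervePromonoidalData : PromonoidalData (NerveCat J) where
  tensor := nerveTensor J
  unit := (nerve J).obj (𝟙_ E)
  assoc X Y Z := nerveCanIso J (J X ⊗ J Y) (J Z) ≪≫
    (nerve J).mapIso (α_ (J X) (J Y) (J Z)) ≪≫ (nerveCanIso J (J X) (J Y ⊗ J Z)).symm
  left X := nerveCanIso J (𝟙_ E) (J X) ≪≫ (nerve J).mapIso (λ_ (J X))
  right X := nerveCanIso J (J X) (𝟙_ E) ≪≫ (nerve J).mapIso (ρ_ (J X))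
  assoc_naturality {X X' Y Y' Z Z'} (f : J X ⟶ J X') (g : J Y ⟶ J Y') (h : J Z ⟶ J Z') := by
    change conv.map ((nerve J).map (f ⊗ₘ g)) ((nerve J).map h) ≫ nerveCan J _ _ ≫
        (nerve J).map _ ≫ (nerveCanIso J _ _).inv
      = (nerveCan J _ _ ≫ (nerve J).map _ ≫ (nerveCanIso J _ _).inv) ≫
        conv.map ((nerve J).map f) ((nerve J).map (g ⊗ₘ h))
    rw [← cancel_mono (nerveCan J _ _)]
    simp only [Category.assoc, nerveCan_naturality, nerveCanIso_inv_comp_assoc,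
      nerveCanIso_inv_comp, nerveCan_naturality_assoc, Category.comp_id]
    rw [← Functor.map_comp, ← Functor.map_comp, associator_naturality]
  left_naturality {X X'} (f : J X ⟶ J X') := by
    change conv.map (𝟙 ((nerve J).obj (𝟙_ E))) ((nerve J).map f) ≫ nerveCan J _ _ ≫
        (nerve J).map _ = (nerveCan J _ _ ≫ (nerve J).map _) ≫ (nerve J).map f
    rw [← (nerve J).map_id, nerveCan_naturality_assoc, Category.assoc, ← Functor.map_comp,
      ← Functor.map_comp, id_tensorHom, leftUnitor_naturality]
  right_naturality {X X'} (f : J X ⟶ J X') := by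
    change conv.map ((nerve J).map f) (𝟙 ((nerve J).obj (𝟙_ E))) ≫ nerveCan J _ _ ≫
        (nerve J).map _ = (nerveCan J _ _ ≫ (nerve J).map _) ≫ (nerve J).map f
    rw [← (nerve J).map_id, nerveCan_naturality_assoc, Category.assoc, ← Functor.map_comp,
      ← Functor.map_comp, tensorHom_id, rightUnitor_naturality]

local notation "𝓟" => nervePromonoidalData J

/-- The associator is transported from `E` along the canonical isomorphisms, so after passing to the
nerve of the triple tensor product it is the associator of `E`. -/
lemma assocHom_nerveId (X Y Z : NerveCat J) :
    (𝓟).assocHom (yo X) (yo Y) (yo Z) ≫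
        nerveMul (nerveId J X) (nerveMul (nerveId J Y) (nerveId J Z))
      = nerveMul (nerveMul (nerveId J X) (nerveId J Y)) (nerveId J Z) ≫
        (nerve J).map (α_ (J X) (J Y) (J Z)).hom := by
  have h : (𝓟).assocHom (yo X) (yo Y) (yo Z) ≫ conv.map (𝟙 (yo X)) (nerveCan J (J Y) (J Z)) ≫
        nerveCan J (J X) (J Y ⊗ J Z)
      = conv.map (nerveCan J (J X) (J Y)) (𝟙 (yo Z)) ≫ nerveCan J (J X ⊗ J Y) (J Z) ≫
        (nerve J).map (α_ (J X) (J Y) (J Z)).hom := by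
    refine ((𝓟).assocHom_reduce_assoc X Y Z _).trans ?_
    change _ ≫ (nerveCan J _ _ ≫ (nerve J).map _ ≫ (nerveCanIso J _ _).inv) ≫ _ = _
    rw [Category.assoc, Category.assoc, nerveCanIso_inv_comp, Category.comp_id]
    rfl
  have e {P : Psh (NerveCat J)} {M M' : E} (a : P ⟶ (nerve J).obj M') :
      nerveMul (𝟙 ((nerve J).obj M)) a = conv.map (𝟙 _) a ≫ nerveCan J M M' := rfl
  have e' {P : Psh (NerveCat J)} {M M' : E} (a : P ⟶ (nerve J).obj M) :
      nerveMul a (𝟙 ((nerve J).obj M')) = conv.map a (𝟙 _) ≫ nerveCan J M M' := rfl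
  change _ ≫ nerveMul (𝟙 _) (nerveMul (𝟙 ((nerve J).obj (J Y))) (𝟙 ((nerve J).obj (J Z))))
    = nerveMul (nerveMul (𝟙 ((nerve J).obj (J X))) (𝟙 ((nerve J).obj (J Y)))) (𝟙 _) ≫ _
  rw [nerveMul_id, nerveMul_id, e, e', Category.assoc]
  exact h

/-- The associator corresponds to the associator. -/
lemma assocHom_nerveMul {P Q R : Psh (NerveCat J)} {M M' M'' : E} (a : P ⟶ (nerve J).obj M)
    (b : Q ⟶ (nerve J).obj M') (c : R ⟶ (nerve J).obj M'') :
    (𝓟).assocHom P Q R ≫ nerveMul a (nerveMul b c)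
      = nerveMul (nerveMul a b) c ≫ (nerve J).map (α_ M M' M'').hom := by
  refine (((covers_el P).conv (covers_el Q)).conv (covers_el R)).hom_ext ?_
  rintro ⟨⟨⟨X, f⟩, ⟨Y, g⟩⟩, ⟨Z, h⟩⟩
  dsimp only
  rw [(𝓟).assocHom_naturality_assoc, map_nerveMul, map_nerveMul, map_nerveMul_assoc,
    map_nerveMul]
  obtain ⟨f', hf⟩ := exists_nerveId (f ≫ a)
  obtain ⟨g', hg⟩ := exists_nerveId (g ≫ b)
  obtain ⟨h', hh⟩ := exists_nerveId (h ≫ c)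
  rw [← hf, ← hg, ← hh, ← nerveMul_map, ← nerveMul_map, ← nerveMul_map, ← nerveMul_map,
    ← Category.assoc, assocHom_nerveId, Category.assoc, Category.assoc, ← Functor.map_comp,
    ← Functor.map_comp, associator_naturality]

lemma assocHom_nerveMul_assoc : type_of% (reassoc_of% @assocHom_nerveMul) :=
  @(reassoc_of% @assocHom_nerveMul)

lemma leftHom_nerve {P : Psh (NerveCat J)} {M : E} (a : P ⟶ (nerve J).obj M) :
    (𝓟).leftHom P ≫ a = nerveMul (𝟙 ((nerve J).obj (𝟙_ E))) a ≫ (nerve J).map (λ_ M).hom := by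
  refine ((covers_id ((nerve J).obj (𝟙_ E))).conv (covers_el P)).hom_ext ?_
  rintro ⟨⟨⟩, ⟨X, f⟩⟩
  dsimp only
  refine ((𝓟).leftHom_naturality_assoc f a).trans ?_
  obtain ⟨f', hf⟩ := exists_nerveId (f ≫ a)
  rw [map_nerveMul_assoc, ← hf, Category.id_comp, nerveMul_map_right, Category.assoc,
    ← Functor.map_comp, leftUnitor_naturality, Functor.map_comp, (𝓟).leftHom_yo X]
  exact (congrArg (· ≫ (nerve J).map (λ_ (J X)).hom ≫ (nerve J).map f')
    (nerveMul_id (𝟙_ E) (J X))).symm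

lemma rightHom_nerve {P : Psh (NerveCat J)} {M : E} (a : P ⟶ (nerve J).obj M) :
    (𝓟).rightHom P ≫ a = nerveMul a (𝟙 ((nerve J).obj (𝟙_ E))) ≫ (nerve J).map (ρ_ M).hom := by
  refine ((covers_el P).conv (covers_id ((nerve J).obj (𝟙_ E)))).hom_ext ?_
  rintro ⟨⟨X, f⟩, ⟨⟩⟩
  dsimp only
  refine ((𝓟).rightHom_naturality_assoc f a).trans ?_
  obtain ⟨f', hf⟩ := exists_nerveId (f ≫ a)
  rw [map_nerveMul_assoc, ← hf, Category.id_comp, nerveMul_map_left, Category.assoc,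
    ← Functor.map_comp, rightUnitor_naturality, Functor.map_comp, (𝓟).rightHom_yo X]
  exact (congrArg (· ≫ (nerve J).map (ρ_ (J X)).hom ≫ (nerve J).map f')
    (nerveMul_id (J X) (𝟙_ E))).symm

lemma leftHom_nerve_obj (M : E) :
    (𝓟).leftHom ((nerve J).obj M) = nerveMul (𝟙 _) (𝟙 _) ≫ (nerve J).map (λ_ M).hom := by
  rw [← leftHom_nerve, Category.comp_id]

lemma rightHom_nerve_obj (M : E) :
    (𝓟).rightHom ((nerve J).obj M) = nerveMul (𝟙 _) (𝟙 _) ≫ (nerve J).map (ρ_ M).hom := by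
  rw [← rightHom_nerve, Category.comp_id]

variable (J) in
/-- The promonoidal structure that a monoidal category induces on a dense family of objects. -/
noncomputable abbrev nervePromonoidal : Promonoidal (NerveCat J) where
  toPromonoidalData := 𝓟
  pentagon X Y Z W := by
    -- Both sides are compared in the nerve of the fourfold tensor product, where they are the
    -- nerves of the two sides of the pentagon in `E`.
    rw [← cancel_mono (nerveMul (nerveId J X) (nerveMul (nerveId J Y)
      (nerveMul (nerveId J Z) (nerveId J W))))]
    simp only [Category.assoc, map_nerveMul, Category.id_comp, assocHom_nerveMul,
      assocHom_nerveMul_assoc, map_nerveMul_assoc, nerveMul_map_left, nerveMul_map_right,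
      ← Functor.map_comp, pentagon]
  triangle X Y := by
    rw [← cancel_mono (nerveMul (nerveId J X) (nerveId J Y))]
    simp only [Category.assoc, map_nerveMul, Category.id_comp, assocHom_nerveMul_assoc,
      nerveMul_map_left, nerveMul_map_right, ← Functor.map_comp, leftHom_nerve, rightHom_nerve,
      triangle]

end Monoidal

/-! ### The produoidal structure on a dense family of objects of a duoidal category. -/

section Duoidal

open Duoidal

variable {K : Type u} {E : Type*} [Category.{u} E] [MonoidalCategory E] [Duoidal E] (J : K → E)

/-- The profunctor `(A, B, C) ↦ (J A ⟶ tri (J B) (J C))`. -/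
def nerveTri : Profunctor.{u} (NerveCat J × NerveCat J) (NerveCat J) :=
  @nerveTensor K E _ (seqMonoidal E) J

/-- The canonical map from the second tensor product of nerves to the nerve. -/
def nerveTriCan (M M' : E) :
    conv (nerveTri J) ((nerve J).obj M) ((nerve J).obj M') ⟶ (nerve J).obj (tri M M') :=
  @nerveCan K E _ (seqMonoidal E) J M M'

/-- `J` is a dense family of objects that is compatible with the second tensor product. -/
abbrev TriDense : Prop := @TensorDense K E _ (seqMonoidal E) J

variable {J}

/-- The second product of two maps into nerves. -/
def nerveTriMul {P Q : Psh (NerveCat J)} {M M' : E} (a : P ⟶ (nerve J).obj M)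
    (b : Q ⟶ (nerve J).obj M') : conv (nerveTri J) P Q ⟶ (nerve J).obj (tri M M') :=
  @nerveMul K E _ (seqMonoidal E) J P Q M M' a b

lemma map_nerveTriMul {P P' Q Q' : Psh (NerveCat J)} {M M' : E} (f : P ⟶ P') (g : Q ⟶ Q')
    (a : P' ⟶ (nerve J).obj M) (b : Q' ⟶ (nerve J).obj M') :
    conv.map (T := nerveTri J) f g ≫ nerveTriMul a b = nerveTriMul (f ≫ a) (g ≫ b) :=
  @map_nerveMul K E _ (seqMonoidal E) J P P' Q Q' M M' f g a b

lemma map_nerveTriMul_assoc : type_of% (reassoc_of% @map_nerveTriMul) :=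
  @(reassoc_of% @map_nerveTriMul)

lemma nerveTriMul_map {P Q : Psh (NerveCat J)} {M M' L L' : E} (a : P ⟶ (nerve J).obj M)
    (b : Q ⟶ (nerve J).obj M') (f : M ⟶ L) (g : M' ⟶ L') :
    nerveTriMul a b ≫ (nerve J).map (triMap f g)
      = nerveTriMul (a ≫ (nerve J).map f) (b ≫ (nerve J).map g) :=
  @nerveMul_map K E _ (seqMonoidal E) J P Q M M' L L' a b f g

lemma nerveTriMul_map_left {P Q : Psh (NerveCat J)} {M M' L : E} (a : P ⟶ (nerve J).obj M)
    (b : Q ⟶ (nerve J).obj M') (f : M ⟶ L) :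
    nerveTriMul (a ≫ (nerve J).map f) b = nerveTriMul a b ≫ (nerve J).map (triMap f (𝟙 M')) :=
  @nerveMul_map_left K E _ (seqMonoidal E) J P Q M M' L a b f

lemma nerveTriMul_map_right {P Q : Psh (NerveCat J)} {M M' L : E} (a : P ⟶ (nerve J).obj M)
    (b : Q ⟶ (nerve J).obj M') (f : M' ⟶ L) :
    nerveTriMul a (b ≫ (nerve J).map f) = nerveTriMul a b ≫ (nerve J).map (triMap (𝟙 M) f) :=
  @nerveMul_map_right K E _ (seqMonoidal E) J P Q M M' L a b f

lemma nerveTriMul_left {Q : Psh (NerveCat J)} {M M' L : E} (f : L ⟶ M)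
    (b : Q ⟶ (nerve J).obj M') :
    nerveTriMul ((nerve J).map f) b = nerveTriMul (𝟙 _) b ≫ (nerve J).map (triMap f (𝟙 M')) := by
  rw [← nerveTriMul_map_left, Category.id_comp]

lemma nerveTriMul_right {P : Psh (NerveCat J)} {M M' L : E} (a : P ⟶ (nerve J).obj M)
    (f : L ⟶ M') :
    nerveTriMul a ((nerve J).map f) = nerveTriMul a (𝟙 _) ≫ (nerve J).map (triMap (𝟙 M) f) := by
  rw [← nerveTriMul_map_right, Category.id_comp]

lemma nerveTriMul_id (M M' : E) :
    nerveTriMul (𝟙 ((nerve J).obj M)) (𝟙 ((nerve J).obj M')) = nerveTriCan J M M' :=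
  @nerveMul_id K E _ (seqMonoidal E) J M M'

variable [TriDense J]

instance {P Q : Psh (NerveCat J)} {M M' : E} (a : P ⟶ (nerve J).obj M)
    (b : Q ⟶ (nerve J).obj M') [IsIso a] [IsIso b] : IsIso (nerveTriMul a b) :=
  @instIsIsoNerveMul K E _ (seqMonoidal E) J _ P Q M M' a b _ _

variable (J) in
/-- The canonical isomorphism from the second tensor product of nerves to the nerve. -/
noncomputable def nerveTriCanIso (M M' : E) :
    conv (nerveTri J) ((nerve J).obj M) ((nerve J).obj M') ≅ (nerve J).obj (tri M M') :=
  @nerveCanIso K E _ (seqMonoidal E) J _ M M'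

lemma nerveTriCanIso_inv_comp (M M' : E) :
    (nerveTriCanIso J M M').inv ≫ nerveTriCan J M M' = 𝟙 _ :=
  (nerveTriCanIso J M M').inv_hom_id

lemma nerveTriCanIso_inv_comp_assoc : type_of% (reassoc_of% @nerveTriCanIso_inv_comp) :=
  @(reassoc_of% @nerveTriCanIso_inv_comp)

instance (M M' : E) : IsIso (nerveTriCan J M M') :=
  inferInstanceAs (IsIso (nerveTriCanIso J M M').hom)

/-- The associator of the second promonoidal structure on `NerveCat J`. -/
noncomputable def nerveTriAssoc (X Y Z : NerveCat J) :
    conv (nerveTri J) ((nerveTri J).obj (X, Y)) (yo Z)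
      ≅ conv (nerveTri J) (yo X) ((nerveTri J).obj (Y, Z)) :=
  (@nervePromonoidal K E _ (seqMonoidal E) J _).assoc X Y Z

/-- The left unitor of the second promonoidal structure on `NerveCat J`. -/
noncomputable def nerveTriLeft (X : NerveCat J) :
    conv (nerveTri J) ((nerve J).obj triUnit) (yo X) ≅ yo X :=
  (@nervePromonoidal K E _ (seqMonoidal E) J _).left X

/-- The right unitor of the second promonoidal structure on `NerveCat J`. -/
noncomputable def nerveTriRight (X : NerveCat J) :
    conv (nerveTri J) (yo X) ((nerve J).obj triUnit) ≅ yo X :=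
  (@nervePromonoidal K E _ (seqMonoidal E) J _).right X

variable (J) in
/-- The data of the second promonoidal structure that a duoidal category induces on a dense family
of objects. -/
noncomputable abbrev nerveSeqData : PromonoidalData (NerveCat J) where
  tensor := nerveTri J
  unit := (nerve J).obj triUnit
  assoc := nerveTriAssoc
  left := nerveTriLeft
  right := nerveTriRight
  assoc_naturality := (@nervePromonoidal K E _ (seqMonoidal E) J _).assoc_naturality
  left_naturality := (@nervePromonoidal K E _ (seqMonoidal E) J _).left_naturality
  right_naturality := (@nervePromonoidal K E _ (seqMonoidal E) J _).right_naturality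

variable (J) in
/-- The second promonoidal structure that a duoidal category induces on a dense family of
objects. -/
noncomputable abbrev nerveSeq : Promonoidal (NerveCat J) where
  toPromonoidalData := nerveSeqData J
  pentagon := (@nervePromonoidal K E _ (seqMonoidal E) J _).pentagon
  triangle := (@nervePromonoidal K E _ (seqMonoidal E) J _).triangle

lemma assocHom_nerveTriMul {P Q R : Psh (NerveCat J)} {M M' M'' : E} (a : P ⟶ (nerve J).obj M)
    (b : Q ⟶ (nerve J).obj M') (c : R ⟶ (nerve J).obj M'') :
    (nerveSeqData J).assocHom P Q R ≫ nerveTriMul a (nerveTriMul b c)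
      = nerveTriMul (nerveTriMul a b) c ≫ (nerve J).map (triAssoc M M' M'').hom :=
  @assocHom_nerveMul K E _ (seqMonoidal E) J _ P Q R M M' M'' a b c

lemma triLeftHom_nerve {P : Psh (NerveCat J)} {M : E} (a : P ⟶ (nerve J).obj M) :
    (nerveSeqData J).leftHom P ≫ a
      = nerveTriMul (𝟙 ((nerve J).obj triUnit)) a ≫ (nerve J).map (triLeft M).hom :=
  @leftHom_nerve K E _ (seqMonoidal E) J _ P M a

lemma triRightHom_nerve {P : Psh (NerveCat J)} {M : E} (a : P ⟶ (nerve J).obj M) :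
    (nerveSeqData J).rightHom P ≫ a
      = nerveTriMul a (𝟙 ((nerve J).obj triUnit)) ≫ (nerve J).map (triRight M).hom :=
  @rightHom_nerve K E _ (seqMonoidal E) J _ P M a

lemma triLeftHom_nerve_obj (M : E) :
    (nerveSeqData J).leftHom ((nerve J).obj M)
      = nerveTriMul (𝟙 _) (𝟙 _) ≫ (nerve J).map (triLeft M).hom := by
  rw [← triLeftHom_nerve, Category.comp_id]

lemma triRightHom_nerve_obj (M : E) :
    (nerveSeqData J).rightHom ((nerve J).obj M)
      = nerveTriMul (𝟙 _) (𝟙 _) ≫ (nerve J).map (triRight M).hom := by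
  rw [← triRightHom_nerve, Category.comp_id]

variable [TensorDense J]

variable (J) in
/-- The data of the produoidal structure that a duoidal category induces on a dense family of
objects. -/
noncomputable abbrev nerveProduoidalData : ProduoidalData (NerveCat J) where
  par := nervePromonoidal J
  seq := nerveSeq J
  psi₂ X Y Z W := nerveCan J (tri (J X) (J Y)) (tri (J Z) (J W)) ≫
    (nerve J).map (psi (J X) (J Y) (J Z) (J W)) ≫ (nerveTriCanIso J (J X ⊗ J Z) (J Y ⊗ J W)).inv
  psi₀ := (nerve J).map psi₀ ≫ (nerveTriCanIso J (𝟙_ E) (𝟙_ E)).inv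
  phi₂ := nerveCan J triUnit triUnit ≫ (nerve J).map phi₂
  phi₀ := (nerve J).map phi₀
  psi₂_naturality {X X' Y Y' Z Z' W W'} (f : J X ⟶ J X') (g : J Y ⟶ J Y') (h : J Z ⟶ J Z')
      (k : J W ⟶ J W') := by
    change conv.map ((nerve J).map (triMap f g)) ((nerve J).map (triMap h k)) ≫
        nerveCan J _ _ ≫ (nerve J).map _ ≫ (nerveTriCanIso J _ _).inv
      = (nerveCan J _ _ ≫ (nerve J).map _ ≫ (nerveTriCanIso J _ _).inv) ≫
        conv.map ((nerve J).map (f ⊗ₘ h)) ((nerve J).map (g ⊗ₘ k))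
    rw [← cancel_mono (nerveTriCan J _ _)]
    have e : conv.map ((nerve J).map (f ⊗ₘ h)) ((nerve J).map (g ⊗ₘ k)) ≫
        nerveTriCan J (J X' ⊗ J Z') (J Y' ⊗ J W')
        = nerveTriCan J _ _ ≫ (nerve J).map (triMap (f ⊗ₘ h) (g ⊗ₘ k)) :=
      @nerveCan_naturality K E _ (seqMonoidal E) J _ _ _ _ (f ⊗ₘ h) (g ⊗ₘ k)
    simp only [Category.assoc, nerveCan_naturality_assoc, nerveTriCanIso_inv_comp, e,
      Category.comp_id, nerveTriCanIso_inv_comp_assoc]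
    rw [← Functor.map_comp, ← Functor.map_comp, psi_naturality]

/-- Since ψ₂ is defined by transport along the canonical isomorphisms, it becomes the laxator of `E`
once these are composed back. -/
lemma psi_nerveId (X Y Z W : NerveCat J) :
    (nerveProduoidalData J).psi (yo X) (yo Y) (yo Z) (yo W) ≫
        nerveTriMul (nerveMul (nerveId J X) (nerveId J Z)) (nerveMul (nerveId J Y) (nerveId J W))
      = nerveMul (nerveTriMul (nerveId J X) (nerveId J Y))
          (nerveTriMul (nerveId J Z) (nerveId J W)) ≫
        (nerve J).map (psi (J X) (J Y) (J Z) (J W)) := by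
  have h : (nerveProduoidalData J).psi (yo X) (yo Y) (yo Z) (yo W) ≫
        conv.map (nerveCan J (J X) (J Z)) (nerveCan J (J Y) (J W)) ≫ nerveTriCan J _ _
      = conv.map (nerveTriCan J (J X) (J Y)) (nerveTriCan J (J Z) (J W)) ≫ nerveCan J _ _ ≫
        (nerve J).map (psi (J X) (J Y) (J Z) (J W)) := by
    refine ((nerveProduoidalData J).psi_reduce_assoc X Y Z W _).trans ?_
    change _ ≫ (nerveCan J _ _ ≫ (nerve J).map _ ≫ (nerveTriCanIso J _ _).inv) ≫ _ = _
    rw [Category.assoc, Category.assoc, nerveTriCanIso_inv_comp, Category.comp_id]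
    rfl
  change _ ≫ nerveTriMul (nerveMul (𝟙 ((nerve J).obj (J X))) (𝟙 ((nerve J).obj (J Z))))
      (nerveMul (𝟙 ((nerve J).obj (J Y))) (𝟙 ((nerve J).obj (J W))))
    = nerveMul (nerveTriMul (𝟙 ((nerve J).obj (J X))) (𝟙 ((nerve J).obj (J Y))))
      (nerveTriMul (𝟙 ((nerve J).obj (J Z))) (𝟙 ((nerve J).obj (J W)))) ≫ _
  rw [nerveMul_id, nerveMul_id, nerveTriMul_id, nerveTriMul_id]
  exact h

lemma psi_nerveId_assoc : type_of% (reassoc_of% @psi_nerveId) :=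
  @(reassoc_of% @psi_nerveId)

/-- The laxator corresponds to the laxator. -/
lemma psi_nerveMul {P Q R S : Psh (NerveCat J)} {M M' L L' : E} (a : P ⟶ (nerve J).obj M)
    (b : Q ⟶ (nerve J).obj M') (c : R ⟶ (nerve J).obj L) (d : S ⟶ (nerve J).obj L') :
    (nerveProduoidalData J).psi P Q R S ≫ nerveTriMul (nerveMul a c) (nerveMul b d)
      = nerveMul (nerveTriMul a b) (nerveTriMul c d) ≫ (nerve J).map (psi M M' L L') := by
  refine (((covers_el P).conv (covers_el Q)).conv ((covers_el R).conv (covers_el S))).hom_ext ?_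
  rintro ⟨⟨⟨X, f⟩, ⟨Y, g⟩⟩, ⟨⟨Z, h⟩, ⟨W, k⟩⟩⟩
  dsimp only
  rw [(nerveProduoidalData J).psi_naturality_assoc, map_nerveTriMul, map_nerveMul, map_nerveMul,
    map_nerveMul_assoc, map_nerveTriMul, map_nerveTriMul]
  obtain ⟨f', hf⟩ := exists_nerveId (f ≫ a)
  obtain ⟨g', hg⟩ := exists_nerveId (g ≫ b)
  obtain ⟨h', hh⟩ := exists_nerveId (h ≫ c)
  obtain ⟨k', hk⟩ := exists_nerveId (k ≫ d)
  rw [← hf, ← hg, ← hh, ← hk, ← nerveMul_map, ← nerveMul_map, ← nerveTriMul_map, ← nerveTriMul_map,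
    ← nerveTriMul_map, ← nerveMul_map, psi_nerveId_assoc, Category.assoc, ← Functor.map_comp,
    ← Functor.map_comp, psi_naturality]

lemma psi_nerveMul_assoc : type_of% (reassoc_of% @psi_nerveMul) :=
  @(reassoc_of% @psi_nerveMul)

omit [TensorDense J] in
lemma nerveTriCanIso_inv_comp_mul (M M' : E) :
    (nerveTriCanIso J M M').inv ≫ nerveTriMul (𝟙 _) (𝟙 _) = 𝟙 _ := by
  rw [nerveTriMul_id, nerveTriCanIso_inv_comp]

lemma nerveTriCanIso_inv_comp_mul_assoc : type_of% (reassoc_of% @nerveTriCanIso_inv_comp_mul) :=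
  @(reassoc_of% @nerveTriCanIso_inv_comp_mul)

variable (J) in
/-- The produoidal structure that a duoidal category induces on a dense family of objects. -/
noncomputable abbrev nerveProduoidal : ProduoidalStruct (NerveCat J) where
  toProduoidalData := nerveProduoidalData J
  psi_par_assoc A B X Y Z W := by
    -- As for the pentagon: in the nerve of the nested tensor product every structure map becomes
    -- the nerve of its counterpart in `E`. Laws whose target is already the nerve of an object need
    -- no such cancellation.
    rw [← cancel_mono (nerveTriMul (nerveMul (nerveId J A) (nerveMul (nerveId J X) (nerveId J Z)))
      (nerveMul (nerveId J B) (nerveMul (nerveId J Y) (nerveId J W))))]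
    simp only [Category.assoc, map_nerveTriMul, Category.id_comp, Category.comp_id, psi_nerveMul,
      psi_nerveMul_assoc, assocHom_nerveMul, assocHom_nerveMul_assoc, map_nerveMul_assoc,
      nerveMul_map_left, nerveMul_map_right, nerveTriMul_map_left, nerveTriMul_map_right,
      ← Functor.map_comp, ← triMap_comp, Duoidal.psi_par_assoc]
  psi_seq_assoc A B X Y Z W := by
    rw [← cancel_mono (nerveTriMul (nerveMul (nerveId J A) (nerveId J Y))
      (nerveTriMul (nerveMul (nerveId J B) (nerveId J Z)) (nerveMul (nerveId J X) (nerveId J W))))]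
    simp only [Category.assoc, map_nerveTriMul, Category.id_comp, psi_nerveMul, psi_nerveMul_assoc,
      assocHom_nerveTriMul, map_nerveMul_assoc, map_nerveTriMul_assoc, nerveMul_map_left,
      nerveMul_map_right, nerveTriMul_map_left, nerveTriMul_map_right, ← Functor.map_comp,
      Duoidal.psi_seq_assoc, MonoidalCategory.tensorHom_def]
  psi₀_left A B := by
    rw [← cancel_mono (nerveTriMul (nerveId J A) (nerveId J B))]
    simp only [Category.assoc, map_nerveTriMul, Category.id_comp, Category.comp_id,
      psi_nerveMul_assoc, map_nerveMul_assoc, leftHom_nerve, nerveTriMul_map_left,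
      nerveTriMul_map_right, ← Functor.map_comp, nerveTriCanIso_inv_comp_mul, ← triMap_comp,
      nerveMul_left, Duoidal.psi₀_left]
  psi₀_right A B := by
    rw [← cancel_mono (nerveTriMul (nerveId J A) (nerveId J B))]
    simp only [Category.assoc, map_nerveTriMul, Category.id_comp, Category.comp_id,
      psi_nerveMul_assoc, map_nerveMul_assoc, rightHom_nerve, nerveTriMul_map_left,
      nerveTriMul_map_right, ← Functor.map_comp, nerveTriCanIso_inv_comp_mul, ← triMap_comp,
      nerveMul_right, Duoidal.psi₀_right]
  phi₂_left A B := by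
    rw [← cancel_mono (nerveMul (nerveId J A) (nerveId J B))]
    simp only [Category.assoc, map_nerveMul, Category.id_comp, Category.comp_id, psi_nerveMul_assoc,
      map_nerveTriMul_assoc, triLeftHom_nerve, nerveMul_map_left, nerveMul_map_right,
      nerveTriMul_map_left, ← Functor.map_comp, ← nerveMul_id, Duoidal.phi₂_left,
      MonoidalCategory.tensorHom_def]
  phi₂_right A B := by
    rw [← cancel_mono (nerveMul (nerveId J A) (nerveId J B))]
    simp only [Category.assoc, map_nerveMul, Category.id_comp, Category.comp_id, psi_nerveMul_assoc,
      map_nerveTriMul_assoc, triRightHom_nerve, nerveMul_map_left, nerveMul_map_right,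
      nerveTriMul_map_right, ← Functor.map_comp, ← nerveMul_id, Duoidal.phi₂_right,
      MonoidalCategory.tensorHom_def]
  phi₂_assoc := by
    simp only [Category.assoc, Category.comp_id, assocHom_nerveMul_assoc, map_nerveMul_assoc,
      nerveMul_map_left, nerveMul_map_right, ← Functor.map_comp, ← nerveMul_id, Duoidal.phi₂_assoc]
  psi₀_assoc := by
    rw [← cancel_mono (nerveTriMul (𝟙 _) (nerveTriMul (𝟙 _) (𝟙 _)))]
    simp only [Category.assoc, map_nerveTriMul, Category.comp_id, assocHom_nerveTriMul,
      map_nerveTriMul_assoc, ← Functor.map_comp, nerveTriCanIso_inv_comp_mul,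
      nerveTriCanIso_inv_comp_mul_assoc, nerveTriMul_left, nerveTriMul_right, Duoidal.psi₀_assoc]
  phi₀_right := by
    simp only [Category.assoc, Category.comp_id, map_nerveMul_assoc, ← Functor.map_comp,
      ← nerveMul_id, nerveMul_right, rightHom_nerve_obj, Duoidal.phi₀_right]
  phi₀_left := by
    simp only [Category.assoc, Category.comp_id, map_nerveMul_assoc, ← Functor.map_comp,
      ← nerveMul_id, nerveMul_left, leftHom_nerve_obj, Duoidal.phi₀_left]
  phi₀_coright := by
    simp only [Category.assoc, Category.comp_id, map_nerveTriMul_assoc, ← Functor.map_comp,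
      (nerve J).map_id, nerveTriCanIso_inv_comp_mul_assoc, nerveTriMul_right, triRightHom_nerve_obj,
      Duoidal.phi₀_coright]
  phi₀_coleft := by
    simp only [Category.assoc, Category.comp_id, map_nerveTriMul_assoc, ← Functor.map_comp,
      (nerve J).map_id, nerveTriCanIso_inv_comp_mul_assoc, nerveTriMul_left, triLeftHom_nerve_obj,
      Duoidal.phi₀_coleft]

end Duoidal

end Produoidal

end

/-! ### Free objects on representables: restriction of nerves, and a criterion for density. -/

section

namespace Produoidal

open MonoidalCategory

section SplitMap

variable {V W : Type u} [SmallCategory V] [SmallCategory W] {F : V ⥤ W}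
  {T : Profunctor.{u} (V × V) V} {T' : Profunctor.{u} (W × W) W} (τ : SplitMap F T T')

lemma SplitMap.map_conv {P Q R S : Psh V} {P' Q' : Psh W} (a : R ⟶ P) (b : S ⟶ Q)
    (c : P ⟶ F.op ⋙ P') (d : Q ⟶ F.op ⋙ Q') :
    conv.map (T := T) a b ≫ τ.conv c d = τ.conv (a ≫ c) (b ≫ d) :=
  conv.hom_ext fun _ _ => rfl

lemma SplitMap.map_conv_assoc : type_of% (reassoc_of% @SplitMap.map_conv) :=
  @(reassoc_of% @SplitMap.map_conv)

lemma SplitMap.conv_map {P Q : Psh V} {P' Q' R' S' : Psh W} (c : P ⟶ F.op ⋙ P')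
    (d : Q ⟶ F.op ⋙ Q') (a : P' ⟶ R') (b : Q' ⟶ S') :
    τ.conv c d ≫ Functor.whiskerLeft F.op (conv.map (T := T') a b)
      = τ.conv (c ≫ Functor.whiskerLeft F.op a) (d ≫ Functor.whiskerLeft F.op b) :=
  conv.hom_ext fun _ _ => rfl

lemma SplitMap.conv_map_assoc : type_of% (reassoc_of% @SplitMap.conv_map) :=
  @(reassoc_of% @SplitMap.conv_map)

end SplitMap

section Free

variable {V : Type u} [SmallCategory V] {E : Type*} [Category.{u} E]

/-- The free objects on representable presheaves. -/
abbrev freeFamily (L : Psh V ⥤ E) (A : V) : E := L.obj (yo A)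

/-- The functor that sends an object to the free object on it. -/
@[simps]
def freeFunctor (L : Psh V ⥤ E) : V ⥤ NerveCat (freeFamily L) where
  obj A := A
  map f := L.map (yoneda.map f)
  map_id A := by
    refine Eq.trans ?_ (L.map_id _)
    rw [yoneda.map_id]
  map_comp f g := by
    refine Eq.trans ?_ (L.map_comp _ _)
    rw [yoneda.map_comp]

variable {L : Psh V ⥤ E} {F : E ⥤ Psh V} (adj : L ⊣ F)

/-- The unit of the adjunction at a representable presheaf. -/
def freeUnit (A : V) : yo A ⟶ F.obj (L.obj (yo A)) := adj.unit.app (yo A)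

lemma freeUnit_naturality {A B : V} (f : A ⟶ B) :
    yoneda.map f ≫ freeUnit adj B = freeUnit adj A ≫ F.map (L.map (yoneda.map f)) :=
  adj.unit.naturality (yoneda.map f)

/-- The nerve of an object, restricted along `freeFunctor`, is the underlying presheaf. -/
def nerveRestrict (M : E) :
    (freeFunctor L).op ⋙ (nerve (freeFamily L)).obj M ≅ F.obj M :=
  NatIso.ofComponents
    (fun A => Equiv.toIso ((adj.homEquiv (yo A.unop) M).trans yonedaEquiv))
    (fun {A B} k => by
      refine ConcreteCategory.hom_ext _ _ fun (g : L.obj (yo A.unop) ⟶ M) => ?_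
      change yonedaEquiv (adj.homEquiv (yo B.unop) M (L.map (yoneda.map k.unop) ≫ g))
        = (F.obj M).map k (yonedaEquiv (adj.homEquiv (yo A.unop) M g))
      rw [adj.homEquiv_naturality_left]
      exact (yonedaEquiv_naturality (adj.homEquiv (yo A.unop) M g) k.unop).symm)

lemma el_nerveRestrict {M : E} {A : V} (g : L.obj (yo A) ⟶ M) :
    el (((nerveRestrict adj M).hom).app (op A) g) = freeUnit adj A ≫ F.map g := by
  exact (yonedaEquiv.symm_apply_apply _).trans (adj.homEquiv_unit (f := g))

lemma nerveRestrict_naturality {M M' : E} (f : M ⟶ M') :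
    Functor.whiskerLeft (freeFunctor L).op ((nerve (freeFamily L)).map f) ≫
        (nerveRestrict adj M').hom
      = (nerveRestrict adj M).hom ≫ F.map f := by
  refine NatTrans.ext (funext fun A => ConcreteCategory.hom_ext _ _
    fun (g : L.obj (yo A.unop) ⟶ M) => ?_)
  change yonedaEquiv (adj.homEquiv (yo A.unop) M' (g ≫ f))
    = (F.map f).app A (yonedaEquiv (adj.homEquiv (yo A.unop) M g))
  rw [adj.homEquiv_naturality_right, yonedaEquiv_comp]

lemma nerveRestrict_naturality_assoc : type_of% (reassoc_of% @nerveRestrict_naturality) :=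
  @(reassoc_of% @nerveRestrict_naturality)

end Free

/-- A lax monoidal structure on a functor to presheaves, with the tensor product of presheaves that
a promonoidal structure induces. -/
structure LaxToDay {V : Type u} [SmallCategory V] {E : Type*} [Category* E] [MonoidalCategory E]
    (M : PromonoidalData V) (F : E ⥤ Psh V) where
  /-- The structure map on tensor products. -/
  μ (X Y : E) : M.conv (F.obj X) (F.obj Y) ⟶ F.obj (X ⊗ Y)
  /-- The structure map on units. -/
  ε : M.unit ⟶ F.obj (𝟙_ E)
  μ_naturality {X X' Y Y' : E} (f : X ⟶ X') (g : Y ⟶ Y') :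
    conv.map (F.map f) (F.map g) ≫ μ X' Y' = μ X Y ≫ F.map (f ⊗ₘ g)
  assoc (X Y Z : E) :
    conv.map (μ X Y) (𝟙 (F.obj Z)) ≫ μ (X ⊗ Y) Z ≫ F.map (α_ X Y Z).hom
      = M.assocHom (F.obj X) (F.obj Y) (F.obj Z) ≫ conv.map (𝟙 (F.obj X)) (μ Y Z) ≫ μ X (Y ⊗ Z)
  left (X : E) : conv.map ε (𝟙 (F.obj X)) ≫ μ (𝟙_ E) X ≫ F.map (λ_ X).hom = M.leftHom (F.obj X)
  right (X : E) : conv.map (𝟙 (F.obj X)) ε ≫ μ X (𝟙_ E) ≫ F.map (ρ_ X).hom = M.rightHom (F.obj X)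

namespace LaxToDay

lemma μ_naturality_assoc : type_of% (reassoc_of% @μ_naturality) :=
  @(reassoc_of% @μ_naturality)

variable {V : Type u} [SmallCategory V] {E : Type*} [Category.{u} E] [MonoidalCategory E]
  {M : PromonoidalData V} {L : Psh V ⥤ E} {F : E ⥤ Psh V} (l : LaxToDay M F) (adj : L ⊣ F)

/-- The action of `freeFunctor` on a split. -/
def splitApp (X Y : V) : M.tensor.obj (X, Y) ⟶
    (freeFunctor L).op ⋙ (nerve (freeFamily L)).obj (L.obj (yo X) ⊗ L.obj (yo Y)) :=
  conv.ι (P := yo X) (Q := yo Y) (𝟙 X) (𝟙 Y) ≫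
    conv.map (freeUnit adj X) (freeUnit adj Y) ≫
    l.μ (L.obj (yo X)) (L.obj (yo Y)) ≫ (nerveRestrict adj _).inv

lemma splitApp_nerveRestrict (X Y : V) : l.splitApp adj X Y ≫ (nerveRestrict adj _).hom
    = conv.ι (P := yo X) (Q := yo Y) (𝟙 X) (𝟙 Y) ≫
      conv.map (freeUnit adj X) (freeUnit adj Y) ≫ l.μ (L.obj (yo X)) (L.obj (yo Y)) := by
  simp [splitApp]

lemma splitApp_nerveRestrict_assoc : type_of% (reassoc_of% @splitApp_nerveRestrict) :=
  @(reassoc_of% @splitApp_nerveRestrict)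

/-- Under the adjunction, maps out of free objects become elements of underlying presheaves, and
tensoring maps becomes plugging in the elements and applying the lax structure. -/
lemma splitApp_nerve {X Y : V} {P Q : E} (f : L.obj (yo X) ⟶ P) (g : L.obj (yo Y) ⟶ Q) :
    l.splitApp adj X Y ≫
        Functor.whiskerLeft (freeFunctor L).op ((nerve (freeFamily L)).map (f ⊗ₘ g)) ≫
        (nerveRestrict adj _).hom
      = conv.ι (P := yo X) (Q := yo Y) (𝟙 X) (𝟙 Y) ≫
        conv.map (freeUnit adj X ≫ F.map f) (freeUnit adj Y ≫ F.map g) ≫ l.μ P Q := by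
  rw [nerveRestrict_naturality, splitApp_nerveRestrict_assoc, ← l.μ_naturality, conv.map_comp,
    Category.assoc]

/-- The action of `freeFunctor` on splits. -/
def splitMap : SplitMap (freeFunctor L) M.tensor (nerveTensor (freeFamily L)) where
  app X Y := l.splitApp adj X Y
  naturality {X X' Y Y'} f g := by
    change M.tensor.map (Prod.mkHom f g) ≫ l.splitApp adj X' Y'
      = l.splitApp adj X Y ≫ Functor.whiskerLeft (freeFunctor L).op
        ((nerve (freeFamily L)).map (L.map (yoneda.map f) ⊗ₘ L.map (yoneda.map g)))
    rw [← cancel_mono (nerveRestrict adj _).hom, Category.assoc, Category.assoc,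
      splitApp_nerve, splitApp_nerveRestrict, conv.ι_naturality_assoc]
    rw [← freeUnit_naturality, ← freeUnit_naturality, conv.map_comp, Category.assoc,
      conv.ι_map_assoc (yoneda.map f) (yoneda.map g)]
    simp

/-- The action of `freeFunctor` on splits corresponds to the lax structure. -/
lemma splitMap_conv_can {P Q : Psh V} {X Y : E}
    (a : P ⟶ (freeFunctor L).op ⋙ (nerve (freeFamily L)).obj X)
    (b : Q ⟶ (freeFunctor L).op ⋙ (nerve (freeFamily L)).obj Y) :
    (l.splitMap adj).conv a b ≫ Functor.whiskerLeft (freeFunctor L).op (nerveCan _ X Y) ≫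
        (nerveRestrict adj (X ⊗ Y)).hom
      = conv.map (a ≫ (nerveRestrict adj X).hom) (b ≫ (nerveRestrict adj Y).hom) ≫ l.μ X Y := by
  refine conv.hom_ext fun {A B} p q => ?_
  have ef (f : L.obj (yo A) ⟶ X) (hf : f = a.app (op A) p) : freeUnit adj A ≫ F.map f
      = el ((a ≫ (nerveRestrict adj X).hom).app (op A) p) := by
    subst hf
    exact (el_nerveRestrict adj _).symm
  have eg (g : L.obj (yo B) ⟶ Y) (hg : g = b.app (op B) q) : freeUnit adj B ≫ F.map g
      = el ((b ≫ (nerveRestrict adj Y).hom).app (op B) q) := by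
    subst hg
    exact (el_nerveRestrict adj _).symm
  refine (l.splitApp_nerve adj (P := X) (Q := Y) (X := A) (Y := B) (a.app _ p) (b.app _ q)).trans ?_
  rw [ef _ rfl, eg _ rfl, conv.ι_map_assoc, conv.ι_map_assoc, el_app_id, el_app_id]

lemma splitMap_conv_can_assoc : type_of% (reassoc_of% @splitMap_conv_can) :=
  @(reassoc_of% @splitMap_conv_can)

/-- The comparison map from the tensor product of the underlying presheaves to the tensor product
of nerves. -/
def spread (X Y : E) : M.conv (F.obj X) (F.obj Y) ⟶ (freeFunctor L).op ⋙
    conv (nerveTensor (freeFamily L)) ((nerve (freeFamily L)).obj X)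
      ((nerve (freeFamily L)).obj Y) :=
  (l.splitMap adj).conv (nerveRestrict adj X).inv (nerveRestrict adj Y).inv

/-- The lax structure map factors through the canonical map of nerves. The converse factorization,
of `spread` through `μ`, is all that density still needs. -/
lemma spread_can (X Y : E) :
    l.spread adj X Y ≫ Functor.whiskerLeft (freeFunctor L).op (nerveCan _ X Y) ≫
      (nerveRestrict adj (X ⊗ Y)).hom = l.μ X Y := by
  rw [spread, splitMap_conv_can, Iso.inv_hom_id, Iso.inv_hom_id, conv.map_id]
  exact Category.id_comp _

lemma spread_naturality {X Y X' Y' : E} (f : X ⟶ X') (g : Y ⟶ Y') :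
    conv.map (F.map f) (F.map g) ≫ l.spread adj X' Y'
      = l.spread adj X Y ≫ Functor.whiskerLeft (freeFunctor L).op
        (conv.map ((nerve (freeFamily L)).map f) ((nerve (freeFamily L)).map g)) := by
  have h {X Y : E} (f : X ⟶ Y) : F.map f ≫ (nerveRestrict adj Y).inv
      = (nerveRestrict adj X).inv ≫ Functor.whiskerLeft (freeFunctor L).op
        ((nerve (freeFamily L)).map f) := by
    rw [Iso.comp_inv_eq, Category.assoc, nerveRestrict_naturality, Iso.inv_hom_id_assoc]
  rw [spread, spread, SplitMap.map_conv, h, h, SplitMap.conv_map]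

/-- The comparison map is surjective when the lax structure is. -/
lemma covers_spread [∀ X Y, Epi (l.μ X Y)] (X Y : E) :
    Covers (fun _ : Unit => l.spread adj X Y) := by
  intro A x
  obtain ⟨B, C, t, (p : L.obj (yo B) ⟶ X), (q : L.obj (yo C) ⟶ Y), rfl⟩ :=
    conv.exists_ι (V := NerveCat (freeFamily L)) (A := A.unop) x
  -- The split t is a map into a tensor product of free objects, hence an element of the underlying
  -- presheaf, which lifts through the epimorphism `μ`.
  obtain ⟨z, hz⟩ : ∃ z, (l.μ (L.obj (yo B)) (L.obj (yo C))).app A z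
    = (nerveRestrict adj _).hom.app A t :=
    (epi_iff_surjective _).1 (inferInstanceAs (Epi ((l.μ _ _).app A))) _
  have e₁ : (nerveCan (freeFamily L) (L.obj (yo B)) (L.obj (yo C))).app A
      ((l.spread adj (L.obj (yo B)) (L.obj (yo C))).app A z) = t :=
    ((isIso_iff_bijective ((nerveRestrict adj (L.obj (yo B) ⊗ L.obj (yo C))).hom.app A)).1
      inferInstance).1 ((congrArg (fun k => k.app A z) (l.spread_can adj _ _)).trans hz)
  -- On members of the family the canonical map is the Yoneda reduction, which is invertible without
  -- any density assumption. The element z therefore spreads to t with identities plugged in, and p,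
  -- q are then applied by naturality.
  have e₂ : (l.spread adj (L.obj (yo B)) (L.obj (yo C))).app A z
      = (conv.reduceIso (T := nerveTensor (freeFamily L)) B C).inv.app A t := by
    rw [← e₁]
    exact (congrArg (fun k => k.app A ((l.spread adj (L.obj (yo B)) (L.obj (yo C))).app A z))
      (conv.reduceIso (T := nerveTensor (freeFamily L)) B C).hom_inv_id).symm
  have e₃ : conv.ι (T := nerveTensor (freeFamily L)) (P := (nerve (freeFamily L)).obj X)
        (Q := (nerve (freeFamily L)).obj Y) (X := B) (Y := C) p q
      = (conv.reduceIso (T := nerveTensor (freeFamily L)) B C).inv ≫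
        conv.map ((nerve (freeFamily L)).map p) ((nerve (freeFamily L)).map q) := by
    refine Eq.trans ?_ (conv.ι_map _ _ _ _).symm
    congr 1
    · exact (Category.id_comp p).symm
    · exact (Category.id_comp q).symm
  refine ⟨(), (conv.map (F.map p) (F.map q)).app A z, ?_⟩
  refine (congrArg (fun k => k.app A z) (l.spread_naturality adj p q)).trans ?_
  rw [e₃]
  exact congrArg (fun k => (conv.map ((nerve (freeFamily L)).map p)
    ((nerve (freeFamily L)).map q)).app A k) e₂

/-- The free objects form a dense family when the lax structure maps are epimorphisms through which
`spread` factors. -/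
lemma tensorDense [∀ X Y, Epi (l.μ X Y)] (h : ∀ X Y, ∃ φ, l.μ X Y ≫ φ = l.spread adj X Y) :
    TensorDense (freeFamily L) where
  isIso_can X Y := by
    obtain ⟨φ, hφ⟩ := h X Y
    let κ := Functor.whiskerLeft (freeFunctor L).op (nerveCan (freeFamily L) X Y) ≫
        (nerveRestrict adj (X ⊗ Y)).hom
    -- One composite is tested after the surjection `spread`, the other after the epimorphism `μ`.
    have h₁ : κ ≫ φ = 𝟙 _ := (l.covers_spread adj X Y).hom_ext fun _ => by
      rw [← Category.assoc, spread_can, hφ, Category.comp_id]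
    have h₂ : φ ≫ κ = 𝟙 _ := by
      rw [← cancel_epi (l.μ X Y), reassoc_of% hφ, spread_can, Category.comp_id]
    have : IsIso κ := ⟨φ, h₁, h₂⟩
    have : IsIso (Functor.whiskerLeft (freeFunctor L).op (nerveCan (freeFamily L) X Y)) :=
      IsIso.of_isIso_comp_right _ (nerveRestrict adj (X ⊗ Y)).hom
    -- `freeFunctor` is the identity on objects, so the components of the restricted map are all the
    -- components.
    rw [NatTrans.isIso_iff_isIso_app]
    intro A
    exact inferInstanceAs (IsIso ((Functor.whiskerLeft (freeFunctor L).op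
      (nerveCan (freeFamily L) X Y)).app (op A.unop)))

end LaxToDay

section

variable {V : Type u} [SmallCategory V] {E : Type*} [Category.{u} E] {L : Psh V ⥤ E}
  {F : E ⥤ Psh V} (adj : L ⊣ F)

/-- `freeFunctor`, as a map from a representable presheaf to a nerve. -/
def yonedaFree (L : Psh V ⥤ E) (X : V) :
    yo X ⟶ (freeFunctor L).op ⋙ (nerve (freeFamily L)).obj (L.obj (yo X)) :=
  yonedaMap (freeFunctor L) X

lemma yonedaFree_nerveRestrict (X : V) :
    yonedaFree L X ≫ (nerveRestrict adj _).hom = freeUnit adj X := by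
  refine yo_hom_ext ?_
  change yonedaEquiv (adj.homEquiv _ _ (L.map (yoneda.map (𝟙 X)))) = _
  rw [yoneda.map_id, L.map_id, adj.homEquiv_id]
  rfl

end

namespace LaxToDay

variable {V : Type u} [SmallCategory V] {E : Type*} [Category.{u} E] [MonoidalCategory E]
  {M : PromonoidalData V} {L : Psh V ⥤ E} {F : E ⥤ Psh V} (l : LaxToDay M F) (adj : L ⊣ F)

/-- Both sides are compared in the underlying presheaf of a triple tensor product of free objects.
There the equation is associativity of the lax structure, preceded by the three units of the
adjunction. -/
lemma splitMap_assoc [TensorDense (freeFamily L)] (X Y Z : V) :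
    (M.assoc X Y Z).hom ≫ (l.splitMap adj).conv (yonedaFree L X) (l.splitApp adj Y Z)
      = (l.splitMap adj).conv (l.splitApp adj X Y) (yonedaFree L Z) ≫
        Functor.whiskerLeft (freeFunctor L).op (nerveCan _ _ _ ≫
          (nerve _).map (α_ (L.obj (yo X)) (L.obj (yo Y)) (L.obj (yo Z))).hom ≫
          (nerveCanIso _ _ _).inv) := by
  rw [← cancel_mono (Functor.whiskerLeft (freeFunctor L).op (nerveCan _ _ _) ≫
    (nerveRestrict adj _).hom)]
  simp only [Category.assoc]
  rw [splitMap_conv_can, ← Functor.whiskerLeft_comp_assoc, Category.assoc, Category.assoc,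
    nerveCanIso_inv_comp, Category.comp_id, Functor.whiskerLeft_comp, Category.assoc,
    nerveRestrict_naturality, splitMap_conv_can_assoc, yonedaFree_nerveRestrict,
    yonedaFree_nerveRestrict, splitApp_nerveRestrict, splitApp_nerveRestrict]
  -- Plugging identities into splits inverts Yoneda reduction, so this is `assocHom_reduce` read
  -- backwards.
  have h₁ : conv.map (T := M.tensor) (conv.ι (P := yo X) (Q := yo Y) (𝟙 X) (𝟙 Y)) (𝟙 (yo Z)) ≫
        M.assocHom (yo X) (yo Y) (yo Z)
      = (M.assoc X Y Z).hom ≫ conv.map (𝟙 (yo X)) (conv.ι (P := yo Y) (Q := yo Z) (𝟙 Y) (𝟙 Z)) := by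
    have e (X Y : V) : conv.ι (𝟙 X) (𝟙 Y) ≫ conv.reduce (T := M.tensor) X Y = 𝟙 _ :=
      (conv.reduceIso X Y).inv_hom_id
    rw [← cancel_mono (conv.mapIso (Iso.refl (yo X)) (conv.reduceIso Y Z)).hom]
    change (_ ≫ _) ≫ conv.map (𝟙 (yo X)) (conv.reduce Y Z)
      = (_ ≫ _) ≫ conv.map (𝟙 (yo X)) (conv.reduce Y Z)
    rw [Category.assoc, M.assocHom_reduce, Category.assoc, ← conv.map_comp, e, Category.comp_id,
      conv.map_id, ← conv.map_comp_assoc, e, Category.comp_id, conv.map_id, Category.comp_id,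
      Category.id_comp]
  have h₂ : conv.map (T := M.tensor) (conv.ι (P := yo X) (Q := yo Y) (𝟙 X) (𝟙 Y) ≫
        conv.map (freeUnit adj X) (freeUnit adj Y) ≫ l.μ _ _) (freeUnit adj Z)
      = conv.map (conv.ι (P := yo X) (Q := yo Y) (𝟙 X) (𝟙 Y)) (𝟙 (yo Z)) ≫
        conv.map (conv.map (freeUnit adj X) (freeUnit adj Y)) (freeUnit adj Z) ≫
        conv.map (l.μ _ _) (𝟙 (F.obj (L.obj (yo Z)))) := by
    rw [← conv.map_comp, ← conv.map_comp, Category.id_comp, Category.comp_id]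
  have h₃ : conv.map (T := M.tensor) (freeUnit adj X) (conv.ι (P := yo Y) (Q := yo Z) (𝟙 Y)
        (𝟙 Z) ≫ conv.map (freeUnit adj Y) (freeUnit adj Z) ≫ l.μ _ _)
      = conv.map (𝟙 (yo X)) (conv.ι (P := yo Y) (Q := yo Z) (𝟙 Y) (𝟙 Z)) ≫
        conv.map (freeUnit adj X) (conv.map (freeUnit adj Y) (freeUnit adj Z)) ≫
        conv.map (𝟙 (F.obj (L.obj (yo X)))) (l.μ _ _) := by
    rw [← conv.map_comp, ← conv.map_comp, Category.id_comp, Category.comp_id]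
  rw [h₂, h₃]
  simp only [Category.assoc]
  rw [l.assoc, M.assocHom_naturality_assoc, reassoc_of% h₁]

lemma splitMap_left [TensorDense (freeFamily L)] (X : V) :
    (M.left X).hom ≫ yonedaFree L X
      = (l.splitMap adj).conv (l.ε ≫ (nerveRestrict adj _).inv) (yonedaFree L X) ≫
        Functor.whiskerLeft (freeFunctor L).op (nerveCan _ _ _ ≫
          (nerve _).map (λ_ (L.obj (yo X))).hom) := by
  rw [← cancel_mono (nerveRestrict adj _).hom]
  simp only [Category.assoc]
  rw [Functor.whiskerLeft_comp, Category.assoc, nerveRestrict_naturality, splitMap_conv_can_assoc,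
    yonedaFree_nerveRestrict, Category.assoc, Iso.inv_hom_id, Category.comp_id]
  have h : conv.map (T := M.tensor) l.ε (freeUnit adj X) = conv.map (𝟙 _) (freeUnit adj X) ≫
        conv.map l.ε (𝟙 (F.obj (L.obj (yo X)))) := by
    rw [← conv.map_comp, Category.id_comp, Category.comp_id]
  rw [h, Category.assoc, l.left, M.leftHom_naturality, M.leftHom_yo]

lemma splitMap_right [TensorDense (freeFamily L)] (X : V) :
    (M.right X).hom ≫ yonedaFree L X
      = (l.splitMap adj).conv (yonedaFree L X) (l.ε ≫ (nerveRestrict adj _).inv) ≫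
        Functor.whiskerLeft (freeFunctor L).op (nerveCan _ _ _ ≫
          (nerve _).map (ρ_ (L.obj (yo X))).hom) := by
  rw [← cancel_mono (nerveRestrict adj _).hom]
  simp only [Category.assoc]
  rw [Functor.whiskerLeft_comp, Category.assoc, nerveRestrict_naturality, splitMap_conv_can_assoc,
    yonedaFree_nerveRestrict, Category.assoc, Iso.inv_hom_id, Category.comp_id]
  have h : conv.map (T := M.tensor) (freeUnit adj X) l.ε = conv.map (freeUnit adj X) (𝟙 _) ≫
        conv.map (𝟙 (F.obj (L.obj (yo X)))) l.ε := by
    rw [← conv.map_comp, Category.id_comp, Category.comp_id]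
  rw [h, Category.assoc, l.right, M.rightHom_naturality, M.rightHom_yo]

/-- The promonoidal structure of `freeFunctor`. -/
noncomputable def freePromonoidal {M : Promonoidal V} (l : LaxToDay M.toPromonoidalData F)
    [TensorDense (freeFamily L)] :
    PromonoidalFunctor (freeFunctor L) M (nervePromonoidal (freeFamily L)) where
  tensor := l.splitMap adj
  unit := l.ε ≫ (nerveRestrict adj _).inv
  map_assoc X Y Z := l.splitMap_assoc adj X Y Z
  map_left X := l.splitMap_left adj X
  map_right X := l.splitMap_right adj X

end LaxToDay

end Produoidal

end

/-! ### Free bimodules over the unit of `◁`. -/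

section

namespace Produoidal

open MonoidalCategory Limits

namespace Duoidal

section FreeBimod

variable {C : Type*} [Category* C] [MonoidalCategory C] [Duoidal C]

/-- The free bimodule on an object. -/
abbrev freeBimod (X : C) : NBimod C where
  X := triUnit ⊗ X ⊗ triUnit
  actLeft := (α_ triUnit triUnit _).inv ≫ phi₂ ▷ _
  actRight := (α_ triUnit (X ⊗ triUnit) triUnit).hom ≫
    triUnit ◁ ((α_ X triUnit triUnit).hom ≫ X ◁ phi₂)
  one_actLeft := by
    change phi₀ ▷ (triUnit ⊗ X ⊗ triUnit) ≫ (α_ _ _ _).inv ≫ phi₂ ▷ (X ⊗ triUnit) = _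
    -- Each bimodule law is rearranged by coherence until an axiom of the monoid N stands as one
    -- uninterrupted composite.
    have e : phi₀ ▷ (triUnit ⊗ X ⊗ triUnit) ≫ (α_ _ _ _).inv ≫ phi₂ ▷ (X ⊗ triUnit)
        = (α_ _ _ _).inv ≫ (phi₀ ▷ triUnit ≫ phi₂) ▷ (X ⊗ triUnit) := by monoidal
    rw [e, phi₀_left]
    monoidal
  left_assoc := by
    change phi₂ ▷ (triUnit ⊗ X ⊗ triUnit) ≫ (α_ _ _ _).inv ≫ phi₂ ▷ (X ⊗ triUnit)
      = (α_ triUnit triUnit (triUnit ⊗ X ⊗ triUnit)).hom ≫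
        triUnit ◁ ((α_ _ _ _).inv ≫ phi₂ ▷ (X ⊗ triUnit)) ≫ (α_ _ _ _).inv ≫ phi₂ ▷ (X ⊗ triUnit)
    have e : phi₂ ▷ (triUnit ⊗ X ⊗ triUnit) ≫ (α_ _ _ _).inv ≫ phi₂ ▷ (X ⊗ triUnit)
        = (α_ _ _ _).inv ≫ (phi₂ ▷ triUnit ≫ phi₂) ▷ (X ⊗ triUnit) := by monoidal
    rw [e, phi₂_assoc]
    monoidal
  actRight_one := by
    change (triUnit ⊗ X ⊗ triUnit) ◁ phi₀ ≫ (α_ triUnit (X ⊗ triUnit) triUnit).hom ≫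
      triUnit ◁ ((α_ X triUnit triUnit).hom ≫ X ◁ phi₂) = _
    have e : (triUnit ⊗ X ⊗ triUnit) ◁ phi₀ ≫ (α_ triUnit (X ⊗ triUnit) triUnit).hom ≫
        triUnit ◁ ((α_ X triUnit triUnit).hom ≫ X ◁ phi₂)
        = (α_ _ _ _).hom ≫ triUnit ◁ (α_ _ _ _).hom ≫
          triUnit ◁ X ◁ (triUnit ◁ phi₀ ≫ phi₂) := by monoidal
    rw [e, phi₀_right]
    monoidal
  right_assoc := by
    have e : (triUnit ⊗ X ⊗ triUnit) ◁ phi₂ ≫ (α_ triUnit (X ⊗ triUnit) triUnit).hom ≫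
        triUnit ◁ ((α_ X triUnit triUnit).hom ≫ X ◁ phi₂)
        = (α_ _ _ _).hom ≫ triUnit ◁ (α_ _ _ _).hom ≫ triUnit ◁ X ◁ (α_ _ _ _).inv ≫
          triUnit ◁ X ◁ ((α_ _ _ _).hom ≫ triUnit ◁ phi₂ ≫ phi₂) := by monoidal
    refine e.trans ?_
    rw [← phi₂_assoc]
    change _ = (α_ (triUnit ⊗ X ⊗ triUnit) triUnit triUnit).inv ≫
      ((α_ triUnit (X ⊗ triUnit) triUnit).hom ≫
        triUnit ◁ ((α_ X triUnit triUnit).hom ≫ X ◁ phi₂)) ▷ triUnit ≫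
      (α_ triUnit (X ⊗ triUnit) triUnit).hom ≫ triUnit ◁ ((α_ X triUnit triUnit).hom ≫ X ◁ phi₂)
    monoidal
  middle_assoc := by
    change ((α_ _ _ _).inv ≫ phi₂ ▷ (X ⊗ triUnit)) ▷ triUnit ≫
      (α_ triUnit (X ⊗ triUnit) triUnit).hom ≫ triUnit ◁ ((α_ X triUnit triUnit).hom ≫ X ◁ phi₂)
      = (α_ triUnit (triUnit ⊗ X ⊗ triUnit) triUnit).hom ≫
      triUnit ◁ ((α_ triUnit (X ⊗ triUnit) triUnit).hom ≫
        triUnit ◁ ((α_ X triUnit triUnit).hom ≫ X ◁ phi₂)) ≫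
      (α_ _ _ _).inv ≫ phi₂ ▷ (X ⊗ triUnit)
    have e : ((α_ triUnit triUnit (X ⊗ triUnit)).inv ≫ phi₂ ▷ (X ⊗ triUnit)) ▷ triUnit ≫
        (α_ triUnit (X ⊗ triUnit) triUnit).hom ≫ triUnit ◁ ((α_ X triUnit triUnit).hom ≫ X ◁ phi₂)
        = (α_ _ _ _).inv ▷ _ ≫ (α_ _ _ _).hom ≫ phi₂ ▷ ((X ⊗ triUnit) ⊗ triUnit) ≫
          triUnit ◁ ((α_ X triUnit triUnit).hom ≫ X ◁ phi₂) := by monoidal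
    -- Left and right multiplication act on different factors, so they commute by interchange.
    rw [e, ← whisker_exchange]
    monoidal

/-- The inclusion of an object in the free bimodule on it. -/
def freeBimodUnit (X : C) : X ⟶ triUnit ⊗ X ⊗ triUnit :=
  (ρ_ X).inv ≫ (λ_ (X ⊗ 𝟙_ C)).inv ≫ (phi₀ ⊗ₘ X ◁ phi₀)

/-- The extension of a map to a bimodule to the free bimodule. -/
def freeBimodMap {X : C} {M : NBimod C} (f : X ⟶ M.X) : triUnit ⊗ X ⊗ triUnit ⟶ M.X :=
  triUnit ◁ (f ▷ triUnit ≫ M.actRight) ≫ M.actLeft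

lemma freeBimodUnit_map {X : C} {M : NBimod C} (f : X ⟶ M.X) :
    freeBimodUnit X ≫ freeBimodMap f = f := by
  have e : (phi₀ ⊗ₘ X ◁ phi₀) ≫ triUnit ◁ (f ▷ triUnit ≫ M.actRight) ≫ M.actLeft
      = (λ_ (X ⊗ 𝟙_ C)).hom ≫ (ρ_ X).hom ≫ f := by
    rw [MonoidalCategory.tensorHom_def, Category.assoc,
      ← MonoidalCategory.whiskerLeft_comp_assoc, whisker_exchange_assoc, NBimod.actRight_one,
      rightUnitor_naturality, ← whisker_exchange_assoc, NBimod.one_actLeft,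
      leftUnitor_naturality]
  rw [freeBimodMap, freeBimodUnit, Category.assoc, Category.assoc, e]
  simp

/-- The extension of a map to a bimodule to the free bimodule. -/
def freeBimodExt {X : C} {M : NBimod C} (f : X ⟶ M.X) : freeBimod X ⟶ M where
  hom := freeBimodMap f
  left_act_hom := by
    change ((α_ triUnit triUnit (X ⊗ triUnit)).inv ≫ phi₂ ▷ (X ⊗ triUnit)) ≫ freeBimodMap f
      = triUnit ◁ freeBimodMap f ≫ M.actLeft
    rw [freeBimodMap]
    generalize f ▷ triUnit ≫ M.actRight = k
    rw [Category.assoc, ← whisker_exchange_assoc, NBimod.left_assoc,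
      MonoidalCategory.whiskerLeft_comp, ← associator_inv_naturality_right_assoc,
      Iso.inv_hom_id_assoc, Category.assoc]
  right_act_hom := by
    change ((α_ triUnit (X ⊗ triUnit) triUnit).hom ≫
        triUnit ◁ ((α_ X triUnit triUnit).hom ≫ X ◁ phi₂)) ≫ freeBimodMap f
      = freeBimodMap f ▷ triUnit ≫ M.actRight
    rw [freeBimodMap, comp_whiskerRight, Category.assoc, Category.assoc, NBimod.middle_assoc,
      associator_naturality_middle_assoc,
      ← MonoidalCategory.whiskerLeft_comp_assoc, ← MonoidalCategory.whiskerLeft_comp_assoc,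
      comp_whiskerRight, Category.assoc, Category.assoc, NBimod.right_assoc,
      associator_naturality_left_assoc, ← whisker_exchange_assoc]

/-- The right action multiplies the φ₀ on the right of the generator away, leaving only the φ₀ on
the left. `whiskerLeft_freeBimodUnit` removes that one in the same way, so the generator produces
the whole free bimodule. -/
lemma whiskerRight_freeBimodUnit (X : C) :
    freeBimodUnit X ▷ triUnit ≫ (α_ triUnit (X ⊗ triUnit) triUnit).hom ≫
        triUnit ◁ ((α_ X triUnit triUnit).hom ≫ X ◁ phi₂)
      = (λ_ (X ⊗ triUnit)).inv ≫ phi₀ ▷ (X ⊗ triUnit) := by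
  have e : freeBimodUnit X ▷ triUnit ≫ (α_ triUnit (X ⊗ triUnit) triUnit).hom ≫
        triUnit ◁ ((α_ X triUnit triUnit).hom ≫ X ◁ phi₂)
      = (ρ_ X).inv ▷ triUnit ≫ (λ_ _).inv ▷ _ ≫ (α_ _ _ _).hom ≫ _ ◁ (α_ _ _ _).hom ≫
        phi₀ ▷ _ ≫ triUnit ◁ X ◁ (phi₀ ▷ triUnit ≫ phi₂) := by
    rw [freeBimodUnit, MonoidalCategory.tensorHom_def]
    monoidal
  rw [e, phi₀_left, ← whisker_exchange]
  monoidal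

lemma whiskerLeft_freeBimodUnit (X : C) :
    triUnit ◁ ((λ_ (X ⊗ triUnit)).inv ≫ phi₀ ▷ (X ⊗ triUnit)) ≫
        (α_ triUnit triUnit (X ⊗ triUnit)).inv ≫ phi₂ ▷ (X ⊗ triUnit) = 𝟙 _ := by
  have e : triUnit ◁ ((λ_ (X ⊗ triUnit)).inv ≫ phi₀ ▷ (X ⊗ triUnit)) ≫
        (α_ triUnit triUnit (X ⊗ triUnit)).inv ≫ phi₂ ▷ (X ⊗ triUnit)
      = triUnit ◁ (λ_ (X ⊗ triUnit)).inv ≫ (α_ _ _ _).inv ≫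
        (triUnit ◁ phi₀ ≫ phi₂) ▷ (X ⊗ triUnit) := by monoidal
  rw [e, phi₀_right]
  simp

/-- Since g commutes with both actions, these can be moved onto the generator, where they cancel the
two copies of φ₀. -/
lemma freeBimodMap_of_commutes {X : C} {M : NBimod C} (g : triUnit ⊗ X ⊗ triUnit ⟶ M.X)
    (hl : ((α_ triUnit triUnit (X ⊗ triUnit)).inv ≫ phi₂ ▷ (X ⊗ triUnit)) ≫ g
      = triUnit ◁ g ≫ M.actLeft)
    (hr : ((α_ triUnit (X ⊗ triUnit) triUnit).hom ≫
        triUnit ◁ ((α_ X triUnit triUnit).hom ≫ X ◁ phi₂)) ≫ g = g ▷ triUnit ≫ M.actRight) :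
    freeBimodMap (freeBimodUnit X ≫ g) = g := by
  rw [freeBimodMap, comp_whiskerRight, Category.assoc, ← hr, ← Category.assoc,
    whiskerRight_freeBimodUnit, MonoidalCategory.whiskerLeft_comp, Category.assoc, ← hl,
    ← Category.assoc, whiskerLeft_freeBimodUnit, Category.id_comp]

/-- A map from a free bimodule is the extension of its restriction. -/
lemma freeBimodMap_unit {X : C} {M : NBimod C} (f : freeBimod X ⟶ M) :
    freeBimodMap (freeBimodUnit X ≫ (f.hom : triUnit ⊗ X ⊗ triUnit ⟶ M.X)) = f.hom :=
  freeBimodMap_of_commutes _ f.left_act_hom f.right_act_hom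

variable (C) in
/-- The underlying object of a bimodule. -/
@[simps]
def NBimod.forget : NBimod C ⥤ C where
  obj M := M.X
  map f := f.hom

/-- The universal property of free bimodules. -/
def freeBimodEquiv (X : C) (M : NBimod C) : (freeBimod X ⟶ M) ≃ (X ⟶ M.X) where
  toFun f := freeBimodUnit X ≫ (f.hom : triUnit ⊗ X ⊗ triUnit ⟶ M.X)
  invFun := freeBimodExt
  left_inv _ := Bimod.hom_ext _ _ (freeBimodMap_unit _)
  right_inv := freeBimodUnit_map

variable (C) in
/-- The functor of free bimodules. -/
def freeBimodFunctor : C ⥤ NBimod C :=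
  Adjunction.leftAdjointOfEquiv (G := NBimod.forget C) freeBimodEquiv
    (fun _ _ _ _ _ => (Category.assoc _ _ _).symm)

variable (C) in
/-- Free bimodules are left adjoint to the forgetful functor. -/
def freeBimodAdj : freeBimodFunctor C ⊣ NBimod.forget C :=
  Adjunction.adjunctionOfEquivLeft (G := NBimod.forget C) freeBimodEquiv
    (fun _ _ _ _ _ => (Category.assoc _ _ _).symm)

lemma freeBimodAdj_unit (X : C) : (freeBimodAdj C).unit.app X = freeBimodUnit X := by
  rw [freeBimodAdj]
  exact (Adjunction.adjunctionOfEquivLeft_unit_app _ _ X).trans (Category.comp_id _)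

section

variable [HasCoequalizers C] [∀ X : C, PreservesColimitsOfSize.{0, 0} (tensorLeft X)]
  [∀ X : C, PreservesColimitsOfSize.{0, 0} (tensorRight X)]

open BimodTensor

lemma whiskerLeft_π_actLeft' (M M' : NBimod C) : triUnit ◁ π M M' ≫ (M ⊗ M').actLeft
    = (α_ triUnit M.X M'.X).inv ≫ M.actLeft ▷ M'.X ≫ π M M' :=
  whiskerLeft_π_actLeft M M'

lemma whiskerLeft_π_actLeft'_assoc : type_of% (reassoc_of% @whiskerLeft_π_actLeft') :=
  @(reassoc_of% @whiskerLeft_π_actLeft')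

/-- `N ⊗ (X ⊗ M)` is the tensor product over `N` of the free bimodule on `X` with `M`. -/
noncomputable def freeBimodTensor (X : C) (M : NBimod C) :
    triUnit ⊗ X ⊗ M.X ⟶ (freeBimod X ⊗ M).X :=
  triUnit ◁ (freeBimodUnit X ▷ M.X ≫ π (freeBimod X) M) ≫ (freeBimod X ⊗ M).actLeft

/-- The inverse of `freeBimodTensor`, on the tensor product. -/
def freeBimodTensorInv (X : C) (M : NBimod C) :
    (triUnit ⊗ X ⊗ triUnit) ⊗ M.X ⟶ triUnit ⊗ X ⊗ M.X :=
  (α_ _ _ _).hom ≫ triUnit ◁ ((α_ _ _ _).hom ≫ X ◁ M.actLeft)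

/-- In the tensor product over N, the right-hand N of the free bimodule may act on M instead, and
its left-hand N acts on the whole product. Hence every element comes from the generator X next to M.
-/
lemma π_freeBimodTensor (X : C) (M : NBimod C) :
    freeBimodTensorInv X M ≫ freeBimodTensor X M = π (freeBimod X) M := by
  have h : (α_ X triUnit M.X).hom ≫ X ◁ M.actLeft ≫ freeBimodUnit X ▷ M.X ≫ π (freeBimod X) M
      = ((λ_ (X ⊗ triUnit)).inv ≫ phi₀ ▷ (X ⊗ triUnit)) ▷ M.X ≫ π (freeBimod X) M := by
    have c : ((α_ triUnit (X ⊗ triUnit) triUnit).hom ≫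
        triUnit ◁ ((α_ X triUnit triUnit).hom ≫ X ◁ phi₂)) ▷ M.X ≫ π (freeBimod X) M
        = (α_ (triUnit ⊗ X ⊗ triUnit) triUnit M.X).hom ≫ (triUnit ⊗ X ⊗ triUnit) ◁ M.actLeft ≫
          π (freeBimod X) M := condition (freeBimod X) M
    rw [← whiskerRight_freeBimodUnit, comp_whiskerRight_assoc, c, whisker_exchange_assoc,
      associator_naturality_left_assoc]
  rw [freeBimodTensor, freeBimodTensorInv, Category.assoc,
    ← MonoidalCategory.whiskerLeft_comp_assoc, Category.assoc, h,
    MonoidalCategory.whiskerLeft_comp_assoc, whiskerLeft_π_actLeft',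
    associator_inv_naturality_middle_assoc, Iso.hom_inv_id_assoc, ← comp_whiskerRight_assoc]
  refine (congrArg (fun k => k ▷ M.X ≫ π (freeBimod X) M) (whiskerLeft_freeBimodUnit X)).trans ?_
  rw [id_whiskerRight, Category.id_comp]

/-- The map that lets the inner N act on M is balanced, by associativity of the action, so it
descends to an inverse. -/
instance isIso_freeBimodTensor (X : C) (M : NBimod C) : IsIso (freeBimodTensor X M) := by
  have h : (freeBimod X).actRight ▷ M.X ≫ freeBimodTensorInv X M
      = (α_ _ _ _).hom ≫ (freeBimod X).X ◁ M.actLeft ≫ freeBimodTensorInv X M := by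
    change ((α_ triUnit (X ⊗ triUnit) triUnit).hom ≫
      triUnit ◁ ((α_ X triUnit triUnit).hom ≫ X ◁ phi₂)) ▷ M.X ≫ freeBimodTensorInv X M
      = (α_ (triUnit ⊗ X ⊗ triUnit) triUnit M.X).hom ≫ (triUnit ⊗ X ⊗ triUnit) ◁ M.actLeft ≫
        freeBimodTensorInv X M
    have e : ((α_ triUnit (X ⊗ triUnit) triUnit).hom ≫
        triUnit ◁ ((α_ X triUnit triUnit).hom ≫ X ◁ phi₂)) ▷ M.X ≫ freeBimodTensorInv X M
        = 𝟙 _ ⊗≫ triUnit ◁ X ◁ (phi₂ ▷ M.X ≫ M.actLeft) := by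
      rw [freeBimodTensorInv]
      monoidal
    rw [e, NBimod.left_assoc, freeBimodTensorInv]
    monoidal
  refine ⟨desc (freeBimodTensorInv X M) h, ?_, ?_⟩
  · rw [freeBimodTensor, Category.assoc, MonoidalCategory.whiskerLeft_comp_assoc,
      whiskerLeft_π_actLeft'_assoc, π_desc]
    change triUnit ◁ freeBimodUnit X ▷ M.X ≫ (α_ triUnit (triUnit ⊗ X ⊗ triUnit) M.X).inv ≫
      ((α_ triUnit triUnit (X ⊗ triUnit)).inv ≫ phi₂ ▷ (X ⊗ triUnit)) ▷ M.X ≫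
      freeBimodTensorInv X M = 𝟙 (triUnit ⊗ X ⊗ M.X)
    -- The two copies of φ₀ in the generator are separated: the left one cancels by a unit law of N,
    -- the right one by the unit law of M.
    have e : triUnit ◁ freeBimodUnit X ▷ M.X ≫ (α_ triUnit (triUnit ⊗ X ⊗ triUnit) M.X).inv ≫
        ((α_ triUnit triUnit (X ⊗ triUnit)).inv ≫ phi₂ ▷ (X ⊗ triUnit)) ▷ M.X ≫
        freeBimodTensorInv X M
        = 𝟙 _ ⊗≫ triUnit ◁ X ◁ phi₀ ▷ M.X ⊗≫ (triUnit ◁ phi₀ ≫ phi₂) ▷ (X ⊗ triUnit ⊗ M.X) ≫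
          triUnit ◁ X ◁ M.actLeft := by
      rw [freeBimodTensorInv, freeBimodUnit, tensorHom_def']
      monoidal
    have e' : 𝟙 (triUnit ⊗ X ⊗ M.X) ⊗≫ triUnit ◁ X ◁ phi₀ ▷ M.X ⊗≫
          (ρ_ (triUnit : C)).hom ▷ (X ⊗ triUnit ⊗ M.X) ≫ triUnit ◁ X ◁ M.actLeft
        = 𝟙 (triUnit ⊗ X ⊗ M.X) ⊗≫ triUnit ◁ X ◁ (phi₀ ▷ M.X ≫ M.actLeft) := by monoidal
    rw [e, phi₀_right, e', NBimod.one_actLeft]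
    monoidal
  · rw [← cancel_epi (π (freeBimod X) M), π_desc_assoc, π_freeBimodTensor, Category.comp_id]

end

end FreeBimod

end Duoidal

end Produoidal

end

/-! ### Lax duoidal functors to presheaves, and the produoidal structure of `freeFunctor`. -/

section

namespace Produoidal

open MonoidalCategory Limits Duoidal

/-- A lax duoidal structure on a functor to presheaves, with the two tensor products that a
produoidal structure induces. -/
structure LaxToDuoidalDay {V : Type u} [SmallCategory V] {E : Type*} [Category* E]
    [MonoidalCategory E] [Duoidal E] (D : ProduoidalStruct V) (F : E ⥤ Psh V) where
  /-- The lax structure for the first tensor product. -/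
  par : LaxToDay D.par.toPromonoidalData F
  /-- The lax structure for the second tensor product. -/
  seq : @LaxToDay V _ E _ (seqMonoidal E) D.seq.toPromonoidalData F
  psi (X Y Z W : E) : D.psi (F.obj X) (F.obj Y) (F.obj Z) (F.obj W) ≫
      conv.map (par.μ X Z) (par.μ Y W) ≫ @LaxToDay.μ _ _ _ _ (seqMonoidal E) _ _ seq (X ⊗ Z) (Y ⊗ W)
    = conv.map (@LaxToDay.μ _ _ _ _ (seqMonoidal E) _ _ seq X Y)
        (@LaxToDay.μ _ _ _ _ (seqMonoidal E) _ _ seq Z W) ≫ par.μ (tri X Y) (tri Z W) ≫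
      F.map (psi X Y Z W)
  psi₀ : D.psi₀ ≫ conv.map par.ε par.ε ≫ @LaxToDay.μ _ _ _ _ (seqMonoidal E) _ _ seq (𝟙_ E) (𝟙_ E)
    = par.ε ≫ F.map psi₀
  phi₂ : D.phi₂ ≫ @LaxToDay.ε _ _ _ _ (seqMonoidal E) _ _ seq
    = conv.map (@LaxToDay.ε _ _ _ _ (seqMonoidal E) _ _ seq)
        (@LaxToDay.ε _ _ _ _ (seqMonoidal E) _ _ seq) ≫ par.μ triUnit triUnit ≫ F.map phi₂
  phi₀ : D.phi₀ ≫ @LaxToDay.ε _ _ _ _ (seqMonoidal E) _ _ seq = par.ε ≫ F.map phi₀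

namespace LaxToDuoidalDay

variable {V : Type u} [SmallCategory V] {E : Type*} [Category.{u} E] [MonoidalCategory E]
  [Duoidal E] {D : ProduoidalStruct V} {L : Psh V ⥤ E} {F : E ⥤ Psh V} (l : LaxToDuoidalDay D F)
  (adj : L ⊣ F)

/-- The structure map on second tensor products. -/
def triμ (X Y : E) : D.tri (F.obj X) (F.obj Y) ⟶ F.obj (tri X Y) :=
  @LaxToDay.μ _ _ _ _ (seqMonoidal E) _ _ l.seq X Y

/-- The structure map on second units. -/
def triε : D.N ⟶ F.obj triUnit := @LaxToDay.ε _ _ _ _ (seqMonoidal E) _ _ l.seq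

/-- The lax structure is compatible with ψ₂ extended to presheaves. Precomposing with Yoneda
reduction, which is invertible, turns the ψ₂ of representables into that extension. -/
lemma psi₂_freeUnit (X Y Z W : V) :
    D.psi₂ X Y Z W ≫ conv.map
        (conv.ι (P := yo X) (Q := yo Z) (𝟙 X) (𝟙 Z) ≫ conv.map (freeUnit adj X) (freeUnit adj Z) ≫
          l.par.μ (L.obj (yo X)) (L.obj (yo Z)))
        (conv.ι (P := yo Y) (Q := yo W) (𝟙 Y) (𝟙 W) ≫ conv.map (freeUnit adj Y) (freeUnit adj W) ≫
          l.par.μ (L.obj (yo Y)) (L.obj (yo W))) ≫ l.triμ _ _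
      = conv.map (conv.ι (P := yo X) (Q := yo Y) (𝟙 X) (𝟙 Y) ≫
            conv.map (freeUnit adj X) (freeUnit adj Y) ≫ l.triμ (L.obj (yo X)) (L.obj (yo Y)))
          (conv.ι (P := yo Z) (Q := yo W) (𝟙 Z) (𝟙 W) ≫
            conv.map (freeUnit adj Z) (freeUnit adj W) ≫ l.triμ (L.obj (yo Z)) (L.obj (yo W))) ≫
        l.par.μ _ _ ≫ F.map (Duoidal.psi _ _ _ _) := by
  have h := D.psi_reduce X Y Z W
  have e (T : Profunctor.{u} (V × V) V) (X Y : V) : conv.reduce (T := T) X Y ≫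
      conv.ι (P := yo X) (Q := yo Y) (𝟙 X) (𝟙 Y) = 𝟙 _ := (conv.reduceIso X Y).hom_inv_id
  rw [← cancel_epi (conv.mapIso (T := D.par.tensor) (conv.reduceIso X Y) (conv.reduceIso Z W)).hom]
  change conv.map (conv.reduce X Y) (conv.reduce Z W) ≫ _
    = conv.map (conv.reduce X Y) (conv.reduce Z W) ≫ _
  rw [← reassoc_of% h, ← conv.map_comp_assoc, ← conv.map_comp_assoc, reassoc_of% e, reassoc_of% e,
    reassoc_of% e, reassoc_of% e, conv.map_comp_assoc, ← D.psi_naturality_assoc,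
    conv.map_comp_assoc]
  exact congrArg (_ ≫ ·) (l.psi _ _ _ _)

section

variable [TriDense (freeFamily L)]

/-- The sequential structure of `freeFunctor`. -/
noncomputable def freeSeq :
    PromonoidalFunctor (freeFunctor L) D.seq (nerveSeq (freeFamily L)) :=
  @LaxToDay.freePromonoidal _ _ _ _ (seqMonoidal E) _ _ adj _ l.seq _

lemma freeSeq_conv_can {P Q : Psh V} {X Y : E}
    (a : P ⟶ (freeFunctor L).op ⋙ (nerve (freeFamily L)).obj X)
    (b : Q ⟶ (freeFunctor L).op ⋙ (nerve (freeFamily L)).obj Y) :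
    (l.freeSeq adj).tensor.conv a b ≫
        Functor.whiskerLeft (freeFunctor L).op (nerveTriCan _ X Y) ≫
        (nerveRestrict adj (tri X Y)).hom
      = conv.map (a ≫ (nerveRestrict adj X).hom) (b ≫ (nerveRestrict adj Y).hom) ≫ l.triμ X Y :=
  @LaxToDay.splitMap_conv_can _ _ _ _ (seqMonoidal E) _ _ _ l.seq adj _ _ _ _ a b

/-- The action of `freeFunctor` on a sequential split. -/
noncomputable def seqApp (X Y : V) : D.seq.tensor.obj (X, Y) ⟶
    (freeFunctor L).op ⋙ (nerve (freeFamily L)).obj (tri (L.obj (yo X)) (L.obj (yo Y))) :=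
  (l.freeSeq adj).tensor.app X Y

lemma freeSeq_app (X Y : V) : l.seqApp adj X Y ≫ (nerveRestrict adj _).hom
    = conv.ι (P := yo X) (Q := yo Y) (𝟙 X) (𝟙 Y) ≫ conv.map (freeUnit adj X) (freeUnit adj Y) ≫
      l.triμ (L.obj (yo X)) (L.obj (yo Y)) :=
  @LaxToDay.splitApp_nerveRestrict _ _ _ _ (seqMonoidal E) _ _ _ l.seq adj X Y

lemma freeSeq_unit : (l.freeSeq adj).unit ≫ (nerveRestrict adj _).hom = l.triε :=
  (Category.assoc _ _ _).trans
    ((congrArg (l.triε ≫ ·) (nerveRestrict adj triUnit).inv_hom_id).trans (Category.comp_id _))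

end

section

variable [TensorDense (freeFamily L)]

lemma freePar_conv_can {P Q : Psh V} {X Y : E}
    (a : P ⟶ (freeFunctor L).op ⋙ (nerve (freeFamily L)).obj X)
    (b : Q ⟶ (freeFunctor L).op ⋙ (nerve (freeFamily L)).obj Y) :
    (l.par.freePromonoidal adj).tensor.conv a b ≫
        Functor.whiskerLeft (freeFunctor L).op (nerveCan _ X Y) ≫ (nerveRestrict adj (X ⊗ Y)).hom
      = conv.map (a ≫ (nerveRestrict adj X).hom) (b ≫ (nerveRestrict adj Y).hom) ≫ l.par.μ X Y :=
  l.par.splitMap_conv_can adj a b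

lemma freePar_conv_can_assoc : type_of% (reassoc_of% @freePar_conv_can) :=
  @(reassoc_of% @freePar_conv_can)

lemma freePar_unit : (l.par.freePromonoidal adj).unit ≫ (nerveRestrict adj _).hom = l.par.ε :=
  (Category.assoc _ _ _).trans
    ((congrArg (l.par.ε ≫ ·) (nerveRestrict adj (𝟙_ E)).inv_hom_id).trans (Category.comp_id _))

lemma freePar_unit_assoc : type_of% (reassoc_of% @freePar_unit) :=
  @(reassoc_of% @freePar_unit)

end

variable [TensorDense (freeFamily L)] [TriDense (freeFamily L)]

/-- Cancelling the canonical isomorphism and the restriction of nerves moves the equation to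
underlying presheaves, where it is `psi₂_freeUnit`. -/
lemma free_psi₂ (X Y Z W : V) :
    D.psi₂ X Y Z W ≫ (l.freeSeq adj).tensor.conv (l.par.splitApp adj X Z) (l.par.splitApp adj Y W)
      = (l.par.freePromonoidal adj).tensor.conv (l.seqApp adj X Y) (l.seqApp adj Z W) ≫
        Functor.whiskerLeft (freeFunctor L).op (nerveCan _ _ _ ≫ (nerve (freeFamily L)).map
          (Duoidal.psi (L.obj (yo X)) (L.obj (yo Y)) (L.obj (yo Z)) (L.obj (yo W))) ≫
          (nerveTriCanIso _ _ _).inv) := by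
  rw [← cancel_mono (Functor.whiskerLeft (freeFunctor L).op (nerveTriCan _ _ _) ≫
    (nerveRestrict adj _).hom)]
  simp only [Category.assoc]
  rw [← Functor.whiskerLeft_comp_assoc, Category.assoc, Category.assoc,
    nerveTriCanIso_inv_comp, Category.comp_id, Functor.whiskerLeft_comp, Category.assoc,
    nerveRestrict_naturality]
  refine (congrArg (_ ≫ ·) (l.freeSeq_conv_can adj _ _)).trans (Eq.trans ?_
    (l.freePar_conv_can_assoc adj _ _ _).symm)
  rw [freeSeq_app, freeSeq_app, LaxToDay.splitApp_nerveRestrict,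
    LaxToDay.splitApp_nerveRestrict, psi₂_freeUnit]

lemma free_psi₀ : D.psi₀ ≫ (l.freeSeq adj).tensor.conv (l.par.freePromonoidal adj).unit
      (l.par.freePromonoidal adj).unit
    = (l.par.freePromonoidal adj).unit ≫ Functor.whiskerLeft (freeFunctor L).op
      ((nerve (freeFamily L)).map Duoidal.psi₀ ≫ (nerveTriCanIso _ _ _).inv) := by
  rw [← cancel_mono (Functor.whiskerLeft (freeFunctor L).op (nerveTriCan _ _ _) ≫
    (nerveRestrict adj _).hom)]
  simp only [Category.assoc]
  rw [← Functor.whiskerLeft_comp_assoc, Category.assoc,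
    nerveTriCanIso_inv_comp, Category.comp_id, nerveRestrict_naturality]
  refine (congrArg (_ ≫ ·) (l.freeSeq_conv_can adj _ _)).trans (Eq.trans ?_
    (l.freePar_unit_assoc adj _).symm)
  rw [freePar_unit]
  exact l.psi₀

lemma free_phi₂ : D.phi₂ ≫ (l.freeSeq adj).unit
    = (l.par.freePromonoidal adj).tensor.conv (l.freeSeq adj).unit (l.freeSeq adj).unit ≫
      Functor.whiskerLeft (freeFunctor L).op
        (nerveCan _ _ _ ≫ (nerve (freeFamily L)).map Duoidal.phi₂) := by
  rw [← cancel_mono (nerveRestrict adj _).hom, Category.assoc, freeSeq_unit, Category.assoc,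
    Functor.whiskerLeft_comp, Category.assoc, nerveRestrict_naturality]
  refine Eq.trans ?_ (l.freePar_conv_can_assoc adj _ _ _).symm
  rw [freeSeq_unit]
  exact l.phi₂

lemma free_phi₀ : D.phi₀ ≫ (l.freeSeq adj).unit = (l.par.freePromonoidal adj).unit ≫
    Functor.whiskerLeft (freeFunctor L).op ((nerve (freeFamily L)).map Duoidal.phi₀) := by
  rw [← cancel_mono (nerveRestrict adj _).hom, Category.assoc, freeSeq_unit, Category.assoc,
    nerveRestrict_naturality]
  refine Eq.trans ?_ (l.freePar_unit_assoc adj _).symm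
  exact l.phi₀

/-- `freeFunctor` as a produoidal functor. -/
noncomputable def freeProduoidal : ProduoidalFunctor D (nerveProduoidal (freeFamily L)) where
  toFunctor := freeFunctor L
  par := l.par.freePromonoidal adj
  seq := l.freeSeq adj
  map_psi₂ := l.free_psi₂ adj
  map_psi₀ := l.free_psi₀ adj
  map_phi₂ := l.free_phi₂ adj
  map_phi₀ := l.free_phi₀ adj

end LaxToDuoidalDay

/-! ### The forgetful functor from bimodules is lax duoidal. -/

section Normalization

variable {V : Type u} [SmallCategory V] (D : ProduoidalStruct V)

open BimodTensor

/-- The functor of free bimodules, on presheaves. -/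
def freeN : Psh V ⥤ NBimod D.Day := freeBimodFunctor D.Day

/-- The underlying presheaf of a bimodule. -/
def forgetN : NBimod D.Day ⥤ Psh V := NBimod.forget D.Day

/-- Free bimodules are left adjoint to the forgetful functor. -/
def freeNAdj : freeN D ⊣ forgetN D := freeBimodAdj D.Day

/-- The lax structure of the forgetful functor from bimodules, for `⊗`. -/
noncomputable def forgetPar : LaxToDay D.par.toPromonoidalData (forgetN D) where
  μ M M' := π M M'
  -- The tensor unit of bimodules is N, so the unit comparison starts at I and is φ₀; the unit laws
  -- below are the unit axioms of the actions.
  ε := D.phi₀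
  μ_naturality f g := (π_tensorHom f g).symm
  assoc X Y Z := π_assoc X Y Z
  left M := (congrArg (fun k => conv.map D.phi₀ (𝟙 _) ≫ k) (π_leftUnitor M)).trans
    (NBimod.one_actLeft M)
  right M := (congrArg (fun k => conv.map (𝟙 _) D.phi₀ ≫ k) (π_rightUnitor M)).trans
    (NBimod.actRight_one M)

/-- The lax structure of the forgetful functor from bimodules, for `◁`. -/
noncomputable def forgetSeq : @LaxToDay V _ (NBimod D.Day) _ (seqMonoidal _)
    D.seq.toPromonoidalData (forgetN D) :=
  letI := seqMonoidal (NBimod D.Day)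
  -- The underlying presheaf of `◁` of bimodules is `◁` of the underlying presheaves, so this
  -- structure is strict.
  { μ M M' := 𝟙 (D.tri M.X M'.X)
    ε := 𝟙 D.N
    μ_naturality f g := (Category.comp_id _).trans (Category.id_comp _).symm
    assoc X Y Z := by
      refine (congrArg (· ≫ _) (conv.map_id _ _)).trans ?_
      refine Eq.trans ?_ (congrArg (D.seq.assocHom X.X Y.X Z.X ≫ ·)
        ((congrArg (· ≫ _) (conv.map_id _ _)).trans (Category.comp_id _)).symm)
      exact (Category.id_comp _).trans ((Category.id_comp _).trans (Category.comp_id _).symm)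
    left M := (congrArg (· ≫ _) (conv.map_id _ _)).trans
      ((Category.id_comp _).trans (Category.id_comp _))
    right M := (congrArg (· ≫ _) (conv.map_id _ _)).trans
      ((Category.id_comp _).trans (Category.id_comp _)) }

/-- The lax structure of the forgetful functor from bimodules. -/
noncomputable def forgetLax : LaxToDuoidalDay D (forgetN D) where
  par := forgetPar D
  seq := forgetSeq D
  psi X Y Z W := by
    have h : Duoidal.psi (C := D.Day) X.X Y.X Z.X W.X ≫ triMap (π X Z) (π Y W) ≫
          𝟙 (triBimod (X ⊗ Z) (Y ⊗ W)).X
        = (𝟙 (triBimod X Y).X ⊗ₘ 𝟙 (triBimod Z W).X) ≫ π (triBimod X Y) (triBimod Z W) ≫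
          (psiBimod X Y Z W).hom := by
      rw [id_tensorHom_id, Category.id_comp, π_psiBimod]
      exact congrArg (_ ≫ ·) (Category.comp_id _)
    exact h
  psi₀ := (congrArg (D.psi₀ ≫ ·) (Category.comp_id _)).trans (phi₀_delta (C := D.Day)).symm
  phi₂ := by
    have h : (Duoidal.phi₂ (C := D.Day)) ≫ 𝟙 _ = (𝟙 _ ⊗ₘ 𝟙 _) ≫
        π (𝟙_ (NBimod D.Day)) (𝟙_ (NBimod D.Day)) ≫ (λ_ (𝟙_ (NBimod D.Day))).hom.hom := by
      rw [id_tensorHom_id, Category.id_comp, π_leftUnitor]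
      exact Category.comp_id _
    exact h
  phi₀ := rfl

end Normalization

end Produoidal

end

/-! ### Density of free bimodules, and the normalization. -/

section

namespace Produoidal

open MonoidalCategory Limits Duoidal BimodTensor

section Normalization

variable {V : Type u} [SmallCategory V] (D : ProduoidalStruct V)

/-- For `◁` the lax structure maps are identities, so `spread` factors through them trivially. -/
instance : TriDense (freeFamily (freeN D)) :=
  letI := seqMonoidal (NBimod D.Day)
  haveI (X Y : NBimod D.Day) : Epi ((forgetSeq D).μ X Y) := inferInstanceAs (Epi (𝟙 _))
  LaxToDay.tensorDense (forgetSeq D) (freeNAdj D) fun X Y =>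
    ⟨(forgetSeq D).spread (freeNAdj D) X Y, Category.id_comp _⟩

variable {D}

/-- The left action on the underlying presheaf of a bimodule. -/
def leftAct (M : NBimod D.Day) : D.otimes D.N ((forgetN D).obj M) ⟶ (forgetN D).obj M := M.actLeft

/-- The right action on the underlying presheaf of a bimodule. -/
def rightAct (M : NBimod D.Day) : D.otimes ((forgetN D).obj M) D.N ⟶ (forgetN D).obj M :=
  M.actRight

lemma leftAct_naturality {M M' : NBimod D.Day} (f : M ⟶ M') :
    conv.map (𝟙 D.N) ((forgetN D).map f) ≫ leftAct M' = leftAct M ≫ (forgetN D).map f :=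
  (NBimod.left_act_hom f).symm

lemma rightAct_naturality {M M' : NBimod D.Day} (f : M ⟶ M') :
    conv.map ((forgetN D).map f) (𝟙 D.N) ≫ rightAct M' = rightAct M ≫ (forgetN D).map f :=
  (NBimod.right_act_hom f).symm

lemma forgetPar_condition (M M' : NBimod D.Day) :
    conv.map (rightAct M) (𝟙 ((forgetN D).obj M')) ≫ (forgetPar D).μ M M'
      = D.par.assocHom _ _ _ ≫ conv.map (𝟙 ((forgetN D).obj M)) (leftAct M') ≫
        (forgetPar D).μ M M' :=
  condition M M'

/-- Between free bimodules on representables the canonical map is invertible by Yoneda. After it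
`spread` becomes the quotient map, which is balanced. -/
lemma spread_condition_free (X Y : V) :
    conv.map (rightAct ((freeN D).obj (yo X))) (𝟙 ((forgetN D).obj ((freeN D).obj (yo Y)))) ≫
        (forgetPar D).spread (freeNAdj D) ((freeN D).obj (yo X)) ((freeN D).obj (yo Y))
      = D.par.assocHom _ _ _ ≫ conv.map (𝟙 ((forgetN D).obj ((freeN D).obj (yo X))))
          (leftAct ((freeN D).obj (yo Y))) ≫
        (forgetPar D).spread (freeNAdj D) ((freeN D).obj (yo X)) ((freeN D).obj (yo Y)) := by
  have : IsIso (nerveCan (freeFamily (freeN D)) ((freeN D).obj (yo X)) ((freeN D).obj (yo Y))) :=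
    (conv.reduceIso (T := nerveTensor (freeFamily (freeN D))) X Y).isIso_hom
  rw [← cancel_mono (Functor.whiskerLeft (freeFunctor (freeN D)).op
    (nerveCan (freeFamily (freeN D)) ((freeN D).obj (yo X)) ((freeN D).obj (yo Y))) ≫
    (nerveRestrict (freeNAdj D) _).hom)]
  simp only [Category.assoc]
  rw [LaxToDay.spread_can]
  exact forgetPar_condition _ _

lemma exists_freeUnit {M : NBimod D.Day} {X : V} (p : yo X ⟶ (forgetN D).obj M) :
    ∃ f, freeUnit (freeNAdj D) X ≫ (forgetN D).map f = p :=
  ⟨((freeNAdj D).homEquiv _ _).symm p, (Adjunction.homEquiv_unit _ _ _ _).symm.trans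
    (((freeNAdj D).homEquiv _ _).apply_symm_apply p)⟩

/-- Every element of M or M' is the image of a generator under a map from a free bimodule. Both
sides are natural in bimodule maps, so the free case suffices. -/
lemma spread_condition (M M' : NBimod D.Day) :
    conv.map (rightAct M) (𝟙 ((forgetN D).obj M')) ≫ (forgetPar D).spread (freeNAdj D) M M'
      = D.par.assocHom _ _ _ ≫ conv.map (𝟙 ((forgetN D).obj M)) (leftAct M') ≫
        (forgetPar D).spread (freeNAdj D) M M' := by
  refine (((covers_el _).conv (covers_id _)).conv (covers_el _)).hom_ext ?_
  rintro ⟨⟨⟨X, p⟩, -⟩, ⟨Y, q⟩⟩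
  obtain ⟨f, rfl⟩ := exists_freeUnit p
  obtain ⟨g, rfl⟩ := exists_freeUnit q
  dsimp only
  have e₁ : conv.map (T := D.par.tensor) (conv.map (T := D.par.tensor)
        (freeUnit (freeNAdj D) X ≫ (forgetN D).map f) (𝟙 D.N))
        (freeUnit (freeNAdj D) Y ≫ (forgetN D).map g)
      = conv.map (conv.map (freeUnit (freeNAdj D) X) (𝟙 D.N)) (freeUnit (freeNAdj D) Y) ≫
        conv.map (conv.map ((forgetN D).map f) (𝟙 D.N)) ((forgetN D).map g) := by
    rw [← conv.map_comp, ← conv.map_comp, Category.id_comp]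
  have e₂ : conv.map (T := D.par.tensor) (conv.map ((forgetN D).map f) (𝟙 D.N) ≫ rightAct M)
        ((forgetN D).map g)
      = conv.map (rightAct _) (𝟙 _) ≫ conv.map ((forgetN D).map f) ((forgetN D).map g) := by
    rw [rightAct_naturality, ← conv.map_comp, Category.id_comp]
  have e₃ : conv.map (T := D.par.tensor) ((forgetN D).map f)
        (conv.map (𝟙 D.N) ((forgetN D).map g) ≫ leftAct M')
      = conv.map (𝟙 _) (leftAct _) ≫ conv.map ((forgetN D).map f) ((forgetN D).map g) := by
    rw [leftAct_naturality, ← conv.map_comp, Category.id_comp]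
  rw [e₁, Category.assoc, Category.assoc]
  congr 1
  rw [← conv.map_comp_assoc, Category.comp_id, D.par.assocHom_naturality_assoc,
    ← conv.map_comp_assoc, Category.comp_id, e₂, e₃, Category.assoc, Category.assoc,
    LaxToDay.spread_naturality, reassoc_of% (spread_condition_free X Y)]

/-- For `⊗` the lax structure map is the coequalizer defining the tensor product over N; being
balanced, `spread` descends along it. -/
instance : TensorDense (freeFamily (freeN D)) :=
  haveI (X Y : NBimod D.Day) : Epi ((forgetPar D).μ X Y) := inferInstanceAs (Epi (π X Y))
  LaxToDay.tensorDense (forgetPar D) (freeNAdj D) fun M M' =>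
    ⟨desc (C := D.Day) (X := (freeFunctor (freeN D)).op ⋙ _)
        ((forgetPar D).spread (freeNAdj D) M M') (spread_condition M M'),
      π_desc (C := D.Day) (X := (freeFunctor (freeN D)).op ⋙ _) _ (spread_condition M M')⟩

variable (D)

/-- The normalization of a produoidal category. -/
noncomputable def normalization : PDuo.{u} where
  carrier := NerveCat (freeFamily (freeN D))
  str := nerveProduoidal (freeFamily (freeN D))

lemma isNormal_normalization : isNormal (normalization D) :=
  inferInstanceAs (IsIso ((nerve (freeFamily (freeN D))).map (𝟙 (𝟙_ (NBimod D.Day)))))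

/-- The canonical functor to the normalization. -/
noncomputable def normalizationUnit : ProduoidalFunctor D (normalization D).str :=
  (forgetLax D).freeProduoidal (freeNAdj D)

end Normalization

end Produoidal

end

/-! ### The canonical functor exhibits the normalization. -/

section

namespace Produoidal

open MonoidalCategory Limits Duoidal BimodTensor

section IsNormalization

variable (V : PDuo.{u})

/-- The normalization of a produoidal category, as a normal produoidal category. -/
noncomputable def normalizationObj : NPDuo.{u} := ⟨normalization V.str, isNormal_normalization V.str⟩

/-- The canonical functor to the normalization. -/
noncomputable def normalizationEta : V ⟶ (normalizationObj V).obj := normalizationUnit V.str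

/-- The family of free bimodules on representable presheaves. -/
abbrev freeFam : V → NBimod V.str.Day := freeFamily (freeN V.str)

/-- `nerveRestrict` for the free bimodules. -/
abbrev nRes (M : NBimod V.str.Day) := nerveRestrict (freeNAdj V.str) M

/-- The action of the canonical functor on parallel splits. -/
noncomputable def etaPar : SplitMap (freeFunctor (freeN V.str)) V.str.par.tensor
    (nerveTensor (freeFam V)) :=
  (forgetPar V.str).splitMap (freeNAdj V.str)

/-- The action of the canonical functor on sequential units. -/
noncomputable def etaUnit : V.str.N ⟶ (freeFunctor (freeN V.str)).op ⋙
    (nerve (freeFam V)).obj (𝟙_ _) :=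
  (normalizationEta V).seq.unit

lemma etaUnit_nRes : etaUnit V ≫ (nRes V (𝟙_ _)).hom = 𝟙 V.str.N :=
  (forgetLax V.str).freeSeq_unit (freeNAdj V.str)

/-- The unitor of bimodules is induced by the action. Removing a unit on the left in the
normalization is therefore the left action of N on the underlying presheaf. -/
lemma etaPar_left {P : Psh V} (M : NBimod V.str.Day)
    (a : P ⟶ (freeFunctor (freeN V.str)).op ⋙ (nerve (freeFam V)).obj M) :
    (etaPar V).conv (etaUnit V) a ≫ Functor.whiskerLeft (freeFunctor (freeN V.str)).op
        (nerveCan _ (𝟙_ _) M ≫ (nerve (freeFam V)).map (λ_ M).hom) ≫ (nRes V M).hom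
      = conv.map (𝟙 _) (a ≫ (nRes V M).hom) ≫ leftAct M := by
  have h : (forgetPar V.str).μ (𝟙_ _) M ≫ (forgetN V.str).map (λ_ M).hom = leftAct M :=
    π_leftUnitor M
  rw [Functor.whiskerLeft_comp, Category.assoc, nerveRestrict_naturality, etaPar,
    LaxToDay.splitMap_conv_can_assoc, etaUnit_nRes, h]
  rfl

lemma etaPar_right {P : Psh V} (M : NBimod V.str.Day)
    (a : P ⟶ (freeFunctor (freeN V.str)).op ⋙ (nerve (freeFam V)).obj M) :
    (etaPar V).conv a (etaUnit V) ≫ Functor.whiskerLeft (freeFunctor (freeN V.str)).op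
        (nerveCan _ M (𝟙_ _) ≫ (nerve (freeFam V)).map (ρ_ M).hom) ≫ (nRes V M).hom
      = conv.map (a ≫ (nRes V M).hom) (𝟙 _) ≫ rightAct M := by
  have h : (forgetPar V.str).μ M (𝟙_ _) ≫ (forgetN V.str).map (ρ_ M).hom = rightAct M :=
    π_rightUnitor M
  rw [Functor.whiskerLeft_comp, Category.assoc, nerveRestrict_naturality, etaPar,
    LaxToDay.splitMap_conv_can_assoc, etaUnit_nRes, h]
  rfl

lemma inv_phi₀_normalization : inv (normalizationObj V).obj.str.phi₀
    = 𝟙 ((nerve (freeFam V)).obj (𝟙_ (NBimod V.str.Day))) :=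
  IsIso.inv_eq_of_hom_inv_id ((Category.comp_id _).trans ((nerve (freeFam V)).map_id _))

/-- The variable i stands for φ₀⁻¹, which is the identity in the normalization
(`inv_phi₀_normalization`). -/
lemma leftHom_normalization (M : NBimod V.str.Day)
    {i : (nerve (freeFam V)).obj (𝟙_ (NBimod V.str.Day)) ⟶ (nerve (freeFam V)).obj (𝟙_ _)}
    (hi : i = 𝟙 _) {P : Psh (NerveCat (freeFam V))} (a : P ⟶ (nerve (freeFam V)).obj M) :
    conv.map i a ≫ (nervePromonoidalData (freeFam V)).leftHom ((nerve (freeFam V)).obj M)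
      = conv.map (𝟙 _) a ≫ nerveCan _ _ _ ≫ (nerve (freeFam V)).map (λ_ M).hom := by
  rw [leftHom_nerve_obj, hi, map_nerveMul_assoc, nerveMul, Category.comp_id, Category.comp_id,
    Category.assoc]

lemma rightHom_normalization (M : NBimod V.str.Day)
    {i : (nerve (freeFam V)).obj (𝟙_ (NBimod V.str.Day)) ⟶ (nerve (freeFam V)).obj (𝟙_ _)}
    (hi : i = 𝟙 _) :
    conv.map (𝟙 ((nerve (freeFam V)).obj M)) i ≫
        (nervePromonoidalData (freeFam V)).rightHom ((nerve (freeFam V)).obj M)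
      = nerveCan _ _ _ ≫ (nerve (freeFam V)).map (ρ_ M).hom := by
  rw [rightHom_nerve_obj, hi, map_nerveMul_assoc, nerveMul, Category.comp_id, Category.comp_id,
    Category.assoc, conv.map_id, Category.id_comp]

/-- `compareHom` for the canonical functor. -/
noncomputable def etaHom (B : V) : V.str.sandwich (yo B) ⟶
    (freeFunctor (freeN V.str)).op ⋙ (nerve (freeFam V)).obj ((freeN V.str).obj (yo B)) :=
  compareHom (W := normalizationObj V) (normalizationEta V) B

lemma etaHom_eq (B : V) : etaHom V B
    = (etaPar V).conv (etaUnit V) ((etaPar V).conv (yonedaFree (freeN V.str) B) (etaUnit V)) ≫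
      Functor.whiskerLeft (freeFunctor (freeN V.str)).op
        (conv.map (T := nerveTensor (freeFam V)) (𝟙 _) (nerveCan _ _ _ ≫
          (nerve (freeFam V)).map (ρ_ ((freeN V.str).obj (yo B))).hom) ≫
        nerveCan _ _ _ ≫ (nerve (freeFam V)).map (λ_ _).hom) := by
  refine congrArg (fun k => _ ≫ Functor.whiskerLeft (freeFunctor (freeN V.str)).op k) ?_
  refine (leftHom_normalization V _ (inv_phi₀_normalization V) _).trans ?_
  exact congrArg (fun k => conv.map _ k ≫ _)
    (rightHom_normalization V _ (inv_phi₀_normalization V))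

variable {V} in
/-- The map from a free bimodule that extends a map to a bimodule. -/
def extend {M : NBimod V.str.Day} {P : Psh V} (a : P ⟶ (forgetN V.str).obj M) :
    V.str.sandwich P ⟶ (forgetN V.str).obj M :=
  conv.map (𝟙 _) (conv.map a (𝟙 _) ≫ rightAct M) ≫ leftAct M

variable {V} in
-- A map out of a free bimodule is recovered from the generator by letting N act on both sides.
lemma extend_freeUnit {B : V} {M : NBimod V.str.Day} (f : (freeN V.str).obj (yo B) ⟶ M) :
    extend (freeUnit (freeNAdj V.str) B ≫ (forgetN V.str).map f) = (forgetN V.str).map f := by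
  have h : freeUnit (freeNAdj V.str) B = freeBimodUnit (C := V.str.Day) (yo B) :=
    freeBimodAdj_unit (C := V.str.Day) (yo B)
  rw [h]
  exact freeBimodMap_unit (C := V.str.Day) f

/-- The underlying presheaf of a free bimodule. -/
def freeIso (P : Psh V) : V.str.sandwich P ≅ (forgetN V.str).obj ((freeN V.str).obj P) :=
  Iso.refl _

variable {V} in
lemma extend_freeUnit_id (B : V) : extend (freeUnit (freeNAdj V.str) B) = (freeIso V _).hom := by
  have h := extend_freeUnit (𝟙 ((freeN V.str).obj (yo B)))
  rwa [CategoryTheory.Functor.map_id, Category.comp_id] at h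

/-- The two unitors in the comparison map become the two actions of N, applied to the generator.
This is the extension of the unit of the adjunction, that is, the identity of the free bimodule. -/
lemma etaHom_nRes (B : V) : etaHom V B ≫ (nRes V _).hom = (freeIso V (yo B)).hom := by
  rw [etaHom_eq, Functor.whiskerLeft_comp, Category.assoc, Category.assoc, SplitMap.conv_map_assoc,
    Functor.whiskerLeft_id', Category.comp_id, etaPar_left, Category.assoc, etaPar_right,
    yonedaFree_nerveRestrict]
  exact extend_freeUnit_id B

instance (B : V) : IsIso (etaHom V B) := by
  have : IsIso (etaHom V B ≫ (nRes V _).hom) := by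
    rw [etaHom_nRes]
    infer_instance
  exact IsIso.of_isIso_comp_right _ (nRes V _).hom

/-- `comparePar` for the canonical functor. -/
noncomputable def etaComparePar (B C : V) :
    V.str.otimes V.str.N (V.str.otimes (yo B) (V.str.sandwich (yo C))) ⟶
      (freeFunctor (freeN V.str)).op ⋙ (nerve (freeFam V)).obj
        ((freeN V.str).obj (yo B) ⊗ (freeN V.str).obj (yo C)) :=
  comparePar (W := normalizationObj V) (normalizationEta V) B C

lemma etaComparePar_eq (B C : V) : etaComparePar V B C
    = (etaPar V).conv (etaUnit V) ((etaPar V).conv (yonedaFree (freeN V.str) B) (etaHom V C)) ≫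
      Functor.whiskerLeft (freeFunctor (freeN V.str)).op
        (conv.map (T := nerveTensor (freeFam V)) (𝟙 _) (nerveCan _ _ _) ≫
        nerveCan _ _ _ ≫ (nerve (freeFam V)).map (λ_ _).hom) := by
  exact congrArg (fun k => _ ≫ Functor.whiskerLeft (freeFunctor (freeN V.str)).op k)
    (leftHom_normalization V _ (inv_phi₀_normalization V) _)

/-- `N ⊗ B ⊗ N ⊗ C ⊗ N` is the tensor product of free bimodules. -/
noncomputable def freeTensorMap (B C : V) :
    V.str.otimes V.str.N (V.str.otimes (yo B) (V.str.sandwich (yo C))) ⟶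
      (forgetN V.str).obj ((freeN V.str).obj (yo B) ⊗ (freeN V.str).obj (yo C)) :=
  conv.map (𝟙 _) (conv.map (freeUnit (freeNAdj V.str) B) (freeIso V (yo C)).hom ≫
    (forgetPar V.str).μ _ _) ≫ leftAct _

/-- The isomorphism (N ⊗ B ⊗ N) ⊗_N M ≅ N ⊗ B ⊗ M, with M free on C. -/
instance (B C : V) : IsIso (freeTensorMap V B C) := by
  have h : freeTensorMap V B C
      = freeBimodTensor (C := V.str.Day) (yo B) (freeBimod (C := V.str.Day) (yo C)) := by
    rw [freeTensorMap]
    have h : freeUnit (freeNAdj V.str) B = freeBimodUnit (C := V.str.Day) (yo B) :=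
      freeBimodAdj_unit (C := V.str.Day) (yo B)
    rw [h]
    rfl
  rw [h]
  exact isIso_freeBimodTensor (C := V.str.Day) (yo B) (freeBimod (C := V.str.Day) (yo C))

lemma etaComparePar_nRes (B C : V) :
    etaComparePar V B C ≫ (nRes V _).hom = freeTensorMap V B C := by
  rw [etaComparePar_eq, Functor.whiskerLeft_comp, Category.assoc, Category.assoc,
    SplitMap.conv_map_assoc, Functor.whiskerLeft_id', Category.comp_id, etaPar_left, Category.assoc,
    etaPar, LaxToDay.splitMap_conv_can, yonedaFree_nerveRestrict, freeTensorMap, ← etaHom_nRes]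

instance (B C : V) : IsIso (etaComparePar V B C) := by
  have : IsIso (etaComparePar V B C ≫ (nRes V _).hom) := by
    rw [etaComparePar_nRes]
    infer_instance
  exact IsIso.of_isIso_comp_right _ (nRes V _).hom

/-- `compareSeq` for the canonical functor. -/
noncomputable def etaCompareSeq (B C : V) :
    V.str.tri (V.str.sandwich (yo B)) (V.str.sandwich (yo C)) ⟶
      (freeFunctor (freeN V.str)).op ⋙ (nerve (freeFam V)).obj
        (tri ((freeN V.str).obj (yo B)) ((freeN V.str).obj (yo C))) :=
  compareSeq (W := normalizationObj V) (normalizationEta V) B C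

lemma etaCompareSeq_nRes (B C : V) :
    etaCompareSeq V B C ≫ (nRes V _).hom
      = conv.map (T := V.str.seq.tensor) (freeIso V _).hom (freeIso V _).hom ≫
        (forgetLax V.str).triμ _ _ := by
  rw [← etaHom_nRes, ← etaHom_nRes]
  refine Eq.trans ?_ ((forgetLax V.str).freeSeq_conv_can (freeNAdj V.str) _ _)
  exact Category.assoc _ _ _

instance (B C : V) : IsIso (etaCompareSeq V B C) := by
  have : IsIso ((forgetLax V.str).triμ ((freeN V.str).obj (yo B)) ((freeN V.str).obj (yo C))) :=
    inferInstanceAs (IsIso (𝟙 _))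
  have : IsIso (etaCompareSeq V B C ≫ (nRes V _).hom) := by
    rw [etaCompareSeq_nRes]
    exact IsIso.comp_isIso' (conv.mapIso (freeIso V _) (freeIso V _)).isIso_hom this
  exact IsIso.of_isIso_comp_right _ (nRes V _).hom

instance : IsIso (etaUnit V) := by
  have : IsIso (etaUnit V ≫ (nRes V _).hom) := by
    rw [etaUnit_nRes]
    exact inferInstanceAs (IsIso (𝟙 _))
  exact IsIso.of_isIso_comp_right _ (nRes V _).hom

lemma freeUnit_eq_sandwichUnit (B : V) :
    freeUnit (freeNAdj V.str) B = V.str.sandwichUnit (yo B) ≫ (freeIso V (yo B)).hom := by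
  have h : freeUnit (freeNAdj V.str) B = freeBimodUnit (C := V.str.Day) (yo B) :=
    freeBimodAdj_unit (C := V.str.Day) (yo B)
  exact h

/-- The promonad multiplies both pairs of N at once, whereas `extend` applies the right and then the
left action. Naturality of the inverse associator commutes the right-hand φ₂ past it. -/
lemma sandwichMul_eq (P : Psh V) : V.str.sandwichMul P ≫ (freeIso V P).hom
    = extend (M := (freeN V.str).obj P) (freeIso V P).hom := by
  have e₁ : extend (M := (freeN V.str).obj P) (freeIso V P).hom = conv.map (𝟙 V.str.N)
      (conv.map (𝟙 (V.str.sandwich P)) (𝟙 V.str.N) ≫ V.str.par.assocHom _ _ _ ≫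
        conv.map (𝟙 V.str.N) (V.str.par.assocHom P V.str.N V.str.N ≫
          conv.map (𝟙 P) V.str.phi₂)) ≫
      V.str.par.assocInv V.str.N V.str.N (V.str.otimes P V.str.N) ≫
      conv.map V.str.phi₂ (𝟙 (V.str.otimes P V.str.N)) := rfl
  have e₂ {P Q R : Psh V} (f : P ⟶ Q) (g : Q ⟶ R) :
      conv.map (T := V.str.par.tensor) (𝟙 V.str.N) (f ≫ g)
        = conv.map (𝟙 V.str.N) f ≫ conv.map (𝟙 V.str.N) g := by
    rw [← conv.map_comp, Category.id_comp]
  rw [e₁, conv.map_id, Category.id_comp, e₂, e₂, e₂, Category.assoc, Category.assoc,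
    PromonoidalData.assocInv_naturality'_assoc, ← conv.map_comp, Category.comp_id, conv.map_id,
    Category.id_comp]
  exact Category.comp_id _

lemma map_extend {P Q : Psh V} {M : NBimod V.str.Day} (a : P ⟶ Q) (b : Q ⟶ (forgetN V.str).obj M) :
    conv.map (𝟙 V.str.N) (conv.map a (𝟙 V.str.N)) ≫ extend b = extend (a ≫ b) := by
  rw [extend, extend, ← conv.map_comp_assoc, ← conv.map_comp_assoc, Category.id_comp]

/-- The bimodule map named by g is determined by its value g on the generator, so it is the Kleisli
extension of g. This identifies composition of bimodule maps with composition in the promonad. -/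
lemma forgetN_map_etaHom {B C : V} (g : V.str.NHom B C) :
    (freeIso V (yo B)).hom ≫ (forgetN V.str).map ((etaHom V C).app (op B) g)
      = conv.map (𝟙 V.str.N) (conv.map (el g) (𝟙 V.str.N)) ≫ V.str.sandwichMul (yo C) ≫
        (freeIso V (yo C)).hom := by
  have h : freeUnit (freeNAdj V.str) B ≫ (forgetN V.str).map ((etaHom V C).app (op B) g)
      = el g ≫ (freeIso V (yo C)).hom := by
    refine (el_nerveRestrict (freeNAdj V.str) (A := B) (M := (freeN V.str).obj (yo C)) _).symm.trans
      ?_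
    rw [el_comp, ← etaHom_nRes]
    rfl
  rw [sandwichMul_eq, map_extend, ← h]
  exact (Category.id_comp _).trans (extend_freeUnit (V := V) _).symm

/-- `normalizationEta` exhibits `normalizationObj` as the normalization. -/
lemma isNormalization_normalizationEta :
    IsNormalization (W := normalizationObj V) (normalizationEta V) where
  obj_bijective := Function.bijective_id
  hom_isIso B := inferInstanceAs (IsIso (etaHom V B))
  map_eq {A B} f := by
    change (freeFunctor (freeN V.str)).map f
      = (etaHom V B).app (op A) ((V.str.sandwichUnit (yo B)).app (op A) f)
    -- On underlying presheaves both sides are the unit of the free-forgetful adjunction.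
    have h₁ : yonedaFree (freeN V.str) B = V.str.sandwichUnit (yo B) ≫ etaHom V B := by
      rw [← cancel_mono (nRes V _).hom, Category.assoc, etaHom_nRes, yonedaFree_nerveRestrict,
        freeUnit_eq_sandwichUnit]
    exact congrArg (fun k => k.app (op A) f) h₁
  comp_eq {A B C} f g := by
    have h₁ := congrArg (fun k => k.app (op A) ((etaHom V B).app (op A) f))
      (nerveRestrict_naturality (freeNAdj V.str) ((etaHom V C).app (op B) g))
    have h₂ := congrArg (fun k => k.app (op A) f) (forgetN_map_etaHom V g)
    have h₃ (B : V) (f : V.str.NHom A B) : (nRes V _).hom.app (op A) ((etaHom V B).app (op A) f)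
        = (freeIso V (yo B)).hom.app (op A) f :=
      congrArg (fun k => k.app (op A) f) (etaHom_nRes V B)
    -- Bimodule maps out of a free bimodule are compared through the elements of the underlying
    -- presheaf that they name.
    refine ((isIso_iff_bijective ((nRes V _).hom.app (op A))).1 inferInstance).1 ?_
    refine h₁.trans ((congrArg (((forgetN V.str).map ((etaHom V C).app (op B) g)).app (op A))
      (h₃ B f)).trans (h₂.trans ?_))
    exact (h₃ C _).symm
  par_isIso B C := inferInstanceAs (IsIso (etaComparePar V B C))
  seq_isIso B C := inferInstanceAs (IsIso (etaCompareSeq V B C))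
  unit_isIso := inferInstanceAs (IsIso (etaUnit V))

end IsNormalization

end Produoidal

end

/-! ### Normal duoidal categories and lax duoidal functors. -/

section

namespace Produoidal

open MonoidalCategory Limits

namespace Duoidal

section Normal

variable (C : Type*) [Category* C] [MonoidalCategory C] [Duoidal C]

/-- A duoidal category is normal when `phi₀` is invertible. -/
class Normal : Prop where
  isIso_phi₀ : IsIso (phi₀ : 𝟙_ C ⟶ triUnit)

attribute [instance] Normal.isIso_phi₀

variable {C} [Normal C]

lemma phi₂_eq_left : phi₂ = inv (phi₀ (C := C)) ▷ triUnit ≫ (λ_ triUnit).hom := by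
  rw [← phi₀_left, ← comp_whiskerRight_assoc, IsIso.inv_hom_id, id_whiskerRight, Category.id_comp]

lemma phi₂_eq_right : phi₂ = triUnit ◁ inv (phi₀ (C := C)) ≫ (ρ_ triUnit).hom := by
  rw [← phi₀_right, ← MonoidalCategory.whiskerLeft_comp_assoc, IsIso.inv_hom_id,
    MonoidalCategory.whiskerLeft_id, Category.id_comp]

/-- The left action of the second unit on an object of a normal duoidal category. -/
noncomputable def actL (X : C) : triUnit ⊗ X ⟶ X := inv phi₀ ▷ X ≫ (λ_ X).hom

/-- The right action of the second unit on an object of a normal duoidal category. -/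
noncomputable def actR (X : C) : X ⊗ triUnit ⟶ X := X ◁ inv phi₀ ≫ (ρ_ X).hom

lemma phi₀_actL (X : C) : phi₀ ▷ X ≫ actL X = (λ_ X).hom := by
  rw [actL, ← comp_whiskerRight_assoc, IsIso.hom_inv_id, id_whiskerRight, Category.id_comp]

lemma phi₀_actR (X : C) : X ◁ phi₀ ≫ actR X = (ρ_ X).hom := by
  rw [actR, ← MonoidalCategory.whiskerLeft_comp_assoc, IsIso.hom_inv_id,
    MonoidalCategory.whiskerLeft_id, Category.id_comp]

lemma actL_naturality {X Y : C} (f : X ⟶ Y) : triUnit ◁ f ≫ actL Y = actL X ≫ f := by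
  rw [actL, actL, whisker_exchange_assoc, leftUnitor_naturality, Category.assoc]

lemma actR_naturality {X Y : C} (f : X ⟶ Y) : f ▷ triUnit ≫ actR Y = actR X ≫ f := by
  rw [actR, actR, ← whisker_exchange_assoc, rightUnitor_naturality, Category.assoc]

lemma actL_assoc (X : C) :
    phi₂ ▷ X ≫ actL X = (α_ triUnit triUnit X).hom ≫ triUnit ◁ actL X ≫ actL X := by
  rw [actL_naturality, phi₂_eq_left, actL, comp_whiskerRight, Category.assoc, actL]
  monoidal

lemma actR_assoc (X : C) :
    actR X ▷ triUnit ≫ actR X = (α_ X triUnit triUnit).hom ≫ X ◁ phi₂ ≫ actR X := by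
  rw [actR_naturality, phi₂_eq_right, actR, MonoidalCategory.whiskerLeft_comp, Category.assoc, actR]
  monoidal

/-- Both actions pass through the unit I by φ₀⁻¹, so the equation is interchange of two copies of
φ₀⁻¹ followed by coherence. -/
lemma act_middle (X : C) :
    actL X ▷ triUnit ≫ actR X = (α_ triUnit X triUnit).hom ≫ triUnit ◁ actR X ≫ actL X := by
  rw [actL, actR]
  generalize inv (phi₀ (C := C)) = g
  have e : (g ▷ X ≫ (λ_ X).hom) ▷ triUnit ≫ X ◁ g ≫ (ρ_ X).hom
      = (α_ _ _ _).hom ≫ g ▷ (X ⊗ triUnit) ≫ 𝟙_ C ◁ X ◁ g ≫ (λ_ _).hom ≫ (ρ_ X).hom := by monoidal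
  rw [e, ← whisker_exchange_assoc]
  monoidal

lemma actL_triUnit : actL triUnit = phi₂ (C := C) := phi₂_eq_left.symm

lemma actR_triUnit : actR triUnit = phi₂ (C := C) := phi₂_eq_right.symm

lemma actL_tensor (X Y : C) : actL X ▷ Y = (α_ triUnit X Y).hom ≫ actL (X ⊗ Y) := by
  rw [actL, actL]
  monoidal

lemma actR_tensor (X Y : C) : X ◁ actR Y = (α_ X Y triUnit).inv ≫ actR (X ⊗ Y) := by
  rw [actR, actR]
  monoidal

lemma act_balanced (X Y : C) : actR X ▷ Y = (α_ X triUnit Y).hom ≫ X ◁ actL Y := by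
  rw [actR, actL]
  monoidal

/-- As φ₀ is invertible, it suffices to compare after precomposing with it; there `phi₀_delta` turns
`delta` into ψ₀, a unit for ψ₂. Thus the action on `◁` of bimodules agrees with the canonical one.
-/
lemma actL_tri (X Y : C) : delta C ▷ tri X Y ≫ psiMap (actL X) (actL Y) = actL (tri X Y) := by
  have h : (triMap phi₀ phi₀) ▷ tri X Y ≫ psiMap (actL X) (actL Y)
      = psiMap (λ_ _).hom (λ_ _).hom := by
    rw [triMap_whiskerRight_psiMap, phi₀_actL, phi₀_actL]
  rw [← cancel_epi (phi₀ ▷ tri X Y), ← comp_whiskerRight_assoc, phi₀_delta,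
    comp_whiskerRight_assoc, h, psiMap, psi₀_left, phi₀_actL]

lemma actR_tri (X Y : C) : tri X Y ◁ delta C ≫ psiMap (actR X) (actR Y) = actR (tri X Y) := by
  have h : tri X Y ◁ (triMap phi₀ phi₀) ≫ psiMap (actR X) (actR Y)
      = psiMap (ρ_ _).hom (ρ_ _).hom := by
    rw [whiskerLeft_triMap_psiMap, phi₀_actR, phi₀_actR]
  rw [← cancel_epi (tri X Y ◁ phi₀), ← MonoidalCategory.whiskerLeft_comp_assoc, phi₀_delta,
    MonoidalCategory.whiskerLeft_comp_assoc, h, psiMap, psi₀_right, phi₀_actR]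

lemma inv_phi₀_psi₀ : inv phi₀ ≫ psi₀ = delta C ≫ triMap (inv phi₀) (inv phi₀) := by
  rw [IsIso.inv_comp_eq, reassoc_of% phi₀_delta (C := C), ← triMap_comp, IsIso.hom_inv_id, triMap_id,
    Category.comp_id]

end Normal

end Duoidal

open Duoidal

/-- A lax duoidal structure on a functor between duoidal categories. -/
structure LaxDuoidal {C C' : Type*} [Category* C] [MonoidalCategory C] [Duoidal C] [Category* C']
    [MonoidalCategory C'] [Duoidal C'] (S : C' ⥤ C) where
  /-- The structure map on first tensor products. -/
  μ (X Y : C') : S.obj X ⊗ S.obj Y ⟶ S.obj (X ⊗ Y)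
  /-- The structure map on first units. -/
  ε : 𝟙_ C ⟶ S.obj (𝟙_ C')
  /-- The structure map on second tensor products. -/
  ν (X Y : C') : tri (S.obj X) (S.obj Y) ⟶ S.obj (tri X Y)
  /-- The structure map on second units. -/
  ζ : triUnit ⟶ S.obj triUnit
  μ_naturality {X X' Y Y' : C'} (f : X ⟶ X') (g : Y ⟶ Y') :
    (S.map f ⊗ₘ S.map g) ≫ μ X' Y' = μ X Y ≫ S.map (f ⊗ₘ g)
  μ_assoc (X Y Z : C') : μ X Y ▷ S.obj Z ≫ μ (X ⊗ Y) Z ≫ S.map (α_ X Y Z).hom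
    = (α_ _ _ _).hom ≫ S.obj X ◁ μ Y Z ≫ μ X (Y ⊗ Z)
  μ_left (X : C') : ε ▷ S.obj X ≫ μ (𝟙_ C') X ≫ S.map (λ_ X).hom = (λ_ _).hom
  μ_right (X : C') : S.obj X ◁ ε ≫ μ X (𝟙_ C') ≫ S.map (ρ_ X).hom = (ρ_ _).hom
  ν_naturality {X X' Y Y' : C'} (f : X ⟶ X') (g : Y ⟶ Y') :
    triMap (S.map f) (S.map g) ≫ ν X' Y' = ν X Y ≫ S.map (triMap f g)
  ν_assoc (X Y Z : C') :
    triMap (ν X Y) (𝟙 (S.obj Z)) ≫ ν (tri X Y) Z ≫ S.map (triAssoc X Y Z).hom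
      = (triAssoc _ _ _).hom ≫ triMap (𝟙 (S.obj X)) (ν Y Z) ≫ ν X (tri Y Z)
  ν_left (X : C') :
    triMap ζ (𝟙 (S.obj X)) ≫ ν triUnit X ≫ S.map (triLeft X).hom = (triLeft _).hom
  ν_right (X : C') :
    triMap (𝟙 (S.obj X)) ζ ≫ ν X triUnit ≫ S.map (triRight X).hom = (triRight _).hom
  psi (X Y Z W : C') : psi (S.obj X) (S.obj Y) (S.obj Z) (S.obj W) ≫
      triMap (μ X Z) (μ Y W) ≫ ν (X ⊗ Z) (Y ⊗ W)
    = (ν X Y ⊗ₘ ν Z W) ≫ μ (tri X Y) (tri Z W) ≫ S.map (psi X Y Z W)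
  psi₀ : psi₀ ≫ triMap ε ε ≫ ν (𝟙_ C') (𝟙_ C') = ε ≫ S.map psi₀
  phi₂ : phi₂ ≫ ζ = (ζ ⊗ₘ ζ) ≫ μ triUnit triUnit ≫ S.map phi₂
  phi₀ : phi₀ ≫ ζ = ε ≫ S.map phi₀

namespace LaxDuoidal

lemma μ_naturality_assoc : type_of% (reassoc_of% @μ_naturality) :=
  @(reassoc_of% @μ_naturality)

lemma μ_assoc_assoc : type_of% (reassoc_of% @μ_assoc) :=
  @(reassoc_of% @μ_assoc)

lemma psi_assoc : type_of% (reassoc_of% @psi) :=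
  @(reassoc_of% @psi)

lemma phi₀_assoc : type_of% (reassoc_of% @phi₀) :=
  @(reassoc_of% @phi₀)

variable {C C' : Type*} [Category* C] [MonoidalCategory C] [Duoidal C] [Category* C']
  [MonoidalCategory C'] [Duoidal C'] {S : C' ⥤ C} (l : LaxDuoidal S)

/-- The structure map on tensor products, followed by a map. -/
def mulMap {X Y Z : C'} (f : X ⊗ Y ⟶ Z) : S.obj X ⊗ S.obj Y ⟶ S.obj Z := l.μ X Y ≫ S.map f

lemma whiskerRight_mulMap {X X' Y Z : C'} (a : X' ⟶ X) (f : X ⊗ Y ⟶ Z) :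
    S.map a ▷ S.obj Y ≫ l.mulMap f = l.mulMap (a ▷ Y ≫ f) := by
  have h := l.μ_naturality_assoc a (𝟙 Y) (S.map f)
  rw [S.map_id, tensorHom_id] at h
  rw [mulMap, h, mulMap, S.map_comp, tensorHom_id]

lemma whiskerLeft_mulMap {X Y Y' Z : C'} (a : Y' ⟶ Y) (f : X ⊗ Y ⟶ Z) :
    S.obj X ◁ S.map a ≫ l.mulMap f = l.mulMap (X ◁ a ≫ f) := by
  have h := l.μ_naturality_assoc (𝟙 X) a (S.map f)
  rw [S.map_id, id_tensorHom] at h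
  rw [mulMap, h, mulMap, S.map_comp, id_tensorHom]

lemma mulMap_map {X Y Z Z' : C'} (f : X ⊗ Y ⟶ Z) (a : Z ⟶ Z') :
    l.mulMap f ≫ S.map a = l.mulMap (f ≫ a) := by
  rw [mulMap, mulMap, S.map_comp, Category.assoc]

lemma mulMap_id (X Y : C') : l.mulMap (𝟙 (X ⊗ Y)) = l.μ X Y := by
  rw [mulMap, S.map_id, Category.comp_id]

/-- Lax monoidal functors carry associativity laws to associativity laws. The three variants below
replace one factor S(N) by N along ζ, which gives the laws for actions of N. -/
lemma mulMap_assoc {P Q R T U Z : C'} {f : P ⊗ Q ⟶ R} {g : R ⊗ T ⟶ U} {h : Q ⊗ T ⟶ Z}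
    {k : P ⊗ Z ⟶ U} (e : f ▷ T ≫ g = (α_ _ _ _).hom ≫ P ◁ h ≫ k) :
    l.mulMap f ▷ S.obj T ≫ l.mulMap g
      = (α_ _ _ _).hom ≫ S.obj P ◁ l.mulMap h ≫ l.mulMap k := by
  have e₁ := l.μ_assoc_assoc P Q T (S.map (P ◁ h ≫ k))
  rw [mulMap, comp_whiskerRight, Category.assoc, whiskerRight_mulMap, e, mulMap, S.map_comp, e₁]
  rw [mulMap, MonoidalCategory.whiskerLeft_comp, Category.assoc, whiskerLeft_mulMap, mulMap]

lemma mulMap_assoc_left {Q R T U Z : C'} {f : triUnit ⊗ Q ⟶ R} {g : R ⊗ T ⟶ U} {h : Q ⊗ T ⟶ Z}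
    {k : triUnit ⊗ Z ⟶ U} (e : f ▷ T ≫ g = (α_ _ _ _).hom ≫ triUnit ◁ h ≫ k) :
    (l.ζ ▷ _ ≫ l.mulMap f) ▷ S.obj T ≫ l.mulMap g
      = (α_ _ _ _).hom ≫ triUnit ◁ l.mulMap h ≫ l.ζ ▷ _ ≫ l.mulMap k := by
  rw [comp_whiskerRight, Category.assoc, l.mulMap_assoc e, associator_naturality_left_assoc,
    whisker_exchange_assoc]

lemma mulMap_assoc_right {P Q R U Z : C'} {f : P ⊗ Q ⟶ R} {g : R ⊗ triUnit ⟶ U}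
    {h : Q ⊗ triUnit ⟶ Z} {k : P ⊗ Z ⟶ U} (e : f ▷ triUnit ≫ g = (α_ _ _ _).hom ≫ P ◁ h ≫ k) :
    l.mulMap f ▷ triUnit ≫ _ ◁ l.ζ ≫ l.mulMap g
      = (α_ _ _ _).hom ≫ S.obj P ◁ (_ ◁ l.ζ ≫ l.mulMap h) ≫ l.mulMap k := by
  rw [← whisker_exchange_assoc, l.mulMap_assoc e, MonoidalCategory.whiskerLeft_comp, Category.assoc,
    ← associator_naturality_right_assoc]

lemma mulMap_assoc_middle {P R T U Z : C'} {f : P ⊗ triUnit ⟶ R} {g : R ⊗ T ⟶ U}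
    {h : triUnit ⊗ T ⟶ Z} {k : P ⊗ Z ⟶ U} (e : f ▷ T ≫ g = (α_ _ _ _).hom ≫ P ◁ h ≫ k) :
    (_ ◁ l.ζ ≫ l.mulMap f) ▷ S.obj T ≫ l.mulMap g
      = (α_ _ _ _).hom ≫ S.obj P ◁ (l.ζ ▷ _ ≫ l.mulMap h) ≫ l.mulMap k := by
  rw [comp_whiskerRight, Category.assoc, l.mulMap_assoc e, MonoidalCategory.whiskerLeft_comp,
    Category.assoc, associator_naturality_middle_assoc]

lemma ζ_ζ_mulMap : (l.ζ ⊗ₘ l.ζ) ≫ l.mulMap Duoidal.phi₂ = Duoidal.phi₂ ≫ l.ζ := l.phi₂.symm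

lemma psiMap_mulMap_ν {X Y Z X' Y' Z' : C'} (f : X ⊗ Y ⟶ Z) (f' : X' ⊗ Y' ⟶ Z') :
    psiMap (l.mulMap f) (l.mulMap f') ≫ l.ν Z Z'
      = (l.ν X X' ⊗ₘ l.ν Y Y') ≫ l.mulMap (psiMap f f') := by
  rw [psiMap, mulMap, mulMap, triMap_comp, Category.assoc, Category.assoc, l.ν_naturality,
    l.psi_assoc, ← S.map_comp]
  rfl

/-- ζ respects the comultiplications, because `delta` inverts the unitor and the unit law of ν
compares the two unitors. -/
lemma delta_ζ : delta C ≫ triMap l.ζ l.ζ ≫ l.ν triUnit triUnit = l.ζ ≫ S.map (delta C') := by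
  have e : triMap l.ζ l.ζ = triMap (𝟙 _) l.ζ ≫ triMap l.ζ (𝟙 _) := by
    rw [← triMap_comp, Category.id_comp, Category.comp_id]
  have h : S.map (triLeft (triUnit : C')).hom ≫ S.map (delta C') = 𝟙 _ := by
    rw [← S.map_comp, delta, Iso.hom_inv_id, S.map_id]
  have h' : delta C ≫ triMap l.ζ l.ζ ≫ l.ν triUnit triUnit ≫ S.map (triLeft triUnit).hom
      = l.ζ := by
    rw [e, Category.assoc, l.ν_left, triLeft_naturality, delta, Iso.inv_hom_id_assoc]
  conv_rhs => rw [← h', Category.assoc, Category.assoc, Category.assoc, h, Category.comp_id]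

lemma delta_ζ_assoc : type_of% (reassoc_of% @delta_ζ) :=
  @(reassoc_of% @delta_ζ)

/-! ### Lax duoidal functors out of a normal duoidal category lift to bimodules. -/

section Lift

variable [Normal C']

/-- The bimodule on the image of an object of a normal duoidal category. -/
@[simps]
noncomputable def liftObj (X : C') : NBimod C where
  X := S.obj X
  actLeft := l.ζ ▷ _ ≫ l.mulMap (actL X)
  actRight := _ ◁ l.ζ ≫ l.mulMap (actR X)
  one_actLeft := by
    change Duoidal.phi₀ ▷ _ ≫ _ = _
    rw [← comp_whiskerRight_assoc, l.phi₀, comp_whiskerRight_assoc, whiskerRight_mulMap, phi₀_actL]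
    exact l.μ_left X
  left_assoc := by
    change Duoidal.phi₂ ▷ _ ≫ _ = (α_ triUnit triUnit _).hom ≫ triUnit ◁ _ ≫ _
    -- ζ is multiplicative, so the law follows from the one for the canonical action of the unit of
    -- `C'`.
    rw [← comp_whiskerRight_assoc, ← ζ_ζ_mulMap, comp_whiskerRight, Category.assoc,
      l.mulMap_assoc (actL_assoc X), MonoidalCategory.tensorHom_def, comp_whiskerRight,
      Category.assoc, associator_naturality_middle_assoc, associator_naturality_left_assoc,
      MonoidalCategory.whiskerLeft_comp, Category.assoc, whisker_exchange_assoc,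
      whisker_exchange_assoc]
  actRight_one := by
    change _ ◁ Duoidal.phi₀ ≫ _ = _
    rw [← MonoidalCategory.whiskerLeft_comp_assoc, l.phi₀, MonoidalCategory.whiskerLeft_comp_assoc,
      whiskerLeft_mulMap, phi₀_actR]
    exact l.μ_right X
  right_assoc := by
    change _ ◁ Duoidal.phi₂ ≫ _ = _
    rw [Iso.eq_inv_comp, ← MonoidalCategory.whiskerLeft_comp_assoc, ← ζ_ζ_mulMap,
      comp_whiskerRight, Category.assoc, ← whisker_exchange_assoc,
      l.mulMap_assoc (actR_assoc X), MonoidalCategory.tensorHom_def,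
      MonoidalCategory.whiskerLeft_comp, MonoidalCategory.whiskerLeft_comp]
    simp only [Category.assoc]
    rw [← associator_naturality_middle_assoc, ← associator_naturality_right_assoc]
  middle_assoc := by
    change _ ▷ triUnit ≫ _ = (α_ triUnit _ triUnit).hom ≫ triUnit ◁ _ ≫ _
    rw [← whisker_exchange_assoc, l.mulMap_assoc_left (act_middle X),
      associator_naturality_right_assoc, MonoidalCategory.whiskerLeft_comp_assoc]

/-- Functoriality of `liftObj`. -/
@[simps]
noncomputable def liftMap {X Y : C'} (f : X ⟶ Y) : l.liftObj X ⟶ l.liftObj Y where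
  hom := S.map f
  left_act_hom := by
    change (l.ζ ▷ _ ≫ l.mulMap _) ≫ S.map f = triUnit ◁ S.map f ≫ l.ζ ▷ _ ≫ l.mulMap _
    rw [Category.assoc, mulMap_map, whisker_exchange_assoc, whiskerLeft_mulMap, actL_naturality]
  right_act_hom := by
    change (_ ◁ l.ζ ≫ l.mulMap _) ≫ S.map f = S.map f ▷ triUnit ≫ _ ◁ l.ζ ≫ l.mulMap _
    rw [Category.assoc, mulMap_map, ← whisker_exchange_assoc, whiskerRight_mulMap, actR_naturality]

/-- The lift of a lax duoidal functor to bimodules. -/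
@[simps]
noncomputable def liftFunctor : C' ⥤ NBimod C where
  obj := l.liftObj
  map := l.liftMap

/-- The structure map on first tensor products, between underlying objects of `liftObj`. -/
def liftMul (X Y : C') : (l.liftObj X).X ⊗ (l.liftObj Y).X ⟶ (l.liftObj (X ⊗ Y)).X := l.μ X Y

/-- The canonical actions on X and Y both cancel the middle unit (`act_balanced`). Hence μ is
balanced over N and descends to the tensor product over N. -/
lemma μ_condition (X Y : C') :
    (l.liftObj X).actRight ▷ (l.liftObj Y).X ≫ l.liftMul X Y
      = (α_ _ _ _).hom ≫ (l.liftObj X).X ◁ (l.liftObj Y).actLeft ≫ l.liftMul X Y := by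
  have e := l.mulMap_assoc_middle (f := actR X) (g := 𝟙 (X ⊗ Y)) (h := actL Y) (k := 𝟙 (X ⊗ Y))
    (by rw [Category.comp_id, Category.comp_id, act_balanced])
  rw [mulMap_id] at e
  exact e

lemma actLeft_μ (X Y : C') : (l.liftObj X).actLeft ▷ (l.liftObj Y).X ≫ l.liftMul X Y
    = (α_ _ _ _).hom ≫ triUnit ◁ l.liftMul X Y ≫ (l.liftObj (X ⊗ Y)).actLeft := by
  have e := l.mulMap_assoc_left (f := actL X) (g := 𝟙 (X ⊗ Y)) (h := 𝟙 (X ⊗ Y))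
    (k := actL (X ⊗ Y)) (by
      rw [Category.comp_id, MonoidalCategory.whiskerLeft_id, Category.id_comp, actL_tensor])
  rw [mulMap_id] at e
  exact e

lemma μ_actRight (X Y : C') : l.liftMul X Y ▷ triUnit ≫ (l.liftObj (X ⊗ Y)).actRight
    = (α_ _ _ _).hom ≫ (l.liftObj X).X ◁ (l.liftObj Y).actRight ≫ l.liftMul X Y := by
  have e := l.mulMap_assoc_right (f := 𝟙 (X ⊗ Y)) (g := actR (X ⊗ Y)) (h := actR Y)
    (k := 𝟙 (X ⊗ Y)) (by
      rw [Category.comp_id, id_whiskerRight, Category.id_comp, actR_tensor, Iso.hom_inv_id_assoc])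
  rw [mulMap_id] at e
  exact e

/-- The structure map of `liftFunctor` on second tensor products. -/
noncomputable def liftNu (X Y : C') :
    triBimod (l.liftObj X) (l.liftObj Y) ⟶ l.liftObj (tri X Y) where
  hom := l.ν X Y
  left_act_hom := by
    change (delta C ▷ _ ≫ psiMap (l.ζ ▷ _ ≫ l.mulMap _) (l.ζ ▷ _ ≫ l.mulMap _)) ≫ l.ν X Y
      = triUnit ◁ l.ν X Y ≫ l.ζ ▷ _ ≫ l.mulMap _
    rw [← triMap_whiskerRight_psiMap, Category.assoc, Category.assoc, psiMap_mulMap_ν,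
      MonoidalCategory.tensorHom_def, Category.assoc, ← comp_whiskerRight_assoc,
      ← comp_whiskerRight_assoc, Category.assoc, delta_ζ, comp_whiskerRight_assoc,
      ← whisker_exchange_assoc, whiskerRight_mulMap, actL_tri, whisker_exchange_assoc]
  right_act_hom := by
    change (_ ◁ delta C ≫ psiMap (_ ◁ l.ζ ≫ l.mulMap _) (_ ◁ l.ζ ≫ l.mulMap _)) ≫ l.ν X Y
      = l.ν X Y ▷ triUnit ≫ _ ◁ l.ζ ≫ l.mulMap _
    rw [← whiskerLeft_triMap_psiMap, Category.assoc, Category.assoc, psiMap_mulMap_ν,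
      tensorHom_def', Category.assoc, ← MonoidalCategory.whiskerLeft_comp_assoc,
      ← MonoidalCategory.whiskerLeft_comp_assoc, Category.assoc, delta_ζ,
      MonoidalCategory.whiskerLeft_comp_assoc, whisker_exchange_assoc, whiskerLeft_mulMap, actR_tri,
      ← whisker_exchange_assoc]

variable [HasCoequalizers C] [∀ X : C, PreservesColimitsOfSize.{0, 0} (tensorLeft X)]
  [∀ X : C, PreservesColimitsOfSize.{0, 0} (tensorRight X)]

open BimodTensor

/-- The structure map of `liftFunctor` on first tensor products. -/
noncomputable def liftMu (X Y : C') : l.liftObj X ⊗ l.liftObj Y ⟶ l.liftObj (X ⊗ Y) where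
  hom := desc (l.liftMul X Y) (l.μ_condition X Y)
  left_act_hom := by
    rw [← cancel_epi ((unitMon C).X ◁ π (l.liftObj X) (l.liftObj Y)),
      whiskerLeft_π_actLeft_assoc, π_desc, ← MonoidalCategory.whiskerLeft_comp_assoc, π_desc,
      Iso.inv_comp_eq, actLeft_μ]
  right_act_hom := by
    rw [← cancel_epi (π (l.liftObj X) (l.liftObj Y) ▷ triUnit),
      π_whiskerRight_actRight_assoc, π_desc, ← comp_whiskerRight_assoc, π_desc, μ_actRight]

lemma π_liftMu (X Y : C') : π (l.liftObj X) (l.liftObj Y) ≫ (l.liftMu X Y).hom = l.liftMul X Y :=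
  π_desc _ (l.μ_condition X Y)

lemma π_liftMu_assoc : type_of% (reassoc_of% @π_liftMu) :=
  @(reassoc_of% @π_liftMu)

/-- The structure map of `liftFunctor` on first units. -/
noncomputable def liftEps : 𝟙_ (NBimod C) ⟶ l.liftObj (𝟙_ C') where
  -- The unit of bimodules is N, not I, so ε has the wrong source. The comparison goes through ζ and
  -- the image of φ₀⁻¹.
  hom := l.ζ ≫ S.map (inv Duoidal.phi₀)
  left_act_hom := by
    change Duoidal.phi₂ ≫ l.ζ ≫ _ = triUnit ◁ (l.ζ ≫ _) ≫ l.ζ ▷ _ ≫ l.mulMap _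
    rw [MonoidalCategory.whiskerLeft_comp, Category.assoc, whisker_exchange_assoc,
      whiskerLeft_mulMap, actL_naturality, actL_triUnit, ← reassoc_of% l.ζ_ζ_mulMap, mulMap_map,
      tensorHom_def', Category.assoc]
  right_act_hom := by
    change Duoidal.phi₂ ≫ l.ζ ≫ _ = (l.ζ ≫ _) ▷ triUnit ≫ _ ◁ l.ζ ≫ l.mulMap _
    rw [comp_whiskerRight, Category.assoc, ← whisker_exchange_assoc,
      whiskerRight_mulMap, actR_naturality, actR_triUnit, ← reassoc_of% l.ζ_ζ_mulMap, mulMap_map,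
      MonoidalCategory.tensorHom_def, Category.assoc]

/-- The structure map of `liftFunctor` on second units. -/
noncomputable def liftZeta : Bimod.regular (unitMon C) ⟶ l.liftObj triUnit where
  hom := l.ζ
  left_act_hom := by
    change Duoidal.phi₂ ≫ l.ζ = triUnit ◁ l.ζ ≫ l.ζ ▷ _ ≫ l.mulMap _
    rw [actL_triUnit, ← ζ_ζ_mulMap, tensorHom_def', Category.assoc]
  right_act_hom := by
    change Duoidal.phi₂ ≫ l.ζ = l.ζ ▷ triUnit ≫ _ ◁ l.ζ ≫ l.mulMap _
    rw [actR_triUnit, ← ζ_ζ_mulMap, MonoidalCategory.tensorHom_def, Category.assoc]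

lemma liftMu_naturality {X X' Y Y' : C'} (f : X ⟶ X') (g : Y ⟶ Y') :
    (l.liftMap f ⊗ₘ l.liftMap g) ≫ l.liftMu X' Y' = l.liftMu X Y ≫ l.liftMap (f ⊗ₘ g) := by
  refine hom_ext ?_
  rw [Bimod.comp_hom', Bimod.comp_hom', π_tensorHom_assoc, π_liftMu, π_liftMu_assoc]
  exact l.μ_naturality f g

lemma liftMu_assoc (X Y Z : C') :
    l.liftMu X Y ▷ l.liftObj Z ≫ l.liftMu (X ⊗ Y) Z ≫ l.liftMap (α_ X Y Z).hom
      = (α_ _ _ _).hom ≫ l.liftObj X ◁ l.liftMu Y Z ≫ l.liftMu X (Y ⊗ Z) := by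
  refine hom_ext ?_
  rw [← cancel_epi (π _ _ ▷ _)]
  simp only [Bimod.comp_hom']
  rw [π_whiskerRight_assoc, π_liftMu_assoc, π_assoc_assoc, π_whiskerLeft_assoc, π_liftMu,
    ← comp_whiskerRight_assoc, ← MonoidalCategory.whiskerLeft_comp_assoc, π_liftMu, π_liftMu]
  exact l.μ_assoc X Y Z

lemma liftMu_left (X : C') :
    l.liftEps ▷ l.liftObj X ≫ l.liftMu (𝟙_ C') X ≫ l.liftMap (λ_ X).hom = (λ_ _).hom := by
  refine hom_ext ?_
  simp only [Bimod.comp_hom']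
  rw [π_whiskerRight_assoc, π_liftMu_assoc, π_leftUnitor]
  change (l.ζ ≫ S.map (inv Duoidal.phi₀)) ▷ _ ≫ l.mulMap (λ_ X).hom = l.ζ ▷ _ ≫ l.mulMap (actL X)
  rw [comp_whiskerRight_assoc, whiskerRight_mulMap, actL]

lemma liftMu_right (X : C') :
    l.liftObj X ◁ l.liftEps ≫ l.liftMu X (𝟙_ C') ≫ l.liftMap (ρ_ X).hom = (ρ_ _).hom := by
  refine hom_ext ?_
  simp only [Bimod.comp_hom']
  rw [π_whiskerLeft_assoc, π_liftMu_assoc, π_rightUnitor]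
  change _ ◁ (l.ζ ≫ S.map (inv Duoidal.phi₀)) ≫ l.mulMap (ρ_ X).hom = _ ◁ l.ζ ≫ l.mulMap (actR X)
  rw [MonoidalCategory.whiskerLeft_comp_assoc, whiskerLeft_mulMap, actR]

lemma lift_psi (X Y Z W : C') :
    psiBimod (l.liftObj X) (l.liftObj Y) (l.liftObj Z) (l.liftObj W) ≫
        triBimodMap (l.liftMu X Z) (l.liftMu Y W) ≫ l.liftNu (X ⊗ Z) (Y ⊗ W)
      = (l.liftNu X Y ⊗ₘ l.liftNu Z W) ≫ l.liftMu (tri X Y) (tri Z W) ≫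
        l.liftMap (Duoidal.psi X Y Z W) := by
  refine hom_ext ?_
  simp only [Bimod.comp_hom']
  rw [π_psiBimod_assoc, π_tensorHom_assoc, π_liftMu_assoc, ← Category.assoc, psiπ_triBimodMap,
    π_liftMu, π_liftMu]
  exact (Category.assoc _ _ _).trans (l.psi X Y Z W)

lemma lift_phi₂ :
    (λ_ (𝟙_ (NBimod C))).hom ≫ l.liftZeta
      = (l.liftZeta ⊗ₘ l.liftZeta) ≫ l.liftMu triUnit triUnit ≫ l.liftMap Duoidal.phi₂ := by
  refine hom_ext ?_
  simp only [Bimod.comp_hom']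
  have e : π (𝟙_ (NBimod C)) (𝟙_ (NBimod C)) ≫ (λ_ (𝟙_ (NBimod C))).hom.hom ≫ l.liftZeta.hom
      = Duoidal.phi₂ ≫ l.ζ := by
    rw [← Category.assoc, π_leftUnitor]
    rfl
  refine (e.trans l.phi₂).trans ?_
  exact ((π_tensorHom_assoc (A := unitMon C) l.liftZeta l.liftZeta _).trans
    (congrArg ((l.liftZeta.hom ⊗ₘ l.liftZeta.hom) ≫ ·) (l.π_liftMu_assoc _ _ _))).symm

lemma lift_psi₀ :
    (triBimodLeft (Bimod.regular _)).inv ≫ triBimodMap l.liftEps l.liftEps ≫ l.liftNu _ _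
      = l.liftEps ≫ l.liftMap Duoidal.psi₀ := by
  refine Bimod.hom_ext _ _ ?_
  change delta C ≫ triMap (l.ζ ≫ S.map (inv Duoidal.phi₀)) (l.ζ ≫ S.map (inv Duoidal.phi₀)) ≫
    l.ν (𝟙_ C') (𝟙_ C') = (l.ζ ≫ S.map (inv Duoidal.phi₀)) ≫ S.map Duoidal.psi₀
  rw [triMap_comp, Category.assoc, l.ν_naturality, delta_ζ_assoc, Category.assoc, ← S.map_comp,
    ← S.map_comp, inv_phi₀_psi₀]

lemma lift_phi₀ : l.liftZeta = l.liftEps ≫ l.liftMap Duoidal.phi₀ := by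
  refine Bimod.hom_ext _ _ ?_
  change l.ζ = (l.ζ ≫ S.map (inv Duoidal.phi₀)) ≫ S.map Duoidal.phi₀
  rw [Category.assoc, ← S.map_comp, IsIso.inv_hom_id, S.map_id, Category.comp_id]

/-- A lax duoidal structure on `S` induces one on its lift to bimodules. -/
noncomputable def lift : LaxDuoidal l.liftFunctor where
  μ := l.liftMu
  ε := l.liftEps
  ν := l.liftNu
  ζ := l.liftZeta
  μ_naturality := l.liftMu_naturality
  μ_assoc := l.liftMu_assoc
  μ_left := l.liftMu_left
  μ_right := l.liftMu_right
  ν_naturality f g := Bimod.hom_ext _ _ (l.ν_naturality f g)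
  ν_assoc X Y Z := Bimod.hom_ext _ _ (l.ν_assoc X Y Z)
  ν_left X := Bimod.hom_ext _ _ (l.ν_left X)
  ν_right X := Bimod.hom_ext _ _ (l.ν_right X)
  psi := l.lift_psi
  psi₀ := l.lift_psi₀
  phi₂ := l.lift_phi₂
  phi₀ := (Category.id_comp _).trans l.lift_phi₀

end Lift

end LaxDuoidal

end Produoidal

end

/-! ### Functors out of a nerve category by evaluation of presheaves. -/

section

namespace Produoidal

open MonoidalCategory

section

variable {W K : Type u} [SmallCategory W] {E : Type*} [Category.{u} E]

/-- A functor `R` from presheaves on `W` for which the presheaf of maps from an object `J A` is the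
evaluation at an object `obj A` of `W`. -/
structure Evaluation (J : K → E) (R : Psh W ⥤ E) where
  /-- The object at which a presheaf is evaluated. -/
  obj : K → W
  /-- The identification of maps with elements. -/
  equiv (A : K) (P : Psh W) : (J A ⟶ R.obj P) ≃ P.obj (op (obj A))
  equiv_naturality {A : K} {P Q : Psh W} (g : J A ⟶ R.obj P) (f : P ⟶ Q) :
    equiv A Q (g ≫ R.map f) = f.app _ (equiv A P g)

namespace Evaluation

variable {J : K → E} {R : Psh W ⥤ E} (e : Evaluation J R)

/-- The generic element. -/
def gen (A : K) : J A ⟶ R.obj (yo (e.obj A)) := (e.equiv A _).symm (𝟙 (e.obj A))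

lemma equiv_gen (A : K) : e.equiv A (yo (e.obj A)) (e.gen A) = 𝟙 (e.obj A) :=
  (e.equiv A _).apply_symm_apply _

lemma equiv_gen_map {A : K} {P : Psh W} (p : yo (e.obj A) ⟶ P) :
    e.equiv A P (e.gen A ≫ R.map p) = yonedaEquiv p := by
  rw [equiv_naturality, equiv_gen]
  rfl

lemma gen_el {A : K} {P : Psh W} (g : J A ⟶ R.obj P) :
    e.gen A ≫ R.map (el (e.equiv A P g)) = g := by
  refine (e.equiv A P).injective ?_
  rw [equiv_gen_map]
  exact yonedaEquiv.apply_symm_apply _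

/-- The map of objects of evaluation that a map in the family induces. -/
def mapHom {A B : K} (f : J A ⟶ J B) : e.obj A ⟶ e.obj B :=
  e.equiv A (yo (e.obj B)) (f ≫ e.gen B)

lemma gen_mapHom {A B : K} (f : J A ⟶ J B) :
    e.gen A ≫ R.map (yoneda.map (e.mapHom f)) = f ≫ e.gen B := by
  refine (e.equiv A _).injective ?_
  rw [equiv_gen_map]
  exact Category.id_comp _

lemma gen_mapHom_assoc : type_of% (reassoc_of% @gen_mapHom) :=
  @(reassoc_of% @gen_mapHom)

/-- Naturality in the object of the family is not assumed. It follows because every map into R P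
factors through a generic element, and `mapHom` is defined by how f moves the generic element. -/
lemma equiv_comp {A B : K} {P : Psh W} (f : J A ⟶ J B) (g : J B ⟶ R.obj P) :
    e.equiv A P (f ≫ g) = P.map (e.mapHom f).op (e.equiv B P g) := by
  have h : f ≫ g = e.gen A ≫ R.map (el (P.map (e.mapHom f).op (e.equiv B P g))) := by
    rw [el_map, R.map_comp, gen_mapHom_assoc, gen_el]
  rw [h, equiv_gen_map]
  exact yonedaEquiv.apply_symm_apply _

lemma mapHom_id (A : K) : e.mapHom (𝟙 (J A)) = 𝟙 (e.obj A) := by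
  rw [mapHom, Category.id_comp, equiv_gen]

lemma mapHom_comp {A B C : K} (f : J A ⟶ J B) (g : J B ⟶ J C) :
    e.mapHom (f ≫ g) = e.mapHom f ≫ e.mapHom g := by
  rw [mapHom, Category.assoc, equiv_comp]
  rfl

/-- The functor from the nerve category that evaluation induces. -/
def functor : NerveCat J ⥤ W where
  obj := e.obj
  map f := e.mapHom f
  map_id A := e.mapHom_id A
  map_comp f g := e.mapHom_comp f g

/-- The nerve of `R.obj P` is the restriction of `P`. -/
def val (P : Psh W) : (nerve J).obj (R.obj P) ≅ e.functor.op ⋙ P :=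
  NatIso.ofComponents (fun A => (e.equiv A.unop P).toIso) (fun k =>
    ConcreteCategory.hom_ext _ _ fun g => e.equiv_comp k.unop g)

lemma val_naturality {P Q : Psh W} (f : P ⟶ Q) :
    (nerve J).map (R.map f) ≫ (e.val Q).hom
      = (e.val P).hom ≫ Functor.whiskerLeft e.functor.op f :=
  NatTrans.ext (funext fun A => ConcreteCategory.hom_ext _ _ fun (g : J A.unop ⟶ R.obj P) =>
    e.equiv_naturality g f)

end Evaluation

end

/-- A lax monoidal structure on a functor from presheaves, with the tensor product of presheaves that
a promonoidal structure induces. -/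
structure LaxFromDay {W : Type u} [SmallCategory W] {E : Type*} [Category* E] [MonoidalCategory E]
    (M : PromonoidalData W) (R : Psh W ⥤ E) where
  /-- The structure map on tensor products. -/
  μ (P Q : Psh W) : R.obj P ⊗ R.obj Q ⟶ R.obj (M.conv P Q)
  /-- The structure map on units. -/
  ε : 𝟙_ E ⟶ R.obj M.unit
  μ_naturality {P P' Q Q' : Psh W} (f : P ⟶ P') (g : Q ⟶ Q') :
    (R.map f ⊗ₘ R.map g) ≫ μ P' Q' = μ P Q ≫ R.map (conv.map f g)
  assoc (P Q S : Psh W) : μ P Q ▷ R.obj S ≫ μ (M.conv P Q) S ≫ R.map (M.assocHom P Q S)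
    = (α_ _ _ _).hom ≫ R.obj P ◁ μ Q S ≫ μ P (M.conv Q S)
  left (P : Psh W) : ε ▷ R.obj P ≫ μ M.unit P ≫ R.map (M.leftHom P) = (λ_ _).hom
  right (P : Psh W) : R.obj P ◁ ε ≫ μ P M.unit ≫ R.map (M.rightHom P) = (ρ_ _).hom

namespace LaxFromDay

lemma μ_naturality_assoc : type_of% (reassoc_of% @μ_naturality) :=
  @(reassoc_of% @μ_naturality)

lemma assoc_assoc : type_of% (reassoc_of% @assoc) :=
  @(reassoc_of% @assoc)

variable {W K : Type u} [SmallCategory W] {E : Type*} [Category.{u} E] [MonoidalCategory E]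
  {M : PromonoidalData W} {J : K → E} {R : Psh W ⥤ E} (l : LaxFromDay M R) (e : Evaluation J R)

/-- The generic split. -/
def genSplit (X Y : K) : J X ⊗ J Y ⟶ R.obj (M.tensor.obj (e.obj X, e.obj Y)) :=
  (e.gen X ⊗ₘ e.gen Y) ≫ l.μ _ _ ≫ R.map (conv.reduce (e.obj X) (e.obj Y))

lemma genSplit_naturality {X X' Y Y' : K} (f : J X ⟶ J X') (g : J Y ⟶ J Y') :
    (f ⊗ₘ g) ≫ l.genSplit e X' Y'
      = l.genSplit e X Y ≫ R.map (M.tensor.map (Prod.mkHom (e.mapHom f) (e.mapHom g))) := by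
  rw [genSplit, genSplit, tensorHom_comp_tensorHom_assoc, ← e.gen_mapHom, ← e.gen_mapHom,
    ← tensorHom_comp_tensorHom_assoc, l.μ_naturality_assoc, Category.assoc, Category.assoc,
    ← R.map_comp, ← R.map_comp, conv.reduce_naturality]

/-- Both maps factor through the generic elements, by Yoneda, so naturality of μ reduces the product
to the generic split. -/
lemma genSplit_ι {X Y : K} {P Q : Psh W} (f : J X ⟶ R.obj P) (g : J Y ⟶ R.obj Q) :
    l.genSplit e X Y ≫ R.map (conv.ι (e.equiv X P f) (e.equiv Y Q g)) = (f ⊗ₘ g) ≫ l.μ P Q := by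
  have h : conv.reduce (T := M.tensor) (e.obj X) (e.obj Y) ≫
      conv.ι (e.equiv X P f) (e.equiv Y Q g)
        = conv.map (el (e.equiv X P f)) (el (e.equiv Y Q g)) := by
    refine (Iso.eq_inv_comp (conv.reduceIso (T := M.tensor) (e.obj X) (e.obj Y))).1 ?_
    refine Eq.trans ?_ (conv.ι_map (el (e.equiv X P f)) (el (e.equiv Y Q g)) _ _).symm
    rw [el_app_id, el_app_id]
  rw [genSplit, Category.assoc, Category.assoc, ← R.map_comp, h, ← l.μ_naturality,
    tensorHom_comp_tensorHom_assoc, e.gen_el, e.gen_el]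

/-- The action of the functor that evaluation induces on a split. -/
def splitApp (X Y : NerveCat J) : (nerveTensor J).obj (X, Y) ⟶
    e.functor.op ⋙ M.tensor.obj (e.functor.obj X, e.functor.obj Y) :=
  (nerve J).map (l.genSplit e X Y) ≫ (e.val _).hom

lemma map_splitApp {X Y : K} {P : Psh W} (f : M.tensor.obj (e.obj X, e.obj Y) ⟶ P) :
    l.splitApp e X Y ≫ Functor.whiskerLeft e.functor.op f
      = (nerve J).map (l.genSplit e X Y ≫ R.map f) ≫ (e.val P).hom := by
  rw [(nerve J).map_comp, Category.assoc, e.val_naturality]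
  exact Category.assoc _ _ _

/-- The action on splits of the functor that evaluation induces. -/
def splitMap : SplitMap e.functor (nerveTensor J) M.tensor where
  app := l.splitApp e
  naturality {X X' Y Y'} f g := by
    refine Eq.trans ?_ (l.map_splitApp e _).symm
    refine Eq.trans ?_ (congrArg (fun k => (nerve J).map k ≫ (e.val _).hom)
      (l.genSplit_naturality e f g))
    exact (Category.assoc _ _ _).symm.trans (congrArg (· ≫ _) ((nerve J).map_comp _ _).symm)

/-- The induced action on composites is multiplication in `E` followed by the lax structure of R.
This turns the axioms of a promonoidal functor into those of R. -/
lemma splitMap_conv {P Q : Psh (NerveCat J)} {P' Q' : Psh W} (a : P ⟶ (nerve J).obj (R.obj P'))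
    (b : Q ⟶ (nerve J).obj (R.obj Q')) :
    (l.splitMap e).conv (a ≫ (e.val P').hom) (b ≫ (e.val Q').hom)
      = nerveMul a b ≫ (nerve J).map (l.μ P' Q') ≫ (e.val _).hom := by
  refine conv.hom_ext fun {X Y} p q => ?_
  refine (l.map_splitApp e (X := X) (Y := Y)
    (conv.ι (e.equiv X P' (a.app _ p)) (e.equiv Y Q' (b.app _ q)))).trans ?_
  refine (congrArg (fun k => (nerve J).map k ≫ (e.val _).hom)
    (l.genSplit_ι e (a.app _ p) (b.app _ q))).trans ?_
  rw [(nerve J).map_comp, Category.assoc]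
  rfl

lemma splitMap_conv_assoc : type_of% (reassoc_of% @splitMap_conv) :=
  @(reassoc_of% @splitMap_conv)

/-- The action of the functor that evaluation induces on units. -/
def unitMap : (nerve J).obj (𝟙_ E) ⟶ e.functor.op ⋙ M.unit := (nerve J).map l.ε ≫ (e.val _).hom

lemma splitMap_conv_nerve {P' Q' S : Psh W} {X Y : E} (a : X ⟶ R.obj P')
    (b : Y ⟶ R.obj Q') (f : M.conv P' Q' ⟶ S) :
    (l.splitMap e).conv ((nerve J).map a ≫ (e.val P').hom) ((nerve J).map b ≫ (e.val Q').hom) ≫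
        Functor.whiskerLeft e.functor.op f
      = nerveCan J X Y ≫ (nerve J).map ((a ⊗ₘ b) ≫ l.μ P' Q' ≫ R.map f) ≫ (e.val S).hom := by
  rw [splitMap_conv_assoc, ← e.val_naturality, nerveMul, Category.assoc,
    nerveCan_naturality_assoc]
  simp only [Functor.map_comp, Category.assoc]

/-- Associativity of the lax structure of R at three generic elements, with the associator on
representables given by `assocHom_reduce`. -/
lemma genSplit_assoc (X Y Z : K) :
    (α_ (J X) (J Y) (J Z)).hom ≫ (e.gen X ⊗ₘ l.genSplit e Y Z) ≫ l.μ _ _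
      = (l.genSplit e X Y ⊗ₘ e.gen Z) ≫ l.μ _ _ ≫
        R.map (M.assoc (e.obj X) (e.obj Y) (e.obj Z)).hom := by
  have h₁ : (e.gen X ⊗ₘ l.genSplit e Y Z) ≫ l.μ _ _ = (e.gen X ⊗ₘ (e.gen Y ⊗ₘ e.gen Z)) ≫
      R.obj _ ◁ l.μ _ _ ≫ l.μ _ _ ≫ R.map (conv.map (𝟙 _) (conv.reduce _ _)) := by
    rw [← l.μ_naturality, R.map_id, id_tensorHom, ← MonoidalCategory.whiskerLeft_comp_assoc,
      ← id_tensorHom, tensorHom_comp_tensorHom_assoc, Category.comp_id, genSplit]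
  have h₂ : (l.genSplit e X Y ⊗ₘ e.gen Z) ≫ l.μ _ _ = ((e.gen X ⊗ₘ e.gen Y) ⊗ₘ e.gen Z) ≫
      l.μ _ _ ▷ R.obj _ ≫ l.μ _ _ ≫ R.map (conv.map (conv.reduce _ _) (𝟙 _)) := by
    rw [← l.μ_naturality, R.map_id, tensorHom_id, ← comp_whiskerRight_assoc,
      ← tensorHom_id, tensorHom_comp_tensorHom_assoc, Category.comp_id, genSplit]
  rw [h₁, reassoc_of% h₂, ← R.map_comp, ← M.assocHom_reduce, R.map_comp, l.assoc_assoc,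
    ← associator_naturality_assoc]

lemma gen_left (X : K) :
    (l.ε ⊗ₘ e.gen X) ≫ l.μ _ _ ≫ R.map (M.left (e.obj X)).hom = (λ_ (J X)).hom ≫ e.gen X := by
  rw [← M.leftHom_yo, tensorHom_def', Category.assoc, l.left, leftUnitor_naturality]

lemma gen_right (X : K) :
    (e.gen X ⊗ₘ l.ε) ≫ l.μ _ _ ≫ R.map (M.right (e.obj X)).hom = (ρ_ (J X)).hom ≫ e.gen X := by
  rw [← M.rightHom_yo, MonoidalCategory.tensorHom_def, Category.assoc, l.right,
    rightUnitor_naturality]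

lemma splitMap_assoc [TensorDense J] (X Y Z : K) :
    ((nervePromonoidalData J).assoc X Y Z).hom ≫
        (l.splitMap e).conv (yonedaMap e.functor X) (l.splitApp e Y Z)
      = (l.splitMap e).conv (l.splitApp e X Y) (yonedaMap e.functor Z) ≫
        Functor.whiskerLeft e.functor.op (M.assoc (e.obj X) (e.obj Y) (e.obj Z)).hom := by
  have h' := l.splitMap_conv_nerve e (l.genSplit e X Y) (e.gen Z) (M.assoc _ _ _).hom
  rw [← l.genSplit_assoc e X Y Z] at h'
  refine Eq.trans ?_ h'.symm
  have h := l.splitMap_conv_nerve e (e.gen X) (l.genSplit e Y Z) (𝟙 _)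
  rw [R.map_id, Category.comp_id, Functor.whiskerLeft_id', Category.comp_id] at h
  refine (congrArg (_ ≫ ·) h).trans ?_
  change (nerveCan J _ _ ≫ (nerve J).map _ ≫ (nerveCanIso J _ _).inv) ≫ _ = _
  simp only [Category.assoc, nerveCanIso_inv_comp_assoc, Functor.map_comp]

lemma splitMap_left [TensorDense J] (X : K) :
    ((nervePromonoidalData J).left X).hom ≫ yonedaMap e.functor X
      = (l.splitMap e).conv (l.unitMap e) (yonedaMap e.functor X) ≫
        Functor.whiskerLeft e.functor.op (M.left (e.obj X)).hom := by
  have h := l.splitMap_conv_nerve e l.ε (e.gen X) (M.left _).hom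
  rw [l.gen_left e X, (nerve J).map_comp] at h
  refine Eq.trans ?_ h.symm
  change (nerveCan J (𝟙_ E) (J X) ≫ (nerve J).map (λ_ (J X)).hom) ≫ (nerve J).map (e.gen X) ≫
    (e.val (yo (e.obj X))).hom = _
  simp only [Category.assoc]

lemma splitMap_right [TensorDense J] (X : K) :
    ((nervePromonoidalData J).right X).hom ≫ yonedaMap e.functor X
      = (l.splitMap e).conv (yonedaMap e.functor X) (l.unitMap e) ≫
        Functor.whiskerLeft e.functor.op (M.right (e.obj X)).hom := by
  have h := l.splitMap_conv_nerve e (e.gen X) l.ε (M.right _).hom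
  rw [l.gen_right e X, (nerve J).map_comp] at h
  refine Eq.trans ?_ h.symm
  change (nerveCan J (J X) (𝟙_ E) ≫ (nerve J).map (ρ_ (J X)).hom) ≫ (nerve J).map (e.gen X) ≫
    (e.val (yo (e.obj X))).hom = _
  simp only [Category.assoc]

/-- The functor that evaluation induces, as a promonoidal functor. -/
def promonoidal [TensorDense J] {M : Promonoidal W} (l : LaxFromDay M.toPromonoidalData R) :
    PromonoidalFunctor e.functor (nervePromonoidal J) M where
  tensor := l.splitMap e
  unit := l.unitMap e
  map_assoc := l.splitMap_assoc e
  map_left := l.splitMap_left e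
  map_right := l.splitMap_right e

end LaxFromDay

/-! ### Evaluation as a produoidal functor. -/

namespace LaxDuoidal

open Duoidal

/-- Compatibility of R with ψ₂, with maps inserted before the structure maps and a commuting square
h after them. With generic elements and Yoneda reductions inserted, h is `psi_reduce`, and the
result is the equation for ψ₂ on generic splits. -/
lemma psi_square {C C' : Type*} [Category* C] [MonoidalCategory C] [Duoidal C] [Category* C']
    [MonoidalCategory C'] [Duoidal C'] {R : C' ⥤ C} (l : LaxDuoidal R) {A B A' B' : C}
    {X Y Z Z' P Q S T : C'} (a : A ⟶ R.obj X) (b : B ⟶ R.obj Y) (a' : A' ⟶ R.obj Z)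
    (b' : B' ⟶ R.obj Z') {p : X ⊗ Z ⟶ P} {q : Y ⊗ Z' ⟶ Q} {s : tri X Y ⟶ S} {t : tri Z Z' ⟶ T}
    {k : S ⊗ T ⟶ tri P Q} (h : (s ⊗ₘ t) ≫ k = Duoidal.psi X Y Z Z' ≫ triMap p q) :
    Duoidal.psi A B A' B' ≫
        triMap ((a ⊗ₘ a') ≫ l.μ _ _ ≫ R.map p) ((b ⊗ₘ b') ≫ l.μ _ _ ≫ R.map q) ≫ l.ν _ _
      = ((triMap a b ≫ l.ν _ _ ≫ R.map s) ⊗ₘ (triMap a' b' ≫ l.ν _ _ ≫ R.map t)) ≫ l.μ _ _ ≫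
        R.map k := by
  rw [← tensorHom_comp_tensorHom_assoc, ← tensorHom_comp_tensorHom_assoc, l.μ_naturality_assoc,
    ← R.map_comp, h, R.map_comp, ← l.psi_assoc, triMap_comp, triMap_comp, Category.assoc,
    Category.assoc, l.ν_naturality, ← Duoidal.psi_naturality_assoc]

variable {W K : Type u} [SmallCategory W] {E : Type*} [Category.{u} E] [MonoidalCategory E]
  [Duoidal E] {D : ProduoidalStruct W} {J : K → E} {R : D.Day ⥤ E} (l : LaxDuoidal R)

/-- The lax monoidal structure for the first tensor products. -/
def fromPar : LaxFromDay D.par.toPromonoidalData (W := W) R where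
  μ := l.μ
  ε := l.ε
  μ_naturality := l.μ_naturality
  assoc := l.μ_assoc
  left := l.μ_left
  right := l.μ_right

/-- The lax monoidal structure for the second tensor products. -/
def fromSeq : @LaxFromDay W _ E _ (seqMonoidal E) D.seq.toPromonoidalData R :=
  @LaxFromDay.mk W _ E _ (seqMonoidal E) _ _ l.ν l.ζ l.ν_naturality l.ν_assoc l.ν_left l.ν_right

variable (e : Evaluation (W := W) J R)

/-- The generic parallel split. -/
def parSplit (X Y : K) : J X ⊗ J Y ⟶ R.obj (D.par.tensor.obj (e.obj X, e.obj Y)) :=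
  l.fromPar.genSplit e X Y

/-- The generic sequential split. -/
def seqSplit (X Y : K) : tri (J X) (J Y) ⟶ R.obj (D.seq.tensor.obj (e.obj X, e.obj Y)) :=
  @LaxFromDay.genSplit _ _ _ _ _ (seqMonoidal E) _ _ _ l.fromSeq e X Y

lemma psi_gen (X Y Z Z' : K) :
    Duoidal.psi (J X) (J Y) (J Z) (J Z') ≫
        triMap (l.parSplit e X Z) (l.parSplit e Y Z') ≫ l.ν _ _
      = (l.seqSplit e X Y ⊗ₘ l.seqSplit e Z Z') ≫ l.μ _ _ ≫
        R.map (D.psi₂ (e.obj X) (e.obj Y) (e.obj Z) (e.obj Z')) :=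
  l.psi_square (e.gen X) (e.gen Y) (e.gen Z) (e.gen Z')
    (D.psi_reduce (e.obj X) (e.obj Y) (e.obj Z) (e.obj Z')).symm

section

variable [TensorDense J]

/-- The parallel structure of the functor that evaluation induces. -/
noncomputable def evalPar : PromonoidalFunctor e.functor (nervePromonoidal J) D.par :=
  l.fromPar.promonoidal e

lemma evalPar_conv {P' Q' S : D.Day} {X Y : E} (a : X ⟶ R.obj P') (b : Y ⟶ R.obj Q')
    (f : P' ⊗ Q' ⟶ S) :
    (l.evalPar e).tensor.conv ((nerve J).map a ≫ (e.val P').hom)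
        ((nerve J).map b ≫ (e.val Q').hom) ≫ Functor.whiskerLeft e.functor.op f
      = nerveCan J X Y ≫ (nerve J).map ((a ⊗ₘ b) ≫ l.μ P' Q' ≫ R.map f) ≫ (e.val S).hom :=
  l.fromPar.splitMap_conv_nerve e a b f

end

section

variable [TriDense J]

/-- The sequential structure of the functor that evaluation induces. -/
noncomputable def evalSeq : PromonoidalFunctor e.functor (nerveSeq J) D.seq :=
  @LaxFromDay.promonoidal _ _ _ _ _ (seqMonoidal E) _ _ e _ _ l.fromSeq

lemma evalSeq_conv {P' Q' S : D.Day} {X Y : E} (a : X ⟶ R.obj P') (b : Y ⟶ R.obj Q')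
    (f : tri P' Q' ⟶ S) :
    (l.evalSeq e).tensor.conv ((nerve J).map a ≫ (e.val P').hom)
        ((nerve J).map b ≫ (e.val Q').hom) ≫ Functor.whiskerLeft e.functor.op f
      = nerveTriCan J X Y ≫ (nerve J).map (triMap a b ≫ l.ν P' Q' ≫ R.map f) ≫ (e.val S).hom :=
  @LaxFromDay.splitMap_conv_nerve _ _ _ _ _ (seqMonoidal E) _ _ _ l.fromSeq e _ _ _ _ _ a b f

lemma evalSeq_conv_id {P' Q' : D.Day} {X Y : E} (a : X ⟶ R.obj P') (b : Y ⟶ R.obj Q') :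
    (l.evalSeq e).tensor.conv ((nerve J).map a ≫ (e.val P').hom)
        ((nerve J).map b ≫ (e.val Q').hom)
      = nerveTriCan J X Y ≫ (nerve J).map (triMap a b ≫ l.ν P' Q') ≫
        (e.val (tri (C := D.Day) P' Q')).hom := by
  have h := l.evalSeq_conv e a b (𝟙 _)
  rw [R.map_id, Category.comp_id] at h
  exact h

end

variable [TensorDense J] [TriDense J]

lemma eval_psi₂ (X Y Z Z' : K) :
    (nerveProduoidalData J).psi₂ X Y Z Z' ≫ (l.evalSeq e).tensor.conv
        ((l.evalPar e).tensor.app X Z) ((l.evalPar e).tensor.app Y Z')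
      = (l.evalPar e).tensor.conv ((l.evalSeq e).tensor.app X Y) ((l.evalSeq e).tensor.app Z Z') ≫
        Functor.whiskerLeft e.functor.op (D.psi₂ (e.obj X) (e.obj Y) (e.obj Z) (e.obj Z')) := by
  refine Eq.trans ?_ (l.evalPar_conv e (l.seqSplit e X Y) (l.seqSplit e Z Z') _).symm
  have h := congrArg (fun k => nerveCan J _ _ ≫ (nerve J).map k ≫ (e.val _).hom)
    (l.psi_gen e X Y Z Z')
  refine Eq.trans ?_ h
  refine (congrArg (_ ≫ ·) (l.evalSeq_conv_id e (l.parSplit e X Z) (l.parSplit e Y Z'))).trans ?_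
  change (nerveCan J _ _ ≫ (nerve J).map _ ≫ (nerveTriCanIso J _ _).inv) ≫ _ = _
  simp only [Category.assoc, nerveTriCanIso_inv_comp_assoc, Functor.map_comp]

omit [MonoidalCategory E] [Duoidal E] [TensorDense J] [TriDense J] in
lemma eval_whisker {X : E} {P Q : D.Day} (a : X ⟶ R.obj P) (f : P ⟶ Q) :
    ((nerve J).map a ≫ (e.val P).hom) ≫ Functor.whiskerLeft e.functor.op f
      = (nerve J).map (a ≫ R.map f) ≫ (e.val Q).hom := by
  refine (Category.assoc _ _ _).trans ((congrArg (_ ≫ ·) (e.val_naturality f).symm).trans ?_)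
  rw [(nerve J).map_comp, Category.assoc]

lemma eval_psi₀ : (nerveProduoidalData J).psi₀ ≫
      (l.evalSeq e).tensor.conv (l.evalPar e).unit (l.evalPar e).unit
    = (l.evalPar e).unit ≫ Functor.whiskerLeft e.functor.op D.psi₀ := by
  refine Eq.trans ?_ (eval_whisker e l.ε (P := 𝟙_ D.Day) (Q := tri (𝟙_ D.Day) (𝟙_ D.Day))
    D.psi₀).symm
  have h := congrArg (fun k => (nerve J).map k ≫ (e.val _).hom) l.psi₀
  refine Eq.trans ?_ h
  refine (congrArg (_ ≫ ·) (l.evalSeq_conv_id e l.ε l.ε)).trans ?_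
  change ((nerve J).map _ ≫ (nerveTriCanIso J _ _).inv) ≫ _ = _
  simp only [Category.assoc, nerveTriCanIso_inv_comp_assoc, Functor.map_comp]

lemma eval_phi₂ : (nerveProduoidalData J).phi₂ ≫ (l.evalSeq e).unit
    = (l.evalPar e).tensor.conv (l.evalSeq e).unit (l.evalSeq e).unit ≫
      Functor.whiskerLeft e.functor.op D.phi₂ := by
  refine Eq.trans ?_ (l.evalPar_conv e l.ζ l.ζ D.phi₂).symm
  have h := congrArg (fun k => nerveCan J _ _ ≫ (nerve J).map k ≫ (e.val _).hom) l.phi₂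
  refine Eq.trans ?_ h
  change (nerveCan J _ _ ≫ (nerve J).map _) ≫ (nerve J).map l.ζ ≫ _ = _
  simp only [Category.assoc, Functor.map_comp]
  rfl

lemma eval_phi₀ : (nerveProduoidalData J).phi₀ ≫ (l.evalSeq e).unit
    = (l.evalPar e).unit ≫ Functor.whiskerLeft e.functor.op D.phi₀ := by
  refine Eq.trans ?_ (eval_whisker e l.ε (P := 𝟙_ D.Day) (Q := triUnit) D.phi₀).symm
  have h := congrArg (fun k => (nerve J).map k ≫ (e.val _).hom) l.phi₀
  refine Eq.trans ?_ h
  rw [(nerve J).map_comp, Category.assoc]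
  rfl

/-- The functor that evaluation induces, as a produoidal functor. -/
noncomputable def produoidal : ProduoidalFunctor (nerveProduoidal J) D where
  toFunctor := e.functor
  par := l.evalPar e
  seq := l.evalSeq e
  map_psi₂ := l.eval_psi₂ e
  map_psi₀ := l.eval_psi₀ e
  map_phi₂ := l.eval_phi₂ e
  map_phi₀ := l.eval_phi₀ e

end LaxDuoidal

end Produoidal

end

/-! ### Produoidal functors preserve associators, unitors and laxators of arbitrary composites. -/

section

namespace Produoidal

section

variable {V W : Type u} [SmallCategory V] [SmallCategory W] {F : V ⥤ W}

lemma exists_yonedaMap {X : V} {P : Psh W} (a : yo X ⟶ F.op ⋙ P) :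
    ∃ p : yo (F.obj X) ⟶ P, yonedaMap F X ≫ Functor.whiskerLeft F.op p = a := by
  refine ⟨el (a.app (op X) (𝟙 X)), yo_hom_ext ?_⟩
  change P.map (F.map (𝟙 X)).op _ = _
  simp

lemma SplitMap.conv_yonedaMap {T : Profunctor.{u} (V × V) V} {T' : Profunctor.{u} (W × W) W}
    (τ : SplitMap F T T') (X Y : V) :
    τ.conv (yonedaMap F X) (yonedaMap F Y) ≫
        Functor.whiskerLeft F.op (conv.reduce (F.obj X) (F.obj Y))
      = conv.reduce X Y ≫ τ.app X Y := by
  refine conv.hom_ext fun {A B} f g => ?_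
  refine Eq.trans ?_ (τ.naturality f g).symm
  rfl

namespace PromonoidalFunctor

variable {M : Promonoidal V} {M' : Promonoidal W} (f : PromonoidalFunctor F M M')

/-- The axiom `map_assoc`, after the Yoneda reductions that identify composites of representables
with splits. -/
lemma conv_assoc_yonedaMap (X Y Z : V) :
    M.assocHom (yo X) (yo Y) (yo Z) ≫
        f.tensor.conv (yonedaMap F X) (f.tensor.conv (yonedaMap F Y) (yonedaMap F Z))
      = f.tensor.conv (f.tensor.conv (yonedaMap F X) (yonedaMap F Y)) (yonedaMap F Z) ≫
        Functor.whiskerLeft F.op (M'.assocHom _ _ _) := by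
  have : IsIso (conv.map (T := M'.tensor) (𝟙 (yo (F.obj X)))
      (conv.reduce (T := M'.tensor) (F.obj Y) (F.obj Z))) :=
    (conv.mapIso (T := M'.tensor) (Iso.refl _)
      (conv.reduceIso (T := M'.tensor) (F.obj Y) (F.obj Z))).isIso_hom
  rw [← cancel_mono (Functor.whiskerLeft F.op (conv.map (T := M'.tensor) (𝟙 (yo (F.obj X)))
    (conv.reduce (T := M'.tensor) (F.obj Y) (F.obj Z))))]
  rw [Category.assoc, Category.assoc, ← Functor.whiskerLeft_comp, M'.assocHom_reduce,
    Functor.whiskerLeft_comp, SplitMap.conv_map, SplitMap.conv_map_assoc, Functor.whiskerLeft_id',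
    Functor.whiskerLeft_id', SplitMap.conv_yonedaMap, SplitMap.conv_yonedaMap]
  erw [Category.comp_id, Category.comp_id]
  have h (Z : V) : yonedaMap F Z = 𝟙 _ ≫ yonedaMap F Z := (Category.id_comp _).symm
  rw [h X, h Z, ← SplitMap.map_conv, ← SplitMap.map_conv, Category.assoc, M.assocHom_reduce_assoc,
    f.map_assoc]

/-- On the cover by representables each map factors through `yonedaMap`, and the second factor
passes through the associator by naturality. -/
lemma conv_assoc {P Q R : Psh V} {P' Q' R' : Psh W} (a : P ⟶ F.op ⋙ P') (b : Q ⟶ F.op ⋙ Q')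
    (c : R ⟶ F.op ⋙ R') :
    M.assocHom P Q R ≫ f.tensor.conv a (f.tensor.conv b c)
      = f.tensor.conv (f.tensor.conv a b) c ≫ Functor.whiskerLeft F.op (M'.assocHom _ _ _) := by
  refine (((covers_el P).conv (covers_el Q)).conv (covers_el R)).hom_ext ?_
  rintro ⟨⟨⟨X, p⟩, ⟨Y, q⟩⟩, ⟨Z, r⟩⟩
  dsimp only
  rw [M.assocHom_naturality_assoc, SplitMap.map_conv, SplitMap.map_conv, SplitMap.map_conv_assoc,
    SplitMap.map_conv]
  obtain ⟨p', hp⟩ := exists_yonedaMap (p ≫ a)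
  obtain ⟨q', hq⟩ := exists_yonedaMap (q ≫ b)
  obtain ⟨r', hr⟩ := exists_yonedaMap (r ≫ c)
  rw [← hp, ← hq, ← hr, ← SplitMap.conv_map, ← SplitMap.conv_map, ← SplitMap.conv_map,
    ← SplitMap.conv_map, reassoc_of% f.conv_assoc_yonedaMap, Category.assoc,
    ← Functor.whiskerLeft_comp, ← Functor.whiskerLeft_comp, M'.assocHom_naturality]

lemma conv_left {P : Psh V} {P' : Psh W} (a : P ⟶ F.op ⋙ P') :
    M.leftHom P ≫ a = f.tensor.conv f.unit a ≫ Functor.whiskerLeft F.op (M'.leftHom P') := by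
  refine ((covers_id M.unit).conv (covers_el P)).hom_ext ?_
  rintro ⟨⟨⟩, ⟨X, p⟩⟩
  dsimp only
  obtain ⟨p', hp⟩ := exists_yonedaMap (p ≫ a)
  refine (M.leftHom_naturality_assoc p a).trans ?_
  have h := f.map_left X
  rw [← M.leftHom_yo, ← M'.leftHom_yo] at h
  rw [SplitMap.map_conv_assoc, ← hp, reassoc_of% h, ← Functor.whiskerLeft_comp,
    ← M'.leftHom_naturality, Functor.whiskerLeft_comp, SplitMap.conv_map_assoc]
  rfl

lemma conv_right {P : Psh V} {P' : Psh W} (a : P ⟶ F.op ⋙ P') :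
    M.rightHom P ≫ a = f.tensor.conv a f.unit ≫ Functor.whiskerLeft F.op (M'.rightHom P') := by
  refine ((covers_el P).conv (covers_id M.unit)).hom_ext ?_
  rintro ⟨⟨X, p⟩, ⟨⟩⟩
  dsimp only
  obtain ⟨p', hp⟩ := exists_yonedaMap (p ≫ a)
  refine (M.rightHom_naturality_assoc p a).trans ?_
  have h := f.map_right X
  rw [← M.rightHom_yo, ← M'.rightHom_yo] at h
  rw [SplitMap.map_conv_assoc, ← hp, reassoc_of% h, ← Functor.whiskerLeft_comp,
    ← M'.rightHom_naturality, Functor.whiskerLeft_comp, SplitMap.conv_map_assoc]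
  rfl

end PromonoidalFunctor

namespace ProduoidalFunctor

variable {D : ProduoidalStruct V} {E : ProduoidalStruct W} (f : ProduoidalFunctor D E)

lemma conv_psi_yonedaMap (X Y Z Z' : V) :
    D.psi (yo X) (yo Y) (yo Z) (yo Z') ≫ f.seq.tensor.conv
        (f.par.tensor.conv (yonedaMap f.toFunctor X) (yonedaMap f.toFunctor Z))
        (f.par.tensor.conv (yonedaMap f.toFunctor Y) (yonedaMap f.toFunctor Z'))
      = f.par.tensor.conv
          (f.seq.tensor.conv (yonedaMap f.toFunctor X) (yonedaMap f.toFunctor Y))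
          (f.seq.tensor.conv (yonedaMap f.toFunctor Z) (yonedaMap f.toFunctor Z')) ≫
        Functor.whiskerLeft f.toFunctor.op (E.psi _ _ _ _) := by
  have : IsIso (conv.map (T := E.seq.tensor)
      (conv.reduce (T := E.par.tensor) (f.toFunctor.obj X) (f.toFunctor.obj Z))
      (conv.reduce (T := E.par.tensor) (f.toFunctor.obj Y) (f.toFunctor.obj Z'))) :=
    (conv.mapIso (T := E.seq.tensor) (conv.reduceIso _ _) (conv.reduceIso _ _)).isIso_hom
  rw [← cancel_mono (Functor.whiskerLeft f.toFunctor.op (conv.map (T := E.seq.tensor)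
      (conv.reduce (T := E.par.tensor) (f.toFunctor.obj X) (f.toFunctor.obj Z))
      (conv.reduce (T := E.par.tensor) (f.toFunctor.obj Y) (f.toFunctor.obj Z'))))]
  rw [Category.assoc, Category.assoc, ← Functor.whiskerLeft_comp, E.psi_reduce,
    Functor.whiskerLeft_comp, SplitMap.conv_map, SplitMap.conv_map_assoc,
    SplitMap.conv_yonedaMap, SplitMap.conv_yonedaMap, SplitMap.conv_yonedaMap,
    SplitMap.conv_yonedaMap, ← SplitMap.map_conv, ← SplitMap.map_conv, Category.assoc,
    D.psi_reduce_assoc, f.map_psi₂]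

lemma conv_psi {P Q R S : Psh V} {P' Q' R' S' : Psh W} (a : P ⟶ f.toFunctor.op ⋙ P')
    (b : Q ⟶ f.toFunctor.op ⋙ Q') (c : R ⟶ f.toFunctor.op ⋙ R') (d : S ⟶ f.toFunctor.op ⋙ S') :
    D.psi P Q R S ≫ f.seq.tensor.conv (f.par.tensor.conv a c) (f.par.tensor.conv b d)
      = f.par.tensor.conv (f.seq.tensor.conv a b) (f.seq.tensor.conv c d) ≫
        Functor.whiskerLeft f.toFunctor.op (E.psi P' Q' R' S') := by
  refine (((covers_el P).conv (covers_el Q)).conv ((covers_el R).conv (covers_el S))).hom_ext ?_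
  rintro ⟨⟨⟨X, p⟩, ⟨Y, q⟩⟩, ⟨⟨Z, r⟩, ⟨Z', s⟩⟩⟩
  dsimp only
  rw [D.psi_naturality_assoc, SplitMap.map_conv, SplitMap.map_conv, SplitMap.map_conv,
    SplitMap.map_conv_assoc, SplitMap.map_conv, SplitMap.map_conv]
  obtain ⟨p', hp⟩ := exists_yonedaMap (p ≫ a)
  obtain ⟨q', hq⟩ := exists_yonedaMap (q ≫ b)
  obtain ⟨r', hr⟩ := exists_yonedaMap (r ≫ c)
  obtain ⟨s', hs⟩ := exists_yonedaMap (s ≫ d)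
  rw [← hp, ← hq, ← hr, ← hs, ← SplitMap.conv_map, ← SplitMap.conv_map, ← SplitMap.conv_map,
    ← SplitMap.conv_map, ← SplitMap.conv_map, ← SplitMap.conv_map,
    reassoc_of% f.conv_psi_yonedaMap, Category.assoc,
    ← Functor.whiskerLeft_comp, ← Functor.whiskerLeft_comp, E.psi_naturality]

end ProduoidalFunctor

end

end Produoidal

end

/-! ### Restriction of presheaves, and extension to the normalization. -/

section

namespace Produoidal

open MonoidalCategory Duoidal BimodTensor

section ProduoidalFunctorExt

variable {V W : Type u} [SmallCategory V] [SmallCategory W] {D : ProduoidalStruct V}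
  {E : ProduoidalStruct W}

/-- Heterogeneous equalities are needed because the targets of all the maps depend on the action on
objects, which is only propositionally equal. -/
lemma ProduoidalFunctor.ext_of_heq {F G : ProduoidalFunctor D E}
    (hobj : F.toFunctor.obj = G.toFunctor.obj)
    (hmap : ∀ {A B : V} (f : A ⟶ B), F.toFunctor.map f ≍ G.toFunctor.map f)
    (hpar : ∀ (X Y A : V) (s : (D.par.tensor.obj (X, Y)).obj (op A)),
      (F.par.tensor.app X Y).app (op A) s ≍ (G.par.tensor.app X Y).app (op A) s)
    (hparUnit : ∀ (A : V) (s : D.par.unit.obj (op A)),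
      F.par.unit.app (op A) s ≍ G.par.unit.app (op A) s)
    (hseq : ∀ (X Y A : V) (s : (D.seq.tensor.obj (X, Y)).obj (op A)),
      (F.seq.tensor.app X Y).app (op A) s ≍ (G.seq.tensor.app X Y).app (op A) s)
    (hseqUnit : ∀ (A : V) (s : D.seq.unit.obj (op A)),
      F.seq.unit.app (op A) s ≍ G.seq.unit.app (op A) s) : F = G := by
  obtain ⟨F, fpar, fseq, _, _, _, _⟩ := F
  obtain ⟨G, gpar, gseq, _, _, _, _⟩ := G
  have h : F = G := CategoryTheory.Functor.hext (fun X => congrFun hobj X) fun _ _ f => hmap f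
  subst h
  have h₁ : fpar = gpar := PromonoidalFunctor.ext
    (SplitMap.ext (funext fun X => funext fun Y => NatTrans.ext (funext fun A =>
      ConcreteCategory.hom_ext _ _ fun s => eq_of_heq (hpar X Y A.unop s))))
    (NatTrans.ext (funext fun A => ConcreteCategory.hom_ext _ _ fun s =>
      eq_of_heq (hparUnit A.unop s)))
  have h₂ : fseq = gseq := PromonoidalFunctor.ext
    (SplitMap.ext (funext fun X => funext fun Y => NatTrans.ext (funext fun A =>
      ConcreteCategory.hom_ext _ _ fun s => eq_of_heq (hseq X Y A.unop s))))
    (NatTrans.ext (funext fun A => ConcreteCategory.hom_ext _ _ fun s =>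
      eq_of_heq (hseqUnit A.unop s)))
  subst h₁ h₂
  rfl

end ProduoidalFunctorExt

section

variable {V W : Type u} [SmallCategory V] [SmallCategory W] {D : ProduoidalStruct V}
  {E : ProduoidalStruct W} (F : ProduoidalFunctor D E)

/-- Restriction of presheaves along a produoidal functor. -/
def restrict : E.Day ⥤ D.Day := (Functor.whiskeringLeft _ _ (Type u)).obj F.toFunctor.op

section

variable {F : V ⥤ W}

lemma SplitMap.conv_id_naturality {T : Profunctor.{u} (V × V) V} {T' : Profunctor.{u} (W × W) W}
    (τ : SplitMap F T T') {P P' Q Q' : Psh W} (f : P ⟶ P') (g : Q ⟶ Q') :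
    conv.map (Functor.whiskerLeft F.op f) (Functor.whiskerLeft F.op g) ≫
        τ.conv (𝟙 (F.op ⋙ P')) (𝟙 (F.op ⋙ Q'))
      = τ.conv (𝟙 (F.op ⋙ P)) (𝟙 (F.op ⋙ Q)) ≫ Functor.whiskerLeft F.op (conv.map f g) := by
  rw [τ.map_conv, τ.conv_map]
  rfl

variable {M : Promonoidal V} {M' : Promonoidal W} (f : PromonoidalFunctor F M M')

/-- The action on composites of restricted presheaves. -/
def PromonoidalFunctor.mul (P Q : Psh W) : M.conv (F.op ⋙ P) (F.op ⋙ Q) ⟶ F.op ⋙ M'.conv P Q :=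
  f.tensor.conv (𝟙 (F.op ⋙ P)) (𝟙 (F.op ⋙ Q))

lemma PromonoidalFunctor.map_mul {P Q : Psh V} {P' Q' : Psh W} (a : P ⟶ F.op ⋙ P')
    (b : Q ⟶ F.op ⋙ Q') : conv.map a b ≫ f.mul P' Q' = f.tensor.conv a b := by
  rw [mul, f.tensor.map_conv, Category.comp_id, Category.comp_id]

lemma PromonoidalFunctor.mul_naturality {P P' Q Q' : Psh W} (a : P ⟶ P') (b : Q ⟶ Q') :
    conv.map (Functor.whiskerLeft F.op a) (Functor.whiskerLeft F.op b) ≫ f.mul P' Q'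
      = f.mul P Q ≫ Functor.whiskerLeft F.op (conv.map a b) :=
  f.tensor.conv_id_naturality a b

lemma PromonoidalFunctor.mul_assoc (P Q R : Psh W) :
    conv.map (f.mul P Q) (𝟙 (F.op ⋙ R)) ≫ f.mul (M'.conv P Q) R ≫
        Functor.whiskerLeft F.op (M'.assocHom P Q R)
      = M.assocHom _ _ _ ≫ conv.map (𝟙 (F.op ⋙ P)) (f.mul Q R) ≫ f.mul P (M'.conv Q R) := by
  rw [← Category.assoc, map_mul, map_mul]
  exact (f.conv_assoc _ _ _).symm

lemma PromonoidalFunctor.mul_left (P : Psh W) :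
    conv.map f.unit (𝟙 (F.op ⋙ P)) ≫ f.mul M'.unit P ≫ Functor.whiskerLeft F.op (M'.leftHom P)
      = M.leftHom (F.op ⋙ P) := by
  rw [← Category.assoc, map_mul, ← f.conv_left, Category.comp_id]

lemma PromonoidalFunctor.mul_right (P : Psh W) :
    conv.map (𝟙 (F.op ⋙ P)) f.unit ≫ f.mul P M'.unit ≫ Functor.whiskerLeft F.op (M'.rightHom P)
      = M.rightHom (F.op ⋙ P) := by
  rw [← Category.assoc, map_mul, ← f.conv_right, Category.comp_id]

end

lemma ProduoidalFunctor.mul_psi (P Q R S : Psh W) :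
    D.psi (F.toFunctor.op ⋙ P) (F.toFunctor.op ⋙ Q) (F.toFunctor.op ⋙ R) (F.toFunctor.op ⋙ S) ≫
        conv.map (F.par.mul P R) (F.par.mul Q S) ≫ F.seq.mul _ _
      = conv.map (F.seq.mul P Q) (F.seq.mul R S) ≫ F.par.mul _ _ ≫
        Functor.whiskerLeft F.toFunctor.op (E.psi P Q R S) := by
  rw [PromonoidalFunctor.map_mul, ← Category.assoc (conv.map _ _), PromonoidalFunctor.map_mul]
  exact F.conv_psi _ _ _ _

/-- Restriction of presheaves along a produoidal functor is lax duoidal. -/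
def restrictLax : LaxDuoidal (restrict F) where
  μ P Q := F.par.mul P Q
  ε := F.par.unit
  ν P Q := F.seq.mul P Q
  ζ := F.seq.unit
  μ_naturality f g := F.par.mul_naturality f g
  μ_assoc P Q R := F.par.mul_assoc P Q R
  μ_left P := F.par.mul_left P
  μ_right P := F.par.mul_right P
  ν_naturality f g := F.seq.mul_naturality f g
  ν_assoc P Q R := F.seq.mul_assoc P Q R
  ν_left P := F.seq.mul_left P
  ν_right P := F.seq.mul_right P
  psi P Q R S := F.mul_psi P Q R S
  psi₀ := (congrArg (_ ≫ ·) (F.seq.map_mul _ _)).trans F.map_psi₀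
  phi₂ := F.map_phi₂.trans ((congrArg (· ≫ _) (F.par.map_mul F.seq.unit F.seq.unit).symm).trans
    (Category.assoc _ _ _))
  phi₀ := F.map_phi₀

section Extension

variable [Normal E.Day]

/-- The bimodule structure on the restriction of a presheaf. -/
noncomputable def restrictDay : E.Day ⥤ NBimod D.Day := (restrictLax F).liftFunctor

/-- `restrictDay`, as a functor of presheaves. -/
noncomputable def restrictBimod : Psh W ⥤ NBimod D.Day := restrictDay F

/-- The restriction of presheaves, as bimodules, is lax duoidal. -/
noncomputable def restrictDayLax : LaxDuoidal (restrictDay F) := (restrictLax F).lift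

/-- The underlying presheaf of `restrictBimod`. -/
noncomputable def restrictBimodIso (P : Psh W) :
    (forgetN D).obj ((restrictBimod F).obj P) ≅ F.toFunctor.op ⋙ P :=
  Iso.refl _

/-- Maps from a free bimodule to the restriction of a presheaf are elements of the presheaf. -/
noncomputable def restrictEquiv (A : V) (P : Psh W) :
    ((freeN D).obj (yo A) ⟶ (restrictBimod F).obj P) ≃ P.obj (op (F.toFunctor.obj A)) :=
  ((freeNAdj D).homEquiv (yo A) ((restrictBimod F).obj P)).trans
    (yonedaEquiv (F := F.toFunctor.op ⋙ P))

/-- Evaluation at the images of objects under a produoidal functor. -/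
noncomputable def restrictEval : Evaluation (W := W) (freeFamily (freeN D)) (restrictBimod F) where
  obj := F.toFunctor.obj
  equiv := restrictEquiv F
  equiv_naturality {A P Q} g f := by
    have h := congrArg yonedaEquiv
      ((freeNAdj D).homEquiv_naturality_right g ((restrictBimod F).map f))
    exact h.trans (yonedaEquiv_comp _ _)

/-- The extension of a produoidal functor to the normalization. -/
noncomputable def extension : ProduoidalFunctor (normalization D).str E :=
  (restrictDayLax F).produoidal (restrictEval F)

/-- The generic element of a representable presheaf. -/
noncomputable def restrictGen (A : V) :
    (freeN D).obj (yo A) ⟶ (restrictBimod F).obj (yo (F.toFunctor.obj A)) :=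
  (restrictEval F).gen A

/-- The generic element corresponds to the identity of FA. As a map of presheaves that element is
the action of F on morphisms into A. -/
lemma freeUnit_restrictGen (A : V) :
    freeUnit (freeNAdj D) A ≫ (forgetN D).map (restrictGen F A) ≫ (restrictBimodIso F _).hom
      = yonedaMap F.toFunctor A := by
  have h : (freeNAdj D).homEquiv (yo A) ((restrictBimod F).obj (yo (F.toFunctor.obj A)))
      (restrictGen F A) = yonedaMap F.toFunctor A := by
    refine yonedaEquiv.injective (((restrictEval F).equiv_gen A).trans ?_)
    exact (F.toFunctor.map_id A).symm
  rw [Adjunction.homEquiv_unit] at h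
  exact h

lemma restrictBimodIso_naturality {P Q : Psh W} (f : P ⟶ Q) :
    (forgetN D).map ((restrictBimod F).map f) ≫ (restrictBimodIso F Q).hom
      = (restrictBimodIso F P).hom ≫ Functor.whiskerLeft F.toFunctor.op f :=
  (Category.comp_id _).trans (Category.id_comp _).symm

/-- The structure map of `restrictBimod` for `⊗`. -/
noncomputable def restrictMu (P Q : Psh W) : (restrictBimod F).obj P ⊗ (restrictBimod F).obj Q ⟶
    (restrictBimod F).obj (E.otimes P Q) :=
  (restrictDayLax F).μ P Q

/-- The structure map of `restrictBimod` for `◁`. -/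
noncomputable def restrictNu (P Q : Psh W) :
    tri ((restrictBimod F).obj P) ((restrictBimod F).obj Q) ⟶ (restrictBimod F).obj (E.tri P Q) :=
  (restrictDayLax F).ν P Q

/-- The lifted structure map is defined by descent along the quotient to the tensor product over N,
so composing with the quotient returns the action of F on composites. -/
lemma forgetPar_restrictMu (P Q : Psh W) :
    (forgetPar D).μ _ _ ≫ (forgetN D).map (restrictMu F P Q) ≫ (restrictBimodIso F _).hom
      = conv.map (restrictBimodIso F P).hom (restrictBimodIso F Q).hom ≫ F.par.mul P Q := by
  refine ((restrictLax F).π_liftMu P Q).trans ?_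
  exact ((congrArg (· ≫ F.par.mul P Q) (conv.map_id (T := D.par.tensor) _ _)).trans
    (Category.id_comp _)).symm

lemma forgetPar_restrictMu_assoc : type_of% (reassoc_of% @forgetPar_restrictMu) :=
  @(reassoc_of% @forgetPar_restrictMu)

lemma forgetSeq_restrictNu (P Q : Psh W) :
    (forgetLax D).triμ _ _ ≫ (forgetN D).map (restrictNu F P Q) ≫ (restrictBimodIso F _).hom
      = conv.map (restrictBimodIso F P).hom (restrictBimodIso F Q).hom ≫ F.seq.mul P Q := by
  refine (Category.id_comp _).trans ?_
  exact ((congrArg (· ≫ F.seq.mul P Q) (conv.map_id (T := D.seq.tensor) _ _)).trans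
    (Category.id_comp _)).symm

lemma forgetSeq_restrictNu_assoc : type_of% (reassoc_of% @forgetSeq_restrictNu) :=
  @(reassoc_of% @forgetSeq_restrictNu)

lemma _root_.Produoidal.PromonoidalFunctor.ι_mul {F : V ⥤ W} {M : Promonoidal V}
    {M' : Promonoidal W} (f : PromonoidalFunctor F M M') (X Y : V) :
    conv.ι (P := yo X) (Q := yo Y) (𝟙 X) (𝟙 Y) ≫
        conv.map (yonedaMap F X) (yonedaMap F Y) ≫ f.mul _ _ ≫
        Functor.whiskerLeft F.op (conv.reduce _ _) = f.tensor.app X Y := by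
  rw [← Category.assoc (conv.map _ _), f.map_mul, SplitMap.conv_yonedaMap]
  exact (conv.reduceIso X Y).inv_hom_id_assoc _

/-- The extension to the normalization, on parallel splits. -/
noncomputable def restrictPar (X Y : V) : (freeN D).obj (yo X) ⊗ (freeN D).obj (yo Y) ⟶
    (restrictBimod F).obj (E.par.tensor.obj (F.toFunctor.obj X, F.toFunctor.obj Y)) :=
  (restrictGen F X ⊗ₘ restrictGen F Y) ≫ restrictMu F _ _ ≫
    (restrictBimod F).map (conv.reduce _ _)

/-- The extension to the normalization, on sequential splits. -/
noncomputable def restrictSeq (X Y : V) : tri ((freeN D).obj (yo X)) ((freeN D).obj (yo Y)) ⟶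
    (restrictBimod F).obj (E.seq.tensor.obj (F.toFunctor.obj X, F.toFunctor.obj Y)) :=
  triMap (restrictGen F X) (restrictGen F Y) ≫ restrictNu F _ _ ≫
    (restrictBimod F).map (conv.reduce _ _)

lemma triμ_naturality {M M' L L' : NBimod D.Day} (f : M ⟶ M') (g : L ⟶ L') :
    conv.map ((forgetN D).map f) ((forgetN D).map g) ≫ (forgetLax D).triμ M' L'
      = (forgetLax D).triμ M L ≫ (forgetN D).map (triMap f g) :=
  (Category.comp_id _).trans (Category.id_comp _).symm

/-- A split of V goes to the same split with two generators plugged in. The extension sends the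
generators to generic elements, and what is left is the action of F on the split. -/
lemma splitApp_restrictPar (X Y : V) :
    (forgetPar D).splitApp (freeNAdj D) X Y ≫
      Functor.whiskerLeft (freeFunctor (freeN D)).op ((nerve (freeFamily (freeN D))).map
        (restrictPar F X Y)) ≫ (nerveRestrict (freeNAdj D) _).hom ≫ (restrictBimodIso F _).hom
      = F.par.tensor.app X Y := by
  rw [← F.par.ι_mul, nerveRestrict_naturality_assoc, LaxToDay.splitApp_nerveRestrict_assoc,
    ← freeUnit_restrictGen, ← freeUnit_restrictGen, conv.map_comp, conv.map_comp, restrictPar,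
    (forgetN D).map_comp, (forgetN D).map_comp]
  simp only [Category.assoc]
  rw [restrictBimodIso_naturality, ← forgetPar_restrictMu_assoc, (forgetPar D).μ_naturality_assoc]

lemma seqApp_restrictSeq (X Y : V) :
    (forgetLax D).seqApp (freeNAdj D) X Y ≫
      Functor.whiskerLeft (freeFunctor (freeN D)).op ((nerve (freeFamily (freeN D))).map
        (restrictSeq F X Y)) ≫ (nerveRestrict (freeNAdj D) _).hom ≫ (restrictBimodIso F _).hom
      = F.seq.tensor.app X Y := by
  rw [← F.seq.ι_mul, nerveRestrict_naturality_assoc, ← Category.assoc, LaxToDuoidalDay.freeSeq_app,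
    ← freeUnit_restrictGen, ← freeUnit_restrictGen, conv.map_comp, conv.map_comp, restrictSeq,
    (forgetN D).map_comp, (forgetN D).map_comp]
  simp only [Category.assoc]
  rw [restrictBimodIso_naturality, ← forgetSeq_restrictNu_assoc,
    reassoc_of% triμ_naturality (D := D)]

/-- The structure map of `restrictBimod` on the unit of `⊗`. -/
noncomputable def restrictEps : 𝟙_ (NBimod D.Day) ⟶ (restrictBimod F).obj E.I :=
  (restrictDayLax F).ε

/-- The structure map of `restrictBimod` on the unit of `◁`. -/
noncomputable def restrictZeta : (triUnit : NBimod D.Day) ⟶ (restrictBimod F).obj E.N :=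
  (restrictDayLax F).ζ

lemma parUnit_restrictEps :
    ((forgetPar D).freePromonoidal (freeNAdj D)).unit ≫
      Functor.whiskerLeft (freeFunctor (freeN D)).op ((nerve (freeFamily (freeN D))).map
        (restrictEps F)) ≫ (nerveRestrict (freeNAdj D) _).hom ≫ (restrictBimodIso F _).hom
      = F.par.unit := by
  -- The lifted unit map is ζ followed by the image of φ₀⁻¹; preceded by φ₀ it becomes ε followed by
  -- φ₀ and φ₀⁻¹.
  have h : D.phi₀ ≫ (forgetN D).map (restrictEps F) ≫ (restrictBimodIso F E.I).hom
      = F.par.unit := by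
    refine (congrArg (D.phi₀ ≫ ·) (Category.comp_id _)).trans
      (((restrictLax F).phi₀_assoc ((restrict F).map (inv Duoidal.phi₀))).trans ?_)
    rw [← (restrict F).map_comp, IsIso.hom_inv_id, (restrict F).map_id]
    exact Category.comp_id _
  rw [nerveRestrict_naturality_assoc]
  refine ((forgetLax D).freePar_unit_assoc (freeNAdj D) _).trans h

lemma seqUnit_restrictZeta :
    ((forgetLax D).freeSeq (freeNAdj D)).unit ≫
      Functor.whiskerLeft (freeFunctor (freeN D)).op ((nerve (freeFamily (freeN D))).map
        (restrictZeta F)) ≫ (nerveRestrict (freeNAdj D) _).hom ≫ (restrictBimodIso F _).hom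
      = F.seq.unit := by
  rw [nerveRestrict_naturality_assoc]
  refine (Category.assoc _ _ _).symm.trans ((congrArg (· ≫ _)
    ((forgetLax D).freeSeq_unit (freeNAdj D))).trans ?_)
  exact (Category.id_comp _).trans (Category.comp_id _)

end Extension

end

end Produoidal

end

/-! ### The extension restricts to the given functor. -/

section

namespace Produoidal

open MonoidalCategory Duoidal BimodTensor

section

variable {V W : Type u} [SmallCategory V] [SmallCategory W] {D : ProduoidalStruct V}
  {E : ProduoidalStruct W} (F : ProduoidalFunctor D E) [Normal E.Day]

lemma extension_map {A B : V} (f : A ⟶ B) :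
    (restrictEval F).mapHom ((freeN D).map (yoneda.map f)) = F.toFunctor.map f := by
  have h₁ := congrArg yonedaEquiv ((freeNAdj D).homEquiv_naturality_left (yoneda.map f)
    (restrictGen F B))
  refine h₁.trans ?_
  have h₂ := congrArg (fun k => k.app (op A) f) (freeUnit_restrictGen F B)
  have h₃ : (freeNAdj D).homEquiv (yo B) _ (restrictGen F B)
      = freeUnit (freeNAdj D) B ≫ (forgetN D).map (restrictGen F B) :=
    Adjunction.homEquiv_unit _ _ _ _
  rw [h₃]
  have h₄ : (yoneda.map f).app (op A) (𝟙 A) = f := Category.id_comp f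
  exact (congrArg ((freeUnit (freeNAdj D) B ≫ (forgetN D).map (restrictGen F B)).app (op A))
    h₄).trans h₂

/-- The extension to the normalization restricts to the given functor. -/
lemma normalizationUnit_comp_extension : (normalizationUnit D).comp (extension F) = F :=
  ProduoidalFunctor.ext_of_heq rfl (fun f => heq_of_eq (extension_map F f))
    (fun X Y A s => heq_of_eq (congrArg (fun k => k.app (op A) s) (splitApp_restrictPar F X Y)))
    (fun A s => heq_of_eq (congrArg (fun k => k.app (op A) s) (parUnit_restrictEps F)))
    (fun X Y A s => heq_of_eq (congrArg (fun k => k.app (op A) s) (seqApp_restrictSeq F X Y)))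
    (fun A s => heq_of_eq (congrArg (fun k => k.app (op A) s) (seqUnit_restrictZeta F)))

end

end Produoidal

end

/-! ### Uniqueness: functors out of the normalization are determined on `V`. -/

section

namespace Produoidal

section

variable {V W : Type u} [SmallCategory V] [SmallCategory W] {D : ProduoidalStruct V}
  {E : ProduoidalStruct W} (F : ProduoidalFunctor D E)

section

variable [IsIso D.phi₀] [IsIso E.phi₀]

lemma ProduoidalFunctor.seq_unit_inv_phi₀ :
    F.seq.unit ≫ Functor.whiskerLeft F.toFunctor.op (inv E.phi₀) = inv D.phi₀ ≫ F.par.unit := by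
  rw [IsIso.eq_inv_comp, ← Category.assoc, F.map_phi₀, Category.assoc, ← Functor.whiskerLeft_comp,
    IsIso.hom_inv_id, Functor.whiskerLeft_id', Category.comp_id]

lemma ProduoidalFunctor.conv_inv_phi₀ {P Q : Psh V} {Q' R' : Psh W} {a : P ⟶ F.toFunctor.op ⋙ Q'}
    {r : Q' ⟶ R'} {k : P ⟶ Q} {b : Q ⟶ F.toFunctor.op ⋙ R'}
    (h : a ≫ Functor.whiskerLeft F.toFunctor.op r = k ≫ b) :
    F.par.tensor.conv F.seq.unit a ≫ Functor.whiskerLeft F.toFunctor.op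
        (conv.map (inv E.phi₀) r ≫ E.par.leftHom R')
      = (conv.map (inv D.phi₀) k ≫ D.par.leftHom Q) ≫ b := by
  rw [Functor.whiskerLeft_comp, SplitMap.conv_map_assoc, h, F.seq_unit_inv_phi₀,
    ← SplitMap.map_conv_assoc, ← F.par.conv_left, Category.assoc]

lemma ProduoidalFunctor.conv_inv_phi₀_right {P : Psh V} {P' : Psh W}
    (a : P ⟶ F.toFunctor.op ⋙ P') :
    F.par.tensor.conv a F.seq.unit ≫ Functor.whiskerLeft F.toFunctor.op
        (conv.map (𝟙 P') (inv E.phi₀) ≫ E.par.rightHom P')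
      = (conv.map (𝟙 P) (inv D.phi₀) ≫ D.par.rightHom P) ≫ a := by
  rw [Functor.whiskerLeft_comp, SplitMap.conv_map_assoc, Functor.whiskerLeft_id', Category.comp_id,
    F.seq_unit_inv_phi₀, Category.assoc, F.par.conv_right, SplitMap.map_conv_assoc,
    Category.id_comp]

/-- Collapsing the two copies of N uses only φ₀⁻¹ and unitors, all of which F preserves. -/
lemma ProduoidalFunctor.conv_collapse {P : Psh V} {P' : Psh W} (a : P ⟶ F.toFunctor.op ⋙ P') :
    F.par.tensor.conv F.seq.unit (F.par.tensor.conv a F.seq.unit) ≫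
        Functor.whiskerLeft F.toFunctor.op (E.collapse P')
      = D.collapse P ≫ a :=
  F.conv_inv_phi₀ (F.conv_inv_phi₀_right a)

end

end

section

variable {V : PDuo.{u}} {W X : NPDuo.{u}} (η : V ⟶ W.obj) (G : W.obj ⟶ X.obj)

/-- G commutes with collapsing. Where the comparison map of η is surjective, the values of G on
morphisms are thus determined by η ≫ G. -/
lemma compareHom_comp (B : V) : compareHom (W := X) (η ≫ G) B
    = compareHom η B ≫ Functor.whiskerLeft (under η).op (yonedaMap (under G) ((under η).obj B)) := by
  refine (congrArg (· ≫ _) ((congrArg ((η ≫ G).par.tensor.conv (η ≫ G).seq.unit)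
    (SplitMap.comp_conv η.par.tensor G.par.tensor (yonedaMap (under η) B) η.seq.unit
      (yonedaMap (under G) _) G.seq.unit)).trans
    (SplitMap.comp_conv η.par.tensor G.par.tensor _ _ G.seq.unit _))).trans ?_
  refine (Category.assoc _ _ _).trans ?_
  refine Eq.trans ?_ (Category.assoc _ _ _).symm
  exact congrArg (fun k => _ ≫ Functor.whiskerLeft (under η).op k)
    (ProduoidalFunctor.conv_collapse G _)

lemma comparePar_comp (B C : V) : comparePar (W := X) (η ≫ G) B C
    = comparePar η B C ≫ Functor.whiskerLeft (under η).op
        (G.par.tensor.app ((under η).obj B) ((under η).obj C)) := by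
  refine (congrArg (· ≫ _) ((congrArg ((η ≫ G).par.tensor.conv (η ≫ G).seq.unit)
    ((congrArg ((η ≫ G).par.tensor.conv _) (compareHom_comp η G C)).trans
    (SplitMap.comp_conv η.par.tensor G.par.tensor (yonedaMap (under η) B) (compareHom η C)
      (yonedaMap (under G) _) _))).trans
    (SplitMap.comp_conv η.par.tensor G.par.tensor _ _ G.seq.unit _))).trans ?_
  refine (Category.assoc _ _ _).trans ?_
  refine Eq.trans ?_ (Category.assoc _ _ _).symm
  exact congrArg (fun k => _ ≫ Functor.whiskerLeft (under η).op k)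
    (ProduoidalFunctor.conv_inv_phi₀ G (SplitMap.conv_yonedaMap G.par.tensor _ _))

lemma compareSeq_comp (B C : V) : compareSeq (W := X) (η ≫ G) B C
    = compareSeq η B C ≫ Functor.whiskerLeft (under η).op
        (G.seq.tensor.app ((under η).obj B) ((under η).obj C)) := by
  refine (congrArg (· ≫ _) ((congrArg₂ (η ≫ G).seq.tensor.conv (compareHom_comp η G B)
    (compareHom_comp η G C)).trans
    (SplitMap.comp_conv η.seq.tensor G.seq.tensor _ _ _ _))).trans ?_
  refine (Category.assoc _ _ _).trans ?_
  refine Eq.trans ?_ (Category.assoc _ _ _).symm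
  exact congrArg (fun k => _ ≫ Functor.whiskerLeft (under η).op k)
    (SplitMap.conv_yonedaMap G.seq.tensor _ _)

lemma surjective_of_isIso {V : Type u} [SmallCategory V] {P Q : Psh V} (f : P ⟶ Q) [IsIso f]
    (A : V) : Function.Surjective (f.app (op A)) :=
  ((isIso_iff_bijective (f.app (op A))).1 inferInstance).2

variable {η} in
/-- Functors out of the normalization are determined by their restriction. -/
lemma IsNormalization.hom_ext (h : IsNormalization η) {G G' : W.obj ⟶ X.obj}
    (e : η ≫ G = η ≫ G') : G = G' := by
  have := h.hom_isIso
  have := h.par_isIso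
  have := h.seq_isIso
  have := h.unit_isIso
  -- The comparison maps depend only on the composites with η, so they agree; the types agree only
  -- after rewriting with e.
  have e₁ {A B : V} (s) : (compareHom (W := X) (η ≫ G) B).app (op A) s
      ≍ (compareHom (W := X) (η ≫ G') B).app (op A) s := by rw [e]
  have e₂ {A B C : V} (s) : (comparePar (W := X) (η ≫ G) B C).app (op A) s
      ≍ (comparePar (W := X) (η ≫ G') B C).app (op A) s := by rw [e]
  have e₃ {A B C : V} (s) : (compareSeq (W := X) (η ≫ G) B C).app (op A) s
      ≍ (compareSeq (W := X) (η ≫ G') B C).app (op A) s := by rw [e]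
  have e₄ {A : V} (s) : (η ≫ G).seq.unit.app (op A) s ≍ (η ≫ G').seq.unit.app (op A) s := by rw [e]
  have hobj : G.toFunctor.obj = G'.toFunctor.obj := funext fun B => by
    obtain ⟨B, rfl⟩ := h.obj_bijective.2 B
    exact congrArg (fun k : V ⟶ X.obj => (under k).obj B) e
  have hN (A : W.obj) (s : W.obj.str.seq.unit.obj (op A)) :
      G.seq.unit.app (op A) s ≍ G'.seq.unit.app (op A) s := by
    obtain ⟨A, rfl⟩ := h.obj_bijective.2 A
    obtain ⟨s, rfl⟩ := surjective_of_isIso η.seq.unit A s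
    exact e₄ s
  refine ProduoidalFunctor.ext_of_heq hobj (fun {A B} f => ?_) (fun B C A s => ?_) (fun A s => ?_)
    (fun B C A s => ?_) hN
  · obtain ⟨A, rfl⟩ := h.obj_bijective.2 A
    obtain ⟨B, rfl⟩ := h.obj_bijective.2 B
    obtain ⟨f, rfl⟩ := surjective_of_isIso (compareHom η B) A f
    have := e₁ f
    rw [compareHom_comp, compareHom_comp] at this
    exact this
  · obtain ⟨A, rfl⟩ := h.obj_bijective.2 A
    obtain ⟨B, rfl⟩ := h.obj_bijective.2 B
    obtain ⟨C, rfl⟩ := h.obj_bijective.2 C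
    obtain ⟨s, rfl⟩ := surjective_of_isIso (comparePar η B C) A s
    have := e₂ s
    rw [comparePar_comp, comparePar_comp] at this
    exact this
  -- Parallel units need no comparison map of their own: φ₀ is invertible on both sides and
  -- preserved, so the action on sequential units determines the action on them.
  · have h₁ (G : W.obj ⟶ X.obj) : G.par.unit.app (op A) s = (inv X.obj.str.phi₀).app _
        (G.seq.unit.app (op A) (W.obj.str.phi₀.app _ s)) := by
      have := congrArg (fun k => k.app (op A) (W.obj.str.phi₀.app _ s)) G.seq_unit_inv_phi₀
      refine Eq.trans ?_ this.symm
      have h₂ := congrArg (fun k => k.app (op A) s) (IsIso.hom_inv_id W.obj.str.phi₀)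
      exact (congrArg (G.par.unit.app (op A)) h₂).symm
    rw [h₁, h₁]
    have h₂ {B B' : X.obj} (hB : B = B') (t : X.obj.str.seq.unit.obj (op B))
        (t' : X.obj.str.seq.unit.obj (op B')) (ht : t ≍ t') :
        (inv X.obj.str.phi₀).app _ t ≍ (inv X.obj.str.phi₀).app _ t' := by
      subst hB
      rw [eq_of_heq ht]
    exact h₂ (congrFun hobj A) _ _ (hN A _)
  · obtain ⟨A, rfl⟩ := h.obj_bijective.2 A
    obtain ⟨B, rfl⟩ := h.obj_bijective.2 B
    obtain ⟨C, rfl⟩ := h.obj_bijective.2 C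
    obtain ⟨s, rfl⟩ := surjective_of_isIso (compareSeq η B C) A s
    have := e₃ s
    rw [compareSeq_comp, compareSeq_comp] at this
    exact this

end

end Produoidal

end

/-! ### The adjunction, and algebras for its monad. -/

section

namespace Produoidal

open Duoidal

instance (W : NPDuo.{u}) : Normal W.obj.str.Day where
  isIso_phi₀ := inferInstanceAs (IsIso W.obj.str.phi₀)

/-- The extension of a functor into a normal produoidal category to the normalization. -/
noncomputable def normalizationDesc {V : PDuo.{u}} {W : NPDuo.{u}} (f : V ⟶ W.obj) :
    (normalizationObj V).obj ⟶ W.obj :=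
  extension (E := W.obj.str) f

lemma normalizationEta_desc {V : PDuo.{u}} {W : NPDuo.{u}} (f : V ⟶ W.obj) :
    normalizationEta V ≫ normalizationDesc f = f :=
  normalizationUnit_comp_extension (E := W.obj.str) f

/-- Functors out of the normalization, into a normal produoidal category. -/
noncomputable def normalizationEquiv (V : PDuo.{u}) (W : NPDuo.{u}) :
    (normalizationObj V ⟶ W) ≃ (V ⟶ isNormal.ι.obj W) where
  toFun g := normalizationEta V ≫ g.hom
  invFun f := ObjectProperty.homMk (normalizationDesc f)
  left_inv _ := ObjectProperty.hom_ext _ ((isNormalization_normalizationEta V).hom_ext (X := W)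
    (normalizationEta_desc _))
  right_inv f := normalizationEta_desc f

lemma normalizationEquiv_comp (V : PDuo.{u}) (W W' : NPDuo.{u}) (g : W ⟶ W')
    (h : normalizationObj V ⟶ W) : normalizationEquiv V W' (h ≫ g)
      = normalizationEquiv V W h ≫ isNormal.ι.map g := rfl

/-- Normalization, as a functor. -/
noncomputable def normalizationFunctor : PDuo.{u} ⥤ NPDuo.{u} :=
  Adjunction.leftAdjointOfEquiv (G := isNormal.ι) (F_obj := normalizationObj) normalizationEquiv
    normalizationEquiv_comp

/-- Normalization is left adjoint to the inclusion of normal produoidal categories. -/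
noncomputable def normalizationAdj : normalizationFunctor.{u} ⊣ isNormal.{u}.ι :=
  Adjunction.adjunctionOfEquivLeft normalizationEquiv normalizationEquiv_comp

lemma normalizationAdj_unit (V : PDuo.{u}) : normalizationAdj.unit.app V = normalizationEta V :=
  (Adjunction.adjunctionOfEquivLeft_unit_app (G := isNormal.ι) normalizationEquiv
    normalizationEquiv_comp V).trans (Category.comp_id (normalizationEta V))

lemma isNormalization_unit (V : PDuo.{u}) : IsNormalization (V := V)
    (W := normalizationFunctor.obj V) (normalizationAdj.unit.app V) := by
  rw [normalizationAdj_unit]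
  exact isNormalization_normalizationEta V

/-- A retract of a normal produoidal category is normal. -/
lemma isNormal_of_retract {V W : PDuo.{u}} (f : V ⟶ W) (g : W ⟶ V) (h : f ≫ g = 𝟙 V)
    (hW : isNormal W) : isNormal V := by
  -- The equation h is used through a variable F, so that substituting the identity for F also
  -- removes the dependence of the types on the object map.
  have key (F : V ⟶ V) (hF : F = 𝟙 V) : (∀ (A : V) (s t : V.str.par.unit.obj (op A)),
      F.par.unit.app (op A) s = F.par.unit.app (op A) t → s = t) ∧
      ∀ (A : V) (n : V.str.seq.unit.obj (op A)),
        (∃ i, V.str.phi₀.app _ i = F.seq.unit.app (op A) n) → ∃ i, V.str.phi₀.app _ i = n := by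
    subst hF
    exact ⟨fun _ _ _ e => e, fun _ _ e => e⟩
  obtain ⟨h₁, h₂⟩ := key _ h
  have : IsIso W.str.phi₀ := hW
  have hb (A : W) : Function.Bijective (W.str.phi₀.app (op A)) :=
    (isIso_iff_bijective _).1 inferInstance
  have hf (A : V) (s) := congrArg (fun k => k.app (op A) s) f.map_phi₀
  have hg (A : W) (s) := congrArg (fun k => k.app (op A) s) g.map_phi₀
  have (A : Vᵒᵖ) : IsIso (V.str.phi₀.app A) := by
    -- φ₀ of V is a retract of φ₀ of W in presheaf maps over f and g: injectivity is tested after f,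
    -- and preimages are found in W and brought back by g.
    refine (isIso_iff_bijective _).2 ⟨fun s t e => h₁ _ s t ?_, fun n => h₂ _ n ?_⟩
    · refine congrArg (g.par.unit.app _) ((hb _).1 ?_)
      exact (hf A.unop s).symm.trans ((congrArg (f.seq.unit.app A) e).trans (hf A.unop t))
    · obtain ⟨i, hi⟩ := (hb _).2 (f.seq.unit.app A n)
      exact ⟨g.par.unit.app _ i, (hg _ i).symm.trans (congrArg (g.seq.unit.app _) hi)⟩
  exact NatIso.isIso_of_isIso_app V.str.phi₀

/-- Maps out of the normalization, into a normal produoidal category, that agree on the unit. -/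
lemma normalizationAdj_hom_ext {V X : PDuo.{u}} (hX : isNormal X)
    {a b : normalizationAdj.toMonad.obj V ⟶ X}
    (h : normalizationAdj.toMonad.η.app V ≫ a = normalizationAdj.toMonad.η.app V ≫ b) : a = b :=
  (isNormalization_unit V).hom_ext (X := ⟨X, hX⟩) h

/-- The universal property at the identity of V gives exactly one retraction of the unit, so only
the associativity law of an algebra needs an argument. -/
lemma normalizationAdj_existsUnique {V : PDuo.{u}} (hV : isNormal V) :
    ∃! a : normalizationAdj.toMonad.obj V ⟶ V,
      normalizationAdj.toMonad.η.app V ≫ a = 𝟙 V ∧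
        normalizationAdj.toMonad.μ.app V ≫ a = normalizationAdj.toMonad.map a ≫ a := by
  obtain ⟨a, ha⟩ : ∃ a : normalizationAdj.toMonad.obj V ⟶ V,
      normalizationAdj.toMonad.η.app V ≫ a = 𝟙 V :=
    ⟨_, (normalizationAdj.homEquiv_unit
        (f := (normalizationAdj.homEquiv V ⟨V, hV⟩).symm (𝟙 V))).symm.trans
      ((normalizationAdj.homEquiv V ⟨V, hV⟩).apply_symm_apply _)⟩
  refine ⟨a, ⟨ha, normalizationAdj_hom_ext hV ?_⟩, fun b hb =>
    normalizationAdj_hom_ext hV (hb.1.trans ha.symm)⟩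
  -- Maps from an iterated normalization into V are determined by the outer unit. Precomposed with
  -- it, both sides become a: by the unit law of the monad, and by naturality of the unit.
  have h₁ := normalizationAdj.toMonad.left_unit V
  have h₂ := normalizationAdj.toMonad.η.naturality a
  refine (Category.assoc _ _ _).symm.trans ((congrArg (· ≫ a) h₁).trans ?_)
  refine Eq.trans ?_ ((congrArg (· ≫ a) h₂).trans (Category.assoc _ _ _))
  exact (Category.id_comp _).trans
    ((Category.comp_id _).symm.trans ((congrArg (a ≫ ·) ha.symm).trans
      (Category.assoc _ _ _).symm))

end Produoidal

end

theorem mainTheorem4 :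
    (Produoidal.isNormal.{u}.ι.Full ∧ Produoidal.isNormal.{u}.ι.Faithful) ∧
    ∃ (Nor : Produoidal.PDuo.{u} ⥤ Produoidal.NPDuo.{u}) (adj : Nor ⊣ Produoidal.isNormal.{u}.ι),
      (∀ V : Produoidal.PDuo.{u},
        Produoidal.IsNormalization (V := V) (W := Nor.obj V) (adj.unit.app V)) ∧
      IsIso adj.toMonad.μ ∧
      (Monad.comparison adj).IsEquivalence ∧
      (∀ V : Produoidal.PDuo.{u}, Produoidal.isNormal V →
        ∃! a : adj.toMonad.obj V ⟶ V,
          adj.toMonad.η.app V ≫ a = 𝟙 V ∧ adj.toMonad.μ.app V ≫ a = adj.toMonad.map a ≫ a) ∧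
      (∀ V : Produoidal.PDuo.{u}, ¬ Produoidal.isNormal V →
        ¬ ∃ a : adj.toMonad.obj V ⟶ V,
          adj.toMonad.η.app V ≫ a = 𝟙 V ∧ adj.toMonad.μ.app V ≫ a = adj.toMonad.map a ≫ a) := by
  -- For a fully faithful right adjoint, invertibility of the multiplication and monadicity are
  -- general facts.
  let _ : Reflective Produoidal.isNormal.{u}.ι :=
    { L := Produoidal.normalizationFunctor, adj := Produoidal.normalizationAdj }
  refine ⟨⟨inferInstance, inferInstance⟩, Produoidal.normalizationFunctor,
    Produoidal.normalizationAdj, Produoidal.isNormalization_unit,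
    μ_iso_of_reflective (R := Produoidal.isNormal.{u}.ι),
    (monadicOfReflective (R := Produoidal.isNormal.{u}.ι)).eqv,
    fun V hV => Produoidal.normalizationAdj_existsUnique hV, fun V hV ⟨a, ha, _⟩ => hV ?_⟩
  -- The unit law alone makes V a retract of its normalization; the associativity law plays no role.
  exact Produoidal.isNormal_of_retract _ a ha (Produoidal.normalizationFunctor.obj V).property
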